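/- All manifolds are smooth, finite dimensional, Hausdorff, second countable and without boundary, and fiber bundles are smooth and locally trivial. **Equations.** Let $\zeta\colon P\to M$ be a fiber bundle, $J^k(\zeta)$ the manifold of $k$-jets $[s]^k_x$ of its local sections, and $J^\infty(\zeta)=\varprojlim J^k(\zeta)$. Let $\mathcal E^0\subset J^k(\zeta)$ be a formally integrable equation projecting onto $M$: its prolongations $\mathcal E^l=\{[s]_x^{k+l}\mid [s]^k_x\in\mathcal E^0$ and the graph of $j_k(s)$ is tangent to $\mathcal E^0$ at $[s]_x^k$ with order $\ge l\}$ are smooth submanifolds of $J^{k+l}(\zeta)$, and the projections $\mathcal E^{l+1}\to\mathcal E^l$ are smooth bundles. Let $\xi\colon\mathcal E\to M$, $\mathcal E=\varprojlim\mathcal E^l\subset J^\infty(\zeta)$, be its infinite prolongation. $C^\infty(\mathcal E)$ denotes the algebra of those functions on $\mathcal E$ that come from a smooth function on some $\mathcal E^l$, and vector fields on $\mathcal E$ are the derivations of $C^\infty(\mathcal E)$. At $\theta=[s]_x^\infty\in\mathcal E$ every $v\in T_xM$ has a Cartan lift, the image of $v$ under the differential of $j_\infty(s)$ at $x$, which is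 tangent to $\mathcal E$; these lifts form the Cartan plane at $\theta$, and the Cartan distribution consists of the vector fields on $\mathcal E$ with values in the Cartan planes. A morphism of equations is a map $\varphi\colon\mathcal E\to\mathcal E'$ with $\varphi^*C^\infty(\mathcal E')\subset C^\infty(\mathcal E)$ whose differential maps Cartan planes into Cartan planes. **Flat connections.** Let $\pi\colon M\to N$ be a fiber bundle. Local connections $\nabla$ in $\pi$ are the local sections of $\pi_{1,0}\colon J^1(\pi)\to M$, that is, smooth families of right inverses $T_{\pi(x)}N\to T_xM$ of the differential of $\pi$. The equation of flat connections $\mathcal E_{\mathrm{fc}}\subset J^\infty(\pi_{1,0})$ is the infinite prolongation of the set of all $[\nabla]^1_x\in J^1(\pi_{1,0})$ such that $[\nabla X,\nabla Y]-\nabla[X,Y]$ vanishes at $x$ for all vector fields $X,Y$ on $N$. **Flat representations.** A flat representation of $\mathcal E$ in $\pi$ is a $C^\infty(N)$-linear map $\mathcal F$ from vector fields on $N$ to vector fields on $\mathcal E$ such that, for all vector fields $X,Y$ on $N$ and all $h\in C^\infty(N)$, $\mathcal F(X)\big((\pi\circ\xi)^*h\big)=(\pi\circ\xi)^*(X(h))$,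 $\mathcal F([X,Y])=[\mathcal F(X),\mathcal F(Y)]$, and $\mathcal F(X)$ lies in the Cartan distribution of $\mathcal E$. **Theorem.** Flat representations of $\mathcal E$ in $\pi$ are in one-to-one correspondence with the morphisms $\varphi\colon\mathcal E\to\mathcal E_{\mathrm{fc}}$ that commute with the projections to $M$. The flat representation $\mathcal F$ corresponding to $\varphi$ is characterized as follows: for every vector field $X$ on $N$ and every $\theta\in\mathcal E$ with $\xi(\theta)=x$ and $\varphi(\theta)=[\nabla]_x^\infty$, the vector $\mathcal F(X)_\theta$ is the Cartan lift to $\theta$ of the vector $(\nabla X)_x\in T_xM$. -/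

import Mathlib

open Set Filter Topology VectorField
open scoped Manifold ContDiff

noncomputable section

namespace FlatReps

/-! ### Smooth fibre bundles -/

section FiberBundles

variable {EB HB B EP HP P EF HF Fb : Type*}
  [NormedAddCommGroup EB] [NormedSpace ℝ EB] [TopologicalSpace HB]
  [TopologicalSpace B] [ChartedSpace HB B]
  [NormedAddCommGroup EP] [NormedSpace ℝ EP] [TopologicalSpace HP]
  [TopologicalSpace P] [ChartedSpace HP P]
  [NormedAddCommGroup EF] [NormedSpace ℝ EF] [TopologicalSpace HF]
  [TopologicalSpace Fb] [ChartedSpace HF Fb]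

/-- `p : P → B` is a smooth locally trivial bundle with typical fibre `Fb`: every point of `B` has
a neighbourhood over which there is a local trivialization which is a diffeomorphism. -/
def IsSmoothFiberBundle (IB : ModelWithCorners ℝ EB HB) (IP : ModelWithCorners ℝ EP HP)
    (IF : ModelWithCorners ℝ EF HF) (Fb : Type*) [TopologicalSpace Fb] [ChartedSpace HF Fb]
    (p : P → B) : Prop :=
  ∀ b : B, ∃ e : Bundle.Trivialization Fb p, b ∈ e.baseSet ∧
    ContMDiffOn IP (IB.prod IF) ∞ e e.source ∧
    ContMDiffOn (IB.prod IF) IP ∞ e.toOpenPartialHomeomorph.symm e.target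

end FiberBundles

/-! ### Jets of local sections

A bundle over `B` is presented by its family of fibres `fib : B → Set P`, which are subsets of a
manifold `P`. For a bundle `p : P → B` one takes `fib b = p ⁻¹' {b}`; for a bundle whose total space
is a submanifold of `P` one takes the fibres of the submanifold. All manifolds to which this is
applied are finite dimensional and have no boundary. -/

section Jets

variable {EB HB B EP HP P : Type*}
  [NormedAddCommGroup EB] [NormedSpace ℝ EB] [TopologicalSpace HB]
  [TopologicalSpace B] [ChartedSpace HB B]
  [NormedAddCommGroup EP] [NormedSpace ℝ EP] [TopologicalSpace HP]
  [TopologicalSpace P] [ChartedSpace HP P]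

/-- A smooth local section, defined near the point `b` (its values far from `b` are irrelevant). -/
structure LocSec (IB : ModelWithCorners ℝ EB HB) (IP : ModelWithCorners ℝ EP HP)
    (fib : B → Set P) (b : B) where
  toFun : B → P
  smooth : ∀ᶠ y in 𝓝 b, ContMDiffAt IB IP ∞ toFun y
  mem_fib : ∀ᶠ y in 𝓝 b, toFun y ∈ fib y

/-- The space in which the local coordinates of `k`-jets live: the base point, and the derivatives
of order `0, …, k`. -/
abbrev JetCoord (EB EP : Type*) [NormedAddCommGroup EB] [NormedSpace ℝ EB]
    [NormedAddCommGroup EP] [NormedSpace ℝ EP] (k : ℕ) : Type _ :=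
  EB × (∀ i : Fin (k + 1), EB [×(i : ℕ)]→L[ℝ] EP)

/-- Forgetting the derivatives of order `> k`. -/
def JetCoord.truncL {k l : ℕ} (h : k ≤ l) : JetCoord EB EP l →L[ℝ] JetCoord EB EP k :=
  (ContinuousLinearMap.fst ℝ _ _).prod
    (ContinuousLinearMap.pi fun i : Fin (k + 1) =>
      (ContinuousLinearMap.proj (R := ℝ) (φ := fun i : Fin (l + 1) => EB [×(i : ℕ)]→L[ℝ] EP)
        (Fin.castLE (Nat.succ_le_succ h) i)).comp
        (ContinuousLinearMap.snd ℝ EB (∀ i : Fin (l + 1), EB [×(i : ℕ)]→L[ℝ] EP)))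

/-- The coordinates of the `k`-jet at `u` of the map `r` between vector spaces. -/
def prol (k : ℕ) (r : EB → EP) (u : EB) : JetCoord EB EP k :=
  (u, fun i => iteratedFDeriv ℝ i r u)

variable {IB : ModelWithCorners ℝ EB HB} {IP : ModelWithCorners ℝ EP HP} {fib : B → Set P}

namespace LocSec

variable {b : B}

/-- The coordinate expression of a section in the charts around `b₀ : B` and `q₀ : P`. -/
def expr (s : LocSec IB IP fib b) (b₀ : B) (q₀ : P) : EB → EP :=
  fun u => extChartAt IP q₀ (s.toFun ((extChartAt IB b₀).symm u))

/-- The point `s(b)` lies in the domain of the charts around `b₀ : B` and `q₀ : P`. -/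
def InChart (s : LocSec IB IP fib b) (b₀ : B) (q₀ : P) : Prop :=
  b ∈ (chartAt HB b₀).source ∧ s.toFun b ∈ (chartAt HP q₀).source

/-- The coordinates of the `k`-jet of `s` at `b`: the coordinates of `b`, and the derivatives up to
order `k` of the coordinate expression of `s` at that point. -/
def coords (s : LocSec IB IP fib b) (k : ℕ) (b₀ : B) (q₀ : P) : JetCoord EB EP k :=
  prol k (s.expr b₀ q₀) (extChartAt IB b₀ b)

end LocSec

variable (IB IP fib)

/-- Two local sections near `b` have the same `k`-jet at `b` when they have the same value at `b`
and, in all local coordinates, the same derivatives up to order `k` at `b`. -/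
def contact (k : ℕ) (b : B) : Setoid (LocSec IB IP fib b) where
  r s t := s.toFun b = t.toFun b ∧
    ∀ b₀ q₀, s.InChart b₀ q₀ → s.coords k b₀ q₀ = t.coords k b₀ q₀
  iseqv :=
    { refl := fun _ => ⟨rfl, fun _ _ _ => rfl⟩
      symm := fun {s t} h => ⟨h.1.symm, fun b₀ q₀ hc =>
        (h.2 b₀ q₀ ⟨hc.1, by rw [h.1]; exact hc.2⟩).symm⟩
      trans := fun {s t u} h h' => ⟨h.1.trans h'.1, fun b₀ q₀ hc =>
        (h.2 b₀ q₀ hc).trans (h'.2 b₀ q₀ ⟨hc.1, by rw [← h.1]; exact hc.2⟩)⟩ }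

/-- The manifold of `k`-jets of local sections, as a set. -/
def Jet (k : ℕ) : Type _ := Σ b : B, Quotient (contact IB IP fib k b)

variable {IB IP fib}

/-- The `k`-jet `[s]_b^k`. -/
def LocSec.jet {b : B} (s : LocSec IB IP fib b) (k : ℕ) : Jet IB IP fib k :=
  ⟨b, Quotient.mk _ s⟩

namespace Jet

variable {k l : ℕ}

/-- The projection `J^k → B`. -/
def base (θ : Jet IB IP fib k) : B := θ.1

/-- A local section representing the jet. -/
def rep (θ : Jet IB IP fib k) : LocSec IB IP fib θ.base := Quotient.out θ.2

/-- The projection `J^k → J^0`. -/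
def value (θ : Jet IB IP fib k) : P := θ.rep.toFun θ.base

/-- The jet lies over the domain of the charts around `b₀ : B` and `q₀ : P`. -/
def InChart (θ : Jet IB IP fib k) (b₀ : B) (q₀ : P) : Prop := θ.rep.InChart b₀ q₀

/-- The coordinates of a jet that lies over the domain of the charts around `b₀ : B` and
`q₀ : P`. -/
def coords (θ : Jet IB IP fib k) (b₀ : B) (q₀ : P) : JetCoord EB EP k := θ.rep.coords k b₀ q₀

/-- The projection `J^l → J^k` for `k ≤ l`. -/
def trunc (h : k ≤ l) (θ : Jet IB IP fib l) : Jet IB IP fib k :=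
  ⟨θ.1, Quotient.map (sa := contact IB IP fib l θ.1) (sb := contact IB IP fib k θ.1) id
    (fun _ _ hst => ⟨hst.1, fun b₀ q₀ hc =>
      congrArg (JetCoord.truncL h) (hst.2 b₀ q₀ hc)⟩) θ.2⟩

theorem rep_jet (θ : Jet IB IP fib k) : θ.rep.jet k = θ :=
  Sigma.ext rfl (heq_of_eq (Quotient.out_eq θ.2))

theorem rep_rel {b : B} (s : LocSec IB IP fib b) :
    contact IB IP fib k b ((s.jet k).rep) s :=
  Quotient.exact (Quotient.out_eq (s := contact IB IP fib k b) (Quotient.mk _ s))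

theorem trunc_jet {b : B} (h : k ≤ l) (s : LocSec IB IP fib b) :
    trunc h (s.jet l) = s.jet k := rfl

theorem value_jet {b : B} (s : LocSec IB IP fib b) : (s.jet k).value = s.toFun b :=
  (rep_rel s).1

theorem inChart_jet {b : B} (s : LocSec IB IP fib b) {b₀ : B} {q₀ : P} :
    (s.jet k).InChart b₀ q₀ ↔ s.InChart b₀ q₀ :=
  and_congr Iff.rfl (by
    have h := (rep_rel (k := k) s).1
    change (s.jet k).rep.toFun b ∈ _ ↔ _
    rw [h])

theorem coords_jet {b : B} (s : LocSec IB IP fib b) {b₀ : B} {q₀ : P} (h : s.InChart b₀ q₀) :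
    (s.jet k).coords b₀ q₀ = s.coords k b₀ q₀ :=
  (rep_rel s).2 b₀ q₀ ((inChart_jet s).2 h)

theorem inChart_trunc (h : k ≤ l) (θ : Jet IB IP fib l) {b₀ : B} {q₀ : P} :
    (trunc h θ).InChart b₀ q₀ ↔ θ.InChart b₀ q₀ := by
  conv_lhs => rw [← rep_jet θ]
  exact inChart_jet θ.rep

theorem coords_trunc (h : k ≤ l) (θ : Jet IB IP fib l) {b₀ : B} {q₀ : P}
    (hc : θ.InChart b₀ q₀) :
    (trunc h θ).coords b₀ q₀ = JetCoord.truncL h (θ.coords b₀ q₀) := by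
  conv_lhs => rw [← rep_jet θ]
  exact coords_jet θ.rep hc

end Jet

variable (IB IP fib)

/-- The manifold of infinite jets, as a set: the inverse limit of the `J^k`. -/
def InfJet : Type _ :=
  {z : ∀ k : ℕ, Jet IB IP fib k // ∀ (k l : ℕ) (h : k ≤ l), Jet.trunc h (z l) = z k}

variable {IB IP fib}

namespace InfJet

/-- The projection `J^∞ → J^k`. -/
def jet (z : InfJet IB IP fib) (k : ℕ) : Jet IB IP fib k := z.1 k

/-- The projection `J^∞ → B`. -/
def base (z : InfJet IB IP fib) : B := (z.jet 0).base

/-- The projection `J^∞ → J^0`. -/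
def value (z : InfJet IB IP fib) : P := (z.jet 0).value

/-- The infinite jet lies over the domain of the charts around `b₀ : B` and `q₀ : P`. -/
def InChart (z : InfJet IB IP fib) (b₀ : B) (q₀ : P) : Prop := (z.jet 0).InChart b₀ q₀

/-- The coordinates of order `≤ k` of an infinite jet. -/
def coords (z : InfJet IB IP fib) (k : ℕ) (b₀ : B) (q₀ : P) : JetCoord EB EP k :=
  (z.jet k).coords b₀ q₀

theorem inChart_iff (z : InfJet IB IP fib) (k : ℕ) {b₀ : B} {q₀ : P} :
    z.InChart b₀ q₀ ↔ (z.jet k).InChart b₀ q₀ := by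
  rw [InChart, ← Jet.inChart_trunc (Nat.zero_le k) (z.jet k)]
  exact iff_of_eq (congrArg (fun θ => Jet.InChart θ b₀ q₀) (z.2 0 k (Nat.zero_le k)).symm)

theorem coords_trunc (z : InfJet IB IP fib) {k l : ℕ} (h : k ≤ l) {b₀ : B} {q₀ : P}
    (hc : z.InChart b₀ q₀) :
    z.coords k b₀ q₀ = JetCoord.truncL h (z.coords l b₀ q₀) := by
  rw [coords, coords, ← Jet.coords_trunc h _ ((z.inChart_iff l).1 hc)]
  exact congrArg (fun θ => Jet.coords θ b₀ q₀) (z.2 k l h).symm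

theorem coords_fst (z : InfJet IB IP fib) (k : ℕ) {b₀ : B} {q₀ : P} (hc : z.InChart b₀ q₀) :
    (z.coords k b₀ q₀).1 = extChartAt IB b₀ z.base :=
  (congrArg Prod.fst (z.coords_trunc (Nat.zero_le k) hc)).symm

end InfJet

/-! ### Differential equations and their prolongations -/

section Equations

variable {k : ℕ}

/-- The graph of `j_k(s)` is tangent to `E⁰ ⊆ J^k` with order `≥ l` at `[s]_b^k`: for every smooth
function `G` (of the local coordinates of `J^k`) that is defined near `[s]_b^k` and vanishes on
`E⁰`, the function `G ∘ j_k(s)` vanishes at `b` with all its derivatives up to order `l`. -/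
def IsTangent (E₀ : Set (Jet IB IP fib k)) (l : ℕ) {b : B} (s : LocSec IB IP fib b) : Prop :=
  ∀ (G : JetCoord EB EP k → ℝ) (U : Set (JetCoord EB EP k)), IsOpen U →
    s.coords k b (s.toFun b) ∈ U → ContDiffOn ℝ ∞ G U →
    (∀ θ ∈ E₀, θ.InChart b (s.toFun b) → θ.coords b (s.toFun b) ∈ U →
      G (θ.coords b (s.toFun b)) = 0) →
    ∀ i ≤ l, iteratedFDeriv ℝ i (fun u => G (prol k (s.expr b (s.toFun b)) u))
      (extChartAt IB b b) = 0

/-- The `l`-th prolongation `E^l ⊆ J^{k+l}` of `E⁰ ⊆ J^k`. -/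
def prolong (E₀ : Set (Jet IB IP fib k)) (l : ℕ) : Set (Jet IB IP fib (k + l)) :=
  {θ | ∃ (b : B) (s : LocSec IB IP fib b), s.jet (k + l) = θ ∧ s.jet k ∈ E₀ ∧ IsTangent E₀ l s}

/-- The infinite prolongation `E ⊆ J^∞` of `E⁰ ⊆ J^k`: the inverse limit of the `E^l`. -/
def infProlong (E₀ : Set (Jet IB IP fib k)) : Set (InfJet IB IP fib) :=
  {z | ∀ l, z.jet (k + l) ∈ prolong E₀ l}

/-- `S ⊆ J^k` is a smooth (embedded) submanifold: in the local coordinates around each of its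
points it is flattened by a local diffeomorphism of the coordinate space. -/
def IsSubmanifold (S : Set (Jet IB IP fib k)) : Prop :=
  ∀ θ₀ ∈ S, ∃ (e : OpenPartialHomeomorph (JetCoord EB EP k) (JetCoord EB EP k))
    (V : Submodule ℝ (JetCoord EB EP k)),
    θ₀.coords θ₀.base θ₀.value ∈ e.source ∧
    ContDiffOn ℝ ∞ e e.source ∧ ContDiffOn ℝ ∞ e.symm e.target ∧
    ∀ x ∈ e.source,
      e x ∈ V ↔ ∃ θ ∈ S, θ.InChart θ₀.base θ₀.value ∧ θ.coords θ₀.base θ₀.value = x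

/-- The projection `J^l → J^k` maps the submanifold `S` onto the submanifold `T` and is a
submersion from `S` to `T`, that is, there is a smooth local section through every point of `S`. -/
def IsSurjSubmersion {k l : ℕ} (h : k ≤ l) (S : Set (Jet IB IP fib l))
    (T : Set (Jet IB IP fib k)) : Prop :=
  Jet.trunc h '' S = T ∧
  ∀ θ₀ ∈ S, ∃ (σ : JetCoord EB EP k → JetCoord EB EP l) (U : Set (JetCoord EB EP k)),
    IsOpen U ∧ (Jet.trunc h θ₀).coords θ₀.base θ₀.value ∈ U ∧ ContDiffOn ℝ ∞ σ U ∧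
    σ ((Jet.trunc h θ₀).coords θ₀.base θ₀.value) = θ₀.coords θ₀.base θ₀.value ∧
    ∀ θ ∈ T, θ.InChart θ₀.base θ₀.value → θ.coords θ₀.base θ₀.value ∈ U →
      ∃ θ' ∈ S, Jet.trunc h θ' = θ ∧
        θ'.coords θ₀.base θ₀.value = σ (θ.coords θ₀.base θ₀.value)

/-- Formally integrable equations `E⁰ ⊆ J^k`: `E⁰` projects onto the base, all prolongations `E^l`
are smooth submanifolds, and the projections `E^{l+1} → E^l` are smooth bundles. The fibres of
`E^{l+1} → E^l` are affine subspaces of the fibres of the affine bundle `J^{k+l+1} → J^{k+l}`, so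
that such a projection is a locally trivial bundle if and only if it is a surjective submersion. -/
structure IsFormallyIntegrable (E₀ : Set (Jet IB IP fib k)) : Prop where
  surj : ∀ b : B, ∃ θ ∈ E₀, θ.base = b
  submanifold : ∀ l, IsSubmanifold (prolong E₀ l)
  submersion : ∀ l, IsSurjSubmersion (Nat.le_succ (k + l)) (prolong E₀ (l + 1)) (prolong E₀ l)

end Equations

/-! ### Differential geometry of subsets of infinite jet spaces -/

section Diffieties

variable {E : Set (InfJet IB IP fib)}

/-- Near `z`, the function `f` on `E` is the smooth function `G` of the local coordinates of order
`≤ k`. -/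
def IsLocalRep (f : E → ℝ) (z : E) (k : ℕ) (G : JetCoord EB EP k → ℝ) : Prop :=
  ∃ U : Set (JetCoord EB EP k), IsOpen U ∧ z.1.coords k z.1.base z.1.value ∈ U ∧
    ContDiffOn ℝ ∞ G U ∧
    ∀ z' : E, z'.1.InChart z.1.base z.1.value → z'.1.coords k z.1.base z.1.value ∈ U →
      f z' = G (z'.1.coords k z.1.base z.1.value)

theorem IsLocalRep.mono {f : E → ℝ} {z : E} {k l : ℕ} (h : k ≤ l) {G : JetCoord EB EP k → ℝ}
    (hG : IsLocalRep f z k G) : IsLocalRep f z l (G ∘ JetCoord.truncL h) := by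
  obtain ⟨U, hU, hz, hGU, hf⟩ := hG
  have hin : z.1.InChart z.1.base z.1.value := ⟨mem_chart_source _ _, mem_chart_source _ _⟩
  refine ⟨JetCoord.truncL h ⁻¹' U, hU.preimage (JetCoord.truncL h).continuous, ?_,
    hGU.comp (ContinuousLinearMap.contDiff (JetCoord.truncL (EB := EB) (EP := EP) h)).contDiffOn
      (fun _ hx => hx), ?_⟩
  · rw [mem_preimage, ← z.1.coords_trunc h hin]
    exact hz
  · intro z' hc hm
    rw [mem_preimage, ← z'.1.coords_trunc h hc] at hm
    rw [Function.comp_apply, ← z'.1.coords_trunc h hc]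
    exact hf z' hc hm

theorem IsLocalRep.op {f g : E → ℝ} {z : E} {k : ℕ} {G H : JetCoord EB EP k → ℝ}
    (m : ℝ → ℝ → ℝ) (hm : ContDiff ℝ ∞ (fun x : ℝ × ℝ => m x.1 x.2))
    (hG : IsLocalRep f z k G) (hH : IsLocalRep g z k H) :
    IsLocalRep (fun z' => m (f z') (g z')) z k (fun x => m (G x) (H x)) := by
  obtain ⟨U, hU, hz, hGU, hf⟩ := hG
  obtain ⟨V, hV, hz', hHV, hg⟩ := hH
  refine ⟨U ∩ V, hU.inter hV, ⟨hz, hz'⟩,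
    hm.comp_contDiffOn ((hGU.mono inter_subset_left).prodMk (hHV.mono inter_subset_right)), ?_⟩
  intro z'' hc hmem
  beta_reduce
  rw [hf z'' hc hmem.1, hg z'' hc hmem.2]

/-- `f` is a smooth function on `E` that comes from jets of order `k`. -/
def IsSmoothOfOrder (k : ℕ) (f : E → ℝ) : Prop := ∀ z : E, ∃ G, IsLocalRep f z k G

theorem IsSmoothOfOrder.op {f g : E → ℝ} {k l : ℕ}
    (m : ℝ → ℝ → ℝ) (hm : ContDiff ℝ ∞ (fun x : ℝ × ℝ => m x.1 x.2))
    (hf : IsSmoothOfOrder k f) (hg : IsSmoothOfOrder l g) :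
    IsSmoothOfOrder (max k l) (fun z => m (f z) (g z)) := fun z => by
  obtain ⟨G, hG⟩ := hf z
  obtain ⟨H, hH⟩ := hg z
  exact ⟨_, IsLocalRep.op m hm (hG.mono (le_max_left k l)) (hH.mono (le_max_right k l))⟩

theorem IsSmoothOfOrder.const (c : ℝ) : IsSmoothOfOrder 0 (fun _ : E => c) := fun _ =>
  ⟨fun _ => c, univ, isOpen_univ, mem_univ _, contDiffOn_const, fun _ _ _ => rfl⟩

variable (E)

/-- The algebra `C^∞(E)` of smooth functions on `E`: the union over `k` of the smooth functions
that come from jets of order `k`. -/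
def smoothFun : Subalgebra ℝ (E → ℝ) where
  carrier := {f | ∃ k, IsSmoothOfOrder k f}
  mul_mem' := by
    rintro f g ⟨k, hf⟩ ⟨l, hg⟩
    exact ⟨_, hf.op (fun x y => x * y) (by fun_prop) hg⟩
  add_mem' := by
    rintro f g ⟨k, hf⟩ ⟨l, hg⟩
    exact ⟨_, hf.op (fun x y => x + y) (by fun_prop) hg⟩
  algebraMap_mem' c := ⟨0, IsSmoothOfOrder.const c⟩

variable {E}

/-- The pullback to `E` of a smooth function on the base. -/
def pullBase [IsManifold IB ∞ B] [IB.Boundaryless] (g : B → ℝ)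
    (hg : ContMDiff IB 𝓘(ℝ, ℝ) ∞ g) : smoothFun E :=
  ⟨fun z => g z.1.base, 0, fun z => by
    have hin : z.1.InChart z.1.base z.1.value := ⟨mem_chart_source _ _, mem_chart_source _ _⟩
    refine ⟨fun x => g ((extChartAt IB z.1.base).symm x.1),
      Prod.fst ⁻¹' (extChartAt IB z.1.base).target,
      (isOpen_extChartAt_target z.1.base).preimage continuous_fst, ?_, ?_, ?_⟩
    · rw [mem_preimage, z.1.coords_fst 0 hin]
      exact mem_extChartAt_target _
    · have h1 : ContDiffOn ℝ ∞ (fun u => g ((extChartAt IB z.1.base).symm u))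
          (extChartAt IB z.1.base).target :=
        (hg.comp_contMDiffOn (contMDiffOn_extChartAt_symm z.1.base)).contDiffOn
      exact h1.comp contDiff_fst.contDiffOn (fun _ hx => hx)
    · intro z' hc _
      beta_reduce
      rw [z'.1.coords_fst 0 hc, PartialEquiv.left_inv]
      rw [extChartAt_source]
      exact hc.1⟩

/-- The derivative at `b`, along the tangent vector `v ∈ T_b B`, of the function `G ∘ j_k(s)`, where
`b` is the base point of the infinite jet `z`, `[s]_b^{k+1}` is its `(k+1)`-jet and `G` is a smooth
function of the local coordinates of order `≤ k`. -/
def totalDeriv (z : InfJet IB IP fib) (k : ℕ) (G : JetCoord EB EP k → ℝ)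
    (v : TangentSpace IB z.base) : ℝ :=
  fderiv ℝ (fun u => G (prol k ((z.jet (k + 1)).rep.expr z.base z.value) u))
    (extChartAt IB z.base z.base) (show EB from v)

/-- `δ` is the tangent vector to `E` at `z` that is the image of `v` under the differential of
`j_∞(s)`, where `z = [s]^∞`: it differentiates every smooth function on `E` as `v` differentiates
the composition with `j_∞(s)` of any local extension of the function to the infinite jet space.
(Such a `δ` is automatically a derivation at `z`.) -/
def IsCartanLift (z : E) (v : TangentSpace IB z.1.base) (δ : smoothFun E →ₗ[ℝ] ℝ) : Prop :=
  ∀ (f : smoothFun E) (k : ℕ) (G : JetCoord EB EP k → ℝ), IsLocalRep f.1 z k G →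
    δ f = totalDeriv z.1 k G v

/-- The Cartan plane of `E` at `z`: the tangent vectors to `E` at `z` that are tangent to the graph
of `j_∞(s)`, where `z = [s]^∞`. -/
def cartanPlane (z : E) : Set (smoothFun E →ₗ[ℝ] ℝ) :=
  {δ | ∃ v : TangentSpace IB z.1.base, IsCartanLift z v δ}

variable (E)

/-- Vector fields on `E`: the derivations of `C^∞(E)`. -/
abbrev VectorFieldOn : Type _ := Derivation ℝ (smoothFun E) (smoothFun E)

variable {E}

/-- The value of a vector field at a point. -/
def VectorFieldOn.at (Y : VectorFieldOn E) (z : E) : smoothFun E →ₗ[ℝ] ℝ where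
  toFun f := (Y f).1 z
  map_add' f g := by rw [map_add]; rfl
  map_smul' c f := by rw [Derivation.map_smul]; rfl

variable (E)

/-- The Cartan distribution on `E`, as a set of vector fields. -/
def cartanDistribution : Set (VectorFieldOn E) := {Y | ∀ z : E, Y.at z ∈ cartanPlane z}

end Diffieties

end Jets

/-! ### Morphisms -/

section Morphisms

variable {EB HB B EP HP P EB' HB' B' EP' HP' P' : Type*}
  [NormedAddCommGroup EB] [NormedSpace ℝ EB] [TopologicalSpace HB]
  [TopologicalSpace B] [ChartedSpace HB B]
  [NormedAddCommGroup EP] [NormedSpace ℝ EP] [TopologicalSpace HP]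
  [TopologicalSpace P] [ChartedSpace HP P]
  [NormedAddCommGroup EB'] [NormedSpace ℝ EB'] [TopologicalSpace HB']
  [TopologicalSpace B'] [ChartedSpace HB' B']
  [NormedAddCommGroup EP'] [NormedSpace ℝ EP'] [TopologicalSpace HP']
  [TopologicalSpace P'] [ChartedSpace HP' P']
  {IB : ModelWithCorners ℝ EB HB} {IP : ModelWithCorners ℝ EP HP} {fib : B → Set P}
  {IB' : ModelWithCorners ℝ EB' HB'} {IP' : ModelWithCorners ℝ EP' HP'} {fib' : B' → Set P'}

/-- The pullback `φ^* : C^∞(E') → C^∞(E)` of a smooth map `φ : E → E'`. -/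
def pullback {E : Set (InfJet IB IP fib)} {E' : Set (InfJet IB' IP' fib')} (φ : E → E')
    (hφ : ∀ f ∈ smoothFun E', f ∘ φ ∈ smoothFun E) : smoothFun E' →ₗ[ℝ] smoothFun E where
  toFun f := ⟨f.1 ∘ φ, hφ f.1 f.2⟩
  map_add' _ _ := rfl
  map_smul' _ _ := rfl

/-- Morphisms of equations: smooth maps that preserve the Cartan distribution. -/
structure EqMorphism (E : Set (InfJet IB IP fib)) (E' : Set (InfJet IB' IP' fib')) where
  toFun : E → E'
  smooth : ∀ f ∈ smoothFun E', f ∘ toFun ∈ smoothFun E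
  cartan : ∀ (z : E), ∀ δ ∈ cartanPlane z, δ ∘ₗ pullback toFun smooth ∈ cartanPlane (toFun z)

end Morphisms

/-! ### Flat connections -/

section Connections

variable {EN N EM M : Type*}
  [NormedAddCommGroup EN] [NormedSpace ℝ EN] [TopologicalSpace N] [ChartedSpace EN N]
  [NormedAddCommGroup EM] [NormedSpace ℝ EM] [TopologicalSpace M] [ChartedSpace EM M]

variable (EN N) in
/-- Smooth vector fields on the manifold `N`. -/
abbrev VF [IsManifold 𝓘(ℝ, EN) ∞ N] : Type _ :=
  Cₛ^∞⟮𝓘(ℝ, EN); EN, (TangentSpace 𝓘(ℝ, EN) : N → Type _)⟯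

section

variable [IsManifold 𝓘(ℝ, EN) ∞ N]

/-- The product of a smooth function and a vector field. -/
def VF.smul (h : C^∞⟮𝓘(ℝ, EN), N; 𝓘(ℝ, ℝ), ℝ⟯) (X : VF EN N) : VF EN N :=
  ⟨fun y => h y • X y, ContMDiff.smul_section h.contMDiff X.contMDiff⟩

/-- The Lie bracket of vector fields. -/
def VF.bracket [FiniteDimensional ℝ EN] (X Y : VF EN N) : VF EN N :=
  ⟨fun y => mlieBracket 𝓘(ℝ, EN) X Y y, fun y => by
    have : CompleteSpace EN := FiniteDimensional.complete ℝ EN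
    have : IsManifold 𝓘(ℝ, EN) (((⊤ : ℕ∞) : ℕ∞ω) + 1) N := ‹IsManifold 𝓘(ℝ, EN) ∞ N›
    have : IsManifold 𝓘(ℝ, EN) (minSmoothness ℝ 2) N := .of_le (n := ∞) (by
      rw [minSmoothness_of_isRCLikeNormedField]; exact ENat.LEInfty.out)
    have : IsManifold 𝓘(ℝ, EN) (minSmoothness ℝ 3) N := .of_le (n := ∞) (by
      rw [minSmoothness_of_isRCLikeNormedField]; exact ENat.LEInfty.out)
    exact ContMDiffAt.mlieBracket_vectorField (n := ⊤) (m := ⊤) (X.contMDiff y) (Y.contMDiff y)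
      (by simp)⟩

/-- The function `X(h)`. -/
def VF.act (X : VF EN N) (h : C^∞⟮𝓘(ℝ, EN), N; 𝓘(ℝ, ℝ), ℝ⟯) (y : N) : ℝ :=
  mfderiv 𝓘(ℝ, EN) 𝓘(ℝ, ℝ) h y (X y)

end

/-- The group structure on the fibres of `π^* TN`. -/
instance pullbackTangentAddCommGroup (π : C^∞⟮𝓘(ℝ, EM), M; 𝓘(ℝ, EN), N⟯) (x : M) :
    AddCommGroup (Bundle.Pullback π (TangentSpace 𝓘(ℝ, EN) : N → Type _) x) :=
  inferInstanceAs (AddCommGroup (TangentSpace 𝓘(ℝ, EN) (π x)))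

/-- The fibres of the vector bundle `Hom(π^* TN, TM)` over `M`. -/
abbrev HomFib (π : C^∞⟮𝓘(ℝ, EM), M; 𝓘(ℝ, EN), N⟯) (x : M) : Type _ :=
  Bundle.Pullback π (TangentSpace 𝓘(ℝ, EN) : N → Type _) x →L[ℝ] TangentSpace 𝓘(ℝ, EM) x

variable [IsManifold 𝓘(ℝ, EN) ∞ N] [IsManifold 𝓘(ℝ, EM) ∞ M]

/-- The model of the total space of `Hom(π^* TN, TM)`. -/
abbrev homModel (EN EM : Type*) [NormedAddCommGroup EN] [NormedSpace ℝ EN]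
    [NormedAddCommGroup EM] [NormedSpace ℝ EM] :
    ModelWithCorners ℝ (EM × (EN →L[ℝ] EM)) (ModelProd EM (EN →L[ℝ] EM)) :=
  𝓘(ℝ, EM).prod 𝓘(ℝ, EN →L[ℝ] EM)

/-- The bundle `π_{1,0} : J^1(π) → M`, as a subbundle of `Hom(π^* TN, TM)`. The `1`-jet `[f]_y^1` of
a local section `f` of `π` with `f(y) = x` is determined by `x` and by the differential of `f` at
`y`, which is a right inverse `T_{π(x)} N → T_x M` of the differential of `π`. The sections of
`π_{1,0}` are the connections in `π`. -/
def connFib (π : C^∞⟮𝓘(ℝ, EM), M; 𝓘(ℝ, EN), N⟯) (x : M) :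
    Set (Bundle.TotalSpace (EN →L[ℝ] EM) (HomFib π)) :=
  {L | L.proj = x ∧ ∀ w : TangentSpace 𝓘(ℝ, EN) (π L.proj),
    mfderiv 𝓘(ℝ, EM) 𝓘(ℝ, EN) π L.proj (L.2 w) = w}

/-- The lift `∇ X` of a vector field `X` on `N` by a connection `∇`. -/
def horLift (π : C^∞⟮𝓘(ℝ, EM), M; 𝓘(ℝ, EN), N⟯) (D : ∀ x : M, HomFib π x) (X : VF EN N) (x : M) :
    TangentSpace 𝓘(ℝ, EM) x :=
  D x (X (π x))

/-- The first-order equation of flat connections: the `1`-jets `[∇]_x^1` of local connections `∇` in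
`π` whose curvature `[∇ X, ∇ Y] - ∇ [X, Y]` vanishes at `x`. -/
def flatEq₀ [FiniteDimensional ℝ EN] (π : C^∞⟮𝓘(ℝ, EM), M; 𝓘(ℝ, EN), N⟯) :
    Set (Jet 𝓘(ℝ, EM) (homModel EN EM) (connFib π) 1) :=
  {θ | ∃ (x : M) (s : LocSec 𝓘(ℝ, EM) (homModel EN EM) (connFib π) x) (D : ∀ x : M, HomFib π x),
    s.jet 1 = θ ∧ (∀ᶠ x' in 𝓝 x, s.toFun x' = ⟨x', D x'⟩) ∧
    ∀ X Y : VF EN N,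
      mlieBracket 𝓘(ℝ, EM) (horLift π D X) (horLift π D Y) x = horLift π D (X.bracket Y) x}

/-- The (infinitely prolonged) equation of flat connections in the bundle `π`. -/
def flatEq [FiniteDimensional ℝ EN] (π : C^∞⟮𝓘(ℝ, EM), M; 𝓘(ℝ, EN), N⟯) :
    Set (InfJet 𝓘(ℝ, EM) (homModel EN EM) (connFib π)) :=
  infProlong (flatEq₀ π)

section FlatRepresentations

variable {EP HP P : Type*} [NormedAddCommGroup EP] [NormedSpace ℝ EP] [TopologicalSpace HP]
  [TopologicalSpace P] [ChartedSpace HP P] {IP : ModelWithCorners ℝ EP HP} {fib : M → Set P}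

/-- The pullback of functions along the composition `E → M → N`. -/
def pullComp (E : Set (InfJet 𝓘(ℝ, EM) IP fib)) (π : C^∞⟮𝓘(ℝ, EM), M; 𝓘(ℝ, EN), N⟯)
    (h : C^∞⟮𝓘(ℝ, EN), N; 𝓘(ℝ, ℝ), ℝ⟯) : smoothFun E :=
  pullBase (fun x => h (π x)) (h.contMDiff.comp π.contMDiff)

/-- Flat representations of `E` in the bundle `π : M → N`: flat connections in the bundle `E → N`
whose lifted fields lie in the Cartan distribution. -/
structure FlatRepresentation [FiniteDimensional ℝ EN] (E : Set (InfJet 𝓘(ℝ, EM) IP fib))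
    (π : C^∞⟮𝓘(ℝ, EM), M; 𝓘(ℝ, EN), N⟯) where
  toFun : VF EN N → VectorFieldOn E
  map_add : ∀ X Y, toFun (X + Y) = toFun X + toFun Y
  map_smul : ∀ (h : C^∞⟮𝓘(ℝ, EN), N; 𝓘(ℝ, ℝ), ℝ⟯) (X : VF EN N),
    toFun (X.smul h) = pullComp E π h • toFun X
  lifts : ∀ (X : VF EN N) (h : C^∞⟮𝓘(ℝ, EN), N; 𝓘(ℝ, ℝ), ℝ⟯) (z : E),
    (toFun X (pullComp E π h)).1 z = X.act h (π z.1.base)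
  flat : ∀ X Y, toFun (X.bracket Y) = ⁅toFun X, toFun Y⁆
  mem_cartan : ∀ X, toFun X ∈ cartanDistribution E

/-- Morphisms from `E` to the equation of flat connections that commute with the projections to
`M`. -/
structure FlatMorphism [FiniteDimensional ℝ EN] (E : Set (InfJet 𝓘(ℝ, EM) IP fib))
    (π : C^∞⟮𝓘(ℝ, EM), M; 𝓘(ℝ, EN), N⟯) extends EqMorphism E (flatEq π) where
  base_eq : ∀ z : E, (toFun z).1.base = z.1.base

/-- For an infinite jet `ζ = [∇]_x^∞` of a connection `∇` in `π` and a vector field `X` on `N`, the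
tangent vector `(∇ X)_x ∈ T_x M`. -/
def liftAt (π : C^∞⟮𝓘(ℝ, EM), M; 𝓘(ℝ, EN), N⟯)
    (ζ : InfJet 𝓘(ℝ, EM) (homModel EN EM) (connFib π)) (X : VF EN N) :
    TangentSpace 𝓘(ℝ, EM) ζ.value.proj :=
  ζ.value.2 (X (π ζ.value.proj))

/-- The flat representation determined by the morphism `φ` is `R`: for `z ∈ E` over `x ∈ M` and
`φ(z) = [∇]_x^∞`, the value at `z` of the lift of `X` is obtained by lifting `X` by `∇` to a tangent
vector to `M` at `x`, and then by the Cartan connection to a tangent vector to `E` at `z`. -/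
def Corresponds [FiniteDimensional ℝ EN] {E : Set (InfJet 𝓘(ℝ, EM) IP fib)}
    {π : C^∞⟮𝓘(ℝ, EM), M; 𝓘(ℝ, EN), N⟯} (R : FlatRepresentation E π) (φ : FlatMorphism E π) :
    Prop :=
  ∀ (X : VF EN N) (z : E),
    IsCartanLift z (show EM from liftAt π (φ.toFun z).1 X) ((R.toFun X).at z)

end FlatRepresentations

end Connections

end FlatReps

end

noncomputable section

namespace FlatReps

/-! ### Calculus in jet coordinates -/

section JetCalculus

variable {EB EP W W' : Type*} [NormedAddCommGroup EB] [NormedSpace ℝ EB]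
  [NormedAddCommGroup EP] [NormedSpace ℝ EP] [NormedAddCommGroup W] [NormedSpace ℝ W]
  [NormedAddCommGroup W'] [NormedSpace ℝ W']

/-! Both sides of the correspondence encode the same object: a family of linear maps `T z : EN →L[ℝ]
EM`, one for each point `z` of `E`, which are right inverse to the differential of `π` at the base
point of `z`, depend smoothly on jets of one bounded order, and have zero curvature. This is
`IsFlatLift`.

From a representation `R`: a vector of the Cartan plane at `z` is determined by its projection to
`M`, and linearity over functions on `N` makes the projection of `R(X)` at `z` depend only on the
value of `X`, linearly. This gives `T`. Second derivatives along Cartan planes are symmetric, so the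
commutator of two lifted fields is again a Cartan lift, of the curvature expression of `T`
(`HasUniformOrder.commutator`); compatibility of `R` with brackets is therefore the vanishing of the
curvature of `T`.

From a morphism `φ`: `T z` is the value at the base point of the connection whose jet is `φ z`. As
`φ` preserves the base and the Cartan planes, it intertwines total derivatives
(`EqMorphism.cartanD_comp`), so that the first-order equation satisfied by `φ z` becomes zero
curvature of `T`. The higher jets of `φ z` are Cartan derivatives of the lower ones, whence `T`
determines `φ` (`FlatMorphism.eq_of_lift_eq`). Conversely `T` is prolonged: the jet of `s` is sent
to the jet of `T` composed with the jet of `s` (`CartanClosed.exists_prolongation`), and zero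
curvature together with its total derivatives puts the result into the equation of flat connections.

Three facts make this work. The Cartan planes are tangent to `E`
(`IsFormallyIntegrable.cartanTangent`), so that derivatives along them are defined on `E` alone; the
proof is by induction on the prolongation, using that prolonged equations are affine in the highest
derivatives. Bundles retract locally onto their fibres (`HasRetraction`), so that maps given only on
`E` extend to maps with values in the bundle. And a family `T` all of whose scalar components have
finite order has one finite order (`exists_uniform_order`); this is a diagonal argument with
globally defined functions and vector fields that are standard near infinitely many points at once.
-/

theorem JetCoord.truncL_truncL {k l m : ℕ} (h : k ≤ l) (h' : l ≤ m) (x : JetCoord EB EP m) :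
    JetCoord.truncL h (JetCoord.truncL h' x) = JetCoord.truncL (h.trans h') x := rfl

/-- The point of the jet of order zero. -/
def JetCoord.val {k : ℕ} : JetCoord EB EP k →L[ℝ] EP :=
  ((ContinuousMultilinearMap.apply ℝ (fun _ : Fin 0 => EB) EP 0).comp
    (ContinuousLinearMap.proj (R := ℝ) (φ := fun i : Fin (k + 1) => EB [×(i : ℕ)]→L[ℝ] EP) 0)).comp
    (ContinuousLinearMap.snd ℝ EB _)

theorem val_prol (k : ℕ) (r : EB → EP) (u : EB) : JetCoord.val (prol k r u) = r u := rfl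

/-- The derivative of order `i` in a jet. -/
def JetCoord.comp {k : ℕ} (i : ℕ) (h : i ≤ k) : JetCoord EB EP k →L[ℝ] EB [×i]→L[ℝ] EP :=
  (ContinuousLinearMap.proj (R := ℝ) (φ := fun i : Fin (k + 1) => EB [×(i : ℕ)]→L[ℝ] EP)
    ⟨i, Nat.lt_succ_of_le h⟩).comp (ContinuousLinearMap.snd ℝ EB _)

theorem comp_prol {k i : ℕ} (h : i ≤ k) (r : EB → EP) (u : EB) :
    JetCoord.comp i h (prol k r u) = iteratedFDeriv ℝ i r u := rfl

theorem JetCoord.ext_comp {k : ℕ} {x y : JetCoord EB EP k} (h₁ : x.1 = y.1)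
    (h₂ : ∀ i (h : i ≤ k), JetCoord.comp i h x = JetCoord.comp i h y) : x = y :=
  Prod.ext h₁ (funext fun i => h₂ i (Nat.le_of_lt_succ i.2))

theorem val_eq_iff {k : ℕ} (x y : JetCoord EB EP k) :
    JetCoord.val x = JetCoord.val y ↔
      JetCoord.comp 0 (Nat.zero_le k) x = JetCoord.comp 0 (Nat.zero_le k) y := by
  constructor
  · intro h
    ext v
    rw [Subsingleton.elim v 0]
    exact h
  · intro h
    exact congrArg (fun m : EB [×0]→L[ℝ] EP => m 0) h

/-- Currying the first variable of a multilinear map. -/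
def curryL (i : ℕ) : (EB [×(i + 1)]→L[ℝ] EP) →L[ℝ] (EB →L[ℝ] EB [×i]→L[ℝ] EP) :=
  ((continuousMultilinearCurryLeftEquiv ℝ (fun _ : Fin (i + 1) => EB)
    EP).toContinuousLinearEquiv : _ ≃L[ℝ] _)

/-- The linear part of `shift`. -/
def shiftL {k : ℕ} :
    JetCoord EB EP (k + 1) →L[ℝ] EB →L[ℝ] (∀ i : Fin (k + 1), EB [×(i : ℕ)]→L[ℝ] EP) :=
  ((ContinuousLinearMap.piEquivL ℝ EB (fun i : Fin (k + 1) => EB [×(i : ℕ)]→L[ℝ] EP)) :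
    _ →L[ℝ] _).comp
  (ContinuousLinearMap.pi fun i : Fin (k + 1) =>
    (curryL (i : ℕ)).comp (JetCoord.comp ((i : ℕ) + 1) (Nat.succ_le_of_lt i.2)))

/-- The total derivative of the coordinates of the `k`-jet, as a function of the
`(k+1)`-jet. -/
def shift {k : ℕ} (x : JetCoord EB EP (k + 1)) : EB →L[ℝ] JetCoord EB EP k :=
  (ContinuousLinearMap.id ℝ EB).prod (shiftL (EB := EB) (EP := EP) (k := k) x)

theorem comp_shift {k i : ℕ} (h : i ≤ k) (x : JetCoord EB EP (k + 1)) (v : EB) :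
    JetCoord.comp i h (shift x v) =
      (JetCoord.comp (i + 1) (Nat.succ_le_succ h) x).curryLeft v := rfl

theorem contDiff_shift {k : ℕ} :
    ContDiff ℝ ∞ (shift : JetCoord EB EP (k + 1) → EB →L[ℝ] JetCoord EB EP k) := by
  have : (shift : JetCoord EB EP (k + 1) → EB →L[ℝ] JetCoord EB EP k) = fun x =>
      (ContinuousLinearMap.inl ℝ EB _).comp (ContinuousLinearMap.id ℝ EB) +
      (ContinuousLinearMap.inr ℝ EB _).comp (shiftL (EB := EB) (EP := EP) (k := k) x) := by
    funext x
    ext v <;> simp [shift]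
  rw [this]
  have h1 : ContDiff ℝ ∞ (fun x => shiftL (EB := EB) (EP := EP) (k := k) x) :=
    by fun_prop
  exact contDiff_const.add (contDiff_const.clm_comp h1)

/-- A map between vector spaces that is smooth near a point. -/
def SmoothNear (r : EB → EP) (u : EB) : Prop := ∀ᶠ y in 𝓝 u, ContDiffAt ℝ ∞ r y

theorem SmoothNear.eventually {r : EB → EP} {u : EB} (h : SmoothNear r u) :
    ∀ᶠ y in 𝓝 u, SmoothNear r y := eventually_eventually_nhds.2 h

theorem SmoothNear.contDiffAt {r : EB → EP} {u : EB} (h : SmoothNear r u) : ContDiffAt ℝ ∞ r u :=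
  h.self_of_nhds

theorem _root_.ContDiffOn.smoothNear {r : EB → EP} {u : EB} {U : Set EB} (h : ContDiffOn ℝ ∞ r U)
    (hU : U ∈ 𝓝 u) : SmoothNear r u := by
  filter_upwards [eventually_mem_nhds_iff.2 hU] with y hy
  exact h.contDiffAt hy

theorem contDiffAt_prol {r : EB → EP} {u : EB} (k : ℕ) (h : ContDiffAt ℝ ∞ r u) :
    ContDiffAt ℝ ∞ (prol k r) u :=
  contDiffAt_id.prodMk (contDiffAt_pi.2 fun i => h.iteratedFDeriv_right (by
    exact_mod_cast le_top))

theorem SmoothNear.prol {r : EB → EP} {u : EB} (k : ℕ) (h : SmoothNear r u) :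
    SmoothNear (prol k r) u := h.mono fun _ hy => contDiffAt_prol k hy

/-- Differentiating a derivative of order `i` gives the derivative of order `i + 1` with its first
slot uncurried. This is why total differentiation raises the jet order by exactly one. -/
theorem hasFDerivAt_prol {r : EB → EP} {u : EB} (k : ℕ) (h : ContDiffAt ℝ ∞ r u) :
    HasFDerivAt (prol k r) (shift (prol (k + 1) r u)) u := by
  refine (hasFDerivAt_id u).prodMk (hasFDerivAt_pi'.2 fun i => ?_)
  have h1 : DifferentiableAt ℝ (iteratedFDeriv ℝ i r) u :=
    (h.iteratedFDeriv_right (m := 1) (i := i) (by exact_mod_cast le_top)).differentiableAt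
      one_ne_zero
  have h2 := h1.hasFDerivAt
  exact h2

theorem prol_congr {r r' : EB → EP} {u : EB} (k : ℕ) (h : r =ᶠ[𝓝 u] r') :
    prol k r u = prol k r' u :=
  JetCoord.ext_comp rfl fun i _ => (h.iteratedFDeriv ℝ i).self_of_nhds

/-- The total derivative of a function of jet coordinates. -/
def totalD {k : ℕ} (G : JetCoord EB EP k → W) (x : JetCoord EB EP (k + 1)) : EB →L[ℝ] W :=
  (fderiv ℝ G (JetCoord.truncL (Nat.le_succ k) x)).comp (shift x)

/-- The link between `totalD`, an algebraic expression in the next jet, and honest differentiation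
along a section. Identities between total derivatives are proved below by writing both sides as
derivatives of one function of the independent variables. -/
theorem fderiv_comp_prol {k : ℕ} {G : JetCoord EB EP k → W} {r : EB → EP} {u : EB}
    (hG : DifferentiableAt ℝ G (prol k r u)) (h : ContDiffAt ℝ ∞ r u) :
    HasFDerivAt (fun y => G (prol k r y)) (totalD G (prol (k + 1) r u)) u :=
  hG.hasFDerivAt.comp u (hasFDerivAt_prol k h)

theorem contDiffOn_totalD {k : ℕ} {G : JetCoord EB EP k → W} {U : Set (JetCoord EB EP k)}
    (hU : IsOpen U) (hG : ContDiffOn ℝ ∞ G U) :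
    ContDiffOn ℝ ∞ (totalD G) (JetCoord.truncL (Nat.le_succ k) ⁻¹' U) := by
  refine ContDiffOn.clm_comp ?_ contDiff_shift.contDiffOn
  exact (hG.fderiv_of_isOpen hU (m := ∞) (by simp)).comp
    (ContinuousLinearMap.contDiff _).contDiffOn (fun _ hx => hx)

theorem totalD_comp_truncL {k l : ℕ} (h : k ≤ l) {G : JetCoord EB EP k → W}
    {x : JetCoord EB EP (l + 1)}
    (hG : DifferentiableAt ℝ G (JetCoord.truncL (h.trans (Nat.le_succ l)) x)) :
    totalD (G ∘ JetCoord.truncL h) x = totalD G (JetCoord.truncL (Nat.succ_le_succ h) x) := by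
  unfold totalD
  rw [fderiv_comp]
  · rw [ContinuousLinearMap.fderiv]; rfl
  · exact hG
  · exact (ContinuousLinearMap.differentiableAt _)

theorem totalD_sub {k : ℕ} {G G' : JetCoord EB EP k → W} {x : JetCoord EB EP (k + 1)}
    (h : DifferentiableAt ℝ G (JetCoord.truncL (Nat.le_succ k) x))
    (h' : DifferentiableAt ℝ G' (JetCoord.truncL (Nat.le_succ k) x)) :
    totalD (fun x => G x - G' x) x = totalD G x - totalD G' x := by
  unfold totalD
  rw [fderiv_fun_sub h h', ContinuousLinearMap.sub_comp]

theorem totalD_clm {k : ℕ} (L : W →L[ℝ] W') {G : JetCoord EB EP k → W}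
    {x : JetCoord EB EP (k + 1)}
    (h : DifferentiableAt ℝ G (JetCoord.truncL (Nat.le_succ k) x)) :
    totalD (fun x => L (G x)) x = L.comp (totalD G x) := by
  unfold totalD
  have := (L.hasFDerivAt.comp _ h.hasFDerivAt).fderiv
  rw [Function.comp_def] at this
  rw [this, ContinuousLinearMap.comp_assoc]

/-- The iterated total derivative of a function of jet coordinates, with respect to a moving
frame. -/
def iterD (A : EB → EB →L[ℝ] EB) {K : ℕ} (G : JetCoord EB EP K → W) :
    ∀ i : ℕ, JetCoord EB EP (K + i) → EB [×i]→L[ℝ] W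
  | 0 => fun x => ContinuousMultilinearMap.uncurry0 ℝ EB (G x)
  | i + 1 => fun x => ((totalD (iterD A G i) x).comp (A x.1)).uncurryLeft

theorem contDiffOn_iterD {A : EB → EB →L[ℝ] EB} {V : Set EB} (hA : ContDiffOn ℝ ∞ A V)
    {K : ℕ} {G : JetCoord EB EP K → W} {U : Set (JetCoord EB EP K)}
    (hU : IsOpen U) (hG : ContDiffOn ℝ ∞ G U) (hUV : ∀ x ∈ U, x.1 ∈ V) (i : ℕ) :
    ContDiffOn ℝ ∞ (iterD A G i) (JetCoord.truncL (Nat.le_add_right K i) ⁻¹' U) := by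
  induction i with
  | zero =>
    exact (LinearIsometryEquiv.contDiff (𝕜 := ℝ)
      (continuousMultilinearCurryFin0 ℝ EB W).symm).comp_contDiffOn hG
  | succ i ih =>
    have h1 : ContDiffOn ℝ ∞ (totalD (iterD A G i))
        (JetCoord.truncL (Nat.le_add_right K (i + 1)) ⁻¹' U) :=
      contDiffOn_totalD (hU.preimage (JetCoord.truncL (Nat.le_add_right K i)).continuous) ih
    have h2 : ContDiffOn ℝ ∞ (fun x : JetCoord EB EP (K + (i + 1)) => A x.1)
        (JetCoord.truncL (Nat.le_add_right K (i + 1)) ⁻¹' U) :=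
      hA.comp contDiff_fst.contDiffOn fun x hx => hUV _ hx
    exact (LinearIsometryEquiv.contDiff (𝕜 := ℝ)
      (continuousMultilinearCurryLeftEquiv ℝ (fun _ : Fin (i + 1) => EB) W).symm).comp_contDiffOn
      (h1.clm_comp h2)

/-- Since the differential of `ρ` at `y` is expressed through the frame at the point `ρ y`, every
differentiation again yields a function of the jet of `r` at `ρ y`. The cases of use are `ρ` a
transition between charts, for changes of jet coordinates, and `ρ` the identity. The equality is
stated near `w` because the induction differentiates it. -/
theorem iteratedFDeriv_comp_prol {A : EB → EB →L[ℝ] EB} {K : ℕ} {G : JetCoord EB EP K → W}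
    {V : Set EB} (hA : ContDiffOn ℝ ∞ A V)
    {U : Set (JetCoord EB EP K)} (hU : IsOpen U) (hG : ContDiffOn ℝ ∞ G U)
    (hUV : ∀ x ∈ U, x.1 ∈ V)
    {r : EB → EP} {ρ : EB → EB} {w : EB} (hρ : SmoothNear ρ w) (hr : SmoothNear r (ρ w))
    (hρA : ∀ᶠ y in 𝓝 w, A (ρ y) = fderiv ℝ ρ y) (hu : prol K r (ρ w) ∈ U) (i : ℕ) :
    ∀ᶠ y in 𝓝 w, iteratedFDeriv ℝ i (fun y => G (prol K r (ρ y))) y =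
      iterD A G i (prol (K + i) r (ρ y)) := by
  have hc : ContinuousAt ρ w := hρ.contDiffAt.continuousAt
  have hmem : ∀ᶠ y in 𝓝 w, prol K r (ρ y) ∈ U :=
    (ContinuousAt.comp (contDiffAt_prol K hr.contDiffAt).continuousAt hc).eventually
      (hU.mem_nhds hu)
  induction i with
  | zero => exact Eventually.of_forall fun y => rfl
  | succ i ih =>
    filter_upwards [ih.eventually_nhds, hmem, hρ, hc.eventually hr, hρA] with y h1 h2 h3 h4 h5
    rw [iteratedFDeriv_succ_eq_comp_left, Function.comp_apply]
    have h6 : iteratedFDeriv ℝ i (fun y => G (prol K r (ρ y))) =ᶠ[𝓝 y]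
      fun y => iterD A G i (prol (K + i) r (ρ y)) := h1
    rw [h6.fderiv_eq]
    have h7 : DifferentiableAt ℝ (iterD A G i) (prol (K + i) r (ρ y)) :=
      ((contDiffOn_iterD hA hU hG hUV i).contDiffAt
        ((hU.preimage (ContinuousLinearMap.continuous _)).mem_nhds h2)).differentiableAt (by simp)
    have h8 := (fderiv_comp_prol h7 h4).comp y (h3.differentiableAt (by simp)).hasFDerivAt
    rw [HasFDerivAt.fderiv (f := fun y => iterD A G i (prol (K + i) r (ρ y))) h8]
    have h9 : (prol (K + (i + 1)) r (ρ y)).1 = ρ y := rfl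
    simp only [iterD, h9, h5]
    rfl

/-- The iterated total derivative with respect to the standard frame. -/
abbrev iterD₁ {K : ℕ} (G : JetCoord EB EP K → W) (i : ℕ) : JetCoord EB EP (K + i) → EB [×i]→L[ℝ] W :=
  iterD (fun _ => ContinuousLinearMap.id ℝ EB) G i

theorem contDiffOn_iterD₁ {K : ℕ} {G : JetCoord EB EP K → W} {U : Set (JetCoord EB EP K)}
    (hU : IsOpen U) (hG : ContDiffOn ℝ ∞ G U) (i : ℕ) :
    ContDiffOn ℝ ∞ (iterD₁ G i) (JetCoord.truncL (Nat.le_add_right K i) ⁻¹' U) :=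
  contDiffOn_iterD (V := univ) contDiffOn_const hU hG (fun _ _ => mem_univ _) i

theorem iteratedFDeriv_comp_prol₁ {K : ℕ} {G : JetCoord EB EP K → W}
    {U : Set (JetCoord EB EP K)} (hU : IsOpen U) (hG : ContDiffOn ℝ ∞ G U)
    {r : EB → EP} {u : EB} (hr : SmoothNear r u) (hu : prol K r u ∈ U) (i : ℕ) :
    ∀ᶠ y in 𝓝 u, iteratedFDeriv ℝ i (fun y => G (prol K r y)) y =
      iterD₁ G i (prol (K + i) r y) :=
  iteratedFDeriv_comp_prol (V := univ) (ρ := fun y => y) contDiffOn_const hU hG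
    (fun _ _ => mem_univ _) (Eventually.of_forall fun _ => contDiffAt_id) hr
    (Eventually.of_forall fun _ => fderiv_fun_id.symm) hu i

/-- The prolongation of a map of jet coordinates. -/
def prolMap {K : ℕ} (G : JetCoord EB EP K → W) (k : ℕ) (x : JetCoord EB EP (K + k)) :
    JetCoord EB W k :=
  (x.1, fun i => iterD₁ G i (JetCoord.truncL (Nat.add_le_add_left (Nat.le_of_lt_succ i.2) K) x))

theorem contDiffOn_prolMap {K : ℕ} {G : JetCoord EB EP K → W} {U : Set (JetCoord EB EP K)}
    (hU : IsOpen U) (hG : ContDiffOn ℝ ∞ G U) (k : ℕ) :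
    ContDiffOn ℝ ∞ (prolMap G k) (JetCoord.truncL (Nat.le_add_right K k) ⁻¹' U) :=
  contDiff_fst.contDiffOn.prodMk (contDiffOn_pi.2 fun i =>
    (contDiffOn_iterD₁ hU hG i).comp (ContinuousLinearMap.contDiff _).contDiffOn
      (fun _ hx => hx))

/-- The defining property of `prolMap`: the differential operator with symbol `G`, followed by
taking the `k`-jet, is a function of the jet of order `K + k`. -/
theorem prol_comp_prol {K : ℕ} {G : JetCoord EB EP K → W}
    {U : Set (JetCoord EB EP K)} (hU : IsOpen U) (hG : ContDiffOn ℝ ∞ G U)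
    {r : EB → EP} {u : EB} (hr : SmoothNear r u) (hu : prol K r u ∈ U) (k : ℕ) :
    prol k (fun y => G (prol K r y)) u = prolMap G k (prol (K + k) r u) :=
  JetCoord.ext_comp rfl fun i _ =>
    (iteratedFDeriv_comp_prol₁ hU hG hr hu i).self_of_nhds

/-- A jet whose only nonzero component is the derivative of the highest order. -/
def topJet (N : ℕ) : (EB [×N]→L[ℝ] EP) →L[ℝ] JetCoord EB EP N :=
  (ContinuousLinearMap.inr ℝ EB _).comp
    (ContinuousLinearMap.single ℝ (fun i : Fin (N + 1) => EB [×(i : ℕ)]→L[ℝ] EP) (Fin.last N))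

theorem comp_topJet_self (N : ℕ) (q : EB [×N]→L[ℝ] EP) :
    JetCoord.comp N le_rfl (topJet N q) = q :=
  Pi.single_eq_same (M := fun i : Fin (N + 1) => EB [×(i : ℕ)]→L[ℝ] EP) (Fin.last N) q

theorem comp_topJet_of_lt {N i : ℕ} (h : i < N) (q : EB [×N]→L[ℝ] EP) :
    JetCoord.comp i h.le (topJet N q) = 0 :=
  Pi.single_eq_of_ne (M := fun i : Fin (N + 1) => EB [×(i : ℕ)]→L[ℝ] EP)
    (i := Fin.last N) (i' := ⟨i, Nat.lt_succ_of_le h.le⟩)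
    (fun h' => h.ne (congrArg Fin.val h')) q

theorem eq_topJet {k : ℕ} {x : JetCoord EB EP (k + 1)}
    (h : JetCoord.truncL (Nat.le_succ k) x = 0) :
    x = topJet (k + 1) (JetCoord.comp (k + 1) le_rfl x) := by
  have h1 := congrArg Prod.fst h
  refine JetCoord.ext_comp h1 fun i hi => ?_
  rcases hi.lt_or_eq with hi' | rfl
  · rw [comp_topJet_of_lt hi']
    exact congrArg (JetCoord.comp i (Nat.le_of_lt_succ hi')) h
  · rw [comp_topJet_self]

set_option synthInstance.maxHeartbeats 200000 in
/-- Iterated total derivatives are affine in the highest derivatives. -/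
theorem iterD₁_add_top {K : ℕ} {G : JetCoord EB EP K → W}
    {U : Set (JetCoord EB EP K)} (hU : IsOpen U) (hG : ContDiffOn ℝ ∞ G U) (i : ℕ)
    {x q : JetCoord EB EP (K + i + 1)}
    (hx : JetCoord.truncL ((Nat.le_add_right K i).trans (Nat.le_succ _)) x ∈ U)
    (hq : JetCoord.truncL (Nat.le_succ (K + i)) q = 0) (t : ℝ) :
    iterD₁ G (i + 1) (x + t • q) = iterD₁ G (i + 1) x + t • fderiv ℝ (iterD₁ G (i + 1)) x q := by
  -- Along the line only the highest derivatives move. They enter `iterD₁ G (i + 1)` through `shift`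
  -- alone, because the differential of `iterD₁ G i` is taken at the truncated jet.
  have hline : ∀ t : ℝ, JetCoord.truncL (Nat.le_succ (K + i)) (x + t • q) =
      JetCoord.truncL (Nat.le_succ (K + i)) x := fun t => by
    rw [map_add, map_smul, hq, smul_zero, add_zero]
  -- `shift` is affine and not linear, as its base component is the constant identity; its linear
  -- part at `q` is `shift q - shift 0`.
  have hshift : ∀ t : ℝ, shift (x + t • q) = shift x + t • (shift q - (shift 0)) := fun t => by
    ext v
    · simp [shift]
    · simp [shift]
  have key : ∀ t : ℝ, iterD₁ G (i + 1) (x + t • q) = iterD₁ G (i + 1) x +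
      t • ((fderiv ℝ (iterD₁ G i) (JetCoord.truncL (Nat.le_succ (K + i)) x)).comp
        (shift q - shift 0)).uncurryLeft := fun t => by
    have h1 : ∀ y : JetCoord EB EP (K + i + 1), iterD₁ G (i + 1) y =
        (continuousMultilinearCurryLeftEquiv ℝ (fun _ : Fin (i + 1) => EB) W).symm
          ((fderiv ℝ (iterD₁ G i) (JetCoord.truncL (Nat.le_succ (K + i)) y)).comp (shift y)) :=
      fun y => rfl
    have h2 : ((fderiv ℝ (iterD₁ G i) (JetCoord.truncL (Nat.le_succ (K + i)) x)).comp
        (shift q - shift 0)).uncurryLeft =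
        (continuousMultilinearCurryLeftEquiv ℝ (fun _ : Fin (i + 1) => EB) W).symm
          ((fderiv ℝ (iterD₁ G i) (JetCoord.truncL (Nat.le_succ (K + i)) x)).comp
            (shift q - shift 0)) := rfl
    rw [h1, h1, h2, hline, hshift, ContinuousLinearMap.comp_add, ContinuousLinearMap.comp_smul,
      map_add, map_smul]
  rw [key]
  -- The slope of the affine function is now identified with its directional derivative by
  -- differentiating at `t = 0`.
  have hd : DifferentiableAt ℝ (iterD₁ G (i + 1)) x :=
    ((contDiffOn_iterD₁ hU hG (i + 1)).contDiffAt
      ((hU.preimage (ContinuousLinearMap.continuous _)).mem_nhds hx)).differentiableAt (by simp)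
  have h3 : HasDerivAt (fun t : ℝ => iterD₁ G (i + 1) (x + t • q))
      (fderiv ℝ (iterD₁ G (i + 1)) x q) 0 := by
    have h4 : HasDerivAt (fun t : ℝ => x + t • q) q 0 := by
      simpa using ((hasDerivAt_id (0 : ℝ)).smul_const q).const_add x
    have h5 : HasFDerivAt (iterD₁ G (i + 1)) (fderiv ℝ (iterD₁ G (i + 1)) x)
        (x + (0 : ℝ) • q) := by
      rw [zero_smul, add_zero]
      exact hd.hasFDerivAt
    exact h5.comp_hasDerivAt 0 h4
  simp_rw [key] at h3
  have h6 := ((hasDerivAt_id (0 : ℝ)).smul_const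
    ((fderiv ℝ (iterD₁ G i) (JetCoord.truncL (Nat.le_succ (K + i)) x)).comp
        (shift q - shift 0)).uncurryLeft).const_add (iterD₁ G (i + 1) x)
  have h7 := h3.unique h6
  rw [h7, one_smul]

end JetCalculus

end FlatReps

end

noncomputable section

namespace FlatReps

/-! ### Changes of charts -/

section Charts

variable {EB HB B : Type*} [NormedAddCommGroup EB] [NormedSpace ℝ EB] [TopologicalSpace HB]
  [TopologicalSpace B] [ChartedSpace HB B]

/-- The transition map between two charts. -/
def chartTrans (I : ModelWithCorners ℝ EB HB) (b₀ b₁ : B) : EB → EB :=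
  fun u => extChartAt I b₁ ((extChartAt I b₀).symm u)

/-- The domain of the transition map between two charts. -/
def chartDom (I : ModelWithCorners ℝ EB HB) (b₀ b₁ : B) : Set EB :=
  (extChartAt I b₀).target ∩ (extChartAt I b₀).symm ⁻¹' (extChartAt I b₁).source

variable (I : ModelWithCorners ℝ EB HB)

theorem isOpen_chartDom [I.Boundaryless] (b₀ b₁ : B) : IsOpen (chartDom I b₀ b₁) :=
  (continuousOn_extChartAt_symm b₀).isOpen_inter_preimage (isOpen_extChartAt_target b₀)
    (isOpen_extChartAt_source b₁)

theorem contDiffOn_chartTrans [IsManifold I ∞ B] (b₀ b₁ : B) :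
    ContDiffOn ℝ ∞ (chartTrans I b₀ b₁) (chartDom I b₀ b₁) := by
  have h1 : ContMDiffOn I 𝓘(ℝ, EB) ∞ (extChartAt I b₁) (extChartAt I b₁).source := by
    rw [extChartAt_source]
    exact contMDiffOn_extChartAt
  exact (h1.comp ((contMDiffOn_extChartAt_symm b₀).mono inter_subset_left)
    (fun _ hx => hx.2)).contDiffOn

variable {I}

theorem extChartAt_mem_chartDom {b b₀ b₁ : B} (h₀ : b ∈ (chartAt HB b₀).source)
    (h₁ : b ∈ (chartAt HB b₁).source) : extChartAt I b₀ b ∈ chartDom I b₀ b₁ := by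
  rw [← extChartAt_source I] at h₀ h₁
  refine ⟨(extChartAt I b₀).map_source h₀, ?_⟩
  rw [mem_preimage, (extChartAt I b₀).left_inv h₀]
  exact h₁

theorem mem_source_of_mem_chartDom {b b₀ b₁ : B} (h₀ : b ∈ (chartAt HB b₀).source)
    (h : extChartAt I b₀ b ∈ chartDom I b₀ b₁) : b ∈ (chartAt HB b₁).source := by
  rw [← extChartAt_source I] at h₀ ⊢
  have := h.2
  rwa [mem_preimage, (extChartAt I b₀).left_inv h₀] at this

theorem chartTrans_extChartAt {b b₀ b₁ : B} (h₀ : b ∈ (chartAt HB b₀).source) :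
    chartTrans I b₀ b₁ (extChartAt I b₀ b) = extChartAt I b₁ b := by
  rw [← extChartAt_source I] at h₀
  rw [chartTrans, (extChartAt I b₀).left_inv h₀]

theorem chartTrans_symm {b₀ b₁ : B} {u : EB} (h : u ∈ chartDom I b₀ b₁) :
    chartTrans I b₁ b₀ (chartTrans I b₀ b₁ u) = u := by
  rw [chartTrans, chartTrans, (extChartAt I b₁).left_inv h.2, (extChartAt I b₀).right_inv h.1]

theorem extChartAt_symm_chartTrans {b₀ b₁ : B} {u : EB} (h : u ∈ chartDom I b₀ b₁) :
    (extChartAt I b₁).symm (chartTrans I b₀ b₁ u) = (extChartAt I b₀).symm u := by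
  rw [chartTrans, (extChartAt I b₁).left_inv h.2]

theorem chartTrans_mem {b₀ b₁ : B} {u : EB} (h : u ∈ chartDom I b₀ b₁) :
    chartTrans I b₀ b₁ u ∈ chartDom I b₁ b₀ := by
  refine ⟨(extChartAt I b₁).map_source h.2, ?_⟩
  rw [mem_preimage, extChartAt_symm_chartTrans h]
  exact (extChartAt I b₀).map_target h.1

end Charts

/-! ### Jet coordinates of sections and their changes -/

section Jets

variable {EB HB B EP HP P W W' : Type*}
  [NormedAddCommGroup EB] [NormedSpace ℝ EB] [TopologicalSpace HB]
  [TopologicalSpace B] [ChartedSpace HB B]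
  [NormedAddCommGroup EP] [NormedSpace ℝ EP] [TopologicalSpace HP]
  [TopologicalSpace P] [ChartedSpace HP P]
  [NormedAddCommGroup W] [NormedSpace ℝ W] [NormedAddCommGroup W'] [NormedSpace ℝ W']
  {IB : ModelWithCorners ℝ EB HB} {IP : ModelWithCorners ℝ EP HP} {fib : B → Set P}

section CoordChange

variable (IB IP)

/-- The set of coordinates in the charts around `b₀`, `q₀` of jets that also lie over the domain
of the charts around `b₁`, `q₁`. -/
def coordDom (b₀ : B) (q₀ : P) (b₁ : B) (q₁ : P) (k : ℕ) : Set (JetCoord EB EP k) :=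
  {x | x.1 ∈ chartDom IB b₀ b₁ ∧ JetCoord.val x ∈ chartDom IP q₀ q₁}

theorem isOpen_coordDom [IB.Boundaryless] [IP.Boundaryless] (b₀ : B) (q₀ : P) (b₁ : B) (q₁ : P)
    (k : ℕ) : IsOpen (coordDom IB IP b₀ q₀ b₁ q₁ k) :=
  ((isOpen_chartDom IB b₀ b₁).preimage continuous_fst).inter
    ((isOpen_chartDom IP q₀ q₁).preimage (JetCoord.val (EB := EB) (EP := EP)).continuous)

/-- The change of coordinates of jets. -/
def changeCoords (b₀ : B) (q₀ : P) (b₁ : B) (q₁ : P) (k : ℕ) (x : JetCoord EB EP k) :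
    JetCoord EB EP k :=
  (chartTrans IB b₀ b₁ x.1, fun i =>
    iterD (fun u => fderiv ℝ (chartTrans IB b₁ b₀) (chartTrans IB b₀ b₁ u))
      (fun y : JetCoord EB EP 0 => chartTrans IP q₀ q₁ (JetCoord.val y)) i
      (JetCoord.truncL ((Nat.zero_add _).trans_le (Nat.le_of_lt_succ i.2)) x))

theorem contDiffOn_chartFrame [IB.Boundaryless] [IsManifold IB ∞ B] (b₀ b₁ : B) :
    ContDiffOn ℝ ∞ (fun u => fderiv ℝ (chartTrans IB b₁ b₀) (chartTrans IB b₀ b₁ u))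
      (chartDom IB b₀ b₁) :=
  ((contDiffOn_chartTrans IB b₁ b₀).fderiv_of_isOpen (isOpen_chartDom IB b₁ b₀)
    (m := ∞) (by simp)).comp (contDiffOn_chartTrans IB b₀ b₁) fun _ h => chartTrans_mem h

theorem contDiffOn_chartTrans_val [IsManifold IP ∞ P] (b₀ : B) (q₀ : P) (b₁ : B) (q₁ : P) :
    ContDiffOn ℝ ∞ (fun y : JetCoord EB EP 0 => chartTrans IP q₀ q₁ (JetCoord.val y))
      (coordDom IB IP b₀ q₀ b₁ q₁ 0) :=
  (contDiffOn_chartTrans IP q₀ q₁).comp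
    (ContinuousLinearMap.contDiff (JetCoord.val (EB := EB) (EP := EP))).contDiffOn
    (fun _ h => h.2)

theorem contDiffOn_changeCoords [IB.Boundaryless] [IsManifold IB ∞ B] [IP.Boundaryless]
    [IsManifold IP ∞ P] (b₀ : B) (q₀ : P) (b₁ : B) (q₁ : P) (k : ℕ) :
    ContDiffOn ℝ ∞ (changeCoords IB IP b₀ q₀ b₁ q₁ k) (coordDom IB IP b₀ q₀ b₁ q₁ k) := by
  refine ContDiffOn.prodMk ((contDiffOn_chartTrans IB b₀ b₁).comp contDiff_fst.contDiffOn
    fun _ h => h.1) (contDiffOn_pi.2 fun i => ?_)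
  exact (contDiffOn_iterD (contDiffOn_chartFrame IB b₀ b₁)
    (isOpen_coordDom IB IP b₀ q₀ b₁ q₁ 0) (contDiffOn_chartTrans_val IB IP b₀ q₀ b₁ q₁)
    (fun _ h => h.1) i).comp
    (ContinuousLinearMap.contDiff (JetCoord.truncL (EB := EB) (EP := EP) _)).contDiffOn
    (fun _ h => h)

end CoordChange

namespace LocSec

variable {b : B}

theorem continuousAt (s : LocSec IB IP fib b) : ContinuousAt s.toFun b :=
  s.smooth.self_of_nhds.continuousAt

/-- A local section near `b`, considered as a local section near another point. -/
def move (s : LocSec IB IP fib b) (y : B)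
    (h : ∀ᶠ x in 𝓝 y, ContMDiffAt IB IP ∞ s.toFun x ∧ s.toFun x ∈ fib x) : LocSec IB IP fib y :=
  ⟨s.toFun, h.mono fun _ h => h.1, h.mono fun _ h => h.2⟩

theorem eventually_move (s : LocSec IB IP fib b) :
    ∀ᶠ y in 𝓝 b, ∀ᶠ x in 𝓝 y, ContMDiffAt IB IP ∞ s.toFun x ∧ s.toFun x ∈ fib x :=
  eventually_eventually_nhds.2 (s.smooth.and s.mem_fib)

theorem eventually_inChart (s : LocSec IB IP fib b) {b₀ : B} {q₀ : P} (h : s.InChart b₀ q₀) :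
    ∀ᶠ y in 𝓝 b, y ∈ (chartAt HB b₀).source ∧ s.toFun y ∈ (chartAt HP q₀).source :=
  ((chartAt HB b₀).open_source.eventually_mem h.1).and
    (s.continuousAt.eventually ((chartAt HP q₀).open_source.mem_nhds h.2))

theorem tendsto_extChartAt_symm [IB.Boundaryless] {b₀ : B} (h : b ∈ (chartAt HB b₀).source) :
    Tendsto (extChartAt IB b₀).symm (𝓝 (extChartAt IB b₀ b)) (𝓝 b) := by
  rw [← extChartAt_source IB] at h
  have h1 := continuousAt_extChartAt_symm' h
  rwa [ContinuousAt, (extChartAt IB b₀).left_inv h] at h1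

theorem smoothNear_expr [IB.Boundaryless] [IsManifold IB ∞ B] [IsManifold IP ∞ P]
    (s : LocSec IB IP fib b) {b₀ : B} {q₀ : P} (h : s.InChart b₀ q₀) :
    SmoothNear (s.expr b₀ q₀) (extChartAt IB b₀ b) := by
  have ht : (extChartAt IB b₀).target ∈ 𝓝 (extChartAt IB b₀ b) :=
    extChartAt_target_mem_nhds' ((extChartAt IB b₀).map_source
      (by rw [extChartAt_source]; exact h.1))
  filter_upwards [ht, (isOpen_extChartAt_target b₀).eventually_mem
    (mem_of_mem_nhds ht), (tendsto_extChartAt_symm h.1).eventually s.smooth,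
    (tendsto_extChartAt_symm h.1).eventually (s.eventually_inChart h)] with u h1 _ h2 h3
  have h4 : ContMDiffAt 𝓘(ℝ, EB) IB ∞ (extChartAt IB b₀).symm u :=
    (contMDiffOn_extChartAt_symm b₀).contMDiffAt ((isOpen_extChartAt_target b₀).mem_nhds h1)
  have h5 : ContMDiffAt IP 𝓘(ℝ, EP) ∞ (extChartAt IP q₀)
      (s.toFun ((extChartAt IB b₀).symm u)) := contMDiffAt_extChartAt' h3.2
  exact (h5.comp u (h2.comp u h4)).contDiffAt

theorem coords_mem_coordDom (s : LocSec IB IP fib b) {b₀ b₁ : B} {q₀ q₁ : P} (k : ℕ)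
    (h₀ : s.InChart b₀ q₀) (h₁ : s.InChart b₁ q₁) :
    s.coords k b₀ q₀ ∈ coordDom IB IP b₀ q₀ b₁ q₁ k := by
  refine ⟨extChartAt_mem_chartDom h₀.1 h₁.1, ?_⟩
  rw [coords, val_prol, expr, (extChartAt IB b₀).left_inv (by rw [extChartAt_source]; exact h₀.1)]
  exact extChartAt_mem_chartDom h₀.2 h₁.2

theorem expr_extChartAt (s : LocSec IB IP fib b) {b₀ y : B} {q₀ : P}
    (h₀ : y ∈ (chartAt HB b₀).source) :
    s.expr b₀ q₀ (extChartAt IB b₀ y) = extChartAt IP q₀ (s.toFun y) := by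
  rw [expr, (extChartAt IB b₀).left_inv (by rw [extChartAt_source]; exact h₀)]

theorem inChart_of_mem_coordDom (s : LocSec IB IP fib b) {b₀ b₁ : B} {q₀ q₁ : P} {k : ℕ}
    (h₀ : s.InChart b₀ q₀) (h : s.coords k b₀ q₀ ∈ coordDom IB IP b₀ q₀ b₁ q₁ k) :
    s.InChart b₁ q₁ := by
  refine ⟨mem_source_of_mem_chartDom h₀.1 h.1, mem_source_of_mem_chartDom h₀.2 ?_ (I := IP)⟩
  have := h.2
  rwa [coords, val_prol, s.expr_extChartAt h₀.1] at this

/-- The coordinate expressions of a section in different charts. -/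
theorem expr_eventuallyEq [IB.Boundaryless] (s : LocSec IB IP fib b) {b₀ b₁ : B} {q₀ q₁ : P}
    (h₀ : s.InChart b₀ q₀) (h₁ : s.InChart b₁ q₁) :
    s.expr b₁ q₁ =ᶠ[𝓝 (extChartAt IB b₁ b)]
      fun y => chartTrans IP q₀ q₁ (s.expr b₀ q₀ (chartTrans IB b₁ b₀ y)) := by
  filter_upwards [(isOpen_chartDom IB b₁ b₀).mem_nhds (extChartAt_mem_chartDom h₁.1 h₀.1),
    (tendsto_extChartAt_symm h₁.1).eventually (s.eventually_inChart h₀)] with y hy h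
  rw [expr, expr, extChartAt_symm_chartTrans hy, chartTrans_extChartAt h.2]

/-- In the new charts the section is its old expression preceded by the transition `ρ` from the
chart at `b₁` to the chart at `b₀`. The differential of `ρ`, written at the image point, is the
frame in `changeCoords`, so `iteratedFDeriv_comp_prol` applies. -/
theorem coords_change [IB.Boundaryless] [IsManifold IB ∞ B] [IP.Boundaryless] [IsManifold IP ∞ P]
    (s : LocSec IB IP fib b) {b₀ b₁ : B} {q₀ q₁ : P} (k : ℕ)
    (h₀ : s.InChart b₀ q₀) (h₁ : s.InChart b₁ q₁) :
    changeCoords IB IP b₀ q₀ b₁ q₁ k (s.coords k b₀ q₀) = s.coords k b₁ q₁ := by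
  refine JetCoord.ext_comp (chartTrans_extChartAt h₀.1) fun i hi => ?_
  have hρ : chartTrans IB b₁ b₀ (extChartAt IB b₁ b) = extChartAt IB b₀ b :=
    chartTrans_extChartAt h₁.1
  have hm : extChartAt IB b₁ b ∈ chartDom IB b₁ b₀ := extChartAt_mem_chartDom h₁.1 h₀.1
  have h2 := iteratedFDeriv_comp_prol (contDiffOn_chartFrame IB b₀ b₁)
    (isOpen_coordDom IB IP b₀ q₀ b₁ q₁ 0) (contDiffOn_chartTrans_val IB IP b₀ q₀ b₁ q₁)
    (fun _ h => h.1) (r := s.expr b₀ q₀) (ρ := chartTrans IB b₁ b₀) (w := extChartAt IB b₁ b)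
    ((contDiffOn_chartTrans IB b₁ b₀).smoothNear ((isOpen_chartDom IB b₁ b₀).mem_nhds hm))
    (by rw [hρ]; exact s.smoothNear_expr h₀)
    (by
      filter_upwards [(isOpen_chartDom IB b₁ b₀).mem_nhds hm] with y hy
      rw [chartTrans_symm hy])
    (by rw [hρ]; exact s.coords_mem_coordDom 0 h₀ h₁) i
  have h3 := h2.self_of_nhds
  have h4 := ((s.expr_eventuallyEq h₀ h₁).iteratedFDeriv ℝ i).self_of_nhds
  rw [hρ] at h3
  change _ = iteratedFDeriv ℝ i (s.expr b₁ q₁) _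
  rw [h4]
  exact h3.symm

/-- The relation `contact` compares coordinates in all charts; one chart suffices, because the
coordinates in any other are the image under `changeCoords`, which does not depend on the section.
-/
theorem jet_eq_of_coords_eq [IB.Boundaryless] [IsManifold IB ∞ B] [IP.Boundaryless]
    [IsManifold IP ∞ P] {s t : LocSec IB IP fib b} {b₀ : B} {q₀ : P} {k : ℕ}
    (hs : s.InChart b₀ q₀) (h : s.toFun b = t.toFun b)
    (hc : s.coords k b₀ q₀ = t.coords k b₀ q₀) : s.jet k = t.jet k := by
  have ht : t.InChart b₀ q₀ := ⟨hs.1, h ▸ hs.2⟩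
  refine Sigma.ext rfl (heq_of_eq (Quotient.sound ⟨h, fun b₁ q₁ hs' => ?_⟩))
  rw [← s.coords_change k hs hs', ← t.coords_change k ht ⟨hs'.1, h ▸ hs'.2⟩, hc]

theorem coords_eq_of_jet_eq {s t : LocSec IB IP fib b} {b₀ : B} {q₀ : P} {k : ℕ}
    (hs : s.InChart b₀ q₀) (h : s.jet k = t.jet k) : s.coords k b₀ q₀ = t.coords k b₀ q₀ := by
  have h2 : contact IB IP fib k b s t := Quotient.exact (eq_of_heq (Sigma.ext_iff.1 h).2)
  exact h2.2 b₀ q₀ hs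

theorem toFun_eq_of_jet_eq {s t : LocSec IB IP fib b} {k : ℕ} (h : s.jet k = t.jet k) :
    s.toFun b = t.toFun b := by
  have h2 : contact IB IP fib k b s t := Quotient.exact (eq_of_heq (Sigma.ext_iff.1 h).2)
  exact h2.1

theorem inChart_self (s : LocSec IB IP fib b) : s.InChart b (s.toFun b) :=
  ⟨mem_chart_source _ _, mem_chart_source _ _⟩

/-- A section near `b` is also a section near every nearby point, so `coords_change` holds there
too. The version on a neighbourhood can be differentiated. -/
theorem eventually_prol_change [IB.Boundaryless] [IsManifold IB ∞ B] [IP.Boundaryless]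
    [IsManifold IP ∞ P] (s : LocSec IB IP fib b) {b₀ b₁ : B} {q₀ q₁ : P} (k : ℕ)
    (h₀ : s.InChart b₀ q₀) (h₁ : s.InChart b₁ q₁) :
    ∀ᶠ u in 𝓝 (extChartAt IB b₀ b), changeCoords IB IP b₀ q₀ b₁ q₁ k (prol k (s.expr b₀ q₀) u) =
      prol k (s.expr b₁ q₁) (chartTrans IB b₀ b₁ u) := by
  filter_upwards [(isOpen_chartDom IB b₀ b₁).mem_nhds (extChartAt_mem_chartDom h₀.1 h₁.1),
    (tendsto_extChartAt_symm h₀.1).eventually (s.eventually_inChart h₀),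
    (tendsto_extChartAt_symm h₀.1).eventually (s.eventually_inChart h₁),
    (tendsto_extChartAt_symm h₀.1).eventually s.eventually_move] with u hu h2 h3 h4
  have h5 := (s.move _ h4).coords_change (b₀ := b₀) (q₀ := q₀) (b₁ := b₁) (q₁ := q₁) k h2 h3
  have h6 : extChartAt IB b₀ ((extChartAt IB b₀).symm u) = u := (extChartAt IB b₀).right_inv hu.1
  unfold coords at h5
  rw [h6] at h5
  exact h5

/-- Total derivatives in different charts. -/
theorem totalD_comp_changeCoords [IB.Boundaryless] [IsManifold IB ∞ B] [IP.Boundaryless]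
    [IsManifold IP ∞ P] (s : LocSec IB IP fib b) {b₀ b₁ : B} {q₀ q₁ : P} {k : ℕ}
    (h₀ : s.InChart b₀ q₀) (h₁ : s.InChart b₁ q₁) {G : JetCoord EB EP k → W}
    (hG : DifferentiableAt ℝ G (s.coords k b₁ q₁)) :
    totalD (fun x => G (changeCoords IB IP b₀ q₀ b₁ q₁ k x)) (s.coords (k + 1) b₀ q₀) =
      (totalD G (s.coords (k + 1) b₁ q₁)).comp
        (fderiv ℝ (chartTrans IB b₀ b₁) (extChartAt IB b₀ b)) := by
  have hΨ : DifferentiableAt ℝ (changeCoords IB IP b₀ q₀ b₁ q₁ k) (s.coords k b₀ q₀) :=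
    ((contDiffOn_changeCoords IB IP b₀ q₀ b₁ q₁ k).contDiffAt
      ((isOpen_coordDom IB IP b₀ q₀ b₁ q₁ k).mem_nhds
        (s.coords_mem_coordDom k h₀ h₁))).differentiableAt (by simp)
  -- The two sides are the derivatives at one point of two functions of `u` that agree near it by
  -- `eventually_prol_change`.
  have h2 : HasFDerivAt (fun u => G (changeCoords IB IP b₀ q₀ b₁ q₁ k (prol k (s.expr b₀ q₀) u)))
      _ (extChartAt IB b₀ b) := fderiv_comp_prol
    (G := fun x => G (changeCoords IB IP b₀ q₀ b₁ q₁ k x)) (r := s.expr b₀ q₀)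
    (u := extChartAt IB b₀ b)
    (DifferentiableAt.comp (s.coords k b₀ q₀) (by rw [s.coords_change k h₀ h₁]; exact hG) hΨ)
    (s.smoothNear_expr h₀).contDiffAt
  have hρ : chartTrans IB b₀ b₁ (extChartAt IB b₀ b) = extChartAt IB b₁ b :=
    chartTrans_extChartAt h₀.1
  have h3 : HasFDerivAt (fun u => G (prol k (s.expr b₁ q₁) (chartTrans IB b₀ b₁ u)))
      ((totalD G (s.coords (k + 1) b₁ q₁)).comp
        (fderiv ℝ (chartTrans IB b₀ b₁) (extChartAt IB b₀ b))) (extChartAt IB b₀ b) := by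
    refine HasFDerivAt.comp (g := fun u => G (prol k (s.expr b₁ q₁) u)) _ ?_
      (((contDiffOn_chartTrans IB b₀ b₁).contDiffAt ((isOpen_chartDom IB b₀ b₁).mem_nhds
        (extChartAt_mem_chartDom h₀.1 h₁.1))).differentiableAt (by simp)).hasFDerivAt
    rw [hρ]
    exact fderiv_comp_prol hG (s.smoothNear_expr h₁).contDiffAt
  refine h2.unique (h3.congr_of_eventuallyEq ?_)
  filter_upwards [s.eventually_prol_change k h₀ h₁] with u hu
  rw [hu]

variable (IB IP fib) in
/-- The local section with a given coordinate expression. -/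
def ofExpr [IB.Boundaryless] [IsManifold IB ∞ B] [IP.Boundaryless] [IsManifold IP ∞ P]
    {b₀ : B} (q₀ : P) (hb : b ∈ (chartAt HB b₀).source) (g : EB → EP)
    (hg : SmoothNear g (extChartAt IB b₀ b))
    (ht : g (extChartAt IB b₀ b) ∈ (extChartAt IP q₀).target)
    (hf : ∀ᶠ u in 𝓝 (extChartAt IB b₀ b),
      (extChartAt IP q₀).symm (g u) ∈ fib ((extChartAt IB b₀).symm u)) : LocSec IB IP fib b where
  toFun y := (extChartAt IP q₀).symm (g (extChartAt IB b₀ y))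
  smooth := by
    have hc : ContinuousAt (extChartAt IB b₀) b :=
      continuousAt_extChartAt' (by rw [extChartAt_source]; exact hb)
    filter_upwards [(chartAt HB b₀).open_source.mem_nhds hb, hc.eventually hg,
      hc.eventually (hg.contDiffAt.continuousAt.eventually
        ((isOpen_extChartAt_target q₀).mem_nhds ht))] with y h1 h2 h3
    have h4 : ContMDiffAt 𝓘(ℝ, EP) IP ∞ (extChartAt IP q₀).symm (g (extChartAt IB b₀ y)) :=
      (contMDiffOn_extChartAt_symm q₀).contMDiffAt ((isOpen_extChartAt_target q₀).mem_nhds h3)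
    exact h4.comp y (h2.contMDiffAt.comp y (contMDiffAt_extChartAt' h1))
  mem_fib := by
    have hc : ContinuousAt (extChartAt IB b₀) b :=
      continuousAt_extChartAt' (by rw [extChartAt_source]; exact hb)
    filter_upwards [(chartAt HB b₀).open_source.mem_nhds hb, hc.eventually hf] with y h1 h2
    rwa [(extChartAt IB b₀).left_inv (by rw [extChartAt_source]; exact h1)] at h2

section OfExpr

variable [IB.Boundaryless] [IsManifold IB ∞ B] [IP.Boundaryless] [IsManifold IP ∞ P]
    {b₀ : B} {q₀ : P} (hb : b ∈ (chartAt HB b₀).source) (g : EB → EP)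
    (hg : SmoothNear g (extChartAt IB b₀ b))
    (ht : g (extChartAt IB b₀ b) ∈ (extChartAt IP q₀).target)
    (hf : ∀ᶠ u in 𝓝 (extChartAt IB b₀ b),
      (extChartAt IP q₀).symm (g u) ∈ fib ((extChartAt IB b₀).symm u))

theorem ofExpr_inChart : (ofExpr IB IP fib q₀ hb g hg ht hf).InChart b₀ q₀ := by
  refine ⟨hb, ?_⟩
  have := (extChartAt IP q₀).map_target ht
  rwa [extChartAt_source] at this

theorem ofExpr_expr :
    (ofExpr IB IP fib q₀ hb g hg ht hf).expr b₀ q₀ =ᶠ[𝓝 (extChartAt IB b₀ b)] g := by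
  filter_upwards [hg.contDiffAt.continuousAt.eventually
    ((isOpen_extChartAt_target q₀).mem_nhds ht), (isOpen_extChartAt_target (I := IB) b₀).mem_nhds
      ((extChartAt IB b₀).map_source (by rw [extChartAt_source]; exact hb))] with u h1 h2
  simp only [expr, ofExpr]
  rw [(extChartAt IB b₀).right_inv h2, (extChartAt IP q₀).right_inv h1]

theorem ofExpr_coords (k : ℕ) :
    (ofExpr IB IP fib q₀ hb g hg ht hf).coords k b₀ q₀ = prol k g (extChartAt IB b₀ b) :=
  prol_congr k (ofExpr_expr hb g hg ht hf)

end OfExpr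

end LocSec

end Jets

end FlatReps

end

noncomputable section

namespace FlatReps

section Jets

variable {EB HB B EP HP P W W' : Type*}
  [NormedAddCommGroup EB] [NormedSpace ℝ EB] [TopologicalSpace HB]
  [TopologicalSpace B] [ChartedSpace HB B]
  [NormedAddCommGroup EP] [NormedSpace ℝ EP] [TopologicalSpace HP]
  [TopologicalSpace P] [ChartedSpace HP P]
  [NormedAddCommGroup W] [NormedSpace ℝ W] [NormedAddCommGroup W'] [NormedSpace ℝ W']
  {IB : ModelWithCorners ℝ EB HB} {IP : ModelWithCorners ℝ EP HP} {fib : B → Set P}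

/-! ### Symmetry of iterated derivatives -/

/-- Adjacent transpositions generate the symmetric group, so only these are needed. Exchanging the
first two slots is symmetry of the second derivative of `iteratedFDeriv ℝ n f`; exchanging later
slots is the derivative of the identity of lower order, which is why the claim is made at all nearby
points. -/
theorem SmoothNear.iteratedFDeriv_swap {f : EB → EP} {u : EB} (h : SmoothNear f u) (n : ℕ)
    (i : Fin n) : ∀ᶠ y in 𝓝 u, ∀ v : Fin (n + 1) → EB,
      iteratedFDeriv ℝ (n + 1) f y (fun j => v (Equiv.swap i.castSucc i.succ j)) =
        iteratedFDeriv ℝ (n + 1) f y v := by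
  induction n with
  | zero => exact i.elim0
  | succ n ih =>
    have hd : ∀ m : ℕ, ∀ y, ContDiffAt ℝ ∞ f y → DifferentiableAt ℝ (iteratedFDeriv ℝ m f) y :=
      fun m y hy => (hy.iteratedFDeriv_right (m := 1) (i := m)
        (by exact_mod_cast le_top)).differentiableAt one_ne_zero
    induction i using Fin.cases with
    | zero =>
      filter_upwards [h] with y hy v
      have h1 : IsSymmSndFDerivAt ℝ (iteratedFDeriv ℝ n f) y :=
        (hy.iteratedFDeriv_right (m := ∞) (i := n) (by exact_mod_cast le_top)).isSymmSndFDerivAt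
          (by rw [minSmoothness_of_isRCLikeNormedField]; exact ENat.LEInfty.out)
      have key : ∀ w : Fin (n + 2) → EB, iteratedFDeriv ℝ (n + 2) f y w =
          fderiv ℝ (fderiv ℝ (iteratedFDeriv ℝ n f)) y (w 0) (w 1) (Fin.tail (Fin.tail w)) := by
        intro w
        have h2 : DifferentiableAt ℝ (fderiv ℝ (iteratedFDeriv ℝ n f)) y :=
          ((hy.iteratedFDeriv_right (m := ∞) (i := n)
            (by exact_mod_cast le_top)).fderiv_right (m := ∞) (by simp)).differentiableAt
              (by simp)
        have h3 := h2.hasFDerivAt.clm_apply (hasFDerivAt_const (w 1) y)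
        have h4 := (ContinuousMultilinearMap.apply ℝ (fun _ : Fin n => EB) EP
          (Fin.tail (Fin.tail w))).hasFDerivAt.comp y h3
        have h5 := (ContinuousMultilinearMap.apply ℝ (fun _ : Fin (n + 1) => EB) EP
          (Fin.tail w)).hasFDerivAt.comp y (hd (n + 1) y hy).hasFDerivAt
        have h6 := congrArg (fun L => L (w 0)) (h5.unique h4)
        rw [iteratedFDeriv_succ_apply_left]
        refine h6.trans ?_
        simp
      rw [key, key]
      have e0 : Equiv.swap (0 : Fin (n + 1)).castSucc (0 : Fin (n + 1)).succ 0 = 1 :=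
        Equiv.swap_apply_left _ _
      have e1 : Equiv.swap (0 : Fin (n + 1)).castSucc (0 : Fin (n + 1)).succ 1 = 0 :=
        Equiv.swap_apply_right _ _
      rw [e0, e1, h1.eq]
      have et : Fin.tail (Fin.tail (fun j => v (Equiv.swap (0 : Fin (n + 1)).castSucc
          (0 : Fin (n + 1)).succ j))) = Fin.tail (Fin.tail v) := by
        funext j
        simp only [Fin.tail]
        rw [Equiv.swap_apply_of_ne_of_ne]
        · exact fun h => by simpa using congrArg Fin.val h
        · exact fun h => by simpa using congrArg Fin.val h
      rw [et]
    | succ i =>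
      filter_upwards [h, (ih i).eventually_nhds] with y hy hi v
      rw [iteratedFDeriv_succ_apply_left, iteratedFDeriv_succ_apply_left]
      have e0 : Equiv.swap i.succ.castSucc i.succ.succ 0 = 0 := by
        rw [Equiv.swap_apply_of_ne_of_ne]
        · exact fun h => by simpa using congrArg Fin.val h
        · exact fun h => by simpa using congrArg Fin.val h
      have et : Fin.tail (fun j => v (Equiv.swap i.succ.castSucc i.succ.succ j)) =
          fun j => Fin.tail v (Equiv.swap i.castSucc i.succ j) := by
        funext j
        simp only [Fin.tail]
        congr 1
        have := (Fin.succ_injective (n + 1)).swap_apply i.castSucc i.succ j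
        rw [← this]
        rfl
      rw [e0, et]
      have happ : ∀ w : Fin (n + 1) → EB, HasFDerivAt (fun x => iteratedFDeriv ℝ (n + 1) f x w)
          ((ContinuousMultilinearMap.apply ℝ (fun _ : Fin (n + 1) => EB) EP w).comp
            (fderiv ℝ (iteratedFDeriv ℝ (n + 1) f) y)) y := fun w =>
        (ContinuousMultilinearMap.apply ℝ (fun _ : Fin (n + 1) => EB) EP w).hasFDerivAt.comp y
          (hd (n + 1) y hy).hasFDerivAt
      have h2 := (happ (fun j => Fin.tail v (Equiv.swap i.castSucc i.succ j))).unique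
        ((happ (Fin.tail v)).congr_of_eventuallyEq (hi.mono fun x hx => hx (Fin.tail v)))
      exact congrArg (fun L => L (v 0)) h2

/-- The iterated derivatives of a smooth map are symmetric. -/
theorem SmoothNear.iteratedFDeriv_perm {f : EB → EP} {u : EB} (h : SmoothNear f u) {n : ℕ}
    (σ : Equiv.Perm (Fin n)) (v : Fin n → EB) :
    iteratedFDeriv ℝ n f u (fun j => v (σ j)) = iteratedFDeriv ℝ n f u v := by
  cases n with
  | zero => exact congrArg _ (funext fun j => j.elim0)
  | succ n =>
    have h1 : σ ∈ Submonoid.closure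
        (Set.range fun i : Fin n => Equiv.swap i.castSucc i.succ) := by
      rw [Equiv.Perm.mclosure_swap_castSucc_succ]
      trivial
    induction h1 using Submonoid.closure_induction generalizing v with
    | mem σ hσ =>
      obtain ⟨i, rfl⟩ := hσ
      exact (h.iteratedFDeriv_swap n i).self_of_nhds v
    | one => rfl
    | mul σ τ _ _ h1 h2 => exact (h2 (fun j => v (σ j))).trans (h1 v)
/-! ### Retractions onto the fibres of a bundle -/

variable (IB IP) in
/-- Locally near every point of the bundle, there is a smooth family of retractions of the ambient
manifold onto the fibres. -/
def HasRetraction (fib : B → Set P) : Prop :=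
  ∀ b, ∀ q ∈ fib b, ∃ R : B × P → P,
    (∀ᶠ p in 𝓝 (b, q), ContMDiffAt (IB.prod IP) IP ∞ R p) ∧
    ∀ᶠ p in 𝓝 (b, q), R p ∈ fib p.1 ∧ (p.2 ∈ fib p.1 → R p = p.2)

/-- The coordinate expression of a retraction onto the fibres. -/
theorem HasRetraction.exists_chart [IB.Boundaryless] [IsManifold IB ∞ B] [IP.Boundaryless]
    [IsManifold IP ∞ P] (hR : HasRetraction IB IP fib) {b b₀ : B} {q q₀ : P} (hq : q ∈ fib b)
    (hb : b ∈ (chartAt HB b₀).source) (hq₀ : q ∈ (chartAt HP q₀).source) :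
    ∃ (R : EB × EP → EP) (U : Set (EB × EP)), IsOpen U ∧
      (extChartAt IB b₀ b, extChartAt IP q₀ q) ∈ U ∧ ContDiffOn ℝ ∞ R U ∧
      ∀ x ∈ U, R x ∈ (extChartAt IP q₀).target ∧
        (extChartAt IP q₀).symm (R x) ∈ fib ((extChartAt IB b₀).symm x.1) ∧
        (x.2 ∈ (extChartAt IP q₀).target →
          (extChartAt IP q₀).symm x.2 ∈ fib ((extChartAt IB b₀).symm x.1) → R x = x.2) := by
  obtain ⟨R, hsm, hRf⟩ := hR b q hq
  have hb' := hb
  have hq' := hq₀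
  rw [← extChartAt_source IB] at hb'
  rw [← extChartAt_source IP] at hq'
  have hRq : R (b, q) = q := hRf.self_of_nhds.2 hq
  have hsrc : ∀ᶠ p in 𝓝 (b, q), R p ∈ (extChartAt IP q₀).source := by
    refine hsm.self_of_nhds.continuousAt.eventually ?_
    rw [hRq]
    exact (isOpen_extChartAt_source q₀).eventually_mem hq'
  have ht1 := (isOpen_extChartAt_target (I := IB) b₀).eventually_mem
    ((extChartAt IB b₀).map_source hb')
  have ht2 := (isOpen_extChartAt_target (I := IP) q₀).eventually_mem
    ((extChartAt IP q₀).map_source hq')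
  have hT : Tendsto (fun x : EB × EP => ((extChartAt IB b₀).symm x.1, (extChartAt IP q₀).symm x.2))
      (𝓝 (extChartAt IB b₀ b, extChartAt IP q₀ q)) (𝓝 (b, q)) := by
    rw [nhds_prod_eq, nhds_prod_eq]
    exact (LocSec.tendsto_extChartAt_symm hb).prodMap (LocSec.tendsto_extChartAt_symm hq₀)
  have hall : ∀ᶠ x in 𝓝 (extChartAt IB b₀ b, extChartAt IP q₀ q),
      x.1 ∈ (extChartAt IB b₀).target ∧ x.2 ∈ (extChartAt IP q₀).target ∧
      ContMDiffAt (IB.prod IP) IP ∞ R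
        ((extChartAt IB b₀).symm x.1, (extChartAt IP q₀).symm x.2) ∧
      R ((extChartAt IB b₀).symm x.1, (extChartAt IP q₀).symm x.2) ∈
        (extChartAt IP q₀).source ∧
      R ((extChartAt IB b₀).symm x.1, (extChartAt IP q₀).symm x.2) ∈
        fib ((extChartAt IB b₀).symm x.1) ∧
      ((extChartAt IP q₀).symm x.2 ∈ fib ((extChartAt IB b₀).symm x.1) →
        R ((extChartAt IB b₀).symm x.1, (extChartAt IP q₀).symm x.2) =
          (extChartAt IP q₀).symm x.2) :=
    (continuous_fst.continuousAt.eventually ht1).and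
      ((continuous_snd.continuousAt.eventually ht2).and ((hT.eventually hsm).and
        ((hT.eventually hsrc).and (hT.eventually hRf))))
  obtain ⟨U, hU, hUo, hmem⟩ := eventually_nhds_iff.1 hall
  refine ⟨fun x => extChartAt IP q₀ (R ((extChartAt IB b₀).symm x.1, (extChartAt IP q₀).symm x.2)),
    U, hUo, hmem, fun x hx => ?_, fun x hx => ?_⟩
  · obtain ⟨h1, h2, h3, h4, -, -⟩ := hU x hx
    have k1 : ContMDiffAt 𝓘(ℝ, EB) IB ∞ (extChartAt IB b₀).symm x.1 :=
      (contMDiffOn_extChartAt_symm b₀).contMDiffAt ((isOpen_extChartAt_target b₀).mem_nhds h1)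
    have k2 : ContMDiffAt 𝓘(ℝ, EP) IP ∞ (extChartAt IP q₀).symm x.2 :=
      (contMDiffOn_extChartAt_symm q₀).contMDiffAt ((isOpen_extChartAt_target q₀).mem_nhds h2)
    have k3 : ContMDiffAt 𝓘(ℝ, EB × EP) (IB.prod IP) ∞
        (fun x : EB × EP => ((extChartAt IB b₀).symm x.1, (extChartAt IP q₀).symm x.2)) x :=
      (k1.comp x contDiff_fst.contMDiff.contMDiffAt).prodMk
        (k2.comp x contDiff_snd.contMDiff.contMDiffAt)
    have k4 := contMDiffAt_extChartAt' (I := IP) (n := ∞) (by rwa [extChartAt_source] at h4)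
    exact ((k4.comp _ h3).comp x k3).contDiffAt.contDiffWithinAt
  · obtain ⟨-, h2, -, h4, h5, h6⟩ := hU x hx
    refine ⟨(extChartAt IP q₀).map_source h4, ?_, fun _ h7 => ?_⟩
    · rw [(extChartAt IP q₀).left_inv h4]
      exact h5
    · beta_reduce
      rw [h6 h7, (extChartAt IP q₀).right_inv h2]

/-- The total space of a fibre bundle locally retracts onto the fibres. -/
theorem IsSmoothFiberBundle.hasRetraction {EF HF Fb : Type*} [NormedAddCommGroup EF]
    [NormedSpace ℝ EF] [TopologicalSpace HF] [TopologicalSpace Fb] [ChartedSpace HF Fb]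
    {IF : ModelWithCorners ℝ EF HF} {p : P → B} (h : IsSmoothFiberBundle IB IP IF Fb p) :
    HasRetraction IB IP (fun b => p ⁻¹' {b}) := by
  rintro b q rfl
  obtain ⟨e, hb, he, hes⟩ := h (p q)
  have hopen : IsOpen (e.baseSet ×ˢ e.source) := e.open_baseSet.prod e.open_source
  have hmem : (p q, q) ∈ e.baseSet ×ˢ e.source := ⟨hb, e.mem_source.2 hb⟩
  -- In a trivialization, the retraction onto the fibre over `x.1` replaces the base component of
  -- the point by `x.1` and keeps its fibre component.
  refine ⟨fun x => e.toOpenPartialHomeomorph.symm (x.1, (e x.2).2), ?_, ?_⟩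
  · filter_upwards [hopen.mem_nhds hmem] with x hx
    have h1 : ContMDiffAt IP (IB.prod IF) ∞ e x.2 := he.contMDiffAt (e.open_source.mem_nhds hx.2)
    have h2 : ContMDiffAt (IB.prod IF) IP ∞ e.toOpenPartialHomeomorph.symm (x.1, (e x.2).2) :=
      hes.contMDiffAt (e.open_target.mem_nhds (e.mem_target.2 hx.1))
    have h3 : ContMDiffAt (IB.prod IP) (IB.prod IF) ∞
        (fun x : B × P => (x.1, (e x.2).2)) x :=
      contMDiffAt_fst.prodMk (contMDiffAt_snd.comp x (h1.comp x contMDiffAt_snd))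
    exact ContMDiffAt.comp x h2 h3
  · filter_upwards [hopen.mem_nhds hmem] with x hx
    refine ⟨e.proj_symm_apply (e.mem_target.2 hx.1), fun hx' => ?_⟩
    have h1 : (x.1, (e x.2).2) = e x.2 := by
      rw [← (hx' : p x.2 = x.1)]
      exact e.mk_proj_snd hx.2
    rw [h1]
    exact e.toOpenPartialHomeomorph.left_inv hx.2

/-! ### Homogeneous polynomials -/

/-- The polynomial is `q` on the diagonal, centred at `u` and divided by `N!`. Its `N`-th derivative
at `u` is the symmetrization of `q`, hence `q`; the lower derivatives vanish there by homogeneity.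
-/
theorem exists_prol_eq_topJet {N : ℕ} (hN : N ≠ 0) (q : EB [×N]→L[ℝ] EP) (u : EB)
    (hq : ∀ (σ : Equiv.Perm (Fin N)) (v : Fin N → EB), q (fun i => v (σ i)) = q v) :
    ∃ Q : EB → EP, ContDiff ℝ ∞ Q ∧ ∀ i (hi : i ≤ N),
      iteratedFDeriv ℝ i Q u = JetCoord.comp i hi (topJet N q) := by
  let Q₀ : EB → EP := fun y => (N.factorial : ℝ)⁻¹ • q (fun _ => y)
  have hQ₁ : ContDiff ℝ ∞ (fun y : EB => q (fun _ => y)) :=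
    q.contDiff.comp (contDiff_pi.2 fun _ => contDiff_id)
  have hQ₀ : ContDiff ℝ ∞ Q₀ := contDiff_const.smul hQ₁
  refine ⟨fun y => Q₀ (y - u), hQ₀.comp (contDiff_id.sub contDiff_const), fun i hi => ?_⟩
  rw [iteratedFDeriv_comp_sub, sub_self]
  rcases hi.lt_or_eq with hi' | rfl
  · rw [comp_topJet_of_lt hi']
    -- Scaling the argument by `2` multiplies `Q₀` by `2 ^ N` but its `i`-th derivative at `0` by `2
    -- ^ i`; for `i < N` these factors differ and the derivative is zero.
    have h1 : (Q₀ ∘ ((2 : ℝ) • ContinuousLinearMap.id ℝ EB)) = (2 : ℝ) ^ N • Q₀ := by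
      funext y
      have := q.map_smul_univ (fun _ => (2 : ℝ)) (fun _ => y)
      simp only [Finset.prod_const, Finset.card_univ, Fintype.card_fin] at this
      simp only [Q₀, Function.comp_apply, _root_.smul_apply,
        ContinuousLinearMap.id_apply, Pi.smul_apply, this]
      rw [smul_comm]
    have h2 := ContinuousLinearMap.iteratedFDeriv_comp_right
      ((2 : ℝ) • ContinuousLinearMap.id ℝ EB) hQ₀ (0 : EB) (i := i) (by exact_mod_cast le_top)
    rw [h1, map_zero, iteratedFDeriv_const_smul_apply
      (hQ₀.contDiffAt.of_le (by exact_mod_cast le_top))] at h2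
    ext v
    have h3 := congrArg (fun m => m v) h2
    have h4 := (iteratedFDeriv ℝ i Q₀ 0).map_smul_univ (fun _ => (2 : ℝ)) v
    simp only [Finset.prod_const, Finset.card_univ, Fintype.card_fin] at h4
    simp only [_root_.smul_apply,
      ContinuousMultilinearMap.compContinuousLinearMap_apply,
      ContinuousLinearMap.id_apply, h4] at h3
    have h5 : ((2 : ℝ) ^ N - (2 : ℝ) ^ i) • (iteratedFDeriv ℝ i Q₀ 0) v = 0 := by
      rw [sub_smul, h3, sub_self]
    have h6 : (2 : ℝ) ^ N - (2 : ℝ) ^ i ≠ 0 := by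
      have := pow_lt_pow_right₀ (one_lt_two : (1 : ℝ) < 2) hi'
      linarith
    exact (smul_eq_zero.1 h5).resolve_left h6
  · rw [comp_topJet_self]
    ext v
    change iteratedFDeriv ℝ i ((i.factorial : ℝ)⁻¹ • fun y : EB => q (fun _ => y)) 0 v = q v
    rw [iteratedFDeriv_const_smul_apply (hQ₁.contDiffAt.of_le (by exact_mod_cast le_top)),
      _root_.smul_apply, ContinuousMultilinearMap.iteratedFDeriv_comp_diagonal]
    simp only [hq, Finset.sum_const, Finset.card_univ, Fintype.card_perm, Fintype.card_fin]
    rw [← Nat.cast_smul_eq_nsmul ℝ, smul_smul, inv_mul_cancel₀ (by positivity), one_smul]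

end Jets

end FlatReps

end

noncomputable section

namespace FlatReps


section Jets

variable {EB HB B EP HP P W W' : Type*}
  [NormedAddCommGroup EB] [NormedSpace ℝ EB] [TopologicalSpace HB]
  [TopologicalSpace B] [ChartedSpace HB B]
  [NormedAddCommGroup EP] [NormedSpace ℝ EP] [TopologicalSpace HP]
  [TopologicalSpace P] [ChartedSpace HP P]
  [NormedAddCommGroup W] [NormedSpace ℝ W] [NormedAddCommGroup W'] [NormedSpace ℝ W']
  {IB : ModelWithCorners ℝ EB HB} {IP : ModelWithCorners ℝ EP HP} {fib : B → Set P}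

/-! ### Prolongations are tangent to the Cartan planes -/

/-- The function `G` of the coordinates in the charts around `b₀`, `q₀` vanishes on `S`. -/
def VanishesOn {k : ℕ} (S : Set (Jet IB IP fib k)) (b₀ : B) (q₀ : P)
    (G : JetCoord EB EP k → W) (U : Set (JetCoord EB EP k)) : Prop :=
  ∀ θ ∈ S, θ.InChart b₀ q₀ → θ.coords b₀ q₀ ∈ U → G (θ.coords b₀ q₀) = 0

/-- A map between the vector spaces of two charts keeps its order of vanishing under a change of
the chart of the domain. -/
theorem iteratedFDeriv_comp_chartTrans_eq_zero [IB.Boundaryless] [IsManifold IB ∞ B] {b₀ b₁ : B}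
    {h : EB → W} {w : EB} (hw : w ∈ chartDom IB b₁ b₀)
    (hh : SmoothNear h (chartTrans IB b₁ b₀ w)) {l : ℕ}
    (h0 : ∀ i ≤ l, iteratedFDeriv ℝ i h (chartTrans IB b₁ b₀ w) = 0) :
    ∀ i ≤ l, iteratedFDeriv ℝ i (fun y => h (chartTrans IB b₁ b₀ y)) w = 0 := by
  intro i hi
  have key : ∀ f : EB → W, SmoothNear f (chartTrans IB b₁ b₀ w) →
      iteratedFDeriv ℝ i (fun y => f (chartTrans IB b₁ b₀ y)) w = _ := fun f hf =>
    (iteratedFDeriv_comp_prol (contDiffOn_chartFrame IB b₀ b₁) (K := 0)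
      (G := fun x : JetCoord EB W 0 => JetCoord.val x)
      (U := {x | x.1 ∈ chartDom IB b₀ b₁}) ((isOpen_chartDom IB b₀ b₁).preimage continuous_fst)
      (ContinuousLinearMap.contDiff (JetCoord.val (EB := EB) (EP := W))).contDiffOn
      (fun _ h => h) (r := f) (ρ := chartTrans IB b₁ b₀) (w := w)
      ((contDiffOn_chartTrans IB b₁ b₀).smoothNear ((isOpen_chartDom IB b₁ b₀).mem_nhds hw))
      hf (by
        filter_upwards [(isOpen_chartDom IB b₁ b₀).mem_nhds hw] with y hy
        rw [chartTrans_symm hy]) (chartTrans_mem hw) i).self_of_nhds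
  -- By `key`, the derivative in the new chart depends only on the jet of the function in the old
  -- one. To order `i` the jet of `h` is that of the zero function, so both give the same result.
  have hz : SmoothNear (fun _ : EB => (0 : W)) (chartTrans IB b₁ b₀ w) :=
    Eventually.of_forall fun _ => contDiffAt_const
  have e : prol (0 + i) h (chartTrans IB b₁ b₀ w) =
      prol (0 + i) (fun _ => (0 : W)) (chartTrans IB b₁ b₀ w) := by
    refine JetCoord.ext_comp rfl fun j hj => ?_
    rw [comp_prol, comp_prol, h0 j (by omega)]
    rw [iteratedFDeriv_fun_zero]
    rfl
  rw [key h hh, e, ← key _ hz]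
  rw [iteratedFDeriv_fun_zero]
  rfl

section Tangency

variable [IB.Boundaryless] [IsManifold IB ∞ B] [IP.Boundaryless] [IsManifold IP ∞ P]

/-- Tangency can be tested in any chart. -/
theorem IsTangent.iterD_eq_zero {k l : ℕ} {E₀ : Set (Jet IB IP fib k)} {b : B}
    {s : LocSec IB IP fib b} (hs : IsTangent E₀ l s) {b₀ : B} {q₀ : P} (hc : s.InChart b₀ q₀)
    {F : JetCoord EB EP k → ℝ} {U : Set (JetCoord EB EP k)} (hU : IsOpen U)
    (hF : ContDiffOn ℝ ∞ F U) (hm : s.coords k b₀ q₀ ∈ U) (hv : VanishesOn E₀ b₀ q₀ F U)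
    {i : ℕ} (hi : i ≤ l) : iterD₁ F i (s.coords (k + i) b₀ q₀) = 0 := by
  have hc₁ : s.InChart b (s.toFun b) := s.inChart_self
  -- `IsTangent` tests only in the charts centred at the point itself, so `F` is transported there
  -- by `Ψ`. The order of vanishing survives the return to the chart at `b₀`.
  let Ψ := changeCoords IB IP b (s.toFun b) b₀ q₀ k
  let U' := coordDom IB IP b (s.toFun b) b₀ q₀ k ∩ Ψ ⁻¹' U
  have hU' : IsOpen U' := (contDiffOn_changeCoords IB IP b (s.toFun b) b₀ q₀ k).continuousOn.isOpen_inter_preimage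
    (isOpen_coordDom IB IP b (s.toFun b) b₀ q₀ k) hU
  have hm' : s.coords k b (s.toFun b) ∈ U' := by
    refine ⟨s.coords_mem_coordDom k hc₁ hc, ?_⟩
    have h0 : Ψ (s.coords k b (s.toFun b)) = s.coords k b₀ q₀ := s.coords_change k hc₁ hc
    rw [mem_preimage, h0]
    exact hm
  have h1 := hs (fun x => F (Ψ x)) U' hU' hm'
    (hF.comp ((contDiffOn_changeCoords IB IP b (s.toFun b) b₀ q₀ k).mono inter_subset_left) fun _ h => h.2)
    (fun θ hθ hθc hθm => by
      have h2 : θ.InChart b₀ q₀ := θ.rep.inChart_of_mem_coordDom hθc hθm.1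
      have h3 : Ψ (θ.coords b (s.toFun b)) = θ.coords b₀ q₀ := θ.rep.coords_change k hθc h2
      rw [h3]
      refine hv θ hθ h2 ?_
      rw [← h3]
      exact hθm.2)
  have hr : SmoothNear (s.expr b₀ q₀) (extChartAt IB b₀ b) := s.smoothNear_expr hc
  have hr₁ : SmoothNear (s.expr b (s.toFun b)) (extChartAt IB b b) := s.smoothNear_expr hc₁
  rw [LocSec.coords, ← (iteratedFDeriv_comp_prol₁ hU hF hr hm i).self_of_nhds]
  have hw : extChartAt IB b₀ b ∈ chartDom IB b₀ b := extChartAt_mem_chartDom hc.1 hc₁.1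
  have hρ : chartTrans IB b₀ b (extChartAt IB b₀ b) = extChartAt IB b b :=
    chartTrans_extChartAt hc.1
  have h4 : (fun y => F (prol k (s.expr b₀ q₀) y)) =ᶠ[𝓝 (extChartAt IB b₀ b)]
      fun y => F (Ψ (prol k (s.expr b (s.toFun b)) (chartTrans IB b₀ b y))) := by
    have h5 : ∀ᶠ y in 𝓝 (extChartAt IB b₀ b), Ψ (prol k (s.expr b (s.toFun b)) (chartTrans IB b₀ b y)) =
        prol k (s.expr b₀ q₀) (chartTrans IB b b₀ (chartTrans IB b₀ b y)) := by
      have hcont : ContinuousAt (chartTrans IB b₀ b) (extChartAt IB b₀ b) :=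
        ((contDiffOn_chartTrans IB b₀ b).continuousOn.continuousAt
          ((isOpen_chartDom IB b₀ b).mem_nhds hw))
      have h6 := s.eventually_prol_change k hc₁ hc
      rw [← hρ] at h6
      exact hcont.eventually h6
    filter_upwards [h5, (isOpen_chartDom IB b₀ b).mem_nhds hw] with y hy hy'
    rw [hy, chartTrans_symm hy']
  rw [(h4.iteratedFDeriv ℝ i).self_of_nhds]
  refine iteratedFDeriv_comp_chartTrans_eq_zero (b₀ := b) (b₁ := b₀)
    (h := fun y => F (Ψ (prol k (s.expr b (s.toFun b)) y))) hw ?_ (l := l) ?_ i hi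
  · rw [hρ]
    have h6 : SmoothNear (fun y => prol k (s.expr b (s.toFun b)) y) (extChartAt IB b b) := hr₁.prol k
    filter_upwards [h6, h6.contDiffAt.continuousAt.eventually (hU'.mem_nhds hm')] with y hy hy'
    have h7 : ContDiffOn ℝ ∞ (fun x => F (Ψ x)) U' :=
      hF.comp ((contDiffOn_changeCoords IB IP b (s.toFun b) b₀ q₀ k).mono inter_subset_left) fun _ h => h.2
    exact (h7.contDiffAt (hU'.mem_nhds hy')).comp y hy
  · rw [hρ]
    exact h1

/-- A section is tangent to an equation if the iterated total derivatives of the functions that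
vanish on the equation vanish on its jet. -/
theorem isTangent_of_iterD_eq_zero {k l : ℕ} {E₀ : Set (Jet IB IP fib k)} {b : B}
    {s : LocSec IB IP fib b}
    (h : ∀ (F : JetCoord EB EP k → ℝ) (U : Set (JetCoord EB EP k)), IsOpen U →
      ContDiffOn ℝ ∞ F U → s.coords k b (s.toFun b) ∈ U → VanishesOn E₀ b (s.toFun b) F U →
      ∀ i ≤ l, iterD₁ F i (s.coords (k + i) b (s.toFun b)) = 0) : IsTangent E₀ l s := by
  intro G U hU hm hG hv i hi
  rw [(iteratedFDeriv_comp_prol₁ hU hG (s.smoothNear_expr s.inChart_self) hm i).self_of_nhds]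
  exact h G U hU hG hm hv i hi

theorem IsTangent.mono {k l l' : ℕ} {E₀ : Set (Jet IB IP fib k)} {b : B}
    {s : LocSec IB IP fib b} (hs : IsTangent E₀ l s) (h : l' ≤ l) : IsTangent E₀ l' s :=
  fun G U hU hm hG hv i hi => hs G U hU hm hG hv i (hi.trans h)

/-- The Cartan planes at the points of `S ⊆ J^{m+1}` are tangent to `T ⊆ J^m`. -/
def CartanTangent {m : ℕ} (S : Set (Jet IB IP fib (m + 1))) (T : Set (Jet IB IP fib m)) : Prop :=
  ∀ (b : B) (s : LocSec IB IP fib b), s.jet (m + 1) ∈ S →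
    ∀ (G : JetCoord EB EP m → ℝ) (U : Set (JetCoord EB EP m)), IsOpen U →
      s.coords m b (s.toFun b) ∈ U → ContDiffOn ℝ ∞ G U → VanishesOn T b (s.toFun b) G U →
      totalD G (s.coords (m + 1) b (s.toFun b)) = 0

/-- Membership in a prolongation asserts tangency for some representative of the jet; a given
section has to be exchanged for that one. -/
theorem LocSec.exists_of_mem_prolong {k l : ℕ} {E₀ : Set (Jet IB IP fib k)} {b : B}
    {s : LocSec IB IP fib b} (h : s.jet (k + l) ∈ prolong E₀ l) :
    ∃ t : LocSec IB IP fib b, t.jet (k + l) = s.jet (k + l) ∧ t.jet k ∈ E₀ ∧ IsTangent E₀ l t := by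
  obtain ⟨b', t, h1, h2, h3⟩ := h
  obtain rfl : b' = b := congrArg Sigma.fst h1
  exact ⟨t, h1, h2, h3⟩

/-- Every jet in the prolongation of an equation satisfies the differential consequences of the
equation. -/
theorem iterD_eq_zero_of_mem_prolong {k l : ℕ} {E₀ : Set (Jet IB IP fib k)}
    {b₀ : B} {q₀ : P} {F : JetCoord EB EP k → ℝ} {U : Set (JetCoord EB EP k)} (hU : IsOpen U)
    (hF : ContDiffOn ℝ ∞ F U) (hv : VanishesOn E₀ b₀ q₀ F U) :
    VanishesOn (prolong E₀ l) b₀ q₀ (iterD₁ F l)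
      (JetCoord.truncL (Nat.le_add_right k l) ⁻¹' U) := by
  intro θ hθ hc hm
  rw [← Jet.rep_jet θ] at hθ
  obtain ⟨t, h1, h2, h3⟩ := LocSec.exists_of_mem_prolong hθ
  have hct : t.InChart b₀ q₀ := ⟨hc.1, by rw [LocSec.toFun_eq_of_jet_eq h1]; exact hc.2⟩
  have hco : t.coords (k + l) b₀ q₀ = θ.coords b₀ q₀ := LocSec.coords_eq_of_jet_eq hct h1
  rw [← hco] at hm ⊢
  exact h3.iterD_eq_zero hct hU hF hm hv le_rfl

end Tangency

end Jets

end FlatReps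

end

noncomputable section

namespace FlatReps


/-! ### Tangent vectors to sets of jets, and lines of jets in the highest derivatives -/

section Jets

variable {EB HB B EP HP P W W' : Type*}
  [NormedAddCommGroup EB] [NormedSpace ℝ EB] [TopologicalSpace HB]
  [TopologicalSpace B] [ChartedSpace HB B]
  [NormedAddCommGroup EP] [NormedSpace ℝ EP] [TopologicalSpace HP]
  [TopologicalSpace P] [ChartedSpace HP P]
  [NormedAddCommGroup W] [NormedSpace ℝ W] [NormedAddCommGroup W'] [NormedSpace ℝ W']
  {IB : ModelWithCorners ℝ EB HB} {IP : ModelWithCorners ℝ EP HP} {fib : B → Set P}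
  [IB.Boundaryless] [IsManifold IB ∞ B] [IP.Boundaryless] [IsManifold IP ∞ P]

theorem LocSec.toFun_eq_of_coords_eq {b : B} {s t : LocSec IB IP fib b} {b₀ : B} {q₀ : P} {k : ℕ}
    (hs : s.InChart b₀ q₀) (ht : t.InChart b₀ q₀) (hc : s.coords k b₀ q₀ = t.coords k b₀ q₀) :
    s.toFun b = t.toFun b := by
  have h1 := congrArg JetCoord.val hc
  simp only [LocSec.coords, val_prol] at h1
  rw [s.expr_extChartAt hs.1, t.expr_extChartAt hs.1] at h1
  exact (extChartAt IP q₀).injOn (by rw [extChartAt_source]; exact hs.2)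
    (by rw [extChartAt_source]; exact ht.2) h1

theorem LocSec.prol_eventually_mem {b : B} (s : LocSec IB IP fib b) {b₀ : B} {q₀ : P}
    (hs : s.InChart b₀ q₀) {k : ℕ} {U : Set (JetCoord EB EP k)} (hU : IsOpen U)
    (hm : s.coords k b₀ q₀ ∈ U) :
    ∀ᶠ y in 𝓝 (extChartAt IB b₀ b), prol k (s.expr b₀ q₀) y ∈ U :=
  (contDiffAt_prol k (s.smoothNear_expr hs).contDiffAt).continuousAt.eventually (hU.mem_nhds hm)

/-- Near the base point of a section, its prolongation consists of jets of sections. -/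
theorem LocSec.eventually_prol_eq_coords {b : B} (s : LocSec IB IP fib b) {b₀ : B} {q₀ : P}
    (hs : s.InChart b₀ q₀) (k : ℕ) :
    ∀ᶠ y in 𝓝 (extChartAt IB b₀ b), ∃ θ : Jet IB IP fib k, θ.InChart b₀ q₀ ∧
      θ.coords b₀ q₀ = prol k (s.expr b₀ q₀) y := by
  filter_upwards [(isOpen_extChartAt_target (I := IB) b₀).mem_nhds
      ((extChartAt IB b₀).map_source (by rw [extChartAt_source]; exact hs.1)),
    (tendsto_extChartAt_symm hs.1).eventually (s.eventually_inChart hs),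
    (tendsto_extChartAt_symm hs.1).eventually s.eventually_move] with y h1 h2 h3
  have hc : (s.move _ h3).InChart b₀ q₀ := h2
  refine ⟨(s.move _ h3).jet k, (Jet.inChart_jet _).2 hc, ?_⟩
  rw [Jet.coords_jet _ hc, LocSec.coords, (extChartAt IB b₀).right_inv h1]
  rfl

/-- The total derivative of an identity between jets of sections. -/
theorem totalD_eq_zero_of_vanishesOn_univ {b : B} (s : LocSec IB IP fib b) {b₀ : B} {q₀ : P}
    (hs : s.InChart b₀ q₀) {k : ℕ} {H : JetCoord EB EP k → W} {U : Set (JetCoord EB EP k)}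
    (hU : IsOpen U) (hm : s.coords k b₀ q₀ ∈ U) (hH : ContDiffOn ℝ ∞ H U)
    (hv : VanishesOn (univ : Set (Jet IB IP fib k)) b₀ q₀ H U) :
    totalD H (s.coords (k + 1) b₀ q₀) = 0 := by
  have h1 : HasFDerivAt (fun y => H (prol k (s.expr b₀ q₀) y))
      (totalD H (s.coords (k + 1) b₀ q₀)) (extChartAt IB b₀ b) :=
    fderiv_comp_prol ((hH.contDiffAt (hU.mem_nhds hm)).differentiableAt (by simp))
      (s.smoothNear_expr hs).contDiffAt
  refine h1.unique ((hasFDerivAt_const (0 : W) _).congr_of_eventuallyEq ?_)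
  filter_upwards [s.eventually_prol_eq_coords hs k, s.prol_eventually_mem hs hU hm] with y h2 h3
  obtain ⟨θ, hθ, hθ'⟩ := h2
  rw [← hθ'] at h3 ⊢
  exact hv θ (mem_univ _) hθ h3

/-- The tangent vector `p` to the coordinate space is tangent to the set of jets `S`. -/
def TangentVec {k : ℕ} (S : Set (Jet IB IP fib k)) (b₀ : B) (q₀ : P)
    (ξ p : JetCoord EB EP k) : Prop :=
  ∀ (H : JetCoord EB EP k → ℝ) (U : Set (JetCoord EB EP k)), IsOpen U → ξ ∈ U →
    ContDiffOn ℝ ∞ H U → VanishesOn S b₀ q₀ H U → fderiv ℝ H ξ p = 0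

/-- Continuous functionals separate points, so the scalar test functions in `TangentVec` control
vector-valued ones as well. -/
theorem TangentVec.fderiv_eq_zero {k : ℕ} {S : Set (Jet IB IP fib k)} {b₀ : B} {q₀ : P}
    {ξ p : JetCoord EB EP k} (h : TangentVec S b₀ q₀ ξ p) {H : JetCoord EB EP k → W}
    {U : Set (JetCoord EB EP k)} (hU : IsOpen U) (hm : ξ ∈ U) (hH : ContDiffOn ℝ ∞ H U)
    (hv : VanishesOn S b₀ q₀ H U) : fderiv ℝ H ξ p = 0 := by
  refine SeparatingDual.eq_zero_of_forall_dual_eq_zero (R := ℝ) fun f => ?_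
  have h1 := h (fun x => f (H x)) U hU hm (f.contDiff.comp_contDiffOn hH)
    (fun θ hθ hc hmem => by
      beta_reduce
      rw [hv θ hθ hc hmem, map_zero])
  have h2 := (f.hasFDerivAt.comp ξ
    ((hH.contDiffAt (hU.mem_nhds hm)).differentiableAt (by simp)).hasFDerivAt).fderiv
  rw [Function.comp_def] at h2
  rw [h2] at h1
  exact h1

theorem TangentVec.mono {k : ℕ} {S T : Set (Jet IB IP fib k)} (hST : S ⊆ T) {b₀ : B} {q₀ : P}
    {ξ p : JetCoord EB EP k} (h : TangentVec S b₀ q₀ ξ p) : TangentVec T b₀ q₀ ξ p :=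
  fun H U hU hm hH hv => h H U hU hm hH fun θ hθ => hv θ (hST hθ)

theorem TangentVec.sub {k : ℕ} {S : Set (Jet IB IP fib k)} {b₀ : B} {q₀ : P}
    {ξ p p' : JetCoord EB EP k} (h : TangentVec S b₀ q₀ ξ p) (h' : TangentVec S b₀ q₀ ξ p') :
    TangentVec S b₀ q₀ ξ (p - p') := fun H U hU hm hH hv => by
  rw [map_sub, h H U hU hm hH hv, h' H U hU hm hH hv, sub_zero]

/-- The vector is the velocity at the base point of the prolongation of `s`, moved in the direction
`v`, and this prolongation runs through jets of sections. -/
theorem tangentVec_univ_shift {b : B} (s : LocSec IB IP fib b) {b₀ : B} {q₀ : P}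
    (hs : s.InChart b₀ q₀) (k : ℕ) (v : EB) :
    TangentVec (univ : Set (Jet IB IP fib k)) b₀ q₀ (s.coords k b₀ q₀)
      (shift (s.coords (k + 1) b₀ q₀) v) := fun _ _ hU hm hH hv =>
  congrArg (fun L => L v) (totalD_eq_zero_of_vanishesOn_univ s hs hU hm hH hv)

theorem cartanTangent_iff {m : ℕ} (S : Set (Jet IB IP fib (m + 1)))
    (T : Set (Jet IB IP fib m)) : CartanTangent S T ↔ ∀ (b : B) (s : LocSec IB IP fib b),
      s.jet (m + 1) ∈ S → ∀ v, TangentVec T b (s.toFun b) (s.coords m b (s.toFun b))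
        (shift (s.coords (m + 1) b (s.toFun b)) v) :=
  ⟨fun h b s hs v G U hU hm hG hv => congrArg (fun L => L v) (h b s hs G U hU hm hG hv),
    fun h b s hs G U hU hm hG hv => by
      ext v
      exact h b s hs v G U hU hm hG hv⟩

/-- A vertical tangent vector to the manifold of jets of sections, of the highest order, is
the tangent vector to a line of jets of sections. -/
theorem HasRetraction.exists_locSec_add_top (hR : HasRetraction IB IP fib) {n : ℕ} {b : B}
    (s : LocSec IB IP fib b) {b₀ : B} {q₀ : P} (hs : s.InChart b₀ q₀)
    {p : JetCoord EB EP (n + 1)} (hp : JetCoord.truncL (Nat.le_succ n) p = 0)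
    (hv : TangentVec (univ : Set (Jet IB IP fib (n + 1))) b₀ q₀ (s.coords (n + 1) b₀ q₀) p)
    (t : ℝ) : ∃ s' : LocSec IB IP fib b, s'.InChart b₀ q₀ ∧
      s'.coords (n + 1) b₀ q₀ = s.coords (n + 1) b₀ q₀ + t • p := by
  set ξ := s.coords (n + 1) b₀ q₀ with hξ
  set r := s.expr b₀ q₀ with hr
  set u := extChartAt IB b₀ b with hu
  have hsm : SmoothNear r u := s.smoothNear_expr hs
  set ptop := JetCoord.comp (n + 1) le_rfl p with hptop
  have hpt : p = topJet (n + 1) ptop := eq_topJet hp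
  -- symmetry of the vector
  have hsym : ∀ (σ : Equiv.Perm (Fin (n + 1))) (v : Fin (n + 1) → EB),
      ptop (fun i => v (σ i)) = ptop v := by
    intro σ v
    let L : JetCoord EB EP (n + 1) →L[ℝ] EP :=
      (ContinuousMultilinearMap.apply ℝ (fun _ : Fin (n + 1) => EB) EP (fun i => v (σ i)) -
        ContinuousMultilinearMap.apply ℝ (fun _ : Fin (n + 1) => EB) EP v).comp
        (JetCoord.comp (n + 1) le_rfl)
    -- Symmetry of derivatives is a linear condition satisfied by the jets of all sections, so it
    -- passes to vectors tangent to the set of these jets.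
    have h1 := hv.fderiv_eq_zero (H := fun x => L x) isOpen_univ (mem_univ _)
      L.contDiff.contDiffOn (fun θ _ hθ _ => sub_eq_zero.2
        ((θ.rep.smoothNear_expr hθ).iteratedFDeriv_perm σ v))
    rw [L.fderiv] at h1
    exact sub_eq_zero.1 h1
  -- the retraction
  obtain ⟨R, UR, hUR, hmR, hsR, hRU⟩ := hR.exists_chart s.mem_fib.self_of_nhds hs.1 hs.2
  let pt : JetCoord EB EP 0 →L[ℝ] EB × EP := (ContinuousLinearMap.fst ℝ EB _).prod JetCoord.val
  let Rc : JetCoord EB EP 0 → EP := fun x => R (pt x)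
  let U₀ : Set (JetCoord EB EP 0) := pt ⁻¹' UR
  have hU₀ : IsOpen U₀ := hUR.preimage pt.continuous
  have hRc : ContDiffOn ℝ ∞ Rc U₀ := hsR.comp pt.contDiff.contDiffOn fun _ h => h
  have hRexpr : ∀ {b' : B} (s' : LocSec IB IP fib b'), s'.InChart b₀ q₀ →
      prol 0 (s'.expr b₀ q₀) (extChartAt IB b₀ b') ∈ U₀ →
      (fun y => Rc (prol 0 (s'.expr b₀ q₀) y)) =ᶠ[𝓝 (extChartAt IB b₀ b')] s'.expr b₀ q₀ := by
    intro b' s' hs' hmem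
    filter_upwards [(contDiffAt_prol 0 (s'.smoothNear_expr hs').contDiffAt).continuousAt.eventually
      (hU₀.mem_nhds hmem), (LocSec.tendsto_extChartAt_symm hs'.1).eventually s'.mem_fib,
      (LocSec.tendsto_extChartAt_symm hs'.1).eventually (s'.eventually_inChart hs')]
      with y h1 h2 h3
    have h3' : s'.toFun ((extChartAt IB b₀).symm y) ∈ (extChartAt IP q₀).source := by
      rw [extChartAt_source]; exact h3.2
    refine (hRU _ h1).2.2 ((extChartAt IP q₀).map_source h3') ?_
    change (extChartAt IP q₀).symm (extChartAt IP q₀ (s'.toFun ((extChartAt IB b₀).symm y))) ∈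
      fib ((extChartAt IB b₀).symm y)
    rw [(extChartAt IP q₀).left_inv h3']
    exact h2
  have hmU₀ : prol 0 r u ∈ U₀ := by
    have : pt (prol 0 r u) = (extChartAt IB b₀ b, extChartAt IP q₀ (s.toFun b)) := by
      rw [← s.expr_extChartAt hs.1]; rfl
    rw [mem_preimage, this]
    exact hmR
  let tr : JetCoord EB EP (n + 1) →L[ℝ] JetCoord EB EP (0 + (n + 1)) :=
    JetCoord.truncL (Nat.zero_add (n + 1)).le
  have htrU : ∀ x, JetCoord.truncL (Nat.le_add_right 0 (n + 1)) (tr x) =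
      JetCoord.truncL (Nat.zero_le (n + 1)) x := fun x => rfl
  have hdiff : DifferentiableAt ℝ (iterD₁ Rc (n + 1)) (tr ξ) :=
    ((contDiffOn_iterD₁ hU₀ hRc (n + 1)).contDiffAt
      ((hU₀.preimage (ContinuousLinearMap.continuous _)).mem_nhds hmU₀)).differentiableAt (by simp)
  -- The prolonged retraction fixes the jet of every section. The difference with the identity thus
  -- vanishes on all jets, and may be differentiated along the tangent vector `p`.
  have hret : fderiv ℝ (iterD₁ Rc (n + 1)) (tr ξ) (tr p) = ptop := by
    have h1 := hv.fderiv_eq_zero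
      (H := fun x => iterD₁ Rc (n + 1) (tr x) - JetCoord.comp (n + 1) le_rfl x)
      (U := JetCoord.truncL (Nat.zero_le (n + 1)) ⁻¹' U₀)
      (hU₀.preimage (ContinuousLinearMap.continuous _)) hmU₀
      (((contDiffOn_iterD₁ hU₀ hRc (n + 1)).comp tr.contDiff.contDiffOn fun _ h => h).sub
        (ContinuousLinearMap.contDiff _).contDiffOn) (fun θ _ hθ hm => by
          have h2 := (iteratedFDeriv_comp_prol₁ hU₀ hRc (θ.rep.smoothNear_expr hθ) hm
            (n + 1)).self_of_nhds
          have h3 := ((hRexpr θ.rep hθ hm).iteratedFDeriv ℝ (n + 1)).self_of_nhds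
          exact sub_eq_zero.2 (h2.symm.trans h3))
    have h2 : HasFDerivAt (fun x => iterD₁ Rc (n + 1) (tr x) - JetCoord.comp (n + 1) le_rfl x)
        ((fderiv ℝ (iterD₁ Rc (n + 1)) (tr ξ)).comp tr - JetCoord.comp (n + 1) le_rfl) ξ :=
      (hdiff.hasFDerivAt.comp ξ tr.hasFDerivAt).sub (by fun_prop)
    rw [h2.fderiv] at h1
    exact sub_eq_zero.1 h1
  -- the family of sections
  obtain ⟨Q, hQ, hQj⟩ := exists_prol_eq_topJet (Nat.succ_ne_zero n) ptop u hsym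
  let f : EB → EP := fun y => r y + t • Q y
  have hf : SmoothNear f u := hsm.mono fun y hy => hy.add (contDiffAt_const.smul hQ.contDiffAt)
  have hprol : prol (n + 1) f u = ξ + t • p := by
    refine JetCoord.ext_comp ?_ fun i hi => ?_
    · have : p.1 = 0 := congrArg Prod.fst hp
      change u = u + t • p.1
      rw [this, smul_zero, add_zero]
    · rw [map_add, map_smul, hpt, ← hQj i hi, comp_prol]
      have h1 : ContDiffAt ℝ i r u := hsm.contDiffAt.of_le (by exact_mod_cast le_top)
      have h2 : ContDiffAt ℝ i Q u := hQ.contDiffAt.of_le (by exact_mod_cast le_top)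
      have h3 : ContDiffAt ℝ i (fun y => t • Q y) u := contDiffAt_const.smul h2
      have h4 := iteratedFDeriv_add_apply h1 h3
      have h5 := iteratedFDeriv_const_smul_apply' (a := t) h2
      rw [h5] at h4
      exact h4
  have htr0 : ∀ i (hi : i ≤ n), JetCoord.truncL (hi.trans (Nat.le_succ n)) (ξ + t • p) =
      JetCoord.truncL (hi.trans (Nat.le_succ n)) ξ := fun i hi => by
    rw [map_add, map_smul, ← JetCoord.truncL_truncL hi (Nat.le_succ n) p, hp, map_zero, smul_zero,
      add_zero]
  have hprol' : ∀ i (hi : i ≤ n), prol i f u = prol i r u := fun i hi => by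
    have := congrArg (JetCoord.truncL (hi.trans (Nat.le_succ n))) hprol
    rw [htr0 i hi] at this
    exact this
  have hmf : prol 0 f u ∈ U₀ := by
    rw [hprol' 0 (Nat.zero_le n)]; exact hmU₀
  -- The map `f` has the required jet but may leave the fibres; the retraction brings it back
  -- without changing this jet, as is checked order by order below.
  let g : EB → EP := fun y => Rc (prol 0 f y)
  have hg : SmoothNear g u := by
    have h1 : SmoothNear (prol 0 f) u := hf.prol 0
    filter_upwards [h1, h1.contDiffAt.continuousAt.eventually (hU₀.mem_nhds hmf)] with y h2 h3
    exact (hRc.contDiffAt (hU₀.mem_nhds h3)).comp y h2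
  have hev : ∀ᶠ y in 𝓝 u, prol 0 f y ∈ U₀ :=
    (contDiffAt_prol 0 hf.contDiffAt).continuousAt.eventually (hU₀.mem_nhds hmf)
  refine ⟨LocSec.ofExpr IB IP fib q₀ hs.1 g hg (hRU _ hmf).1
    (hev.mono fun y hy => (hRU _ hy).2.1), LocSec.ofExpr_inChart _ _ _ _ _, ?_⟩
  rw [LocSec.ofExpr_coords, ← hprol]
  refine JetCoord.ext_comp rfl fun i hi => ?_
  rw [comp_prol, comp_prol]
  have h1 : iteratedFDeriv ℝ i g u = iterD₁ Rc i (prol (0 + i) f u) :=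
    (iteratedFDeriv_comp_prol₁ hU₀ hRc hf hmf i).self_of_nhds
  have h2 : iteratedFDeriv ℝ i r u = iterD₁ Rc i (prol (0 + i) r u) :=
    ((hRexpr s hs hmU₀).iteratedFDeriv ℝ i).self_of_nhds.symm.trans
      (iteratedFDeriv_comp_prol₁ hU₀ hRc hsm hmU₀ i).self_of_nhds
  -- Below the top order `f` and `r` have the same jet. In the top order the prolonged retraction is
  -- affine along `p`, with slope given by `hret`.
  rcases hi.lt_or_eq with hi' | rfl
  · have h3 : 0 + i ≤ n := by omega
    refine h1.trans ?_
    rw [hprol' _ h3, ← h2, ← comp_prol (Nat.le_of_lt_succ hi'), ← comp_prol (Nat.le_of_lt_succ hi'),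
      hprol' n le_rfl]
  · have h3 : prol (0 + (n + 1)) f u = tr ξ + t • tr p := by
      rw [← map_smul, ← map_add, ← hprol]
      rfl
    have h4 : JetCoord.truncL (Nat.le_succ (0 + n)) (tr p) = 0 := by
      have : JetCoord.truncL (Nat.le_succ (0 + n)) (tr p) =
          JetCoord.truncL (Nat.zero_add n).le (JetCoord.truncL (Nat.le_succ n) p) := rfl
      rw [this, hp, map_zero]
    have h5 := iterD₁_add_top hU₀ hRc n (x := tr ξ) (q := tr p) hmU₀ h4 t
    have h6 : iteratedFDeriv ℝ (n + 1) f u = JetCoord.comp (n + 1) le_rfl (ξ + t • p) := by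
      rw [← hprol]; rfl
    rw [h1, h3, h6, map_add, map_smul]
    refine h5.trans ?_
    have h7 : iterD₁ Rc (n + 1) (tr ξ) = JetCoord.comp (n + 1) le_rfl ξ := h2.symm
    have h8 : fderiv ℝ (iterD₁ Rc (n + 1)) (tr ξ) (tr p) = JetCoord.comp (n + 1) le_rfl p := hret
    rw [h7]
    exact congrArg (fun z => JetCoord.comp (n + 1) le_rfl ξ + t • z) h8

end Jets

end FlatReps

end

noncomputable section

namespace FlatReps


/-! ### Tangency of the Cartan planes to the prolongations, and extension to infinite jets -/

section Jets

variable {EB HB B EP HP P W W' : Type*}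
  [NormedAddCommGroup EB] [NormedSpace ℝ EB] [TopologicalSpace HB]
  [TopologicalSpace B] [ChartedSpace HB B]
  [NormedAddCommGroup EP] [NormedSpace ℝ EP] [TopologicalSpace HP]
  [TopologicalSpace P] [ChartedSpace HP P]
  [NormedAddCommGroup W] [NormedSpace ℝ W] [NormedAddCommGroup W'] [NormedSpace ℝ W']
  {IB : ModelWithCorners ℝ EB HB} {IP : ModelWithCorners ℝ EP HP} {fib : B → Set P}
  [IB.Boundaryless] [IsManifold IB ∞ B] [IP.Boundaryless] [IsManifold IP ∞ P]

theorem iterD₁_one_apply {k : ℕ} {G : JetCoord EB EP k → W} {x : JetCoord EB EP (k + 1)}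
    (hG : DifferentiableAt ℝ G (JetCoord.truncL (Nat.le_succ k) x)) (v : EB) :
    iterD₁ G 1 x (fun _ => v) = totalD G x v := by
  let L : W →L[ℝ] (EB [×0]→L[ℝ] W) :=
    ((continuousMultilinearCurryFin0 ℝ EB W).symm.toContinuousLinearEquiv : _ ≃L[ℝ] _)
  have h : totalD (fun x => L (G x)) x = L.comp (totalD G x) := totalD_clm L hG
  change totalD (fun x => L (G x)) x v (Fin.tail fun _ => v) = _
  rw [h]
  rfl

/-- Tangency of order one to `E₀` says precisely that first total derivatives of functions vanishing
on `E₀` vanish at the jet. -/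
theorem cartanTangent_prolong_zero {k : ℕ} {E₀ : Set (Jet IB IP fib k)} :
    CartanTangent (prolong E₀ 1) (prolong E₀ 0) := by
  intro b s₀ hs₀ G U hU hm hG hv
  obtain ⟨s, hs1, hsE, hsT⟩ := LocSec.exists_of_mem_prolong (l := 1) hs₀
  have hval : s.toFun b = s₀.toFun b := LocSec.toFun_eq_of_jet_eq hs1
  have hc : s.InChart b (s₀.toFun b) := ⟨mem_chart_source _ _, hval ▸ mem_chart_source _ _⟩
  have hco : s.coords (k + 1) b (s₀.toFun b) = s₀.coords (k + 1) b (s₀.toFun b) :=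
    LocSec.coords_eq_of_jet_eq hc hs1
  have hm' : s.coords k b (s₀.toFun b) ∈ U := by
    have := congrArg (JetCoord.truncL (Nat.le_succ k)) hco
    exact (show s.coords k b (s₀.toFun b) = s₀.coords k b (s₀.toFun b) from this) ▸ hm
  -- A function vanishing on `prolong E₀ 0` vanishes on `E₀`, since tangency of order zero holds for
  -- every section through `E₀`.
  have h1 := hsT.iterD_eq_zero hc hU hG hm' (fun θ hθ hθc hθm => hv θ
    ⟨θ.base, θ.rep, Jet.rep_jet θ, (Jet.rep_jet θ).symm ▸ hθ,
      isTangent_of_iterD_eq_zero fun F V hV hF hFm hFv i hi => by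
        obtain rfl : i = 0 := Nat.le_zero.1 hi
        have h2 := hFv θ hθ θ.rep.inChart_self hFm
        change ContinuousMultilinearMap.uncurry0 ℝ EB (F (θ.coords θ.base _)) = 0
        rw [h2]
        rfl⟩ hθc hθm) (i := 1) le_rfl
  rw [hco] at h1
  ext v
  rw [← iterD₁_one_apply ((hG.contDiffAt (hU.mem_nhds hm)).differentiableAt (by simp)), h1]
  rfl

/-- If the Cartan planes at `S` are tangent to `T` and `σ` is a local section of `S` over `T`, then
`σ` maps the Cartan planes to vectors tangent to `S`. -/
theorem tangentVec_fderiv_section {m : ℕ} {S : Set (Jet IB IP fib (m + 1))}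
    {T : Set (Jet IB IP fib m)} {b₀ : B} {q₀ : P} {ξ' a : JetCoord EB EP m}
    (ha : TangentVec T b₀ q₀ ξ' a)
    {σ : JetCoord EB EP m → JetCoord EB EP (m + 1)} {U : Set (JetCoord EB EP m)} (hU : IsOpen U)
    (hm : ξ' ∈ U) (hσ : ContDiffOn ℝ ∞ σ U)
    (hσT : ∀ θ ∈ T, θ.InChart b₀ q₀ → θ.coords b₀ q₀ ∈ U →
      ∃ θ' ∈ S, Jet.trunc (Nat.le_succ m) θ' = θ ∧ θ'.coords b₀ q₀ = σ (θ.coords b₀ q₀)) :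
    TangentVec S b₀ q₀ (σ ξ') (fderiv ℝ σ ξ' a) ∧
      JetCoord.truncL (Nat.le_succ m) (fderiv ℝ σ ξ' a) = a := by
  have hdσ : DifferentiableAt ℝ σ ξ' :=
    (hσ.contDiffAt (hU.mem_nhds hm)).differentiableAt (by simp)
  constructor
  · intro H V hV hξ hH hv
    have hW : IsOpen (U ∩ σ ⁻¹' V) := hσ.continuousOn.isOpen_inter_preimage hU hV
    have h1 := ha (fun x => H (σ x)) (U ∩ σ ⁻¹' V) hW ⟨hm, hξ⟩
      (hH.comp (hσ.mono inter_subset_left) fun _ h => h.2) (fun θ hθ hc hmem => by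
        obtain ⟨θ', h1, h2, h3⟩ := hσT θ hθ hc hmem.1
        beta_reduce
        rw [← h3]
        refine hv θ' h1 ?_ ?_
        · rw [← h2] at hc
          exact (Jet.inChart_trunc _ θ').1 hc
        · rw [h3]; exact hmem.2)
    have h2 := (((hH.contDiffAt (hV.mem_nhds hξ)).differentiableAt (by simp)).hasFDerivAt.comp ξ'
      hdσ.hasFDerivAt).fderiv
    rw [Function.comp_def] at h2
    rw [h2] at h1
    exact h1
  -- On `T` the map `σ` followed by truncation is the identity, and `a` is tangent to `T`; hence the
  -- differentials agree on `a`.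
  · have h1 := ha.fderiv_eq_zero (H := fun x => JetCoord.truncL (Nat.le_succ m) (σ x) - x) hU hm
      (((ContinuousLinearMap.contDiff _).comp_contDiffOn hσ).sub contDiffOn_id)
      (fun θ hθ hc hmem => by
        obtain ⟨θ', h1, h2, h3⟩ := hσT θ hθ hc hmem
        beta_reduce
        have hc' : θ'.InChart b₀ q₀ := by
          rw [← h2] at hc
          exact (Jet.inChart_trunc _ θ').1 hc
        rw [← h3, ← Jet.coords_trunc _ θ' hc', h2, sub_self])
    let L : JetCoord EB EP (m + 1) →L[ℝ] JetCoord EB EP m := JetCoord.truncL (Nat.le_succ m)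
    have h3 : HasFDerivAt (fun x => L (σ x)) (L.comp (fderiv ℝ σ ξ')) ξ' :=
      L.hasFDerivAt.comp ξ' hdσ.hasFDerivAt
    have h2 : HasFDerivAt (fun x => JetCoord.truncL (Nat.le_succ m) (σ x) - x)
        (L.comp (fderiv ℝ σ ξ') - ContinuousLinearMap.id ℝ _) ξ' := h3.sub (hasFDerivAt_id _)
    rw [h2.fderiv] at h1
    exact sub_eq_zero.1 h1

/-- A line of sections in a direction that is compatible with the equation and of the highest order
consists of solutions of the equation. -/
theorem mem_prolong_of_coords_eq_add {k l : ℕ} {E₀ : Set (Jet IB IP fib k)} {b : B}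
    {s s' : LocSec IB IP fib b} (hsE : s.jet k ∈ E₀) (hsT : IsTangent E₀ (l + 1) s)
    (hc' : s'.InChart b (s.toFun b)) {p : JetCoord EB EP (k + l + 1)}
    (hp : JetCoord.truncL (Nat.le_succ (k + l)) p = 0)
    (hpT : ∀ (F : JetCoord EB EP k → ℝ) (U : Set (JetCoord EB EP k)), IsOpen U → ContDiffOn ℝ ∞ F U →
        s.coords k b (s.toFun b) ∈ U → VanishesOn E₀ b (s.toFun b) F U →
        fderiv ℝ (iterD₁ F (l + 1)) (s.coords (k + l + 1) b (s.toFun b)) p = 0) (t : ℝ)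
    (hs' : s'.coords (k + l + 1) b (s.toFun b) = s.coords (k + l + 1) b (s.toFun b) + t • p) :
    s'.jet (k + (l + 1)) ∈ prolong E₀ (l + 1) := by
  have hc : s.InChart b (s.toFun b) := s.inChart_self
  have htr : ∀ i (hi : i ≤ k + l), s'.coords i b (s.toFun b) = s.coords i b (s.toFun b) := by
    intro i hi
    have h1 := congrArg (JetCoord.truncL (hi.trans (Nat.le_succ _))) hs'
    rw [map_add, map_smul, ← JetCoord.truncL_truncL hi (Nat.le_succ (k + l)) p, hp, map_zero,
      smul_zero, add_zero] at h1
    exact h1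
  have hval : s'.toFun b = s.toFun b := LocSec.toFun_eq_of_coords_eq hc' hc (htr 0 (Nat.zero_le _))
  have hjet : s'.jet k = s.jet k :=
    LocSec.jet_eq_of_coords_eq hc' hval (htr k (Nat.le_add_right k l))
  refine ⟨b, s', rfl, hjet ▸ hsE, isTangent_of_iterD_eq_zero ?_⟩
  rw [hval]
  intro F U hU hF hm hv i hi
  rw [htr k (Nat.le_add_right k l)] at hm
  -- Consequences of order at most `l` see only the unchanged lower jet. Those of order `l + 1` are
  -- affine along `p`, start at zero and have slope zero by `hpT`.
  rcases hi.lt_or_eq with hi' | rfl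
  · rw [htr (k + i) (by omega)]
    exact hsT.iterD_eq_zero hc hU hF hm hv hi
  · have h1 := iterD₁_add_top hU hF l (x := s.coords (k + l + 1) b (s.toFun b)) (q := p) hm hp t
    have h2 : iterD₁ F (l + 1) (s.coords (k + (l + 1)) b (s.toFun b)) = 0 :=
      hsT.iterD_eq_zero hc hU hF hm hv le_rfl
    have h3 : fderiv ℝ (iterD₁ F (l + 1)) (s.coords (k + l + 1) b (s.toFun b)) p = 0 :=
      hpT F U hU hF hm hv
    rw [← hs'] at h1
    refine h1.trans ?_
    rw [h3, smul_zero, add_zero]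
    exact h2

/-- A Cartan vector `a` at a point of the equation of level `l + 1` projects to a Cartan vector
tangent to level `l`, by the induction hypothesis. A local section `σ` of the submersion lifts the
latter to a vector `w` tangent to level `l + 1`. The difference `a - w` changes only the highest
derivatives, and the line in its direction stays in the equation, because there the equation is
affine and its linear part annihilates `a - w`. Hence `a` is tangent too. -/
theorem cartanTangent_prolong_succ (hR : HasRetraction IB IP fib) {k l : ℕ}
    {E₀ : Set (Jet IB IP fib k)}
    (hsub : IsSurjSubmersion (Nat.le_succ (k + l)) (prolong E₀ (l + 1)) (prolong E₀ l))
    (ih : CartanTangent (prolong E₀ (l + 1)) (prolong E₀ l)) :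
    CartanTangent (prolong E₀ (l + 2)) (prolong E₀ (l + 1)) := by
  intro b s₀ hs₀ G U hU hm hG hv
  obtain ⟨s, hs1, hsE, hsT⟩ := LocSec.exists_of_mem_prolong (l := l + 2) hs₀
  have hval : s.toFun b = s₀.toFun b := LocSec.toFun_eq_of_jet_eq hs1
  have hc : s.InChart b (s.toFun b) := s.inChart_self
  have hco : s.coords (k + (l + 2)) b (s.toFun b) = s₀.coords (k + (l + 2)) b (s.toFun b) :=
    LocSec.coords_eq_of_jet_eq hc hs1
  have hco' : s.coords (k + (l + 1)) b (s.toFun b) = s₀.coords (k + (l + 1)) b (s.toFun b) :=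
    congrArg (JetCoord.truncL (Nat.le_succ (k + (l + 1)))) hco
  rw [← hval] at hm hv ⊢
  rw [show s₀.coords (k.add (l + 1)) b (s.toFun b) = _ from hco'.symm] at hm
  rw [show s₀.coords (k.add (l + 1) + 1) b (s.toFun b) = _ from hco.symm]
  clear hco hco' hs₀ hs1 hval s₀
  have hθ₀ : s.jet (k + (l + 1)) ∈ prolong E₀ (l + 1) := ⟨b, s, rfl, hsE, hsT.mono (Nat.le_succ _)⟩
  obtain ⟨σ, V, hV, hVm, hσ, hσ0, hσT⟩ := hsub.2 _ hθ₀
  have hbase : (s.jet (k + (l + 1))).base = b := rfl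
  have htr : Jet.trunc (Nat.le_succ (k + l)) (s.jet (k + (l + 1))) = s.jet (k + l) := rfl
  have hvalue : (s.jet (k + (l + 1))).value = s.toFun b := Jet.value_jet s
  simp only [hbase, hvalue] at hVm hσ0 hσT
  rw [htr, Jet.coords_jet s hc] at hVm hσ0
  replace hσ0 := hσ0.trans (Jet.coords_jet (k := k + (l + 1)) s hc)
  ext v
  have hξ' : TangentVec (prolong E₀ l) b (s.toFun b) (s.coords (k + l) b (s.toFun b))
      (shift (s.coords (k + l + 1) b (s.toFun b)) v) := (cartanTangent_iff _ _).1 ih b s hθ₀ v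
  set q := s.toFun b
  obtain ⟨hw1, hw2⟩ := tangentVec_fderiv_section hξ' hV hVm hσ hσT
  rw [hσ0] at hw1
  set w := fderiv ℝ σ (s.coords (k + l) b q) (shift (s.coords (k + l + 1) b q) v)
  set ξ := s.coords (k + (l + 1)) b q
  set a := shift (s.coords (k + (l + 1) + 1) b q) v
  have hp : JetCoord.truncL (Nat.le_succ (k + l)) (a - w) = 0 := by
    rw [map_sub, hw2]
    exact sub_self _
  have hpv : TangentVec (univ : Set (Jet IB IP fib (k + l + 1))) b q ξ (a - w) :=
    (tangentVec_univ_shift s hc _ v).sub (hw1.mono (subset_univ _))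
  -- The differential of the order `l + 1` consequence kills `a` because its total derivative is a
  -- consequence of order `l + 2`, and kills `w` because `w` is tangent to the level where that
  -- consequence vanishes.
  have hpF : ∀ (F : JetCoord EB EP k → ℝ) (U : Set (JetCoord EB EP k)), IsOpen U →
      ContDiffOn ℝ ∞ F U → s.coords k b q ∈ U → VanishesOn E₀ b q F U →
      fderiv ℝ (iterD₁ F (l + 1)) ξ (a - w) = 0 := by
    intro F U hU hF hm hv
    have h1 : iterD₁ F (l + 2) (s.coords (k + (l + 2)) b q) = 0 :=
      hsT.iterD_eq_zero hc hU hF hm hv le_rfl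
    have h2 : fderiv ℝ (iterD₁ F (l + 1)) ξ a = 0 := by
      ext m
      exact congrArg (fun f : EB [×(l + 2)]→L[ℝ] ℝ => f (Fin.cons v m)) h1
    have h3 : fderiv ℝ (iterD₁ F (l + 1)) ξ w = 0 :=
      hw1.fderiv_eq_zero (U := JetCoord.truncL (Nat.le_add_right k (l + 1)) ⁻¹' U)
          (hU.preimage (ContinuousLinearMap.continuous _)) hm
          (contDiffOn_iterD₁ hU hF (l + 1)) (iterD_eq_zero_of_mem_prolong hU hF hv)
    rw [map_sub, h2, h3, sub_zero]
  have hdG : DifferentiableAt ℝ G ξ := (hG.contDiffAt (hU.mem_nhds hm)).differentiableAt (by simp)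
  -- This needs the retraction: a point of the line must be the jet of an actual section of the
  -- bundle before it can be a solution.
  have hline : ∀ t : ℝ, ξ + t • (a - w) ∈ U → G (ξ + t • (a - w)) = 0 := by
    intro t ht
    obtain ⟨s', hc', hs'⟩ := hR.exists_locSec_add_top s hc hp hpv t
    have h1 := mem_prolong_of_coords_eq_add hsE (hsT.mono (Nat.le_succ _)) hc' hp hpF t hs'
    have h2 := hv _ h1 ((Jet.inChart_jet s').2 hc')
    have h3 : (s'.jet (k + (l + 1))).coords b q = ξ + t • (a - w) :=
      (Jet.coords_jet (k := k + (l + 1)) s' hc').trans hs'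
    have h4 : (s'.jet (k + (l + 1))).coords b q ∈ U →
        G ((s'.jet (k + (l + 1))).coords b q) = 0 := h2
    rw [h3] at h4
    exact h4 ht
  have hp0 : fderiv ℝ G ξ (a - w) = 0 := by
    have h4 : HasDerivAt (fun t : ℝ => ξ + t • (a - w)) (a - w) 0 := by
      simpa using ((hasDerivAt_id (0 : ℝ)).smul_const (a - w)).const_add ξ
    have h5 : HasFDerivAt G (fderiv ℝ G ξ) (ξ + (0 : ℝ) • (a - w)) := by
      rw [zero_smul, add_zero]
      exact hdG.hasFDerivAt
    refine (h5.comp_hasDerivAt 0 h4).unique ((hasDerivAt_const (0 : ℝ) (0 : ℝ)).congr_of_eventuallyEq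
      ?_)
    have h6 : ∀ᶠ t : ℝ in 𝓝 0, ξ + t • (a - w) ∈ U := by
      refine h4.continuousAt.eventually ?_
      change U ∈ 𝓝 (ξ + (0 : ℝ) • (a - w))
      rw [zero_smul, add_zero]
      exact hU.mem_nhds hm
    exact h6.mono fun t ht => hline t ht
  have hw0 : fderiv ℝ G ξ w = 0 := hw1 G U hU hm hG hv
  rw [map_sub, hw0, sub_zero] at hp0
  exact hp0

/-- The Cartan planes of a formally integrable equation are tangent to it. -/
theorem IsFormallyIntegrable.cartanTangent (hR : HasRetraction IB IP fib) {k : ℕ}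
    {E₀ : Set (Jet IB IP fib k)} (hE : IsFormallyIntegrable E₀) (l : ℕ) :
    CartanTangent (prolong E₀ (l + 1)) (prolong E₀ l) := by
  induction l with
  | zero => exact cartanTangent_prolong_zero
  | succ l ih => exact cartanTangent_prolong_succ hR (hE.submersion l) ih

/-- Every jet in a prolongation of a formally integrable equation extends to an infinite jet. -/
theorem IsFormallyIntegrable.exists_infJet {k : ℕ} {E₀ : Set (Jet IB IP fib k)}
    (hE : IsFormallyIntegrable E₀) {l : ℕ} {θ : Jet IB IP fib (k + l)} (hθ : θ ∈ prolong E₀ l) :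
    ∃ z ∈ infProlong E₀, z.jet (k + l) = θ := by
  have hext : ∀ l (θ : prolong E₀ l), ∃ θ' : prolong E₀ (l + 1),
      Jet.trunc (Nat.le_succ (k + l)) θ'.1 = θ.1 := by
    intro l θ
    have h1 : θ.1 ∈ Jet.trunc (Nat.le_succ (k + l)) '' prolong E₀ (l + 1) := by
      rw [(hE.submersion l).1]
      exact θ.2
    obtain ⟨θ', h2, h3⟩ := h1
    exact ⟨⟨θ', h2⟩, h3⟩
  choose next hnext using hext
  let seq : ∀ n : ℕ, prolong E₀ (l + n) := fun n =>
    Nat.rec (motive := fun n => prolong E₀ (l + n)) ⟨θ, hθ⟩ (fun n θ => next (l + n) θ) n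
  have hseq : ∀ n, Jet.trunc (Nat.le_succ (k + (l + n))) (seq (n + 1)).1 = (seq n).1 := fun n =>
    hnext (l + n) (seq n)
  have htt : ∀ {a b c : ℕ} (h : a ≤ b) (h' : b ≤ c) (η : Jet IB IP fib c),
      Jet.trunc h (Jet.trunc h' η) = Jet.trunc (h.trans h') η := by
    intro a b c h h' η
    rw [← Jet.rep_jet η]
    rfl
  have hseq' : ∀ n m (h : k + (l + n) ≤ k + (l + (n + m))),
      Jet.trunc h (seq (n + m)).1 = (seq n).1 := by
    intro n m
    induction m with
    | zero =>
      intro h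
      change Jet.trunc h (seq n).1 = (seq n).1
      rw [← Jet.rep_jet (seq n).1]
      rfl
    | succ m ihm =>
      intro h
      rw [← ihm (by omega), ← hseq (n + m), htt]
      rfl
  have hle : ∀ m, m ≤ k + (l + m) := fun m => by omega
  -- Term `m` of the sequence has order `k + (l + m)`, which is at least `m`; its truncation serves
  -- as the part of order `m` of the infinite jet. Any other term of sufficient order has the same
  -- truncation.
  have hcompat : ∀ m n (h : m ≤ k + (l + n)), Jet.trunc h (seq n).1 =
      Jet.trunc (hle m) (seq m).1 := by
    intro m n h
    rcases le_total m n with hmn | hmn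
    · obtain ⟨c, rfl⟩ := Nat.exists_eq_add_of_le hmn
      rw [← hseq' m c (by omega), htt]
    · obtain ⟨c, rfl⟩ := Nat.exists_eq_add_of_le hmn
      rw [← hseq' n c (by omega), htt]
  let z : InfJet IB IP fib := ⟨fun m => Jet.trunc (hle m) (seq m).1, fun m n h => by
    rw [htt, hcompat]⟩
  refine ⟨z, fun l' => ?_, ?_⟩
  · have h1 : ∀ j n (h : k + j ≤ k + (l + n)), Jet.trunc h (seq n).1 ∈ prolong E₀ j := by
      intro j n h
      obtain ⟨b, s, h1, h2, h3⟩ := (seq n).2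
      rw [← h1]
      exact ⟨b, s, rfl, h2, h3.mono (by omega)⟩
    exact h1 l' (k + l') (by omega)
  · change Jet.trunc (hle (k + l)) (seq (k + l)).1 = θ
    rw [← hcompat (k + l) 0 le_rfl]
    change Jet.trunc _ θ = θ
    rw [← Jet.rep_jet θ]
    rfl

end Jets

end FlatReps

end

noncomputable section

namespace FlatReps


/-! ### Infinite jets in coordinates -/

section Jets

variable {EB HB B EP HP P W W' : Type*}
  [NormedAddCommGroup EB] [NormedSpace ℝ EB] [TopologicalSpace HB]
  [TopologicalSpace B] [ChartedSpace HB B]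
  [NormedAddCommGroup EP] [NormedSpace ℝ EP] [TopologicalSpace HP]
  [TopologicalSpace P] [ChartedSpace HP P]
  [NormedAddCommGroup W] [NormedSpace ℝ W] [NormedAddCommGroup W'] [NormedSpace ℝ W']
  {IB : ModelWithCorners ℝ EB HB} {IP : ModelWithCorners ℝ EP HP} {fib : B → Set P}
  [IB.Boundaryless] [IsManifold IB ∞ B] [IP.Boundaryless] [IsManifold IP ∞ P]

theorem fderiv_chartTrans_comp {b₀ b₁ b : B} (h₀ : b ∈ (chartAt HB b₀).source)
    (h₁ : b ∈ (chartAt HB b₁).source) :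
    (fderiv ℝ (chartTrans IB b₁ b₀) (extChartAt IB b₁ b)).comp
      (fderiv ℝ (chartTrans IB b₀ b₁) (extChartAt IB b₀ b)) = ContinuousLinearMap.id ℝ EB := by
  have hm : extChartAt IB b₀ b ∈ chartDom IB b₀ b₁ := extChartAt_mem_chartDom h₀ h₁
  have hm' : extChartAt IB b₁ b ∈ chartDom IB b₁ b₀ := extChartAt_mem_chartDom h₁ h₀
  have e : chartTrans IB b₀ b₁ (extChartAt IB b₀ b) = extChartAt IB b₁ b :=
    chartTrans_extChartAt h₀
  have d₀ : DifferentiableAt ℝ (chartTrans IB b₀ b₁) (extChartAt IB b₀ b) :=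
    ((contDiffOn_chartTrans IB b₀ b₁).contDiffAt
      ((isOpen_chartDom IB b₀ b₁).mem_nhds hm)).differentiableAt (by simp)
  have d₁ : DifferentiableAt ℝ (chartTrans IB b₁ b₀) (chartTrans IB b₀ b₁ (extChartAt IB b₀ b)) := by
    rw [e]
    exact ((contDiffOn_chartTrans IB b₁ b₀).contDiffAt
      ((isOpen_chartDom IB b₁ b₀).mem_nhds hm')).differentiableAt (by simp)
  have h2 := (d₁.hasFDerivAt.comp _ d₀.hasFDerivAt)
  rw [e] at h2
  refine h2.unique ((hasFDerivAt_id _).congr_of_eventuallyEq ?_)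
  filter_upwards [(isOpen_chartDom IB b₀ b₁).mem_nhds hm] with u hu
  exact chartTrans_symm hu

namespace InfJet

theorem inChart_self (z : InfJet IB IP fib) : z.InChart z.base z.value :=
  ⟨mem_chart_source _ _, mem_chart_source _ _⟩

theorem base_jet (z : InfJet IB IP fib) (k : ℕ) : (z.jet k).base = z.base :=
  congrArg Sigma.fst (z.2 0 k (Nat.zero_le k))

/-- A jet of finite order of an infinite jet is represented by a section. -/
theorem exists_section (z : InfJet IB IP fib) (k : ℕ) :
    ∃ s : LocSec IB IP fib z.base, s.toFun z.base = z.value ∧ (∀ j ≤ k, s.jet j = z.jet j) ∧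
      ∀ j ≤ k, ∀ b₀ q₀, z.InChart b₀ q₀ → s.InChart b₀ q₀ ∧ s.coords j b₀ q₀ = z.coords j b₀ q₀ := by
  have h1 : ∃ s : LocSec IB IP fib z.base, s.jet k = z.jet k := by
    rw [← z.base_jet k]
    exact ⟨_, Jet.rep_jet _⟩
  obtain ⟨s, hs⟩ := h1
  have h2 : ∀ j ≤ k, s.jet j = z.jet j := fun j hj => by
    have h3 := congrArg (Jet.trunc hj) hs
    exact h3.trans (z.2 j k hj)
  have h4 : s.toFun z.base = z.value := by
    rw [← Jet.value_jet (k := 0) s, h2 0 (Nat.zero_le _)]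
    rfl
  refine ⟨s, h4, h2, fun j hj b₀ q₀ hc => ?_⟩
  have h5 : s.InChart b₀ q₀ := ⟨hc.1, by rw [h4]; exact hc.2⟩
  refine ⟨h5, ?_⟩
  rw [← Jet.coords_jet s h5, h2 j hj]
  rfl

theorem coords_change (z : InfJet IB IP fib) {b₀ b₁ : B} {q₀ q₁ : P} (k : ℕ)
    (h₀ : z.InChart b₀ q₀) (h₁ : z.InChart b₁ q₁) :
    changeCoords IB IP b₀ q₀ b₁ q₁ k (z.coords k b₀ q₀) = z.coords k b₁ q₁ := by
  obtain ⟨s, -, -, hs⟩ := z.exists_section k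
  rw [← (hs k le_rfl _ _ h₀).2, ← (hs k le_rfl _ _ h₁).2]
  exact s.coords_change k (hs k le_rfl _ _ h₀).1 (hs k le_rfl _ _ h₁).1

theorem coords_mem_coordDom (z : InfJet IB IP fib) {b₀ b₁ : B} {q₀ q₁ : P} (k : ℕ)
    (h₀ : z.InChart b₀ q₀) (h₁ : z.InChart b₁ q₁) :
    z.coords k b₀ q₀ ∈ coordDom IB IP b₀ q₀ b₁ q₁ k := by
  obtain ⟨s, -, -, hs⟩ := z.exists_section k
  rw [← (hs k le_rfl _ _ h₀).2]
  exact s.coords_mem_coordDom k (hs k le_rfl _ _ h₀).1 (hs k le_rfl _ _ h₁).1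

theorem inChart_of_mem_coordDom (z : InfJet IB IP fib) {b₀ b₁ : B} {q₀ q₁ : P} {k : ℕ}
    (h₀ : z.InChart b₀ q₀) (h : z.coords k b₀ q₀ ∈ coordDom IB IP b₀ q₀ b₁ q₁ k) :
    z.InChart b₁ q₁ := by
  obtain ⟨s, h4, -, hs⟩ := z.exists_section k
  rw [← (hs k le_rfl _ _ h₀).2] at h
  have h5 := s.inChart_of_mem_coordDom (hs k le_rfl _ _ h₀).1 h
  refine ⟨h5.1, ?_⟩
  have h6 := h5.2
  rw [h4] at h6
  exact h6

theorem jet_eq_of_coords_eq {z z' : InfJet IB IP fib} (hb : z.base = z'.base)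
    (hv : z.value = z'.value) {k : ℕ} (h : z.coords k z.base z.value = z'.coords k z.base z.value) :
    z.jet k = z'.jet k := by
  obtain ⟨s, h1, h2, h3⟩ := z.exists_section k
  have h4 : ∃ s' : LocSec IB IP fib z.base, s'.toFun z.base = z.value ∧ s'.jet k = z'.jet k ∧
      s'.coords k z.base z.value = z'.coords k z.base z.value := by
    rw [hb, hv]
    obtain ⟨s', h1, h2, h3⟩ := z'.exists_section k
    exact ⟨s', h1, h2 k le_rfl, (h3 k le_rfl _ _ z'.inChart_self).2⟩
  obtain ⟨s', h5, h6, h7⟩ := h4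
  have h8 := h3 k le_rfl _ _ z.inChart_self
  have h9 := LocSec.jet_eq_of_coords_eq h8.1 (h1.trans h5.symm)
    (h8.2.trans (h.trans h7.symm))
  rw [h2 k le_rfl, h6] at h9
  exact h9

/-- `totalDeriv` is defined with a chosen representative; by the chain rule it depends only on the
coordinates of order `k + 1`, so the choice is immaterial. -/
theorem totalDeriv_eq (z : InfJet IB IP fib) {k : ℕ} {G : JetCoord EB EP k → ℝ}
    (hG : DifferentiableAt ℝ G (z.coords k z.base z.value)) (v : TangentSpace IB z.base) :
    totalDeriv z k G v = totalD G (z.coords (k + 1) z.base z.value) (show EB from v) := by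
  have hc : (z.jet (k + 1)).InChart z.base z.value := (z.inChart_iff (k + 1)).1 z.inChart_self
  have hb : extChartAt IB z.base (z.jet (k + 1)).base = extChartAt IB z.base z.base :=
    congrArg _ (z.base_jet _)
  have h1 : prol (k + 1) ((z.jet (k + 1)).rep.expr z.base z.value) (extChartAt IB z.base z.base) =
      z.coords (k + 1) z.base z.value := by
    rw [coords, Jet.coords, LocSec.coords, hb]
  have h2 : SmoothNear ((z.jet (k + 1)).rep.expr z.base z.value)
      (extChartAt IB z.base z.base) := by
    have h3 := (z.jet (k + 1)).rep.smoothNear_expr hc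
    rwa [hb] at h3
  have h3 : prol k ((z.jet (k + 1)).rep.expr z.base z.value) (extChartAt IB z.base z.base) =
      z.coords k z.base z.value := by
    rw [z.coords_trunc (Nat.le_succ k) z.inChart_self, ← h1]
    rfl
  have h4 := fderiv_comp_prol (G := G) (by rw [h3]; exact hG) h2.contDiffAt
  rw [totalDeriv, h4.fderiv, h1]

theorem totalD_comp_changeCoords (z : InfJet IB IP fib) {b₀ b₁ : B} {q₀ q₁ : P} {k : ℕ}
    (h₀ : z.InChart b₀ q₀) (h₁ : z.InChart b₁ q₁) {G : JetCoord EB EP k → W}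
    (hG : DifferentiableAt ℝ G (z.coords k b₁ q₁)) :
    totalD (fun x => G (changeCoords IB IP b₀ q₀ b₁ q₁ k x)) (z.coords (k + 1) b₀ q₀) =
      (totalD G (z.coords (k + 1) b₁ q₁)).comp
        (fderiv ℝ (chartTrans IB b₀ b₁) (extChartAt IB b₀ z.base)) := by
  obtain ⟨s, -, -, hs⟩ := z.exists_section (k + 1)
  rw [← (hs (k + 1) le_rfl _ _ h₀).2, ← (hs (k + 1) le_rfl _ _ h₁).2]
  refine s.totalD_comp_changeCoords (hs k (Nat.le_succ k) _ _ h₀).1 (hs k (Nat.le_succ k) _ _ h₁).1 ?_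
  rw [(hs k (Nat.le_succ k) _ _ h₁).2]
  exact hG

end InfJet

/-! ### Functions on subsets of infinite jet spaces -/

variable {E : Set (InfJet IB IP fib)}

/-- On the part of `E` whose coordinates in the charts around `b₀`, `q₀` are in the open set `U`,
the function `f` is the smooth function `G` of the coordinates of order `≤ k`. -/
structure RepIn (f : E → W) (b₀ : B) (q₀ : P) (k : ℕ) (G : JetCoord EB EP k → W)
    (U : Set (JetCoord EB EP k)) : Prop where
  isOpen : IsOpen U
  contDiffOn : ContDiffOn ℝ ∞ G U
  eq : ∀ z : E, z.1.InChart b₀ q₀ → z.1.coords k b₀ q₀ ∈ U → f z = G (z.1.coords k b₀ q₀)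

namespace RepIn

variable {f : E → W} {g : E → W'} {b₀ : B} {q₀ : P} {k l : ℕ} {G : JetCoord EB EP k → W}
  {U : Set (JetCoord EB EP k)} {H : JetCoord EB EP k → W'} {V : Set (JetCoord EB EP k)}

theorem differentiableAt (h : RepIn f b₀ q₀ k G U) {x : JetCoord EB EP k} (hx : x ∈ U) :
    DifferentiableAt ℝ G x :=
  (h.contDiffOn.contDiffAt (h.isOpen.mem_nhds hx)).differentiableAt (by simp)

theorem mono (h : RepIn f b₀ q₀ k G U) (hkl : k ≤ l) :
    RepIn f b₀ q₀ l (G ∘ JetCoord.truncL hkl) (JetCoord.truncL hkl ⁻¹' U) where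
  isOpen := h.isOpen.preimage (JetCoord.truncL hkl).continuous
  contDiffOn := h.contDiffOn.comp (ContinuousLinearMap.contDiff _).contDiffOn fun _ hx => hx
  eq z hc hm := by
    rw [mem_preimage, ← z.1.coords_trunc hkl hc] at hm
    rw [Function.comp_apply, ← z.1.coords_trunc hkl hc]
    exact h.eq z hc hm

theorem prodMk (h : RepIn f b₀ q₀ k G U) (h' : RepIn g b₀ q₀ k H V) :
    RepIn (fun z => (f z, g z)) b₀ q₀ k (fun x => (G x, H x)) (U ∩ V) where
  isOpen := h.isOpen.inter h'.isOpen
  contDiffOn := (h.contDiffOn.mono inter_subset_left).prodMk (h'.contDiffOn.mono inter_subset_right)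
  eq z hc hm := by rw [h.eq z hc hm.1, h'.eq z hc hm.2]

theorem comp (h : RepIn f b₀ q₀ k G U) {Φ : W → W'} {O : Set W} (hO : IsOpen O)
    (hΦ : ContDiffOn ℝ ∞ Φ O) : RepIn (fun z => Φ (f z)) b₀ q₀ k (fun x => Φ (G x)) (U ∩ G ⁻¹' O) where
  isOpen := h.contDiffOn.continuousOn.isOpen_inter_preimage h.isOpen hO
  contDiffOn := hΦ.comp (h.contDiffOn.mono inter_subset_left) fun _ hx => hx.2
  eq z hc hm := by rw [h.eq z hc hm.1]

theorem change (h : RepIn f b₀ q₀ k G U) (b₁ : B) (q₁ : P) :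
    RepIn f b₁ q₁ k (fun x => G (changeCoords IB IP b₁ q₁ b₀ q₀ k x))
      (coordDom IB IP b₁ q₁ b₀ q₀ k ∩ changeCoords IB IP b₁ q₁ b₀ q₀ k ⁻¹' U) where
  isOpen := (contDiffOn_changeCoords IB IP b₁ q₁ b₀ q₀ k).continuousOn.isOpen_inter_preimage
    (isOpen_coordDom IB IP b₁ q₁ b₀ q₀ k) h.isOpen
  contDiffOn := h.contDiffOn.comp
    ((contDiffOn_changeCoords IB IP b₁ q₁ b₀ q₀ k).mono inter_subset_left) fun _ hx => hx.2
  eq z hc hm := by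
    have h1 := z.1.inChart_of_mem_coordDom hc hm.1
    have h2 := hm.2
    rw [mem_preimage, z.1.coords_change k hc h1] at h2
    rw [z.1.coords_change k hc h1]
    exact h.eq z h1 h2

theorem change_mem {b₁ : B} {q₁ : P} {z : InfJet IB IP fib}
    (hc : z.InChart b₀ q₀) (hc' : z.InChart b₁ q₁) (hm : z.coords k b₀ q₀ ∈ U) :
    z.coords k b₁ q₁ ∈ coordDom IB IP b₁ q₁ b₀ q₀ k ∩ changeCoords IB IP b₁ q₁ b₀ q₀ k ⁻¹' U := by
  refine ⟨z.coords_mem_coordDom k hc' hc, ?_⟩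
  rw [mem_preimage, z.coords_change k hc' hc]
  exact hm

theorem of_base {Φ : EB → W} {O : Set EB} (hO : IsOpen O) (hΦ : ContDiffOn ℝ ∞ Φ O)
    (hf : ∀ z : E, z.1.InChart b₀ q₀ → extChartAt IB b₀ z.1.base ∈ O →
      f z = Φ (extChartAt IB b₀ z.1.base)) :
    RepIn f b₀ q₀ k (fun x => Φ x.1) (Prod.fst ⁻¹' O) where
  isOpen := hO.preimage continuous_fst
  contDiffOn := hΦ.comp contDiff_fst.contDiffOn fun _ hx => hx
  eq z hc hm := by
    rw [mem_preimage, z.1.coords_fst k hc] at hm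
    rw [z.1.coords_fst k hc]
    exact hf z hc hm

end RepIn

/-- The Cartan planes at the points of `E` are tangent to `E`. -/
def CartanClosed (E : Set (InfJet IB IP fib)) : Prop :=
  ∀ (z : E) (k : ℕ) (G : JetCoord EB EP k → ℝ) (U : Set (JetCoord EB EP k)),
    RepIn (fun _ : E => (0 : ℝ)) z.1.base z.1.value k G U → z.1.coords k z.1.base z.1.value ∈ U →
    totalD G (z.1.coords (k + 1) z.1.base z.1.value) = 0

/-- A function of finite order that vanishes on the infinite prolongation vanishes on a finite one,
since every jet of the latter extends to an infinite solution jet. Then tangency at finite level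
applies, after the order is raised from `m` to `k + m`, where `prolong E₀ m` lives. -/
theorem IsFormallyIntegrable.cartanClosed (hR : HasRetraction IB IP fib) {k : ℕ}
    {E₀ : Set (Jet IB IP fib k)} (hE : IsFormallyIntegrable E₀) : CartanClosed (infProlong E₀) := by
  intro z m G U hG hz
  have hk : m ≤ k + m := Nat.le_add_left m k
  obtain ⟨s, h1, h2, h3⟩ := z.1.exists_section (k + (m + 1))
  have hG' := hG.mono hk
  have hc := z.1.inChart_self
  have hs : s.jet (k + (m + 1)) ∈ prolong E₀ (m + 1) := by
    rw [h2 _ le_rfl]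
    exact z.2 (m + 1)
  have hm : s.coords (k + m) z.1.base (s.toFun z.1.base) ∈ JetCoord.truncL hk ⁻¹' U := by
    rw [h1, (h3 (k + m) (by omega) _ _ hc).2, mem_preimage, ← z.1.coords_trunc hk hc]
    exact hz
  have h4 := hE.cartanTangent hR m z.1.base s hs (G ∘ JetCoord.truncL hk) _ hG'.isOpen hm
    hG'.contDiffOn (fun θ hθ hθc hθm => by
      obtain ⟨z', hz', rfl⟩ := hE.exists_infJet hθ
      rw [h1] at hθc hθm ⊢
      have := hG'.eq ⟨z', hz'⟩ ((z'.inChart_iff _).2 hθc) hθm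
      exact this.symm)
  have h5 := totalD_comp_truncL hk (G := G) (x := s.coords (k + m + 1) z.1.base (s.toFun z.1.base))
    (hG.differentiableAt hm)
  have h6 : s.coords (m + 1) z.1.base (s.toFun z.1.base) =
      z.1.coords (m + 1) z.1.base z.1.value := by
    rw [h1]
    exact (h3 (m + 1) (by omega) _ _ hc).2
  rw [← h6]
  exact h5.symm.trans h4

namespace CartanClosed

variable {b₀ : B} {q₀ : P} {k l : ℕ} {G : JetCoord EB EP k → W} {U : Set (JetCoord EB EP k)} {z : E}

/-- The change of chart multiplies the total derivative by an invertible differential, which is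
cancelled with `fderiv_chartTrans_comp`; vector values are reduced to scalar ones by functionals. -/
theorem totalD_eq_zero (hE : CartanClosed E) (h : RepIn (fun _ : E => (0 : W)) b₀ q₀ k G U)
    (hc : z.1.InChart b₀ q₀) (hm : z.1.coords k b₀ q₀ ∈ U) :
    totalD G (z.1.coords (k + 1) b₀ q₀) = 0 := by
  have hc' := z.1.inChart_self
  have hd : DifferentiableAt ℝ G (JetCoord.truncL (Nat.le_succ k) (z.1.coords (k + 1) b₀ q₀)) := by
    rw [← z.1.coords_trunc _ hc]
    exact h.differentiableAt hm
  ext v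
  refine SeparatingDual.eq_zero_of_forall_dual_eq_zero (R := ℝ) fun f => ?_
  have h1 := h.comp isOpen_univ f.contDiff.contDiffOn
  simp only [map_zero, preimage_univ, inter_univ] at h1
  have h2 := hE z k _ _ (h1.change z.1.base z.1.value) (RepIn.change_mem hc hc' hm)
  rw [z.1.totalD_comp_changeCoords (G := fun x => f (G x)) hc' hc (h1.differentiableAt hm),
    totalD_clm f hd] at h2
  have h3 := congrArg (fun A => A (fderiv ℝ (chartTrans IB b₀ z.1.base)
    (extChartAt IB b₀ z.1.base) v)) h2
  have h4 : fderiv ℝ (chartTrans IB z.1.base b₀) (extChartAt IB z.1.base z.1.base)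
      (fderiv ℝ (chartTrans IB b₀ z.1.base) (extChartAt IB b₀ z.1.base) v) = v :=
    congrArg (fun A => A v) (fderiv_chartTrans_comp (IB := IB) hc.1 hc'.1)
  change f (totalD G (z.1.coords (k + 1) b₀ q₀) (fderiv ℝ (chartTrans IB z.1.base b₀)
    (extChartAt IB z.1.base z.1.base) (fderiv ℝ (chartTrans IB b₀ z.1.base)
      (extChartAt IB b₀ z.1.base) v))) = 0 at h3
  rwa [h4] at h3

/-- Closedness can be iterated: a total derivative of a function vanishing on `E` is again such a
function. So all differential consequences hold on `E`. -/
theorem repIn_iterD₁ (hE : CartanClosed E) (h : RepIn (fun _ : E => (0 : W)) b₀ q₀ k G U) (i : ℕ) :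
    RepIn (fun _ : E => (0 : EB [×i]→L[ℝ] W)) b₀ q₀ (k + i) (iterD₁ G i)
      (JetCoord.truncL (Nat.le_add_right k i) ⁻¹' U) := by
  refine ⟨h.isOpen.preimage (ContinuousLinearMap.continuous _), contDiffOn_iterD₁ h.isOpen
    h.contDiffOn i, ?_⟩
  have h0 : ∀ z : E, z.1.InChart b₀ q₀ → z.1.coords (k + i) b₀ q₀ ∈
      JetCoord.truncL (Nat.le_add_right k i) ⁻¹' U → z.1.coords k b₀ q₀ ∈ U := by
    intro z hc hm
    rw [z.1.coords_trunc (Nat.le_add_right k i) hc]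
    exact hm
  induction i with
  | zero =>
    intro z hc hm
    have h1 := h.eq z hc hm
    change 0 = ContinuousMultilinearMap.uncurry0 ℝ EB (G (z.1.coords k b₀ q₀))
    rw [← h1]
    rfl
  | succ i ih =>
    have h0' : ∀ z : E, z.1.InChart b₀ q₀ → z.1.coords (k + i) b₀ q₀ ∈
        JetCoord.truncL (Nat.le_add_right k i) ⁻¹' U → z.1.coords k b₀ q₀ ∈ U := by
      intro z hc hm
      rw [z.1.coords_trunc (Nat.le_add_right k i) hc]
      exact hm
    have h1 : RepIn (fun _ : E => (0 : EB [×i]→L[ℝ] W)) b₀ q₀ (k + i) (iterD₁ G i)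
        (JetCoord.truncL (Nat.le_add_right k i) ⁻¹' U) :=
      ⟨h.isOpen.preimage (ContinuousLinearMap.continuous _), contDiffOn_iterD₁ h.isOpen
        h.contDiffOn i, ih h0'⟩
    intro z hc hm
    have h2 : z.1.coords (k + i) b₀ q₀ ∈ JetCoord.truncL (Nat.le_add_right k i) ⁻¹' U := by
      rw [mem_preimage, ← z.1.coords_trunc _ hc]
      exact h0 z hc hm
    have h3 : totalD (iterD₁ G i) (z.1.coords (k + (i + 1)) b₀ q₀) = 0 :=
      hE.totalD_eq_zero h1 hc h2
    ext m
    change 0 = totalD (iterD₁ G i) (z.1.coords (k + (i + 1)) b₀ q₀) (m 0) (Fin.tail m)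
    rw [h3]
    rfl

/-- Two local representatives of a function have the same iterated total derivatives on `E`. -/
theorem iterD₁_eq (hE : CartanClosed E) {f : E → W} {G' : JetCoord EB EP k → W}
    {U' : Set (JetCoord EB EP k)} (h : RepIn f b₀ q₀ k G U) (h' : RepIn f b₀ q₀ k G' U')
    (hc : z.1.InChart b₀ q₀) (hm : z.1.coords k b₀ q₀ ∈ U) (hm' : z.1.coords k b₀ q₀ ∈ U') (i : ℕ) :
    iterD₁ G i (z.1.coords (k + i) b₀ q₀) = iterD₁ G' i (z.1.coords (k + i) b₀ q₀) := by
  have h1 : RepIn (fun _ : E => (0 : W)) b₀ q₀ k (fun x => G x - G' x) (U ∩ U') :=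
    ⟨h.isOpen.inter h'.isOpen, (h.contDiffOn.mono inter_subset_left).sub
      (h'.contDiffOn.mono inter_subset_right), fun z hc hm => by
        rw [← h.eq z hc hm.1, ← h'.eq z hc hm.2, sub_self]⟩
  have h2 := (hE.repIn_iterD₁ h1 i).eq z hc (by
    rw [mem_preimage, ← z.1.coords_trunc _ hc]
    exact ⟨hm, hm'⟩)
  -- Additivity of iterated total derivatives is read off along a section representing `z`, where
  -- they are ordinary iterated derivatives.
  obtain ⟨s, -, -, hs⟩ := z.1.exists_section (k + i)
  have hsm : prol k (s.expr b₀ q₀) (extChartAt IB b₀ z.1.base) ∈ U ∩ U' := by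
    have := (hs k (Nat.le_add_right k i) _ _ hc).2
    exact (show prol k (s.expr b₀ q₀) (extChartAt IB b₀ z.1.base) = _ from this) ▸ ⟨hm, hm'⟩
  have hsc := (hs k (Nat.le_add_right k i) _ _ hc).1
  have hr := s.smoothNear_expr hsc
  have e1 := (iteratedFDeriv_comp_prol₁ h1.isOpen h1.contDiffOn hr hsm i).self_of_nhds
  have e2 := (iteratedFDeriv_comp_prol₁ h.isOpen h.contDiffOn hr hsm.1 i).self_of_nhds
  have e3 := (iteratedFDeriv_comp_prol₁ h'.isOpen h'.contDiffOn hr hsm.2 i).self_of_nhds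
  have hco : prol (k + i) (s.expr b₀ q₀) (extChartAt IB b₀ z.1.base) = z.1.coords (k + i) b₀ q₀ :=
    (hs (k + i) le_rfl _ _ hc).2
  rw [hco] at e1 e2 e3
  have d2 : ContDiffAt ℝ i (fun y => G (prol k (s.expr b₀ q₀) y)) (extChartAt IB b₀ z.1.base) :=
    ((h.contDiffOn.contDiffAt (h.isOpen.mem_nhds hsm.1)).comp _
      (contDiffAt_prol k hr.contDiffAt)).of_le (by exact_mod_cast le_top)
  have d3 : ContDiffAt ℝ i (fun y => G' (prol k (s.expr b₀ q₀) y)) (extChartAt IB b₀ z.1.base) :=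
    ((h'.contDiffOn.contDiffAt (h'.isOpen.mem_nhds hsm.2)).comp _
      (contDiffAt_prol k hr.contDiffAt)).of_le (by exact_mod_cast le_top)
  rw [← sub_eq_zero, ← e2, ← e3, ← iteratedFDeriv_sub_apply d2 d3]
  rw [← h2] at e1
  exact e1

end CartanClosed

/-- `f` is a smooth function of the coordinates of order `≤ k` near `z`. -/
def SmoothOfOrderAt (k : ℕ) (f : E → W) (z : E) : Prop :=
  ∃ (G : JetCoord EB EP k → W) (U : Set (JetCoord EB EP k)),
    RepIn f z.1.base z.1.value k G U ∧ z.1.coords k z.1.base z.1.value ∈ U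

theorem isLocalRep_iff {f : E → ℝ} {z : E} {k : ℕ} {G : JetCoord EB EP k → ℝ} :
    IsLocalRep f z k G ↔
      ∃ U, RepIn f z.1.base z.1.value k G U ∧ z.1.coords k z.1.base z.1.value ∈ U :=
  ⟨fun ⟨U, h1, h2, h3, h4⟩ => ⟨U, ⟨h1, h3, h4⟩, h2⟩, fun ⟨U, h1, h2⟩ => ⟨U, h1.1, h2, h1.2, h1.3⟩⟩

theorem isSmoothOfOrder_iff {f : E → ℝ} {k : ℕ} :
    IsSmoothOfOrder k f ↔ ∀ z, SmoothOfOrderAt k f z :=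
  forall_congr' fun _ => exists_congr fun _ => isLocalRep_iff

theorem RepIn.smoothOfOrderAt {f : E → W} {z : E} {b₀ : B} {q₀ : P} {k : ℕ}
    {G : JetCoord EB EP k → W} {U : Set (JetCoord EB EP k)} (h : RepIn f b₀ q₀ k G U)
    (hc : z.1.InChart b₀ q₀) (hm : z.1.coords k b₀ q₀ ∈ U) : SmoothOfOrderAt k f z :=
  ⟨_, _, h.change z.1.base z.1.value, RepIn.change_mem hc z.1.inChart_self hm⟩

open Classical in
/-- The derivative of `f` along the Cartan plane at `z`, which is identified with the tangent space
of `B`. -/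
def cartanD (f : E → W) (z : E) : EB →L[ℝ] W :=
  if h : ∃ (k : ℕ) (G : JetCoord EB EP k → W) (U : Set (JetCoord EB EP k)),
      RepIn f z.1.base z.1.value k G U ∧ z.1.coords k z.1.base z.1.value ∈ U then
    totalD h.choose_spec.choose (z.1.coords (h.choose + 1) z.1.base z.1.value)
  else 0

namespace CartanClosed

/-- The definition selects one local representative of `f`. Another one, raised to a common order,
differs from it by a function vanishing on `E`, whose total derivative at `z` is zero because the
Cartan planes are tangent to `E`. -/
theorem cartanD_eq_self (hE : CartanClosed E) {f : E → W} {z : E} {k : ℕ}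
    {G : JetCoord EB EP k → W} {U : Set (JetCoord EB EP k)}
    (h : RepIn f z.1.base z.1.value k G U) (hm : z.1.coords k z.1.base z.1.value ∈ U) :
    cartanD f z = totalD G (z.1.coords (k + 1) z.1.base z.1.value) := by
  have hex : ∃ (k : ℕ) (G : JetCoord EB EP k → W) (U : Set (JetCoord EB EP k)),
      RepIn f z.1.base z.1.value k G U ∧ z.1.coords k z.1.base z.1.value ∈ U := ⟨k, G, U, h, hm⟩
  rw [cartanD, dif_pos hex]
  obtain ⟨U', h', hm'⟩ := hex.choose_spec.choose_spec
  have hc := z.1.inChart_self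
  generalize hex.choose_spec.choose = G' at h' hm'
  generalize hex.choose = k' at *
  have e1 : k ≤ max k k' := le_max_left _ _
  have e2 : k' ≤ max k k' := le_max_right _ _
  have a1 := h.mono e1
  have a2 := h'.mono e2
  have hm1 : z.1.coords k z.1.base z.1.value ∈ U := hm
  have hm2 : z.1.coords k' z.1.base z.1.value ∈ U' := hm'
  rw [z.1.coords_trunc e1 hc] at hm1
  rw [z.1.coords_trunc e2 hc] at hm2
  have h1 : RepIn (fun _ : E => (0 : W)) z.1.base z.1.value (max k k')
      (fun x => (G ∘ JetCoord.truncL e1) x - (G' ∘ JetCoord.truncL e2) x) _ :=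
    ⟨a1.isOpen.inter a2.isOpen, (a1.contDiffOn.mono inter_subset_left).sub
      (a2.contDiffOn.mono inter_subset_right), fun z hc hm => by
        rw [← a1.eq z hc hm.1, ← a2.eq z hc hm.2, sub_self]⟩
  have h2 := hE.totalD_eq_zero h1 hc ⟨hm1, hm2⟩
  have d1 : DifferentiableAt ℝ G (JetCoord.truncL (e1.trans (Nat.le_succ _))
      (z.1.coords (max k k' + 1) z.1.base z.1.value)) := by
    rw [← z.1.coords_trunc _ hc]
    exact h.differentiableAt hm
  have d2 : DifferentiableAt ℝ G' (JetCoord.truncL (e2.trans (Nat.le_succ _))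
      (z.1.coords (max k k' + 1) z.1.base z.1.value)) := by
    rw [← z.1.coords_trunc _ hc]
    exact h'.differentiableAt hm'
  rw [totalD_sub, totalD_comp_truncL e1 d1, totalD_comp_truncL e2 d2, ← z.1.coords_trunc _ hc,
    ← z.1.coords_trunc _ hc, sub_eq_zero] at h2
  · exact h2.symm
  · rw [← z.1.coords_trunc _ hc]
    exact a1.differentiableAt hm1
  · rw [← z.1.coords_trunc _ hc]
    exact a2.differentiableAt hm2

theorem cartanD_eq (hE : CartanClosed E) {f : E → W} {z : E} {b₀ : B} {q₀ : P} {k : ℕ}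
    {G : JetCoord EB EP k → W} {U : Set (JetCoord EB EP k)} (h : RepIn f b₀ q₀ k G U)
    (hc : z.1.InChart b₀ q₀) (hm : z.1.coords k b₀ q₀ ∈ U) :
    cartanD f z = (totalD G (z.1.coords (k + 1) b₀ q₀)).comp
      (fderiv ℝ (chartTrans IB z.1.base b₀) (extChartAt IB z.1.base z.1.base)) := by
  rw [hE.cartanD_eq_self (h.change z.1.base z.1.value) (RepIn.change_mem hc z.1.inChart_self hm)]
  exact z.1.totalD_comp_changeCoords z.1.inChart_self hc (h.differentiableAt hm)

/-- The chain rule. -/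
theorem cartanD_comp (hE : CartanClosed E) {f : E → W} {z : E} {k : ℕ} (h : SmoothOfOrderAt k f z)
    {Φ : W → W'} {O : Set W} (hO : IsOpen O) (hΦ : ContDiffOn ℝ ∞ Φ O) (hz : f z ∈ O) :
    SmoothOfOrderAt k (fun z => Φ (f z)) z ∧
      cartanD (fun z => Φ (f z)) z = (fderiv ℝ Φ (f z)).comp (cartanD f z) := by
  obtain ⟨G, U, h, hm⟩ := h
  have hc := z.1.inChart_self
  have hfz : f z = G (z.1.coords k z.1.base z.1.value) := h.eq z hc hm
  have hm' : z.1.coords k z.1.base z.1.value ∈ U ∩ G ⁻¹' O := ⟨hm, by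
    rw [mem_preimage, ← hfz]; exact hz⟩
  refine ⟨⟨_, _, h.comp hO hΦ, hm'⟩, ?_⟩
  rw [hE.cartanD_eq_self (h.comp hO hΦ) hm', hE.cartanD_eq_self h hm, totalD, totalD,
    ← z.1.coords_trunc _ hc]
  have h1 := ((hΦ.contDiffAt (hO.mem_nhds hz)).differentiableAt (by simp)).hasFDerivAt
  rw [hfz] at h1
  have h2 := (h1.comp _ (h.differentiableAt hm).hasFDerivAt).fderiv
  rw [Function.comp_def] at h2
  rw [h2, hfz, ContinuousLinearMap.comp_assoc]

theorem cartanD_prodMk (hE : CartanClosed E) {f : E → W} {g : E → W'} {z : E} {k : ℕ}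
    (hf : SmoothOfOrderAt k f z) (hg : SmoothOfOrderAt k g z) :
    SmoothOfOrderAt k (fun z => (f z, g z)) z ∧
      cartanD (fun z => (f z, g z)) z = (cartanD f z).prod (cartanD g z) := by
  obtain ⟨G, U, hf, hm⟩ := hf
  obtain ⟨H, V, hg, hm'⟩ := hg
  have hc := z.1.inChart_self
  refine ⟨⟨_, _, hf.prodMk hg, hm, hm'⟩, ?_⟩
  rw [hE.cartanD_eq_self (hf.prodMk hg) ⟨hm, hm'⟩, hE.cartanD_eq_self hf hm,
    hE.cartanD_eq_self hg hm', totalD, totalD, totalD, ← z.1.coords_trunc _ hc]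
  have h1 := ((hf.differentiableAt hm).hasFDerivAt.prodMk (hg.differentiableAt hm').hasFDerivAt).fderiv
  rw [h1]
  rfl

end CartanClosed

theorem SmoothOfOrderAt.mono {f : E → W} {z : E} {k l : ℕ} (h : SmoothOfOrderAt k f z)
    (hkl : k ≤ l) : SmoothOfOrderAt l f z := by
  obtain ⟨G, U, h, hm⟩ := h
  refine ⟨_, _, h.mono hkl, ?_⟩
  rw [mem_preimage, ← z.1.coords_trunc _ z.1.inChart_self]
  exact hm

/-- The coordinates of the points over an open subset of the base. -/
theorem RepIn.congr_base {f g : E → W} {b₀ : B} {q₀ : P} {k : ℕ} {G : JetCoord EB EP k → W}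
    {U : Set (JetCoord EB EP k)} (h : RepIn f b₀ q₀ k G U) {O : Set B} (hO : IsOpen O)
    (hfg : ∀ z : E, z.1.base ∈ O → f z = g z) :
    RepIn g b₀ q₀ k G
      (U ∩ {x | x.1 ∈ (extChartAt IB b₀).target ∩ (extChartAt IB b₀).symm ⁻¹' O}) where
  isOpen := h.isOpen.inter (((continuousOn_extChartAt_symm b₀).isOpen_inter_preimage
    (isOpen_extChartAt_target b₀) hO).preimage continuous_fst)
  contDiffOn := h.contDiffOn.mono inter_subset_left
  eq z hc hm := by
    have h1 := hm.2.2
    rw [mem_preimage, z.1.coords_fst k hc,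
      (extChartAt IB b₀).left_inv (by rw [extChartAt_source]; exact hc.1)] at h1
    rw [← hfg z h1]
    exact h.eq z hc hm.1

theorem RepIn.congr_base_mem {b₀ : B} {q₀ : P} {k : ℕ} {U : Set (JetCoord EB EP k)}
    {O : Set B} {z : InfJet IB IP fib} (hc : z.InChart b₀ q₀) (hm : z.coords k b₀ q₀ ∈ U)
    (hz : z.base ∈ O) : z.coords k b₀ q₀ ∈
      U ∩ {x | x.1 ∈ (extChartAt IB b₀).target ∩ (extChartAt IB b₀).symm ⁻¹' O} := by
  have hs : z.base ∈ (extChartAt IB b₀).source := by rw [extChartAt_source]; exact hc.1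
  refine ⟨hm, ?_, ?_⟩
  · rw [z.coords_fst k hc]
    exact (extChartAt IB b₀).map_source hs
  · rw [mem_preimage, z.coords_fst k hc, (extChartAt IB b₀).left_inv hs]
    exact hz

theorem SmoothOfOrderAt.congr_base {f g : E → W} {z : E} {k : ℕ} (h : SmoothOfOrderAt k f z)
    {O : Set B} (hO : IsOpen O) (hz : z.1.base ∈ O) (hfg : ∀ z : E, z.1.base ∈ O → f z = g z) :
    SmoothOfOrderAt k g z := by
  obtain ⟨G, U, h, hm⟩ := h
  exact ⟨_, _, h.congr_base hO hfg, RepIn.congr_base_mem z.1.inChart_self hm hz⟩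

theorem CartanClosed.cartanD_congr_base (hE : CartanClosed E) {f g : E → W} {z : E} {k : ℕ}
    (h : SmoothOfOrderAt k f z) {O : Set B} (hO : IsOpen O) (hz : z.1.base ∈ O)
    (hfg : ∀ z : E, z.1.base ∈ O → f z = g z) : cartanD f z = cartanD g z := by
  obtain ⟨G, U, h, hm⟩ := h
  rw [hE.cartanD_eq_self h hm, hE.cartanD_eq_self (h.congr_base hO hfg)
    (RepIn.congr_base_mem z.1.inChart_self hm hz)]

/-- A linear functional is the Cartan lift of `v` if and only if it is the derivative along `v`. -/
theorem CartanClosed.isCartanLift_iff (hE : CartanClosed E) (z : E) (v : TangentSpace IB z.1.base)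
    (δ : smoothFun E →ₗ[ℝ] ℝ) :
    IsCartanLift z v δ ↔ ∀ f : smoothFun E, δ f = cartanD f.1 z (show EB from v) := by
  constructor
  · intro h f
    obtain ⟨k, hk⟩ := f.2
    obtain ⟨G, hG⟩ := hk z
    obtain ⟨U, h1, h2⟩ := isLocalRep_iff.1 hG
    rw [h f k G hG, z.1.totalDeriv_eq (h1.differentiableAt h2), hE.cartanD_eq_self h1 h2]
  · intro h f k G hG
    obtain ⟨U, h1, h2⟩ := isLocalRep_iff.1 hG
    rw [h, z.1.totalDeriv_eq (h1.differentiableAt h2), hE.cartanD_eq_self h1 h2]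

end Jets

end FlatReps

end

noncomputable section

namespace FlatReps


section Jets

variable {EB HB B EP HP P EP' HP' P' W W' : Type*}
  [NormedAddCommGroup EB] [NormedSpace ℝ EB] [TopologicalSpace HB]
  [TopologicalSpace B] [ChartedSpace HB B]
  [NormedAddCommGroup EP] [NormedSpace ℝ EP] [TopologicalSpace HP]
  [TopologicalSpace P] [ChartedSpace HP P]
  [NormedAddCommGroup EP'] [NormedSpace ℝ EP'] [TopologicalSpace HP']
  [TopologicalSpace P'] [ChartedSpace HP' P']
  [NormedAddCommGroup W] [NormedSpace ℝ W] [NormedAddCommGroup W'] [NormedSpace ℝ W']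
  {IB : ModelWithCorners ℝ EB HB} {IP : ModelWithCorners ℝ EP HP} {fib : B → Set P}
  {IP' : ModelWithCorners ℝ EP' HP'} {fib' : B → Set P'}
  [IB.Boundaryless] [IsManifold IB ∞ B] [IP.Boundaryless] [IsManifold IP ∞ P]
  [IP'.Boundaryless] [IsManifold IP' ∞ P']

/-! ### Prolongations of maps -/

/-- Both sides are the derivative at `u` of `G` along the `k`-jet of the map obtained by applying
`Θ` to the jet of `r`. -/
theorem totalD_comp_prolMap {K k : ℕ} {Θ : JetCoord EB EP K → W} {U : Set (JetCoord EB EP K)}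
    (hU : IsOpen U) (hΘ : ContDiffOn ℝ ∞ Θ U) {r : EB → EP} {u : EB} (hr : SmoothNear r u)
    (hu : prol K r u ∈ U) {G : JetCoord EB W k → W'}
    (hG : DifferentiableAt ℝ G (prolMap Θ k (prol (K + k) r u))) :
    totalD (fun x => G (prolMap Θ k x)) (prol (K + k + 1) r u) =
      totalD G (prolMap Θ (k + 1) (prol (K + (k + 1)) r u)) := by
  have hmem : ∀ᶠ y in 𝓝 u, prol K r y ∈ U :=
    (contDiffAt_prol K hr.contDiffAt).continuousAt.eventually (hU.mem_nhds hu)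
  have hg : SmoothNear (fun y => Θ (prol K r y)) u := by
    filter_upwards [hmem, hr.prol K] with y h1 h2
    exact (hΘ.contDiffAt (hU.mem_nhds h1)).comp y h2
  have hd : DifferentiableAt ℝ (prolMap Θ k) (prol (K + k) r u) :=
    ((contDiffOn_prolMap hU hΘ k).contDiffAt ((hU.preimage
      (ContinuousLinearMap.continuous _)).mem_nhds hu)).differentiableAt (by simp)
  have h1 := fderiv_comp_prol (G := fun x => G (prolMap Θ k x)) (r := r) (u := u)
    (hG.comp _ hd) hr.contDiffAt
  have e : prol k (fun y => Θ (prol K r y)) u = prolMap Θ k (prol (K + k) r u) :=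
    prol_comp_prol hU hΘ hr hu k
  have h2 := fderiv_comp_prol (G := G) (r := fun y => Θ (prol K r y)) (u := u)
    (by rw [e]; exact hG) hg.contDiffAt
  rw [prol_comp_prol hU hΘ hr hu (k + 1)] at h2
  refine h1.unique (h2.congr_of_eventuallyEq ?_)
  filter_upwards [hmem, hr.eventually] with y h3 h4
  rw [prol_comp_prol hU hΘ h4 h3 k]

/-- As for `totalD_comp_prolMap`, with iterated derivatives: prolonged maps intertwine total
derivatives of every order. -/
theorem iterD₁_comp_prolMap {K k : ℕ} {Θ : JetCoord EB EP K → W} {U : Set (JetCoord EB EP K)}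
    (hU : IsOpen U) (hΘ : ContDiffOn ℝ ∞ Θ U) {r : EB → EP} {u : EB} (hr : SmoothNear r u)
    (hu : prol K r u ∈ U) {G : JetCoord EB W k → W'} {V : Set (JetCoord EB W k)} (hV : IsOpen V)
    (hG : ContDiffOn ℝ ∞ G V) (hm : prolMap Θ k (prol (K + k) r u) ∈ V) (i : ℕ) :
    iterD₁ (fun x => G (prolMap Θ k x)) i (prol (K + k + i) r u) =
      iterD₁ G i (prolMap Θ (k + i) (prol (K + (k + i)) r u)) := by
  have hmem : ∀ᶠ y in 𝓝 u, prol K r y ∈ U :=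
    (contDiffAt_prol K hr.contDiffAt).continuousAt.eventually (hU.mem_nhds hu)
  have hg : SmoothNear (fun y => Θ (prol K r y)) u := by
    filter_upwards [hmem, hr.prol K] with y h1 h2
    exact (hΘ.contDiffAt (hU.mem_nhds h1)).comp y h2
  have hU' : IsOpen (JetCoord.truncL (Nat.le_add_right K k) ⁻¹' U) :=
    hU.preimage (ContinuousLinearMap.continuous _)
  have hW := (contDiffOn_prolMap hU hΘ k).continuousOn.isOpen_inter_preimage hU' hV
  have h1 := (iteratedFDeriv_comp_prol₁ hW (G := fun x => G (prolMap Θ k x))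
    (hG.comp ((contDiffOn_prolMap hU hΘ k).mono inter_subset_left) fun _ h => h.2) hr
    (show prol (K + k) r u ∈ _ from ⟨hu, hm⟩) i).self_of_nhds
  have e : ∀ j, prol j (fun y => Θ (prol K r y)) u = prolMap Θ j (prol (K + j) r u) :=
    prol_comp_prol hU hΘ hr hu
  have h2 := (iteratedFDeriv_comp_prol₁ hV hG hg (by rw [e]; exact hm) i).self_of_nhds
  rw [e] at h2
  rw [← h1, ← h2]
  refine Filter.EventuallyEq.eq_of_nhds (Filter.EventuallyEq.iteratedFDeriv ℝ ?_ i)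
  filter_upwards [hmem, hr.eventually] with y h3 h4
  rw [prol_comp_prol hU hΘ h4 h3 k]

variable {E : Set (InfJet IB IP fib)}

/-- On the part of `E` whose coordinates in the charts around `b₀`, `q₀` are in the open set `U`,
the map `τ` takes its values in the chart around `q₁` and has the coordinate expression `Θ`. -/
structure MapRep (IP' : ModelWithCorners ℝ EP' HP') (τ : E → P') (b₀ : B) (q₀ : P) (q₁ : P') (K : ℕ)
    (Θ : JetCoord EB EP K → EP') (U : Set (JetCoord EB EP K)) : Prop where
  rep : RepIn (fun z => extChartAt IP' q₁ (τ z)) b₀ q₀ K Θ U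
  mem_source : ∀ z : E, z.1.InChart b₀ q₀ → z.1.coords K b₀ q₀ ∈ U → τ z ∈ (chartAt HP' q₁).source

/-- Off `E` a representative of `τ` is arbitrary and may leave the bundle, while a section
representing a point of `E` need not have its nearby jets in `E`. Composing with a retraction forces
values in the fibres and changes nothing on `E`. -/
theorem MapRep.exists_fib (hR : HasRetraction IB IP' fib') {τ : E → P'} {K : ℕ}
    (hfib : ∀ z : E, τ z ∈ fib' z.1.base) {z : E} {Θ : JetCoord EB EP K → EP'}
    {U : Set (JetCoord EB EP K)} (h : MapRep IP' τ z.1.base z.1.value (τ z) K Θ U)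
    (hm : z.1.coords K z.1.base z.1.value ∈ U) :
    ∃ (Θ' : JetCoord EB EP K → EP') (U' : Set (JetCoord EB EP K)),
      MapRep IP' τ z.1.base z.1.value (τ z) K Θ' U' ∧ z.1.coords K z.1.base z.1.value ∈ U' ∧
      ∀ x ∈ U', Θ' x ∈ (extChartAt IP' (τ z)).target ∧
        (extChartAt IP' (τ z)).symm (Θ' x) ∈ fib' ((extChartAt IB z.1.base).symm x.1) := by
  obtain ⟨R, O, hO, hzO, hRs, hRx⟩ := hR.exists_chart (hfib z)
    (mem_chart_source HB z.1.base) (mem_chart_source HP' (τ z))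
  have hc := z.1.inChart_self
  have hpair : ContDiffOn ℝ ∞ (fun x : JetCoord EB EP K => (x.1, Θ x)) U :=
    contDiff_fst.contDiffOn.prodMk h.rep.contDiffOn
  refine ⟨fun x => R (x.1, Θ x), U ∩ (fun x => (x.1, Θ x)) ⁻¹' O,
    ⟨⟨hpair.continuousOn.isOpen_inter_preimage h.rep.isOpen hO,
      hRs.comp (hpair.mono inter_subset_left) fun _ hx => hx.2, ?_⟩,
      fun z' hc' hm' => h.mem_source z' hc' hm'.1⟩, ⟨hm, ?_⟩, fun x hx => ?_⟩
  · intro z' hc' hm'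
    have h1 := h.rep.eq z' hc' hm'.1
    have h2 := h.mem_source z' hc' hm'.1
    rw [← extChartAt_source IP'] at h2
    have h3 : (extChartAt IB z.1.base).symm (z'.1.coords K z.1.base z.1.value).1 = z'.1.base := by
      rw [z'.1.coords_fst K hc', (extChartAt IB z.1.base).left_inv]
      rw [extChartAt_source]
      exact hc'.1
    have h4 := (hRx _ hm'.2).2.2
    dsimp only at h4 ⊢
    rw [← h1, h3, (extChartAt IP' (τ z)).left_inv h2] at h4
    rw [← h1]
    exact (h4 ((extChartAt IP' (τ z)).map_source h2) (hfib z')).symm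
  · rw [mem_preimage, z.1.coords_fst K hc, ← h.rep.eq z hc hm]
    exact hzO
  · exact ⟨(hRx _ hx.2).1, (hRx _ hx.2).2.1⟩

/-- The map `φ` to the infinite jets is the prolongation of the map `τ`. -/
structure IsProlongation (τ : E → P') (K : ℕ) (φ : E → InfJet IB IP' fib') : Prop where
  rep : ∀ z : E, ∃ (Θ : JetCoord EB EP K → EP') (U : Set (JetCoord EB EP K)),
      MapRep IP' τ z.1.base z.1.value (τ z) K Θ U ∧ z.1.coords K z.1.base z.1.value ∈ U
  base : ∀ z, (φ z).base = z.1.base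
  value : ∀ z, (φ z).value = τ z
  coords : ∀ (z : E) (b₀ : B) (q₀ : P) (q₁ : P') (Θ : JetCoord EB EP K → EP')
        (U : Set (JetCoord EB EP K)), MapRep IP' τ b₀ q₀ q₁ K Θ U → z.1.InChart b₀ q₀ →
        z.1.coords K b₀ q₀ ∈ U →
        ∀ k, (φ z).coords k b₀ q₁ = prolMap Θ k (z.1.coords (K + k) b₀ q₀)

namespace CartanClosed

variable {τ : E → P'} {K : ℕ}

/-- The coordinates of a section of the form `Θ ∘ j_K(s)` are given by the prolongation of any
coordinate expression of the map `τ` represented by `Θ`. -/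
theorem coords_eq_prolMap (hE : CartanClosed E) {z : E} {Θ : JetCoord EB EP K → EP'}
    {U : Set (JetCoord EB EP K)} (h : MapRep IP' τ z.1.base z.1.value (τ z) K Θ U)
    (hm : z.1.coords K z.1.base z.1.value ∈ U) {N : ℕ} {s : LocSec IB IP fib z.1.base}
    (hs : ∀ j ≤ N, ∀ b₀ q₀, z.1.InChart b₀ q₀ →
      s.InChart b₀ q₀ ∧ s.coords j b₀ q₀ = z.1.coords j b₀ q₀)
    {t : LocSec IB IP' fib' z.1.base} (ht : t.toFun z.1.base = τ z)
    (hts : t.expr z.1.base (τ z) =ᶠ[𝓝 (extChartAt IB z.1.base z.1.base)]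
      fun u => Θ (prol K (s.expr z.1.base z.1.value) u))
    {b₀ : B} {q₀ : P} {q₁ : P'} {Θ' : JetCoord EB EP K → EP'} {U' : Set (JetCoord EB EP K)}
    (h' : MapRep IP' τ b₀ q₀ q₁ K Θ' U') (hc : z.1.InChart b₀ q₀)
    (hm' : z.1.coords K b₀ q₀ ∈ U') {j : ℕ} (hj : K + j ≤ N) :
    t.coords j b₀ q₁ = prolMap Θ' j (z.1.coords (K + j) b₀ q₀) := by
  have hc₁ := z.1.inChart_self
  have htc : t.InChart z.1.base (τ z) := by
    rw [← ht]
    exact t.inChart_self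
  have hτz := h'.mem_source z hc hm'
  have htc' : t.InChart b₀ q₁ := ⟨hc.1, by rw [ht]; exact hτz⟩
  have hsc := (hs K (by omega) _ _ hc).1
  have hsc₁ := (hs K (by omega) _ _ hc₁).1
  have hρ : chartTrans IB b₀ z.1.base (extChartAt IB b₀ z.1.base) =
      extChartAt IB z.1.base z.1.base := chartTrans_extChartAt hc.1
  have hcont : ContinuousAt (chartTrans IB b₀ z.1.base) (extChartAt IB b₀ z.1.base) :=
    (contDiffOn_chartTrans IB b₀ z.1.base).continuousOn.continuousAt
      ((isOpen_chartDom IB b₀ z.1.base).mem_nhds (extChartAt_mem_chartDom hc.1 hc₁.1))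
  -- `Θ₁` is `Θ` transported to the charts of `Θ'`. The two represent the same function on `E`, so
  -- by `iterD₁_eq` their iterated total derivatives agree at `z`, although they may differ off `E`.
  let Θ₁ : JetCoord EB EP K → EP' := fun x => chartTrans IP' (τ z) q₁
    (Θ (changeCoords IB IP b₀ q₀ z.1.base z.1.value K x))
  have hrep₁ := (h.rep.change b₀ q₀).comp (isOpen_chartDom IP' (τ z) q₁)
    (contDiffOn_chartTrans IP' (τ z) q₁)
  have hrep : RepIn (fun z => extChartAt IP' q₁ (τ z)) b₀ q₀ K Θ₁ _ :=
    ⟨hrep₁.isOpen, hrep₁.contDiffOn, fun z' hc' hx => by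
      refine Eq.trans ?_ (hrep₁.eq z' hc' hx)
      rw [chartTrans_extChartAt]
      have h1 := z'.1.inChart_of_mem_coordDom hc' hx.1.1
      have h2 := hx.1.2
      rw [mem_preimage, z'.1.coords_change K hc' h1] at h2
      exact h.mem_source z' h1 h2⟩
  have hmem : z.1.coords K b₀ q₀ ∈ (coordDom IB IP b₀ q₀ z.1.base z.1.value K ∩
      changeCoords IB IP b₀ q₀ z.1.base z.1.value K ⁻¹' U) ∩
      (fun x => Θ (changeCoords IB IP b₀ q₀ z.1.base z.1.value K x)) ⁻¹'
        chartDom IP' (τ z) q₁ := by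
    refine ⟨RepIn.change_mem hc₁ hc hm, ?_⟩
    rw [mem_preimage, z.1.coords_change K hc hc₁, ← h.rep.eq z hc₁ hm]
    exact extChartAt_mem_chartDom (mem_chart_source _ _) hτz
  have hexpr : t.expr b₀ q₁ =ᶠ[𝓝 (extChartAt IB b₀ z.1.base)]
      fun y => Θ₁ (prol K (s.expr b₀ q₀) y) := by
    rw [← hρ] at hts
    filter_upwards [t.expr_eventuallyEq htc htc', hcont.eventually hts,
      s.eventually_prol_change K hsc hsc₁] with y h1 h2 h3
    rw [h1, h2, ← h3]
  have hsK : prol K (s.expr b₀ q₀) (extChartAt IB b₀ z.1.base) = z.1.coords K b₀ q₀ :=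
    (hs K (by omega) _ _ hc).2
  have hsN : prol (K + j) (s.expr b₀ q₀) (extChartAt IB b₀ z.1.base) =
      z.1.coords (K + j) b₀ q₀ := (hs (K + j) hj _ _ hc).2
  have h1 : t.coords j b₀ q₁ = prol j _ _ := prol_congr j hexpr
  rw [h1, prol_comp_prol hrep.isOpen hrep.contDiffOn (s.smoothNear_expr hsc)
    (by rw [hsK]; exact hmem), hsN]
  refine JetCoord.ext_comp rfl fun i hi => ?_
  change iterD₁ Θ₁ i (JetCoord.truncL _ (z.1.coords (K + j) b₀ q₀)) =
    iterD₁ Θ' i (JetCoord.truncL _ (z.1.coords (K + j) b₀ q₀))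
  rw [← z.1.coords_trunc (Nat.add_le_add_left hi K) hc]
  exact hE.iterD₁_eq hrep h'.rep hc hmem hm' i

/-- A smooth map from `E` to a bundle `fib'` over `B` extends to a map to the infinite jets of
sections of `fib'`. -/
theorem exists_prolongation (hE : CartanClosed E) (hR : HasRetraction IB IP' fib')
    (hfib : ∀ z : E, τ z ∈ fib' z.1.base)
    (hτ : ∀ z : E, ∃ (Θ : JetCoord EB EP K → EP') (U : Set (JetCoord EB EP K)),
      MapRep IP' τ z.1.base z.1.value (τ z) K Θ U ∧ z.1.coords K z.1.base z.1.value ∈ U) :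
    ∃ φ : E → InfJet IB IP' fib', IsProlongation τ K φ := by
  have key : ∀ (z : E) (k : ℕ), ∃ t : LocSec IB IP' fib' z.1.base, t.toFun z.1.base = τ z ∧
      ∀ (b₀ : B) (q₀ : P) (q₁ : P') (Θ : JetCoord EB EP K → EP')
        (U : Set (JetCoord EB EP K)), MapRep IP' τ b₀ q₀ q₁ K Θ U → z.1.InChart b₀ q₀ →
        z.1.coords K b₀ q₀ ∈ U → ∀ j ≤ k,
          t.coords j b₀ q₁ = prolMap Θ j (z.1.coords (K + j) b₀ q₀) := by
    intro z k
    have hc₁ := z.1.inChart_self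
    obtain ⟨Θ₀, U₀, h0, hm0⟩ := hτ z
    obtain ⟨Θ, U, h, hm, hΘ⟩ := h0.exists_fib hR hfib hm0
    obtain ⟨s, -, -, hs⟩ := z.1.exists_section (K + k)
    have hsK : prol K (s.expr z.1.base z.1.value) (extChartAt IB z.1.base z.1.base) =
        z.1.coords K z.1.base z.1.value := (hs K (by omega) _ _ hc₁).2
    have hr := s.smoothNear_expr (hs K (by omega) _ _ hc₁).1
    have hev : ∀ᶠ u in 𝓝 (extChartAt IB z.1.base z.1.base),
        prol K (s.expr z.1.base z.1.value) u ∈ U :=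
      (contDiffAt_prol K hr.contDiffAt).continuousAt.eventually (h.rep.isOpen.mem_nhds (by
        rw [hsK]; exact hm))
    -- A section `s` with the jet of `z` to order `K + k` determines the image jet to order `k`,
    -- because `Θ` has order `K`.
    let t : LocSec IB IP' fib' z.1.base := LocSec.ofExpr IB IP' fib' (τ z)
      (mem_chart_source HB z.1.base) (fun u => Θ (prol K (s.expr z.1.base z.1.value) u))
      (by
        filter_upwards [hev, hr.prol K] with y h1 h2
        exact (h.rep.contDiffOn.contDiffAt (h.rep.isOpen.mem_nhds h1)).comp y h2)
      (hΘ _ hev.self_of_nhds).1 (hev.mono fun u hu => (hΘ _ hu).2)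
    have ht : t.toFun z.1.base = τ z := by
      change (extChartAt IP' (τ z)).symm (Θ (prol K (s.expr z.1.base z.1.value)
        (extChartAt IB z.1.base z.1.base))) = τ z
      rw [hsK, ← h.rep.eq z hc₁ hm, (extChartAt IP' (τ z)).left_inv (mem_extChartAt_source _)]
    refine ⟨t, ht, fun b₀ q₀ q₁ Θ' U' h' hc hm' j hj => ?_⟩
    exact hE.coords_eq_prolMap h hm hs ht (LocSec.ofExpr_expr _ _ _ _ _) h' hc hm'
      (Nat.add_le_add_left hj K)
  choose t ht htc using key
  -- The sections chosen for different orders are unrelated, but their coordinates are given by the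
  -- same prolonged representative.
  have hcompat : ∀ (z : E) (k l : ℕ) (h : k ≤ l),
      Jet.trunc h ((t z l).jet l) = (t z k).jet k := by
    intro z k l hkl
    obtain ⟨Θ₀, U₀, h0, hm0⟩ := hτ z
    refine LocSec.jet_eq_of_coords_eq (s := t z l) (t := t z k) (b₀ := z.1.base) (q₀ := τ z)
      ?_ ((ht z l).trans (ht z k).symm) ?_
    · rw [← ht z l]
      exact (t z l).inChart_self
    · rw [htc z l _ _ _ _ _ h0 z.1.inChart_self hm0 k hkl,
        htc z k _ _ _ _ _ h0 z.1.inChart_self hm0 k le_rfl]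
  refine ⟨fun z => ⟨fun k => (t z k).jet k, hcompat z⟩, hτ, fun z => rfl, fun z => ?_, ?_⟩
  · exact (Jet.value_jet (t z 0)).trans (ht z 0)
  · intro z b₀ q₀ q₁ Θ U h hc hm k
    have h1 : (t z k).InChart b₀ q₁ := ⟨hc.1, by rw [ht]; exact h.mem_source z hc hm⟩
    exact (Jet.coords_jet (t z k) h1).trans (htc z k _ _ _ _ _ h hc hm k le_rfl)

end CartanClosed

section Prolongation

variable {τ : E → P'} {K : ℕ} {φ : E → InfJet IB IP' fib'}

namespace IsProlongation

/-- The pullback of a smooth function under a prolongation, and its derivatives along the Cartan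
planes. -/
theorem repIn (hφ : IsProlongation τ K φ) {E' : Set (InfJet IB IP' fib')} (hφE : ∀ z, φ z ∈ E')
    {f : E' → W} {b₀ : B} {q₀ : P} {q₁ : P'} {k : ℕ} {G : JetCoord EB EP' k → W}
    {V : Set (JetCoord EB EP' k)} (hf : RepIn f b₀ q₁ k G V) {Θ : JetCoord EB EP K → EP'}
    {U : Set (JetCoord EB EP K)} (h : MapRep IP' τ b₀ q₀ q₁ K Θ U) :
    RepIn (fun z => f ⟨φ z, hφE z⟩) b₀ q₀ (K + k) (fun x => G (prolMap Θ k x))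
      (JetCoord.truncL (Nat.le_add_right K k) ⁻¹' U ∩ prolMap Θ k ⁻¹' V) := by
  have hU : IsOpen (JetCoord.truncL (Nat.le_add_right K k) ⁻¹' U) :=
    h.rep.isOpen.preimage (ContinuousLinearMap.continuous _)
  have hs := contDiffOn_prolMap h.rep.isOpen h.rep.contDiffOn k
  refine ⟨hs.continuousOn.isOpen_inter_preimage hU hf.isOpen,
    hf.contDiffOn.comp (hs.mono inter_subset_left) fun _ hx => hx.2, fun z hc hm => ?_⟩
  have h1 := hm.1
  rw [mem_preimage, ← z.1.coords_trunc _ hc] at h1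
  have h2 := hφ.coords z _ _ _ _ _ h hc h1 k
  have h3 : (φ z).InChart b₀ q₁ := by
    refine ⟨?_, ?_⟩
    · rw [show ((φ z).jet 0).base = _ from hφ.base z]
      exact hc.1
    · rw [show ((φ z).jet 0).rep.toFun ((φ z).jet 0).base = _ from hφ.value z]
      exact h.mem_source z hc h1
  rw [← h2]
  exact hf.eq ⟨φ z, hφE z⟩ h3 (by rw [h2]; exact hm.2)

/-- A prolongation is smooth, and the derivative of a pullback along the Cartan lift of `v` is the
derivative at the image along the Cartan lift of the same `v`. In particular prolongations preserve
Cartan planes. -/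
theorem cartanD_comp (hφ : IsProlongation τ K φ) (hE : CartanClosed E)
    {E' : Set (InfJet IB IP' fib')} (hφE : ∀ z, φ z ∈ E') {f : E' → W} {z : E} {k : ℕ}
    {G : JetCoord EB EP' k → W} {V : Set (JetCoord EB EP' k)}
    (hf : RepIn f (φ z).base (φ z).value k G V)
    (hm : (φ z).coords k (φ z).base (φ z).value ∈ V) :
    SmoothOfOrderAt (K + k) (fun z => f ⟨φ z, hφE z⟩) z ∧
      cartanD (fun z => f ⟨φ z, hφE z⟩) z =
        totalD G ((φ z).coords (k + 1) (φ z).base (φ z).value) := by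
  rw [hφ.base, hφ.value] at hf hm ⊢
  obtain ⟨Θ, U, h, hmU⟩ := hφ.rep z
  have hc := z.1.inChart_self
  have hmem : z.1.coords (K + k) z.1.base z.1.value ∈
      JetCoord.truncL (Nat.le_add_right K k) ⁻¹' U ∩ prolMap Θ k ⁻¹' V := by
    refine ⟨?_, ?_⟩
    · rw [mem_preimage, ← z.1.coords_trunc _ hc]
      exact hmU
    · rw [mem_preimage, ← hφ.coords z _ _ _ _ _ h hc hmU k]
      exact hm
  have h1 := hφ.repIn hφE hf h
  refine ⟨⟨_, _, h1, hmem⟩, ?_⟩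
  rw [hE.cartanD_eq_self h1 hmem]
  obtain ⟨s, -, -, hs⟩ := z.1.exists_section (K + (k + 1))
  have hsj : ∀ j ≤ K + (k + 1), prol j (s.expr z.1.base z.1.value)
      (extChartAt IB z.1.base z.1.base) = z.1.coords j z.1.base z.1.value :=
    fun j hj => (hs j hj _ _ hc).2
  have hr := s.smoothNear_expr (hs 0 (by omega) _ _ hc).1
  have h2 := totalD_comp_prolMap (K := K) (k := k) h.rep.isOpen h.rep.contDiffOn hr
    (by rw [hsj K (by omega)]; exact hmU) (G := G)
    (by
      rw [hsj (K + k) (by omega)]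
      exact hf.differentiableAt hmem.2)
  rw [hsj (K + k + 1) (by omega), hsj (K + (k + 1)) le_rfl] at h2
  rw [h2, hφ.coords z _ _ _ _ _ h hc hmU (k + 1)]

/-- The prolongation of `τ` takes its values in an infinitely prolonged equation if its jets of
finite order satisfy the equation. -/
theorem mem_infProlong (hφ : IsProlongation τ K φ) (hE : CartanClosed E) {k : ℕ}
    {E₀ : Set (Jet IB IP' fib' k)} (h0 : ∀ z, (φ z).jet k ∈ E₀) (z : E) :
    φ z ∈ infProlong E₀ := by
  intro l
  obtain ⟨t, ht1, ht2, ht3⟩ := (φ z).exists_section (k + l)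
  refine ⟨_, t, ht2 _ le_rfl, ?_, isTangent_of_iterD_eq_zero ?_⟩
  · rw [ht2 k (by omega)]
    exact h0 z
  rw [ht1]
  intro G V hV hG hm hv i hi
  have hc' := (φ z).inChart_self
  rw [(ht3 k (by omega) _ _ hc').2] at hm
  rw [(ht3 (k + i) (by omega) _ _ hc').2]
  rw [hφ.base, hφ.value] at hm hv ⊢
  obtain ⟨Θ, U, h, hmU⟩ := hφ.rep z
  have hc := z.1.inChart_self
  rw [hφ.coords z _ _ _ _ _ h hc hmU] at hm ⊢
  obtain ⟨s, -, -, hs⟩ := z.1.exists_section (K + (k + i))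
  have hsj : ∀ j ≤ K + (k + i), prol j (s.expr z.1.base z.1.value)
      (extChartAt IB z.1.base z.1.base) = z.1.coords j z.1.base z.1.value :=
    fun j hj => (hs j hj _ _ hc).2
  have hr := s.smoothNear_expr (hs 0 (by omega) _ _ hc).1
  have h2 := iterD₁_comp_prolMap (K := K) (k := k) h.rep.isOpen h.rep.contDiffOn hr
    (by rw [hsj K (by omega)]; exact hmU) hV hG
    (by rw [hsj (K + k) (by omega)]; exact hm) i
  rw [hsj (K + k + i) (by omega), hsj (K + (k + i)) le_rfl] at h2
  rw [← h2]
  -- `E'` imposes only the original equation, which is known for `φ`. A function vanishing there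
  -- pulls back to zero on `E`, and its iterated total derivatives vanish because `E` is Cartan
  -- closed; this gives tangency of all orders.
  let E' : Set (InfJet IB IP' fib') := {z' | z'.jet k ∈ E₀}
  have hf : RepIn (fun _ : E' => (0 : ℝ)) z.1.base (τ z) k G V :=
    ⟨hV, hG, fun z' hc' hm' => (hv _ z'.2 ((z'.1.inChart_iff k).1 hc') hm').symm⟩
  have h3 := hφ.repIn (E' := E') h0 hf h
  have h4 := hE.repIn_iterD₁ h3 i
  refine (h4.eq z hc ?_).symm
  rw [mem_preimage, ← z.1.coords_trunc _ hc]
  refine ⟨?_, hm⟩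
  rw [mem_preimage, ← z.1.coords_trunc _ hc]
  exact hmU

end IsProlongation

end Prolongation

end Jets

end FlatReps

end

noncomputable section

namespace FlatReps


/-! ### Coordinates of tangent vectors -/

section TangentCoordinates

variable {EM M W : Type*} [NormedAddCommGroup EM] [NormedSpace ℝ EM] [TopologicalSpace M]
  [ChartedSpace EM M] [NormedAddCommGroup W] [NormedSpace ℝ W]

variable (EM) in
/-- The change of the coordinates of tangent vectors at `b` from the chart around `b₀` to the chart
around `b₁`. -/
def tcc (b₀ b₁ b : M) : EM →L[ℝ] EM :=
  fderiv ℝ (chartTrans 𝓘(ℝ, EM) b₀ b₁) (extChartAt 𝓘(ℝ, EM) b₀ b)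

theorem tcc_eq_coordChange [IsManifold 𝓘(ℝ, EM) 1 M] (b₀ b₁ b : M) :
    tcc EM b₀ b₁ b = tangentCoordChange 𝓘(ℝ, EM) b₀ b₁ b := by
  rw [tangentCoordChange_def, modelWithCornersSelf_coe, range_id, fderivWithin_univ]
  rfl

theorem trivializationAt_snd [IsManifold 𝓘(ℝ, EM) 1 M] (c x : M) (v : TangentSpace 𝓘(ℝ, EM) x) :
    (trivializationAt EM (TangentSpace 𝓘(ℝ, EM)) c ⟨x, v⟩).2 = tcc EM x c x v := by
  rw [tcc_eq_coordChange]
  rfl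

variable [IsManifold 𝓘(ℝ, EM) ∞ M]

theorem tcc_comp_apply {b₀ b₁ b₂ b : M} (h₀ : b ∈ (chartAt EM b₀).source)
    (h₁ : b ∈ (chartAt EM b₁).source) (h₂ : b ∈ (chartAt EM b₂).source) (v : EM) :
    tcc EM b₁ b₂ b (tcc EM b₀ b₁ b v) = tcc EM b₀ b₂ b v := by
  have : IsManifold 𝓘(ℝ, EM) 1 M := .of_le (n := ∞) (by exact_mod_cast le_top)
  simp only [tcc_eq_coordChange]
  exact tangentCoordChange_comp (by simp only [extChartAt_source]; exact ⟨⟨h₀, h₁⟩, h₂⟩)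

theorem tcc_self_apply {b₀ b : M} (h₀ : b ∈ (chartAt EM b₀).source) (v : EM) :
    tcc EM b₀ b₀ b v = v := by
  have : IsManifold 𝓘(ℝ, EM) 1 M := .of_le (n := ∞) (by exact_mod_cast le_top)
  rw [tcc_eq_coordChange]
  exact tangentCoordChange_self (by rw [extChartAt_source]; exact h₀)

theorem tcc_tcc {b₀ b₁ b : M} (h₀ : b ∈ (chartAt EM b₀).source)
    (h₁ : b ∈ (chartAt EM b₁).source) (v : EM) : tcc EM b₁ b₀ b (tcc EM b₀ b₁ b v) = v := by
  rw [tcc_comp_apply h₀ h₁ h₀, tcc_self_apply h₀]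

theorem contMDiffAt_tcc {b₀ b₁ b : M} (h₀ : b ∈ (chartAt EM b₀).source)
    (h₁ : b ∈ (chartAt EM b₁).source) :
    ContMDiffAt 𝓘(ℝ, EM) 𝓘(ℝ, EM →L[ℝ] EM) ∞ (tcc EM b₀ b₁) b := by
  have h1 : ContDiffAt ℝ ∞ (fderiv ℝ (chartTrans 𝓘(ℝ, EM) b₀ b₁)) (extChartAt 𝓘(ℝ, EM) b₀ b) :=
    ((contDiffOn_chartTrans 𝓘(ℝ, EM) b₀ b₁).contDiffAt ((isOpen_chartDom 𝓘(ℝ, EM) b₀ b₁).mem_nhds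
      (extChartAt_mem_chartDom h₀ h₁))).fderiv_right (by simp)
  exact h1.contMDiffAt.comp b (contMDiffAt_extChartAt' h₀)

theorem VF.contMDiffAt_coord (X : VF EM M) {c y : M} (hy : y ∈ (chartAt EM c).source) :
    ContMDiffAt 𝓘(ℝ, EM) 𝓘(ℝ, EM) ∞ (fun y => tcc EM y c y (X y)) y := by
  have : IsManifold 𝓘(ℝ, EM) 1 M := .of_le (n := ∞) (by exact_mod_cast le_top)
  have h := ((trivializationAt EM (TangentSpace 𝓘(ℝ, EM)) c).contMDiffAt_section_iff
    (IB := 𝓘(ℝ, EM)) (n := ∞) (s := fun y => X y) (x₀ := y) hy).1 (X.contMDiff y)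
  exact h.congr_of_eventuallyEq (Eventually.of_forall fun y' => (trivializationAt_snd c y' _).symm)

theorem contMDiffOn_section_of_coord {c : M} {O : Set M} (hO : IsOpen O)
    (hOc : O ⊆ (chartAt EM c).source) {s : ∀ y : M, TangentSpace 𝓘(ℝ, EM) y}
    (hs : ContMDiffOn 𝓘(ℝ, EM) 𝓘(ℝ, EM) ∞ (fun y => tcc EM y c y (s y)) O) :
    ContMDiffOn 𝓘(ℝ, EM) (𝓘(ℝ, EM).prod 𝓘(ℝ, EM)) ∞
      (fun y => Bundle.TotalSpace.mk' EM y (s y)) O := by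
  have : IsManifold 𝓘(ℝ, EM) 1 M := .of_le (n := ∞) (by exact_mod_cast le_top)
  refine ((trivializationAt EM (TangentSpace 𝓘(ℝ, EM)) c).contMDiffOn_section_iff
    (IB := 𝓘(ℝ, EM)) (n := ∞) (s := s) hO hOc).2 ?_
  exact hs.congr fun y _ => trivializationAt_snd c y _

variable (EM) in
/-- The derivative of a map to a vector space. -/
def mderiv (h : M → W) (x : M) : EM →L[ℝ] W := mfderiv 𝓘(ℝ, EM) 𝓘(ℝ, W) h x

theorem mderiv_eq_fderiv_self {h : M → W} {x : M}
    (hh : MDifferentiableAt 𝓘(ℝ, EM) 𝓘(ℝ, W) h x) :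
    mderiv EM h x =
      fderiv ℝ (fun u => h ((extChartAt 𝓘(ℝ, EM) x).symm u)) (extChartAt 𝓘(ℝ, EM) x x) := by
  rw [mderiv, hh.mfderiv, modelWithCornersSelf_coe, range_id, fderivWithin_univ]
  rfl

theorem mderiv_clm_comp {W' : Type*} [NormedAddCommGroup W'] [NormedSpace ℝ W'] (ℓ : W →L[ℝ] W')
    {g : M → W} {x : M} (hg : MDifferentiableAt 𝓘(ℝ, EM) 𝓘(ℝ, W) g x) :
    mderiv EM (fun x => ℓ (g x)) x = ℓ.comp (mderiv EM g x) := by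
  have h := (ℓ.hasMFDerivAt (x := g x)).comp x hg.hasMFDerivAt
  rw [Function.comp_def] at h
  exact h.mfderiv

theorem mderiv_eq_fderiv {h : M → W} {x c : M} (hh : MDifferentiableAt 𝓘(ℝ, EM) 𝓘(ℝ, W) h x)
    (hx : x ∈ (chartAt EM c).source) (v : EM) :
    mderiv EM h x v =
      fderiv ℝ (fun u => h ((extChartAt 𝓘(ℝ, EM) c).symm u)) (extChartAt 𝓘(ℝ, EM) c x)
        (tcc EM x c x v) := by
  have hm : extChartAt 𝓘(ℝ, EM) x x ∈ chartDom 𝓘(ℝ, EM) x c :=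
    extChartAt_mem_chartDom (mem_chart_source _ _) hx
  have e : chartTrans 𝓘(ℝ, EM) x c (extChartAt 𝓘(ℝ, EM) x x) = extChartAt 𝓘(ℝ, EM) c x :=
    chartTrans_extChartAt (mem_chart_source _ _)
  have hm' : extChartAt 𝓘(ℝ, EM) c x ∈ chartDom 𝓘(ℝ, EM) c x :=
    extChartAt_mem_chartDom hx (mem_chart_source _ _)
  have e' : chartTrans 𝓘(ℝ, EM) c x (extChartAt 𝓘(ℝ, EM) c x) = extChartAt 𝓘(ℝ, EM) x x :=
    chartTrans_extChartAt hx
  have h1 : DifferentiableAt ℝ (fun u => h ((extChartAt 𝓘(ℝ, EM) x).symm u))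
      (extChartAt 𝓘(ℝ, EM) x x) := by
    have h2 := hh.differentiableWithinAt_writtenInExtChartAt
    rw [modelWithCornersSelf_coe, range_id, differentiableWithinAt_univ] at h2
    exact h2
  have d1 : DifferentiableAt ℝ (chartTrans 𝓘(ℝ, EM) x c) (extChartAt 𝓘(ℝ, EM) x x) :=
    ((contDiffOn_chartTrans 𝓘(ℝ, EM) x c).contDiffAt
      ((isOpen_chartDom 𝓘(ℝ, EM) x c).mem_nhds hm)).differentiableAt (by simp)
  have d2 : DifferentiableAt ℝ (chartTrans 𝓘(ℝ, EM) c x) (extChartAt 𝓘(ℝ, EM) c x) :=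
    ((contDiffOn_chartTrans 𝓘(ℝ, EM) c x).contDiffAt
      ((isOpen_chartDom 𝓘(ℝ, EM) c x).mem_nhds hm')).differentiableAt (by simp)
  have h3 : DifferentiableAt ℝ (fun u => h ((extChartAt 𝓘(ℝ, EM) c).symm u))
      (chartTrans 𝓘(ℝ, EM) x c (extChartAt 𝓘(ℝ, EM) x x)) := by
    rw [e]
    rw [← e'] at h1
    refine (h1.comp _ d2).congr_of_eventuallyEq ?_
    filter_upwards [(isOpen_chartDom 𝓘(ℝ, EM) c x).mem_nhds hm'] with u hu
    rw [Function.comp_apply, extChartAt_symm_chartTrans hu]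
  rw [mderiv_eq_fderiv_self hh]
  have h4 := h3.hasFDerivAt.comp _ d1.hasFDerivAt
  rw [e] at h4
  have h5 : HasFDerivAt (fun u => h ((extChartAt 𝓘(ℝ, EM) x).symm u)) _
      (extChartAt 𝓘(ℝ, EM) x x) := h4.congr_of_eventuallyEq (by
    filter_upwards [(isOpen_chartDom 𝓘(ℝ, EM) x c).mem_nhds hm] with u hu
    rw [Function.comp_apply, extChartAt_symm_chartTrans hu])
  rw [h5.fderiv]
  rfl

end TangentCoordinates

/-! ### Functions and vector fields that are prescribed on a family of small sets -/

section Interpolation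

variable {EM M : Type*} [NormedAddCommGroup EM] [NormedSpace ℝ EM] [FiniteDimensional ℝ EM]
  [TopologicalSpace M] [ChartedSpace EM M]

variable (EM) in
/-- A disjoint locally finite family of closed sets that lie in the domains of charts. -/
structure ChartFamily {ι : Type*} (A : ι → Set M) (c : ι → M) : Prop where
  isClosed : ∀ i, IsClosed (A i)
  locallyFinite : LocallyFinite A
  disjoint : ∀ i j, i ≠ j → Disjoint (A i) (A j)
  subset : ∀ i, A i ⊆ (chartAt EM (c i)).source

/-- Local finiteness makes the union of those members that miss `x` closed; off it only the members
containing `x` remain, and disjointness leaves at most one. This solves the gluing problems below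
locally. -/
theorem ChartFamily.exists_nhds {ι : Type*} {A : ι → Set M} {c : ι → M} (h : ChartFamily EM A c)
    (x : M) : ∃ O, IsOpen O ∧ x ∈ O ∧
      ((∃ i, O ⊆ (chartAt EM (c i)).source ∧ ∀ j, (O ∩ A j).Nonempty → j = i) ∨
        ∀ j, ¬ (O ∩ A j).Nonempty) := by
  have h1 : IsOpen (⋃ j : {j // x ∉ A j}, A j)ᶜ :=
    ((h.locallyFinite.comp_injective Subtype.val_injective).isClosed_iUnion
      fun j => h.isClosed j.1).isOpen_compl
  have h2 : x ∈ (⋃ j : {j // x ∉ A j}, A j)ᶜ := by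
    simp
  have h3 : ∀ j, ((⋃ j : {j // x ∉ A j}, A j)ᶜ ∩ A j).Nonempty → x ∈ A j := by
    rintro j ⟨y, hy, hyj⟩
    by_contra hx
    exact hy (mem_iUnion.2 ⟨⟨j, hx⟩, hyj⟩)
  by_cases hx : ∃ i, x ∈ A i
  · obtain ⟨i, hi⟩ := hx
    refine ⟨(⋃ j : {j // x ∉ A j}, A j)ᶜ ∩ (chartAt EM (c i)).source,
      h1.inter (chartAt EM (c i)).open_source, ⟨h2, h.subset i hi⟩,
      Or.inl ⟨i, inter_subset_right, fun j hj => ?_⟩⟩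
    by_contra hij
    exact disjoint_left.1 (h.disjoint j i hij) (h3 j (hj.mono fun y hy => ⟨hy.1.1, hy.2⟩)) hi
  · exact ⟨_, h1, h2, Or.inr fun j hj => hx ⟨j, h3 j hj⟩⟩

/-- If the sequence has a cluster point, one closed neighbourhood in a chart catches a subsequence.
Otherwise the sequence leaves every compact set, and a subsequence lies in disjoint shells of a
compact exhaustion, each point with its own chart. -/
theorem exists_chartFamily [T2Space M] [SecondCountableTopology M] (p : ℕ → M) :
    ∃ (A : ℕ → Set M) (c : ℕ → M) (σ : ℕ → ℕ), ChartFamily EM A c ∧ StrictMono σ ∧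
      ∀ j, ∃ i, A i ∈ 𝓝 (p (σ j)) := by
  have : LocallyCompactSpace M := Manifold.locallyCompact_of_finiteDimensional 𝓘(ℝ, EM)
  by_cases hcl : ∃ x, MapClusterPt x atTop p
  · obtain ⟨x, hx⟩ := hcl
    obtain ⟨A, hA, hAc, hAs⟩ := exists_mem_nhds_isClosed_subset
      ((chartAt EM x).open_source.mem_nhds (mem_chart_source EM x))
    obtain ⟨σ, hσ, hσA⟩ := Filter.extraction_of_frequently_atTop
      (hx.frequently (interior_mem_nhds.2 hA))
    refine ⟨fun i => if i = 0 then A else ∅, fun _ => x, σ, ⟨fun i => ?_, fun y => ?_, ?_, ?_⟩,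
      hσ, fun j => ⟨0, mem_interior_iff_mem_nhds.1 (hσA j)⟩⟩
    · split_ifs
      exacts [hAc, isClosed_empty]
    · refine ⟨univ, univ_mem, (finite_singleton 0).subset fun i hi => ?_⟩
      by_contra h
      rw [mem_singleton_iff] at h
      simp [h] at hi
    · intro i j hij
      by_cases hi : i = 0
      · simp [show j ≠ 0 from fun h => hij (hi.trans h.symm)]
      · simp [hi]
    · intro i
      split_ifs
      exacts [hAs, empty_subset _]
  · have hcl' : ∀ x, ∃ O ∈ 𝓝 x, ∀ᶠ n in atTop, p n ∉ O := by
      intro x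
      by_contra hc
      refine hcl ⟨x, mapClusterPt_iff_frequently.2 fun O hO => ?_⟩
      by_contra hf
      exact hc ⟨O, hO, not_frequently.1 hf⟩
    let C : CompactExhaustion M := default
    have hC : Tendsto (fun n => C.find (p n)) atTop atTop := by
      refine tendsto_atTop.2 fun m => ?_
      have h1 : ∀ᶠ n in atTop, p n ∉ C m := by
        refine (C.isCompact m).induction_on (p := fun s => ∀ᶠ n in atTop, p n ∉ s)
          (Eventually.of_forall fun _ => notMem_empty _)
          (fun s t hst ht => ht.mono fun n hn h => hn (hst h))
          (fun s t hs ht => (hs.and ht).mono fun n hn h => h.elim hn.1 hn.2) fun x _ => ?_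
        obtain ⟨O, hO, h⟩ := hcl' x
        exact ⟨O, mem_nhdsWithin_of_mem_nhds hO, h⟩
      filter_upwards [h1] with n hn
      exact (not_le.1 fun h => hn (C.mem_iff_find_le.2 h)).le
    obtain ⟨σ, hσ, hσ'⟩ := strictMono_subseq_of_tendsto_atTop hC
    -- Taking every second term makes the indices in the exhaustion grow by at least two, which
    -- separates the shells; starting at the odd terms makes these indices positive, so that
    -- subtracting one below is not truncated.
    let q : ℕ → M := fun j => p (σ (2 * j + 1))
    have hq : ∀ i j, i < j → C.find (q i) + 2 ≤ C.find (q j) := by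
      intro i j hij
      have h1 : C.find (p (σ (2 * i + 1))) < C.find (p (σ (2 * i + 2))) := hσ' (by omega)
      have h2 : C.find (p (σ (2 * i + 2))) < C.find (p (σ (2 * j + 1))) := hσ' (by omega)
      change C.find (p (σ (2 * i + 1))) + 2 ≤ C.find (p (σ (2 * j + 1)))
      omega
    have hq1 : ∀ j, 1 ≤ C.find (q j) := by
      intro j
      have h1 : C.find (p (σ (2 * j))) < C.find (p (σ (2 * j + 1))) := hσ' (by omega)
      change 1 ≤ C.find (p (σ (2 * j + 1)))
      omega
    let L : ℕ → Set M := fun j => interior (C (C.find (q j) + 1)) \ C (C.find (q j) - 1)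
    have hL : ∀ j, L j ∩ (chartAt EM (q j)).source ∈ 𝓝 (q j) := by
      intro j
      refine inter_mem ((isOpen_interior.sdiff (C.isCompact _).isClosed).mem_nhds ⟨?_, ?_⟩)
        ((chartAt EM (q j)).open_source.mem_nhds (mem_chart_source EM _))
      · exact C.subset_interior_succ _ (C.mem_find _)
      · rw [C.mem_iff_find_le]
        have := hq1 j
        omega
    choose A hA hAc hAs using fun j => exists_mem_nhds_isClosed_subset (hL j)
    have hLd : ∀ i j, i < j → Disjoint (L i) (L j) := by
      intro i j hij
      refine disjoint_left.2 fun y hy hy' => hy'.2 ?_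
      have := hq i j hij
      exact C.subset (by omega) (interior_subset hy.1)
    refine ⟨A, q, fun j => σ (2 * j + 1), ⟨hAc, fun x => ?_, fun i j hij => ?_, fun i => ?_⟩,
      hσ.comp fun i j hij => by simpa using hij, fun j => ⟨j, hA j⟩⟩
    · obtain ⟨n, hn⟩ := C.exists_mem_nhds x
      refine ⟨C n, hn, (finite_Iic n).subset ?_⟩
      rintro i ⟨y, hy, hyn⟩
      have h1 := (hAs i hy).1.2
      rw [C.mem_iff_find_le] at h1
      have h2 := C.mem_iff_find_le.1 hyn
      have h3 : i ≤ C.find (q i) := by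
        have : StrictMono fun j => C.find (q j) := fun i j hij => by
          have := hq i j hij
          dsimp only
          omega
        exact this.id_le i
      rw [mem_Iic]
      omega
    · rcases lt_or_gt_of_ne hij with h | h
      · exact (hLd i j h).mono (fun y hy => (hAs i hy).1) (fun y hy => (hAs j hy).1)
      · exact ((hLd j i h).mono (fun y hy => (hAs j hy).1) (fun y hy => (hAs i hy).1)).symm
    · exact fun y hy => (hAs i hy).2

variable [IsManifold 𝓘(ℝ, EM) ∞ M] [T2Space M] [SecondCountableTopology M]

/-- The prescribed values form a convex condition at each point that is solvable locally, so a
partition of unity produces a global solution. -/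
theorem ChartFamily.exists_map {ι : Type*} {A : ι → Set M} {c : ι → M} (h : ChartFamily EM A c) :
    ∃ g : C^∞⟮𝓘(ℝ, EM), M; 𝓘(ℝ, EM), EM⟯, ∀ i, ∀ x ∈ A i, g x = extChartAt 𝓘(ℝ, EM) (c i) x := by
  have : LocallyCompactSpace M := Manifold.locallyCompact_of_finiteDimensional 𝓘(ℝ, EM)
  obtain ⟨g, hg⟩ := exists_contMDiffMap_forall_mem_convex_of_local 𝓘(ℝ, EM) (n := ⊤)
    (t := fun x => {v : EM | ∀ i, x ∈ A i → v = extChartAt 𝓘(ℝ, EM) (c i) x})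
    (fun x v hv w hw a b _ _ hab i hi => by rw [hv i hi, hw i hi, ← add_smul, hab, one_smul])
    (fun x => by
      obtain ⟨O, hO, hx, h1 | h1⟩ := h.exists_nhds x
      · obtain ⟨i, hi, hj⟩ := h1
        refine ⟨O, hO.mem_nhds hx, extChartAt 𝓘(ℝ, EM) (c i), ?_, fun y hy j hjy => ?_⟩
        · exact (contMDiffOn_extChartAt (I := 𝓘(ℝ, EM)) (n := ∞)).mono hi
        · rw [hj j ⟨y, hy, hjy⟩]
      · exact ⟨O, hO.mem_nhds hx, fun _ => 0, contMDiffOn_const, fun y hy j hjy =>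
          (h1 j ⟨y, hy, hjy⟩).elim⟩)
  exact ⟨g, fun i x hx => hg x i hx⟩

theorem ChartFamily.exists_vectorField {ι : Type*} {A : ι → Set M} {c : ι → M}
    (h : ChartFamily EM A c) (w : EM) :
    ∃ X : VF EM M, ∀ i, ∀ x ∈ A i, X x = tcc EM (c i) x x w := by
  have : LocallyCompactSpace M := Manifold.locallyCompact_of_finiteDimensional 𝓘(ℝ, EM)
  obtain ⟨g, hg⟩ := exists_contMDiffSection_forall_mem_convex_of_local 𝓘(ℝ, EM) (n := ⊤)
    (TangentSpace 𝓘(ℝ, EM) : M → Type _)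
    (fun x => {v : TangentSpace 𝓘(ℝ, EM) x | ∀ i, x ∈ A i → v = tcc EM (c i) x x w})
    (fun x v hv w hw a b _ _ hab i hi => by
      have h1 : ∀ u : EM, a • u + b • u = u := fun u => by rw [← add_smul, hab, one_smul]
      rw [hv i hi, hw i hi]
      exact h1 _)
    (fun x => by
      obtain ⟨O, hO, hx, h1 | h1⟩ := h.exists_nhds x
      · obtain ⟨i, hi, hj⟩ := h1
        refine ⟨O, hO.mem_nhds hx, fun y => tcc EM (c i) y y w, ?_, fun y hy j hjy => ?_⟩
        · refine contMDiffOn_section_of_coord hO hi ?_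
          exact (contMDiffOn_const (c := w)).congr fun y hy =>
            tcc_tcc (hi hy) (mem_chart_source _ _) w
        · rw [hj j ⟨y, hy, hjy⟩]
      · exact ⟨O, hO.mem_nhds hx, fun _ => 0,
          (Bundle.contMDiff_zeroSection ℝ (TangentSpace 𝓘(ℝ, EM) : M → Type _)).contMDiffOn,
          fun y hy j hjy => (h1 j ⟨y, hy, hjy⟩).elim⟩)
  exact ⟨g, fun i x hx => hg x i hx⟩

end Interpolation

end FlatReps

end

noncomputable section

namespace FlatReps


section Jets

variable {EB HB B EP HP P W W' : Type*}
  [NormedAddCommGroup EB] [NormedSpace ℝ EB] [TopologicalSpace HB]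
  [TopologicalSpace B] [ChartedSpace HB B]
  [NormedAddCommGroup EP] [NormedSpace ℝ EP] [TopologicalSpace HP]
  [TopologicalSpace P] [ChartedSpace HP P]
  [NormedAddCommGroup W] [NormedSpace ℝ W] [NormedAddCommGroup W'] [NormedSpace ℝ W']
  {IB : ModelWithCorners ℝ EB HB} {IP : ModelWithCorners ℝ EP HP} {fib : B → Set P}
  [IB.Boundaryless] [IsManifold IB ∞ B] [IP.Boundaryless] [IsManifold IP ∞ P]
  {E : Set (InfJet IB IP fib)}

/-! ### Operations on functions of finite order -/

theorem SmoothOfOrderAt.comp {f : E → W} {z : E} {k : ℕ} (h : SmoothOfOrderAt k f z)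
    {Φ : W → W'} {O : Set W} (hO : IsOpen O) (hΦ : ContDiffOn ℝ ∞ Φ O) (hz : f z ∈ O) :
    SmoothOfOrderAt k (fun z => Φ (f z)) z := by
  obtain ⟨G, U, h, hm⟩ := h
  refine ⟨_, _, h.comp hO hΦ, hm, ?_⟩
  rw [mem_preimage, ← h.eq z z.1.inChart_self hm]
  exact hz

theorem SmoothOfOrderAt.contDiff_comp {f : E → W} {z : E} {k : ℕ} (h : SmoothOfOrderAt k f z)
    {Φ : W → W'} (hΦ : ContDiff ℝ ∞ Φ) : SmoothOfOrderAt k (fun z => Φ (f z)) z :=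
  h.comp isOpen_univ hΦ.contDiffOn (mem_univ _)

theorem SmoothOfOrderAt.prodMk {f : E → W} {g : E → W'} {z : E} {k : ℕ}
    (hf : SmoothOfOrderAt k f z) (hg : SmoothOfOrderAt k g z) :
    SmoothOfOrderAt k (fun z => (f z, g z)) z := by
  obtain ⟨G, U, hf, hm⟩ := hf
  obtain ⟨H, V, hg, hm'⟩ := hg
  exact ⟨_, _, hf.prodMk hg, hm, hm'⟩

theorem SmoothOfOrderAt.pi {ι : Type*} [Fintype ι] {f : ι → E → W} {z : E} {k : ℕ}
    (hf : ∀ i, SmoothOfOrderAt k (f i) z) : SmoothOfOrderAt k (fun z i => f i z) z := by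
  choose G U h hm using hf
  refine ⟨fun x i => G i x, ⋂ i, U i, ⟨isOpen_iInter_of_finite fun i => (h i).isOpen,
    contDiffOn_pi.2 fun i => (h i).contDiffOn.mono (iInter_subset _ i), fun z hc hx => ?_⟩,
    mem_iInter.2 hm⟩
  funext i
  exact (h i).eq z hc (mem_iInter.1 hx i)

theorem SmoothOfOrderAt.of_base {g : B → W} {z : E} (k : ℕ)
    (hg : ∀ᶠ b in 𝓝 z.1.base, ContMDiffAt IB 𝓘(ℝ, W) ∞ g b) :
    SmoothOfOrderAt k (fun z : E => g z.1.base) z := by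
  obtain ⟨O, hO, hOo, hz⟩ := eventually_nhds_iff.1 hg
  have hO' := (continuousOn_extChartAt_symm (I := IB) z.1.base).isOpen_inter_preimage
    (isOpen_extChartAt_target z.1.base) hOo
  have h1 : ContDiffOn ℝ ∞ (fun u => g ((extChartAt IB z.1.base).symm u))
      ((extChartAt IB z.1.base).target ∩ (extChartAt IB z.1.base).symm ⁻¹' O) := fun u hu =>
    ((hO _ hu.2).comp u ((contMDiffOn_extChartAt_symm z.1.base).contMDiffAt
      ((isOpen_extChartAt_target z.1.base).mem_nhds hu.1))).contDiffAt.contDiffWithinAt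
  refine ⟨_, _, RepIn.of_base hO' h1 fun z' hc hm => ?_, ?_⟩
  · rw [(extChartAt IB z.1.base).left_inv (by rw [extChartAt_source]; exact hc.1)]
  · rw [mem_preimage, z.1.coords_fst k z.1.inChart_self]
    refine ⟨mem_extChartAt_target _, ?_⟩
    rw [mem_preimage, extChartAt_to_inv]
    exact hz

theorem CartanClosed.cartanD_base (hE : CartanClosed E) {g : B → W} {z : E}
    (hg : ∀ᶠ b in 𝓝 z.1.base, ContMDiffAt IB 𝓘(ℝ, W) ∞ g b) :
    cartanD (fun z : E => g z.1.base) z =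
      fderiv ℝ (fun u => g ((extChartAt IB z.1.base).symm u)) (extChartAt IB z.1.base z.1.base) := by
  obtain ⟨O, hO, hOo, hz⟩ := eventually_nhds_iff.1 hg
  have hO' := (continuousOn_extChartAt_symm (I := IB) z.1.base).isOpen_inter_preimage
    (isOpen_extChartAt_target z.1.base) hOo
  have h1 : ContDiffOn ℝ ∞ (fun u => g ((extChartAt IB z.1.base).symm u))
      ((extChartAt IB z.1.base).target ∩ (extChartAt IB z.1.base).symm ⁻¹' O) := fun u hu =>
    ((hO _ hu.2).comp u ((contMDiffOn_extChartAt_symm z.1.base).contMDiffAt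
      ((isOpen_extChartAt_target z.1.base).mem_nhds hu.1))).contDiffAt.contDiffWithinAt
  have hc := z.1.inChart_self
  have h2 : RepIn (fun z : E => g z.1.base) z.1.base z.1.value 0 _ _ :=
    RepIn.of_base hO' h1 fun z' hc hm => by
      rw [(extChartAt IB z.1.base).left_inv (by rw [extChartAt_source]; exact hc.1)]
  have hmem : extChartAt IB z.1.base z.1.base ∈ (extChartAt IB z.1.base).target ∩
      (extChartAt IB z.1.base).symm ⁻¹' O := by
    refine ⟨mem_extChartAt_target _, ?_⟩
    rw [mem_preimage, extChartAt_to_inv]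
    exact hz
  have hm : z.1.coords 0 z.1.base z.1.value ∈ Prod.fst ⁻¹' ((extChartAt IB z.1.base).target ∩
      (extChartAt IB z.1.base).symm ⁻¹' O) := by
    rw [mem_preimage, z.1.coords_fst 0 hc]
    exact hmem
  rw [hE.cartanD_eq_self h2 hm, totalD, ← z.1.coords_trunc (Nat.le_succ 0) hc]
  have h3 := ((h1.contDiffAt (hO'.mem_nhds hmem)).differentiableAt (by simp)).hasFDerivAt
  have h4 : HasFDerivAt (fun x : JetCoord EB EP 0 => g ((extChartAt IB z.1.base).symm x.1)) _
      (z.1.coords 0 z.1.base z.1.value) :=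
    HasFDerivAt.comp (g := fun u => g ((extChartAt IB z.1.base).symm u))
      (z.1.coords 0 z.1.base z.1.value) (by rw [z.1.coords_fst 0 hc]; exact h3) hasFDerivAt_fst
  rw [h4.fderiv]
  rfl

end Jets

/-! ### Families of linear maps of uniformly bounded order -/

section UniformOrder

variable {EN N EM M EP HP P : Type*}
  [NormedAddCommGroup EN] [NormedSpace ℝ EN] [TopologicalSpace N] [ChartedSpace EN N]
  [NormedAddCommGroup EM] [NormedSpace ℝ EM] [TopologicalSpace M] [ChartedSpace EM M]
  [NormedAddCommGroup EP] [NormedSpace ℝ EP] [TopologicalSpace HP]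
  [TopologicalSpace P] [ChartedSpace HP P] {IP : ModelWithCorners ℝ EP HP} {fib : M → Set P}
  [IP.Boundaryless] [IsManifold IP ∞ P] {E : Set (InfJet 𝓘(ℝ, EM) IP fib)}
  [IsManifold 𝓘(ℝ, EN) ∞ N] [IsManifold 𝓘(ℝ, EM) ∞ M]

/-- The coordinate expression of a family of linear maps `T_{π(x)} N → T_x M` in the charts around
`c : M` and `c' : N`. -/
def homCoord (π : C^∞⟮𝓘(ℝ, EM), M; 𝓘(ℝ, EN), N⟯) (T : E → EN →L[ℝ] EM) (c : M) (c' : N) (z : E) :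
    EN →L[ℝ] EM :=
  (tcc EM z.1.base c z.1.base).comp ((T z).comp (tcc EN c' (π z.1.base) (π z.1.base)))

theorem homCoord_eq_comp {π : C^∞⟮𝓘(ℝ, EM), M; 𝓘(ℝ, EN), N⟯} {T : E → EN →L[ℝ] EM} {c c₁ : M}
    {c' c₁' : N} {z : E} (hc : z.1.base ∈ (chartAt EM c).source)
    (hc₁ : z.1.base ∈ (chartAt EM c₁).source) (hc' : π z.1.base ∈ (chartAt EN c').source)
    (hc₁' : π z.1.base ∈ (chartAt EN c₁').source) :
    homCoord π T c₁ c₁' z =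
      (tcc EM c c₁ z.1.base).comp ((homCoord π T c c' z).comp (tcc EN c₁' c' (π z.1.base))) := by
  ext w
  change tcc EM _ _ _ (T z (tcc EN _ _ _ w)) = tcc EM _ _ _ (tcc EM _ _ _ (T z (tcc EN _ _ _
    (tcc EN _ _ _ w))))
  rw [tcc_comp_apply (mem_chart_source _ _) hc hc₁, tcc_comp_apply hc₁' hc' (mem_chart_source _ _)]

theorem SmoothOfOrderAt.homCoord_change {π : C^∞⟮𝓘(ℝ, EM), M; 𝓘(ℝ, EN), N⟯} {T : E → EN →L[ℝ] EM}
    {c c₁ : M} {c' c₁' : N} {z : E} {k : ℕ} (hc : z.1.base ∈ (chartAt EM c).source)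
    (hc₁ : z.1.base ∈ (chartAt EM c₁).source) (hc' : π z.1.base ∈ (chartAt EN c').source)
    (hc₁' : π z.1.base ∈ (chartAt EN c₁').source) {f : E → EN →L[ℝ] EM}
    (h : SmoothOfOrderAt k f z) {O : Set M} (hO : IsOpen O) (hz : z.1.base ∈ O)
    (hf : ∀ z : E, z.1.base ∈ O → f z = homCoord π T c c' z) :
    SmoothOfOrderAt k (homCoord π T c₁ c₁') z := by
  have hsrc : IsOpen ((chartAt EM c).source ∩ (chartAt EM c₁).source) :=
    (chartAt EM c).open_source.inter (chartAt EM c₁).open_source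
  have hsrc' : IsOpen (π ⁻¹' ((chartAt EN c').source ∩ (chartAt EN c₁').source)) :=
    ((chartAt EN c').open_source.inter (chartAt EN c₁').open_source).preimage π.contMDiff.continuous
  have h1 : SmoothOfOrderAt k (fun z : E => tcc EM c c₁ z.1.base) z := by
    refine SmoothOfOrderAt.of_base k ?_
    filter_upwards [hsrc.mem_nhds ⟨hc, hc₁⟩] with x hx
    exact contMDiffAt_tcc hx.1 hx.2
  have h2 : SmoothOfOrderAt k (fun z : E => tcc EN c₁' c' (π z.1.base)) z := by
    refine SmoothOfOrderAt.of_base (g := fun x => tcc EN c₁' c' (π x)) k ?_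
    filter_upwards [hsrc'.mem_nhds ⟨hc', hc₁'⟩] with x hx
    exact (contMDiffAt_tcc hx.2 hx.1).comp x (π.contMDiff x)
  have h3 := (h1.prodMk (h.prodMk h2)).contDiff_comp
    (Φ := fun p : (EM →L[ℝ] EM) × (EN →L[ℝ] EM) × (EN →L[ℝ] EN) => p.1.comp (p.2.1.comp p.2.2))
    (by fun_prop)
  refine h3.congr_base ((hO.inter hsrc).inter hsrc') ⟨⟨hz, hc, hc₁⟩, hc', hc₁'⟩ fun z' hz' => ?_
  rw [hf z' hz'.1.1, homCoord_eq_comp hz'.1.2.1 hz'.1.2.2 hz'.2.1 hz'.2.2]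

variable [FiniteDimensional ℝ EN] [FiniteDimensional ℝ EM]
  [T2Space N] [SecondCountableTopology N] [T2Space M] [SecondCountableTopology M]

/-- A family of linear maps `T_{π(x)} N → T_x M` is of finite order if all its components are. -/
theorem exists_uniform_order (π : C^∞⟮𝓘(ℝ, EM), M; 𝓘(ℝ, EN), N⟯) (T : E → EN →L[ℝ] EM)
    (hT : ∀ (h : C^∞⟮𝓘(ℝ, EM), M; 𝓘(ℝ, ℝ), ℝ⟯) (X : VF EN N), ∃ k, IsSmoothOfOrder k
      (fun z : E => mderiv EM h z.1.base (T z (X (π z.1.base))))) :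
    ∃ K, ∀ z : E, SmoothOfOrderAt K (homCoord π T z.1.base (π z.1.base)) z := by
  -- For each order `n` there is now a point `z n` where that order fails. The aim is finitely many
  -- global functions and vector fields which express `T` in coordinates near infinitely many of
  -- these points; the finitely many orders attached to them then bound the order at all those
  -- points.
  by_contra! hneg
  choose z hz using hneg
  obtain ⟨A, c, σ, hA, hσ, hAσ⟩ := exists_chartFamily (EM := EM) fun n => (z n).1.base
  -- The second subsequence is extracted from the first, so that the points are controlled in `M`
  -- and in `N` simultaneously.
  obtain ⟨A', c', σ', hA', hσ', hAσ'⟩ := exists_chartFamily (EM := EN)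
    fun n => π (z (σ n)).1.base
  obtain ⟨g, hg⟩ := hA.exists_map
  choose X hX using hA'.exists_vectorField
  let b := Module.finBasis ℝ EN
  let e := Module.finBasis ℝ EM
  let ℓ : ∀ j, EM →L[ℝ] ℝ := fun j => LinearMap.toContinuousLinearMap (e.coord j)
  let h : ∀ j, C^∞⟮𝓘(ℝ, EM), M; 𝓘(ℝ, ℝ), ℝ⟯ := fun j =>
    ⟨fun x => ℓ j (g x), (ℓ j).contMDiff.comp g.contMDiff⟩
  choose k hk using fun p : Fin (Module.finrank ℝ EN) × Fin (Module.finrank ℝ EM) =>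
    hT (h p.2) (X (b p.1))
  let K₀ := Finset.univ.sup k
  let a : Fin (Module.finrank ℝ EN) × Fin (Module.finrank ℝ EM) → E → ℝ := fun p z =>
    mderiv EM (h p.2) z.1.base (T z (X (b p.1) (π z.1.base)))
  let B : Fin (Module.finrank ℝ EN) × Fin (Module.finrank ℝ EM) → EN →L[ℝ] EM := fun p =>
    (LinearMap.toContinuousLinearMap (b.coord p.1)).smulRight (e p.2)
  -- `Λ` reassembles `T` from its scalar components. It is globally defined and of order `K₀`, and
  -- agrees with the coordinate expression of `T` wherever `g` is the chart and the fields `X` are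
  -- constant in the chart.
  let Λ : E → EN →L[ℝ] EM := fun z => ∑ p, a p z • B p
  have hΛ : ∀ z, SmoothOfOrderAt K₀ Λ z := fun z => by
    have h1 := SmoothOfOrderAt.pi (f := a) (z := z) (k := K₀) fun p =>
        (isSmoothOfOrder_iff.1 (hk p) z).mono (Finset.le_sup (Finset.mem_univ p))
    exact h1.contDiff_comp (Φ := fun a => ∑ p, a p • B p) (by fun_prop)
  have hgd : ∀ x, MDifferentiableAt 𝓘(ℝ, EM) 𝓘(ℝ, EM) g x := fun x =>
    (g.contMDiff x).mdifferentiableAt (by simp)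
  have hΛ' : ∀ (i i' : ℕ) (z : E), z.1.base ∈ interior (A i) → π z.1.base ∈ A' i' →
      Λ z = homCoord π T (c i) (c' i') z := by
    intro i i' z hx hy
    have hxc := hA.subset i (interior_subset hx)
    have h1 : ∀ v : EM, mderiv EM g z.1.base v =
        tcc EM z.1.base (c i) z.1.base v := by
      intro v
      rw [mderiv_eq_fderiv (hgd _) hxc]
      have h2 : (fun u => g ((extChartAt 𝓘(ℝ, EM) (c i)).symm u)) =ᶠ[𝓝
          (extChartAt 𝓘(ℝ, EM) (c i) z.1.base)] id := by
        filter_upwards [(LocSec.tendsto_extChartAt_symm (IB := 𝓘(ℝ, EM)) hxc).eventually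
          (isOpen_interior.mem_nhds hx), (isOpen_extChartAt_target (I := 𝓘(ℝ, EM)) (c i)).mem_nhds
          ((extChartAt 𝓘(ℝ, EM) (c i)).map_source (by rw [extChartAt_source]; exact hxc))]
          with u hu hu'
        rw [hg i _ (interior_subset hu), (extChartAt 𝓘(ℝ, EM) (c i)).right_inv hu']
        rfl
      rw [h2.fderiv_eq, fderiv_id]
      rfl
    refine ContinuousLinearMap.coe_injective (b.ext fun m => ?_)
    change Λ z (b m) = tcc EM _ _ _ (T z (tcc EN _ _ _ (b m)))
    rw [← hX (b m) i' _ hy, ← h1]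
    simp only [Λ, B, _root_.sum_apply, _root_.smul_apply, ContinuousLinearMap.smulRight_apply]
    rw [Fintype.sum_prod_type, Finset.sum_eq_single m]
    · have h3 := e.sum_repr (mderiv EM g z.1.base (T z (X (b m) (π z.1.base))))
      refine Eq.trans (Finset.sum_congr rfl fun j _ => ?_) h3
      have h4 : mderiv EM (h j) z.1.base (T z (X (b m) (π z.1.base))) =
        ℓ j (mderiv EM g z.1.base (T z (X (b m) (π z.1.base)))) :=
          congrArg (fun L : EM →L[ℝ] ℝ => L (T z (X (b m) (π z.1.base))))
            (mderiv_clm_comp (ℓ j) (hgd z.1.base))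
      simp only [a, h4]
      simp [ℓ]
    · intro m' _ hm'
      refine Finset.sum_eq_zero fun j _ => ?_
      simp [hm'.symm]
    · simp
  -- Strictly increasing sequences dominate the identity, so this bad point, chosen to violate an
  -- order that is at least `K₀`, contradicts the order of `Λ`.
  have hle : K₀ ≤ σ (σ' K₀) := (hσ'.id_le K₀).trans (hσ.id_le _)
  obtain ⟨i, hi⟩ := hAσ (σ' K₀)
  obtain ⟨i', hi'⟩ := hAσ' K₀
  refine hz (σ (σ' K₀)) (SmoothOfOrderAt.homCoord_change (c := c i) (c' := c' i')
    (hA.subset i (mem_of_mem_nhds hi)) (mem_chart_source _ _)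
    (hA'.subset i' (mem_of_mem_nhds hi')) (mem_chart_source _ _) ((hΛ _).mono hle)
    (isOpen_interior.inter (isOpen_interior.preimage π.contMDiff.continuous))
    ⟨mem_interior_iff_mem_nhds.2 hi, mem_interior_iff_mem_nhds.2 hi'⟩ fun z hz => ?_)
  exact hΛ' i i' z hz.1 (interior_subset hz.2)

end UniformOrder

end FlatReps

end

noncomputable section

namespace FlatReps


/-! ### The bundle of connections -/

section HomBundle

variable {EN N EM M : Type*}
  [NormedAddCommGroup EN] [NormedSpace ℝ EN] [TopologicalSpace N] [ChartedSpace EN N]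
  [NormedAddCommGroup EM] [NormedSpace ℝ EM] [TopologicalSpace M] [ChartedSpace EM M]
  [IsManifold 𝓘(ℝ, EN) ∞ N] [IsManifold 𝓘(ℝ, EM) ∞ M]

/-- The total space of `Hom(π^* TN, TM)`. -/
abbrev HomTotal (π : C^∞⟮𝓘(ℝ, EM), M; 𝓘(ℝ, EN), N⟯) : Type _ :=
  Bundle.TotalSpace (EN →L[ℝ] EM) (HomFib π)

variable {π : C^∞⟮𝓘(ℝ, EM), M; 𝓘(ℝ, EN), N⟯}

/-- The linear map `T_{π(x)} N → T_x M` given by a point of `Hom(π^* TN, TM)`, as a map between the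
model spaces. -/
def HomTotal.raw (q : HomTotal π) : EN →L[ℝ] EM := q.2

/-- The point of `Hom(π^* TN, TM)` given by a linear map. -/
def HomTotal.mk (x : M) (A : EN →L[ℝ] EM) : HomTotal π := ⟨x, A⟩

instance : IsManifold (homModel EN EM) ∞ (HomTotal π) := by
  have : ContMDiffVectorBundle ∞ (EN →L[ℝ] EM) (HomFib π) 𝓘(ℝ, EM) :=
    ContMDiffVectorBundle.continuousLinearMap
  exact Bundle.TotalSpace.isManifold _ _

theorem HomTotal.mem_source_iff (q₀ q : HomTotal π) :
    q ∈ (chartAt (ModelProd EM (EN →L[ℝ] EM)) q₀).source ↔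
      q.proj ∈ (chartAt EM q₀.proj).source ∧ π q.proj ∈ (chartAt EN (π q₀.proj)).source := by
  rw [FiberBundle.chartedSpace_chartAt]
  simp only [OpenPartialHomeomorph.trans_source, OpenPartialHomeomorph.prod_source, mem_inter_iff, mem_preimage]
  exact ⟨fun h => ⟨h.1.2, h.1.1⟩, fun h => ⟨⟨h.2, h.1⟩, h.1, trivial⟩⟩

/-- Makes the chart of the hom bundle explicit: conjugation by the coordinate changes of tangent
vectors, which is how `homCoord` is defined. Thus smoothness of `T` and of the map to the bundle are
the same thing. -/
theorem HomTotal.chart_apply (q₀ q : HomTotal π)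
    (h : q.proj ∈ (chartAt EM q₀.proj).source) (h' : π q.proj ∈ (chartAt EN (π q₀.proj)).source) :
    extChartAt (homModel EN EM) q₀ q = (extChartAt 𝓘(ℝ, EM) q₀.proj q.proj,
      (tcc EM q.proj q₀.proj q.proj).comp
        (q.raw.comp (tcc EN (π q₀.proj) (π q.proj) (π q.proj)))) := by
  have h1 : extChartAt (homModel EN EM) q₀ q = (extChartAt 𝓘(ℝ, EM) q₀.proj q.proj,
      (trivializationAt (EN →L[ℝ] EM) (HomFib π) q₀.proj q).2) := by
    rw [FiberBundle.extChartAt]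
    rfl
  rw [h1, hom_trivializationAt_apply]
  refine Prod.ext rfl ?_
  ext w
  change ContinuousLinearMap.inCoordinates EN (Bundle.Pullback π (TangentSpace 𝓘(ℝ, EN) : N → Type _)) EM (TangentSpace 𝓘(ℝ, EM)) q₀.proj q.proj q₀.proj q.proj q.2 w = tcc EM _ _ _ (q.2 (tcc EN _ _ _ w))
  rw [ContinuousLinearMap.inCoordinates]
  change (trivializationAt EM (TangentSpace 𝓘(ℝ, EM)) q₀.proj).continuousLinearMapAt ℝ q.proj (q.2 ((trivializationAt EN (Bundle.Pullback π (TangentSpace 𝓘(ℝ, EN) : N → Type _)) q₀.proj).symmL ℝ q.proj w)) = _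
  have : IsManifold 𝓘(ℝ, EM) 1 M := .of_le (n := ∞) (by exact_mod_cast le_top)
  have : IsManifold 𝓘(ℝ, EN) 1 N := .of_le (n := ∞) (by exact_mod_cast le_top)
  have h2 : (trivializationAt EN (Bundle.Pullback π (TangentSpace 𝓘(ℝ, EN) : N → Type _)) q₀.proj).symmL ℝ q.proj w = tcc EN (π q₀.proj) (π q.proj) (π q.proj) w := by
    let e := trivializationAt EN (Bundle.Pullback π (TangentSpace 𝓘(ℝ, EN) : N → Type _)) q₀.proj
    have hb : q.proj ∈ e.baseSet := h'
    let v : EN := tcc EN (π q₀.proj) (π q.proj) (π q.proj) w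
    have h3 : e.continuousLinearMapAt ℝ q.proj v = w := by
      rw [Bundle.Trivialization.continuousLinearMapAt_apply, e.coe_linearMapAt_of_mem hb]
      refine (trivializationAt_snd (π q₀.proj) (π q.proj) v).trans ?_
      exact tcc_tcc h' (mem_chart_source _ _) w
    exact (congrArg (e.symmL ℝ q.proj) h3).symm.trans (e.symmL_continuousLinearMapAt hb v)
  rw [h2, TangentBundle.continuousLinearMapAt_trivializationAt_eq_core h, tcc_eq_coordChange q.proj]
  rfl

theorem HomTotal.mk_raw {q : HomTotal π} {x : M} (h : q.proj = x) : HomTotal.mk x q.raw = q := by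
  subst h
  rfl

theorem HomTotal.chart_mk {q₀ : HomTotal π} {x : M} (h : x ∈ (chartAt EM q₀.proj).source)
    (h' : π x ∈ (chartAt EN (π q₀.proj)).source) (A : EN →L[ℝ] EM) :
    extChartAt (homModel EN EM) q₀ (HomTotal.mk x
      ((tcc EM q₀.proj x x).comp (A.comp (tcc EN (π x) (π q₀.proj) (π x))))) =
        (extChartAt 𝓘(ℝ, EM) q₀.proj x, A) := by
  refine (HomTotal.chart_apply q₀ _ h h').trans (Prod.ext rfl ?_)
  ext w
  change tcc EM x q₀.proj x (tcc EM q₀.proj x x (A (tcc EN (π x) (π q₀.proj) (π x)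
    (tcc EN (π q₀.proj) (π x) (π x) w)))) = A w
  rw [tcc_tcc h' (mem_chart_source _ _), tcc_tcc h (mem_chart_source _ _)]

theorem HomTotal.mk_mem_source {q₀ : HomTotal π} {x : M} (h : x ∈ (chartAt EM q₀.proj).source)
    (h' : π x ∈ (chartAt EN (π q₀.proj)).source) (A : EN →L[ℝ] EM) :
    HomTotal.mk x A ∈ (extChartAt (homModel EN EM) q₀).source := by
  rw [extChartAt_source]
  exact (HomTotal.mem_source_iff q₀ _).2 ⟨h, h'⟩

theorem HomTotal.chart_symm_apply {q₀ : HomTotal π} {x : M} (h : x ∈ (chartAt EM q₀.proj).source)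
    (h' : π x ∈ (chartAt EN (π q₀.proj)).source) (A : EN →L[ℝ] EM) :
    (extChartAt (homModel EN EM) q₀).symm (extChartAt 𝓘(ℝ, EM) q₀.proj x, A) =
      HomTotal.mk x ((tcc EM q₀.proj x x).comp (A.comp (tcc EN (π x) (π q₀.proj) (π x)))) := by
  rw [← HomTotal.chart_mk h h' A, (extChartAt (homModel EN EM) q₀).left_inv
    (HomTotal.mk_mem_source h h' _)]

theorem HomTotal.mem_target {q₀ : HomTotal π} {x : M} (h : x ∈ (chartAt EM q₀.proj).source)
    (h' : π x ∈ (chartAt EN (π q₀.proj)).source) (A : EN →L[ℝ] EM) :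
    (extChartAt 𝓘(ℝ, EM) q₀.proj x, A) ∈ (extChartAt (homModel EN EM) q₀).target := by
  rw [← HomTotal.chart_mk h h' A]
  exact (extChartAt (homModel EN EM) q₀).map_source (HomTotal.mk_mem_source h h' _)

theorem mderiv_extChartAt {c x : M} (hx : x ∈ (chartAt EM c).source) :
    mderiv EM (extChartAt 𝓘(ℝ, EM) c) x = tcc EM x c x := by
  have : IsManifold 𝓘(ℝ, EM) 1 M := .of_le (n := ∞) (by exact_mod_cast le_top)
  rw [tcc_eq_coordChange]
  exact (TangentBundle.continuousLinearMapAt_trivializationAt (I := 𝓘(ℝ, EM)) hx).symm.trans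
    (TangentBundle.continuousLinearMapAt_trivializationAt_eq_core (I := 𝓘(ℝ, EM)) hx)

/-- The differential of the projection `π`. -/
def dbase (π : C^∞⟮𝓘(ℝ, EM), M; 𝓘(ℝ, EN), N⟯) (x : M) : EM →L[ℝ] EN :=
  mfderiv 𝓘(ℝ, EM) 𝓘(ℝ, EN) π x

theorem mderiv_comp_base {W : Type*} [NormedAddCommGroup W] [NormedSpace ℝ W] {h : N → W} {x : M}
    (hh : MDifferentiableAt 𝓘(ℝ, EN) 𝓘(ℝ, W) h (π x)) :
    mderiv EM (fun x => h (π x)) x = (mderiv EN h (π x)).comp (dbase π x) :=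
  mfderiv_comp x hh ((π.contMDiff x).mdifferentiableAt (by simp))

theorem tcc_dbase {x c : M} {c' : N} (hx : x ∈ (chartAt EM c).source)
    (hx' : π x ∈ (chartAt EN c').source) (v : EM) :
    tcc EN (π x) c' (π x) (dbase π x v) =
      fderiv ℝ (fun u => extChartAt 𝓘(ℝ, EN) c' (π ((extChartAt 𝓘(ℝ, EM) c).symm u)))
        (extChartAt 𝓘(ℝ, EM) c x) (tcc EM x c x v) := by
  have h1 : MDifferentiableAt 𝓘(ℝ, EN) 𝓘(ℝ, EN) (extChartAt 𝓘(ℝ, EN) c') (π x) :=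
    (contMDiffAt_extChartAt' (n := ∞) hx').mdifferentiableAt (by simp)
  have h2 : MDifferentiableAt 𝓘(ℝ, EM) 𝓘(ℝ, EN) (fun x => extChartAt 𝓘(ℝ, EN) c' (π x)) x :=
    h1.comp x ((π.contMDiff x).mdifferentiableAt (by simp))
  rw [← mderiv_eq_fderiv h2 hx, mderiv_comp_base h1, mderiv_extChartAt hx']
  rfl

/-- The coordinate expression of the differential of `π`. -/
def baseCoord (π : C^∞⟮𝓘(ℝ, EM), M; 𝓘(ℝ, EN), N⟯) (c : M) (c' : N) (x : M) : EM →L[ℝ] EN :=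
  fderiv ℝ (fun u => extChartAt 𝓘(ℝ, EN) c' (π ((extChartAt 𝓘(ℝ, EM) c).symm u)))
        (extChartAt 𝓘(ℝ, EM) c x)

theorem contMDiffAt_baseCoord {x c : M} {c' : N} (hx : x ∈ (chartAt EM c).source)
    (hx' : π x ∈ (chartAt EN c').source) :
    ContMDiffAt 𝓘(ℝ, EM) 𝓘(ℝ, EM →L[ℝ] EN) ∞ (baseCoord π c c') x := by
  have hx₁ : x ∈ (extChartAt 𝓘(ℝ, EM) c).source := by rw [extChartAt_source]; exact hx
  have h1 : ContMDiffAt 𝓘(ℝ, EM) 𝓘(ℝ, EN) ∞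
      (fun u => extChartAt 𝓘(ℝ, EN) c' (π ((extChartAt 𝓘(ℝ, EM) c).symm u)))
        (extChartAt 𝓘(ℝ, EM) c x) := by
    have h2 : ContMDiffAt 𝓘(ℝ, EM) 𝓘(ℝ, EM) ∞ (extChartAt 𝓘(ℝ, EM) c).symm
        (extChartAt 𝓘(ℝ, EM) c x) :=
      (contMDiffOn_extChartAt_symm c).contMDiffAt ((isOpen_extChartAt_target c).mem_nhds
        ((extChartAt 𝓘(ℝ, EM) c).map_source hx₁))
    have h3 := π.contMDiff ((extChartAt 𝓘(ℝ, EM) c).symm (extChartAt 𝓘(ℝ, EM) c x))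
    have h4 : ContMDiffAt 𝓘(ℝ, EN) 𝓘(ℝ, EN) ∞ (extChartAt 𝓘(ℝ, EN) c')
        (π ((extChartAt 𝓘(ℝ, EM) c).symm (extChartAt 𝓘(ℝ, EM) c x))) := by
      rw [(extChartAt 𝓘(ℝ, EM) c).left_inv hx₁]
      exact contMDiffAt_extChartAt' hx'
    exact (h4.comp _ h3).comp _ h2
  exact (h1.contDiffAt.fderiv_right (m := ∞) (by simp)).contMDiffAt.comp x
    (contMDiffAt_extChartAt' hx)

/-- The linear maps that are right inverse to the differential of `π`, in coordinates. -/
theorem dbase_comp_iff {x c : M} {c' : N} (hx : x ∈ (chartAt EM c).source)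
    (hx' : π x ∈ (chartAt EN c').source) (A : EN →L[ℝ] EM) :
    (∀ w, dbase π x (A w) = w) ↔ ∀ w, baseCoord π c c' x
      (tcc EM x c x (A (tcc EN c' (π x) (π x) w))) = w := by
  have h1 : ∀ v, baseCoord π c c' x (tcc EM x c x v) = tcc EN (π x) c' (π x) (dbase π x v) :=
    fun v => (tcc_dbase hx hx' v).symm
  constructor
  · intro h w
    rw [h1, h, tcc_tcc hx' (mem_chart_source _ _)]
  · intro h w
    have h2 := h (tcc EN (π x) c' (π x) w)
    rw [tcc_tcc (mem_chart_source _ _) hx', h1] at h2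
    rw [← tcc_tcc (mem_chart_source _ _) hx' (dbase π x (A w)), h2,
      tcc_tcc (mem_chart_source _ _) hx']

theorem mem_connFib_iff {x : M} {q : HomTotal π} :
    q ∈ connFib π x ↔ q.proj = x ∧ ∀ w, dbase π q.proj (q.raw w) = w := Iff.rfl

/-- The bracket of vector fields in the chart around a point. -/
theorem mlieBracket_eq (V W : ∀ x : M, TangentSpace 𝓘(ℝ, EM) x) (x : M) [CompleteSpace EM] :
    (mlieBracket 𝓘(ℝ, EM) V W x : EM) =
      fderiv ℝ (fun u => tcc EM ((extChartAt 𝓘(ℝ, EM) x).symm u) x ((extChartAt 𝓘(ℝ, EM) x).symm u)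
        (W ((extChartAt 𝓘(ℝ, EM) x).symm u))) (extChartAt 𝓘(ℝ, EM) x x) (V x) -
      fderiv ℝ (fun u => tcc EM ((extChartAt 𝓘(ℝ, EM) x).symm u) x ((extChartAt 𝓘(ℝ, EM) x).symm u)
        (V ((extChartAt 𝓘(ℝ, EM) x).symm u))) (extChartAt 𝓘(ℝ, EM) x x) (W x) := by
  have h0 : IsManifold 𝓘(ℝ, EM) 1 M := .of_le (n := ∞) (by exact_mod_cast le_top)
  have hV : ∀ V : ∀ x : M, TangentSpace 𝓘(ℝ, EM) x,
      (mpullbackWithin 𝓘(ℝ, EM) 𝓘(ℝ, EM) (extChartAt 𝓘(ℝ, EM) x).symm V (range 𝓘(ℝ, EM)) :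
        EM → EM) =ᶠ[𝓝 (extChartAt 𝓘(ℝ, EM) x x)]
      fun u => tcc EM ((extChartAt 𝓘(ℝ, EM) x).symm u) x ((extChartAt 𝓘(ℝ, EM) x).symm u)
        (V ((extChartAt 𝓘(ℝ, EM) x).symm u)) := by
    intro V
    filter_upwards [(isOpen_extChartAt_target (I := 𝓘(ℝ, EM)) x).mem_nhds
      (mem_extChartAt_target x)] with u hu
    have hs : (extChartAt 𝓘(ℝ, EM) x).symm u ∈ (chartAt EM x).source := by
      rw [← extChartAt_source 𝓘(ℝ, EM)]
      exact (extChartAt 𝓘(ℝ, EM) x).map_target hu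
    rw [← mderiv_extChartAt hs, mpullbackWithin_apply, ContinuousLinearMap.inverse_eq
      (mfderivWithin_extChartAt_symm_comp_mfderiv_extChartAt hu)
      (mfderiv_extChartAt_comp_mfderivWithin_extChartAt_symm hu)]
    rfl
  rw [← mlieBracketWithin_univ, mlieBracketWithin_apply, preimage_univ, univ_inter,
    mfderiv_extChartAt_self]
  refine (congrArg (fun L : EM →L[ℝ] EM => L _) ContinuousLinearMap.inverse_id).trans ?_
  have h1 : ∀ V W : EM → EM, lieBracketWithin ℝ V W (range 𝓘(ℝ, EM)) (extChartAt 𝓘(ℝ, EM) x x) =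
      fderiv ℝ W (extChartAt 𝓘(ℝ, EM) x x) (V (extChartAt 𝓘(ℝ, EM) x x)) -
      fderiv ℝ V (extChartAt 𝓘(ℝ, EM) x x) (W (extChartAt 𝓘(ℝ, EM) x x)) := fun V W => by
    rw [modelWithCornersSelf_coe, range_id, lieBracketWithin_univ, lieBracket]
  refine (h1 _ _).trans ?_
  have h2 : ∀ (V : ∀ x : M, TangentSpace 𝓘(ℝ, EM) x) (y : M), y = x →
      tcc EM y x y (V y) = (V x : EM) := by
    rintro V y rfl
    exact tcc_self_apply (mem_chart_source _ _) _
  rw [(hV V).fderiv_eq, (hV W).fderiv_eq, (hV V).self_of_nhds, (hV W).self_of_nhds]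
  exact congrArg₂ (fun a b => fderiv ℝ _ _ a - fderiv ℝ _ _ b) (h2 V _ (extChartAt_to_inv x))
    (h2 W _ (extChartAt_to_inv x))

/-- In coordinates the fibre over `x` consists of the right inverses of a surjection `D`. With `A₀`
the coordinate of `q`, the product `D A₀` is invertible near `q`, and `B + A₀ (D A₀)⁻¹ (1 - D B)` is
a right inverse of `D` which equals `B` if `B` already is one. -/
theorem hasRetraction_connFib [CompleteSpace EN] :
    HasRetraction 𝓘(ℝ, EM) (homModel EN EM) (connFib π) := by
  intro b (q : HomTotal π) hq
  obtain ⟨rfl, hq⟩ := hq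
  let c := q.proj
  have hc : q.proj ∈ (chartAt EM c).source := mem_chart_source _ _
  have hc' : π q.proj ∈ (chartAt EN (π c)).source := mem_chart_source _ _
  let D : M → EM →L[ℝ] EN := baseCoord π c (π c)
  let A₀ : EN →L[ℝ] EM := (extChartAt (homModel EN EM) q q).2
  let Φ : M × HomTotal π → EN →L[ℝ] EM := fun x => (extChartAt (homModel EN EM) q x.2).2 +
    (A₀.comp (ContinuousLinearMap.inverse ((D x.1).comp A₀))).comp
      (ContinuousLinearMap.id ℝ EN - (D x.1).comp (extChartAt (homModel EN EM) q x.2).2)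
  let R : M × HomTotal π → HomTotal π := fun x =>
    (extChartAt (homModel EN EM) q).symm (extChartAt 𝓘(ℝ, EM) c x.1, Φ x)
  have hD₀ : (D c).comp A₀ = ContinuousLinearMap.id ℝ EN := by
    ext w
    have h1 := (dbase_comp_iff hc hc' q.raw).1 hq w
    have h2 := congrArg Prod.snd (HomTotal.chart_apply q q hc hc')
    change D c ((extChartAt (homModel EN EM) q q).2 w) = w
    rw [h2]
    exact h1
  have hDs : ∀ᶠ x in 𝓝 c, ContMDiffAt 𝓘(ℝ, EM) 𝓘(ℝ, EM →L[ℝ] EN) ∞ D x := by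
    filter_upwards [(chartAt EM c).open_source.mem_nhds hc, ((chartAt EN (π c)).open_source.preimage
      π.contMDiff.continuous).mem_nhds hc'] with x hx hx'
    exact contMDiffAt_baseCoord hx hx'
  have hinv : ∀ᶠ x in 𝓝 c, ((D x).comp A₀).IsInvertible := by
    have h1 : ContinuousAt (fun x => (D x).comp A₀) c :=
      (hDs.self_of_nhds.continuousAt).clm_comp continuousAt_const
    refine h1.eventually (p := fun L => L.IsInvertible) ?_
    beta_reduce
    rw [hD₀]
    exact (ContinuousLinearEquiv.nhds (ContinuousLinearEquiv.refl ℝ EN))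
  have hev : ∀ᶠ x : M × HomTotal π in 𝓝 (c, q), x.1 ∈ (chartAt EM c).source ∧
      π x.1 ∈ (chartAt EN (π c)).source ∧ ContMDiffAt 𝓘(ℝ, EM) 𝓘(ℝ, EM →L[ℝ] EN) ∞ D x.1 ∧
      ((D x.1).comp A₀).IsInvertible ∧ x.2 ∈ (extChartAt (homModel EN EM) q).source := by
    refine ((continuousAt_fst (p := ((c, q) : M × HomTotal π))).eventually
      (((chartAt EM c).open_source.mem_nhds hc))).and (((continuousAt_fst
      (p := ((c, q) : M × HomTotal π))).eventually (((chartAt EN (π c)).open_source.preimage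
      π.contMDiff.continuous).mem_nhds hc')).and (((continuousAt_fst
      (p := ((c, q) : M × HomTotal π))).eventually hDs).and (((continuousAt_fst
      (p := ((c, q) : M × HomTotal π))).eventually hinv).and ((continuousAt_snd
      (p := ((c, q) : M × HomTotal π))).eventually
        ((isOpen_extChartAt_source q).mem_nhds (mem_extChartAt_source q))))))
  refine ⟨R, ?_, ?_⟩
  · filter_upwards [hev] with x ⟨h1, h2, h3, h4, h5⟩
    have e1 : ContMDiffAt (𝓘(ℝ, EM).prod (homModel EN EM)) 𝓘(ℝ, EM →L[ℝ] EN) ∞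
        (fun x : M × HomTotal π => D x.1) x := h3.comp x contMDiffAt_fst
    have e2 : ContMDiffAt (𝓘(ℝ, EM).prod (homModel EN EM)) 𝓘(ℝ, EM × (EN →L[ℝ] EM)) ∞
        (fun x : M × HomTotal π => extChartAt (homModel EN EM) q x.2) x :=
      (contMDiffAt_extChartAt' (by rw [extChartAt_source] at h5; exact h5)).comp x contMDiffAt_snd
    have e3 : ContMDiffAt (𝓘(ℝ, EM).prod (homModel EN EM)) 𝓘(ℝ, EM) ∞
        (fun x : M × HomTotal π => extChartAt 𝓘(ℝ, EM) c x.1) x :=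
      (contMDiffAt_extChartAt' h1).comp x contMDiffAt_fst
    have e4 : ContDiffAt ℝ ∞ (fun p : (EM →L[ℝ] EN) × (EM × (EN →L[ℝ] EM)) => p.2.2 +
        (A₀.comp (ContinuousLinearMap.inverse (p.1.comp A₀))).comp
        (ContinuousLinearMap.id ℝ EN - p.1.comp p.2.2)) (D x.1, extChartAt (homModel EN EM) q x.2) := by
      have f1 : ContDiffAt ℝ ∞ (fun p : (EM →L[ℝ] EN) × (EM × (EN →L[ℝ] EM)) =>
          ContinuousLinearMap.inverse (p.1.comp A₀)) (D x.1, extChartAt (homModel EN EM) q x.2) := by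
        refine ContDiffAt.comp (g := ContinuousLinearMap.inverse) (f := fun
          p : (EM →L[ℝ] EN) × (EM × (EN →L[ℝ] EM)) => p.1.comp A₀) _ ?_ (by fun_prop)
        exact h4.contDiffAt_map_inverse
      fun_prop
    have e5 : ContMDiffAt (𝓘(ℝ, EM).prod (homModel EN EM)) 𝓘(ℝ, EM × (EN →L[ℝ] EM)) ∞
        (fun x => (extChartAt 𝓘(ℝ, EM) c x.1, Φ x)) x :=
      e3.prodMk_space ((e4.contMDiffAt).comp x (e1.prodMk_space e2))
    exact ((contMDiffOn_extChartAt_symm q).contMDiffAt ((isOpen_extChartAt_target q).mem_nhds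
      (HomTotal.mem_target h1 h2 _))).comp x e5
  · filter_upwards [hev] with x ⟨h1, h2, h3, h4, h5⟩
    have hR : R x = HomTotal.mk x.1 ((tcc EM q.proj x.1 x.1).comp
        ((Φ x).comp (tcc EN (π x.1) (π q.proj) (π x.1)))) := HomTotal.chart_symm_apply h1 h2 (Φ x)
    have hDΦ : ∀ w, D x.1 (Φ x w) = w := fun w => by
      have f1 : ∀ w, D x.1 (A₀ (ContinuousLinearMap.inverse ((D x.1).comp A₀) w)) = w := fun w =>
        congrArg (fun L : EN →L[ℝ] EN => L w) h4.self_comp_inverse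
      change D x.1 ((extChartAt (homModel EN EM) q x.2).2 w + A₀ (ContinuousLinearMap.inverse
        ((D x.1).comp A₀) (w - D x.1 ((extChartAt (homModel EN EM) q x.2).2 w)))) = w
      rw [map_add, f1, add_sub_cancel]
    refine ⟨?_, ?_⟩
    · rw [hR]
      refine mem_connFib_iff.2 ⟨rfl, ?_⟩
      refine (dbase_comp_iff h1 h2 _).2 fun w => ?_
      change D x.1 (tcc EM _ _ _ (tcc EM _ _ _ (Φ x (tcc EN _ _ _ (tcc EN _ _ _ w))))) = w
      rw [tcc_tcc h1 (mem_chart_source _ _), tcc_tcc h2 (mem_chart_source _ _), hDΦ]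
    · rintro ⟨hp, hx⟩
      have hpx : x.2.proj = x.1 := hp
      have h1' : x.2.proj ∈ (chartAt EM c).source := by rw [hpx]; exact h1
      have h2' : π x.2.proj ∈ (chartAt EN (π c)).source := by rw [hpx]; exact h2
      have f1 := HomTotal.chart_apply q x.2 h1' h2'
      have f2 : (D x.1).comp (extChartAt (homModel EN EM) q x.2).2 = ContinuousLinearMap.id ℝ EN := by
        ext w
        have f3 := (dbase_comp_iff h1' h2' (HomTotal.raw x.2)).1 hx w
        rw [f1, ← hpx]
        exact f3
      have f4 : Φ x = (extChartAt (homModel EN EM) q x.2).2 := by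
        change _ + _ = _
        rw [f2, sub_self, ContinuousLinearMap.comp_zero, add_zero]
      have f5 : extChartAt 𝓘(ℝ, EM) c x.1 = (extChartAt (homModel EN EM) q x.2).1 := by
        rw [f1, hpx]
      change (extChartAt (homModel EN EM) q).symm (extChartAt 𝓘(ℝ, EM) c x.1, Φ x) = x.2
      rw [f4, f5]
      exact (extChartAt (homModel EN EM) q).left_inv h5

end HomBundle

end FlatReps

end

noncomputable section

namespace FlatReps


/-! ### The equation of flat connections in coordinates -/

section FlatConnections

variable {EN N EM M : Type*}
  [NormedAddCommGroup EN] [NormedSpace ℝ EN] [TopologicalSpace N] [ChartedSpace EN N]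
  [NormedAddCommGroup EM] [NormedSpace ℝ EM] [TopologicalSpace M] [ChartedSpace EM M]
  [IsManifold 𝓘(ℝ, EN) ∞ N] [IsManifold 𝓘(ℝ, EM) ∞ M]
  {π : C^∞⟮𝓘(ℝ, EM), M; 𝓘(ℝ, EN), N⟯}

/-- The part of `M` over which the charts of `Hom(π^* TN, TM)` around the points over `c` are
defined. -/
def homDom (π : C^∞⟮𝓘(ℝ, EM), M; 𝓘(ℝ, EN), N⟯) (c : M) : Set M :=
  (chartAt EM c).source ∩ π ⁻¹' (chartAt EN (π c)).source

theorem isOpen_homDom (π : C^∞⟮𝓘(ℝ, EM), M; 𝓘(ℝ, EN), N⟯) (c : M) : IsOpen (homDom π c) :=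
  (chartAt EM c).open_source.inter ((chartAt EN (π c)).open_source.preimage π.contMDiff.continuous)

theorem mem_homDom_self (c : M) : c ∈ homDom π c := ⟨mem_chart_source _ _, mem_chart_source _ _⟩

/-- The coordinates of the vector field `X ∘ π` along `π`. -/
def pullCoord (π : C^∞⟮𝓘(ℝ, EM), M; 𝓘(ℝ, EN), N⟯) (c : M) (X : VF EN N) (x : M) : EN :=
  tcc EN (π x) (π c) (π x) (X (π x))

theorem contMDiffAt_pullCoord {c x : M} (hx : x ∈ homDom π c) (X : VF EN N) :
    ContMDiffAt 𝓘(ℝ, EM) 𝓘(ℝ, EN) ∞ (pullCoord π c X) x :=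
  (X.contMDiffAt_coord hx.2).comp x (π.contMDiff x)

/-- The coordinate expression, in the chart around `c`, of the lift of the vector field `X` by a
connection, as a function of the coordinates of the connection. -/
def fieldCoord (π : C^∞⟮𝓘(ℝ, EM), M; 𝓘(ℝ, EN), N⟯) (c : M) (X : VF EN N)
    (x : JetCoord EM (EM × (EN →L[ℝ] EM)) 0) : EM :=
  (JetCoord.val x).2 (pullCoord π c X ((extChartAt 𝓘(ℝ, EM) c).symm x.1))

variable (EM) in
/-- The open set of the coordinates of the points of a subset of `M`. -/
def coordSet (c : M) (O : Set M) : Set EM :=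
  (extChartAt 𝓘(ℝ, EM) c).target ∩ (extChartAt 𝓘(ℝ, EM) c).symm ⁻¹' O

theorem isOpen_coordSet (c : M) {O : Set M} (hO : IsOpen O) : IsOpen (coordSet EM c O) :=
  (continuousOn_extChartAt_symm (I := 𝓘(ℝ, EM)) c).isOpen_inter_preimage
    (isOpen_extChartAt_target c) hO

theorem mem_coordSet {c x : M} {O : Set M} (hx : x ∈ (chartAt EM c).source) (hO : x ∈ O) :
    extChartAt 𝓘(ℝ, EM) c x ∈ coordSet EM c O := by
  rw [← extChartAt_source 𝓘(ℝ, EM)] at hx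
  refine ⟨(extChartAt 𝓘(ℝ, EM) c).map_source hx, ?_⟩
  rw [mem_preimage, (extChartAt 𝓘(ℝ, EM) c).left_inv hx]
  exact hO

theorem contDiffOn_fieldCoord (c : M) (X : VF EN N) :
    ContDiffOn ℝ ∞ (fieldCoord π c X) (Prod.fst ⁻¹' coordSet EM c (homDom π c)) := by
  have h1 : ContDiffOn ℝ ∞ (fun u => pullCoord π c X ((extChartAt 𝓘(ℝ, EM) c).symm u))
      (coordSet EM c (homDom π c)) := fun u hu =>
    ((contMDiffAt_pullCoord hu.2 X).comp u ((contMDiffOn_extChartAt_symm c).contMDiffAt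
      ((isOpen_extChartAt_target c).mem_nhds hu.1))).contDiffAt.contDiffWithinAt
  refine ContDiffOn.clm_apply ?_ (h1.comp contDiff_fst.contDiffOn fun _ hx => hx)
  exact (contDiff_snd.comp (ContinuousLinearMap.contDiff _)).contDiffOn

theorem differentiableAt_fieldCoord {c : M} {X : VF EN N}
    {x : JetCoord EM (EM × (EN →L[ℝ] EM)) 0} (hx : x.1 ∈ coordSet EM c (homDom π c)) :
    DifferentiableAt ℝ (fieldCoord π c X) x :=
  ((contDiffOn_fieldCoord c X).contDiffAt (((isOpen_coordSet c (isOpen_homDom π c)).preimage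
    continuous_fst).mem_nhds hx)).differentiableAt (by simp)

theorem HomTotal.fieldCoord_eq {q₀ q : HomTotal π} (h : q.proj ∈ homDom π q₀.proj) (X : VF EN N)
    {x : JetCoord EM (EM × (EN →L[ℝ] EM)) 0} (h₁ : x.1 = extChartAt 𝓘(ℝ, EM) q₀.proj q.proj)
    (h₂ : JetCoord.val x = extChartAt (homModel EN EM) q₀ q) :
    fieldCoord π q₀.proj X x =
      tcc EM q.proj q₀.proj q.proj (q.raw (X (π q.proj))) := by
  have hs : q.proj ∈ (extChartAt 𝓘(ℝ, EM) q₀.proj).source := by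
    rw [extChartAt_source]
    exact h.1
  rw [fieldCoord, h₁, h₂, HomTotal.chart_apply q₀ q h.1 h.2, (extChartAt 𝓘(ℝ, EM) q₀.proj).left_inv hs]
  change tcc EM _ _ _ (q.raw (tcc EN _ _ _ (tcc EN _ _ _ (X (π q.proj))))) = _
  exact congrArg (fun w => tcc EM _ _ _ (q.raw w)) (tcc_tcc (mem_chart_source _ _) h.2 _)

abbrev ConnSec (π : C^∞⟮𝓘(ℝ, EM), M; 𝓘(ℝ, EN), N⟯) (x : M) : Type _ :=
  LocSec 𝓘(ℝ, EM) (homModel EN EM) (connFib π) x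

abbrev ConnJet (π : C^∞⟮𝓘(ℝ, EM), M; 𝓘(ℝ, EN), N⟯) (k : ℕ) : Type _ :=
  Jet 𝓘(ℝ, EM) (homModel EN EM) (connFib π) k

abbrev ConnInfJet (π : C^∞⟮𝓘(ℝ, EM), M; 𝓘(ℝ, EN), N⟯) : Type _ :=
  InfJet 𝓘(ℝ, EM) (homModel EN EM) (connFib π)

theorem ConnSec.proj_eq {x : M} (s : ConnSec π x) : (s.toFun x).proj = x :=
  s.mem_fib.self_of_nhds.1

/-- The derivative of the lift of a vector field by a local connection, in the chart around a
point. -/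
theorem ConnSec.totalD_fieldCoord {x : M} (s : ConnSec π x) (X : VF EN N) :
    totalD (fieldCoord π x X) (s.coords 1 x (s.toFun x)) =
      fderiv ℝ (fun u => tcc EM ((extChartAt 𝓘(ℝ, EM) x).symm u) x ((extChartAt 𝓘(ℝ, EM) x).symm u)
        (HomTotal.raw (s.toFun ((extChartAt 𝓘(ℝ, EM) x).symm u))
          (X (π ((extChartAt 𝓘(ℝ, EM) x).symm u))))) (extChartAt 𝓘(ℝ, EM) x x) := by
  have hx : extChartAt 𝓘(ℝ, EM) x x ∈ coordSet EM x (homDom π x) :=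
    mem_coordSet (mem_chart_source _ _) (mem_homDom_self x)
  have h1 := fderiv_comp_prol (G := fieldCoord π x X) (r := s.expr x (s.toFun x))
    (differentiableAt_fieldCoord hx) (s.smoothNear_expr s.inChart_self).contDiffAt
  refine Eq.trans h1.fderiv.symm (Filter.EventuallyEq.fderiv_eq ?_)
  have h2 := (LocSec.tendsto_extChartAt_symm (IB := 𝓘(ℝ, EM)) (mem_chart_source EM x)).eventually
    s.mem_fib
  filter_upwards [h2, (isOpen_coordSet x (isOpen_homDom π x)).mem_nhds hx] with u hu hu'
  have hp : (s.toFun ((extChartAt 𝓘(ℝ, EM) x).symm u)).proj = (extChartAt 𝓘(ℝ, EM) x).symm u := hu.1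
  have hx' := s.proj_eq
  have h3 := HomTotal.fieldCoord_eq (q₀ := s.toFun x)
    (q := s.toFun ((extChartAt 𝓘(ℝ, EM) x).symm u)) (by rw [hp, hx']; exact hu'.2) X
    (x := prol 0 (s.expr x (s.toFun x)) u) (by
      rw [hp, hx', (extChartAt 𝓘(ℝ, EM) x).right_inv hu'.1]; rfl) (val_prol _ _ _)
  rw [hx', hp] at h3
  exact h3

/-- In a chart the bracket is a difference of directional derivatives, and the derivative of a
lifted field is a total derivative of `fieldCoord`. So the bracket of lifts depends only on the
`1`-jet of the connection. -/
theorem ConnSec.mlieBracket_horLift [CompleteSpace EM] {x : M} (s : ConnSec π x)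
    {D : ∀ x : M, HomFib π x} (hD : ∀ᶠ x' in 𝓝 x, s.toFun x' = ⟨x', D x'⟩) (X Y : VF EN N) :
    (mlieBracket 𝓘(ℝ, EM) (horLift π D X) (horLift π D Y) x : EM) =
      totalD (fieldCoord π x Y) (s.coords 1 x (s.toFun x)) (HomTotal.raw (s.toFun x) (X (π x))) -
      totalD (fieldCoord π x X) (s.coords 1 x (s.toFun x))
        (HomTotal.raw (s.toFun x) (Y (π x))) := by
  have h1 : ∀ X : VF EN N, totalD (fieldCoord π x X) (s.coords 1 x (s.toFun x)) =
      fderiv ℝ (fun u => tcc EM ((extChartAt 𝓘(ℝ, EM) x).symm u) x ((extChartAt 𝓘(ℝ, EM) x).symm u)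
        (horLift π D X ((extChartAt 𝓘(ℝ, EM) x).symm u))) (extChartAt 𝓘(ℝ, EM) x x) := fun X => by
    rw [s.totalD_fieldCoord]
    refine Filter.EventuallyEq.fderiv_eq ?_
    filter_upwards [(LocSec.tendsto_extChartAt_symm (IB := 𝓘(ℝ, EM))
      (mem_chart_source EM x)).eventually hD] with u hu
    rw [hu]
    rfl
  have h2 : ∀ X : VF EN N, HomTotal.raw (s.toFun x) (X (π x)) = horLift π D X x := fun X => by
    rw [hD.self_of_nhds]
    rfl
  rw [mlieBracket_eq, h1, h1, h2, h2]

/-- The curvature of a connection, as a function of its `1`-jet. -/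
def ConnJet.curv (θ : ConnJet π 1) (X Y : VF EN N) : EM :=
  totalD (fieldCoord π θ.base Y) (θ.coords θ.base θ.value)
    (HomTotal.raw θ.value (X (π θ.base))) -
  totalD (fieldCoord π θ.base X) (θ.coords θ.base θ.value)
    (HomTotal.raw θ.value (Y (π θ.base)))

theorem ConnSec.curv_jet {x : M} (s : ConnSec π x) (X Y : VF EN N) :
    ConnJet.curv (s.jet 1) X Y =
      totalD (fieldCoord π x Y) (s.coords 1 x (s.toFun x)) (HomTotal.raw (s.toFun x) (X (π x))) -
      totalD (fieldCoord π x X) (s.coords 1 x (s.toFun x))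
        (HomTotal.raw (s.toFun x) (Y (π x))) := by
  rw [ConnJet.curv, Jet.value_jet]
  have h2 : (s.jet 1).coords x (s.toFun x) = s.coords 1 x (s.toFun x) :=
    Jet.coords_jet s s.inChart_self
  change totalD _ ((s.jet 1).coords x (s.toFun x)) _ -
    totalD _ ((s.jet 1).coords x (s.toFun x)) _ = _
  rw [h2]
  rfl

/-- Replaces the existence of a flat representative by a condition on the jet itself, valid for
whichever section represents it. -/
theorem mem_flatEq₀_iff [FiniteDimensional ℝ EN] [CompleteSpace EM] (θ : ConnJet π 1) :
    θ ∈ flatEq₀ π ↔ ∀ X Y : VF EN N,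
      ConnJet.curv θ X Y = HomTotal.raw θ.value (X.bracket Y (π θ.base)) := by
  constructor
  · rintro ⟨x, s, D, rfl, hD, hflat⟩ X Y
    rw [ConnSec.curv_jet, ← ConnSec.mlieBracket_horLift s hD, Jet.value_jet, hD.self_of_nhds]
    exact hflat X Y
  · intro h
    have hθ := Jet.rep_jet θ
    rw [← hθ] at h
    have hD : ∀ᶠ x' in 𝓝 θ.base, θ.rep.toFun x' =
        ⟨x', (HomTotal.raw (θ.rep.toFun x') : EN →L[ℝ] EM)⟩ := by
      filter_upwards [θ.rep.mem_fib] with x' hx'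
      exact (HomTotal.mk_raw hx'.1).symm
    refine ⟨θ.base, θ.rep, fun x => (HomTotal.raw (θ.rep.toFun x) : EN →L[ℝ] EM), hθ, hD,
      fun X Y => ?_⟩
    refine (ConnSec.mlieBracket_horLift θ.rep hD X Y).trans ?_
    rw [← ConnSec.curv_jet, h X Y, Jet.value_jet]
    rfl

end FlatConnections

/-! ### Infinite jets of connections -/

section ConnectionJets

variable {EN N EM M : Type*}
  [NormedAddCommGroup EN] [NormedSpace ℝ EN] [TopologicalSpace N] [ChartedSpace EN N]
  [NormedAddCommGroup EM] [NormedSpace ℝ EM] [TopologicalSpace M] [ChartedSpace EM M]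
  [IsManifold 𝓘(ℝ, EN) ∞ N] [IsManifold 𝓘(ℝ, EM) ∞ M]
  {π : C^∞⟮𝓘(ℝ, EM), M; 𝓘(ℝ, EN), N⟯}

namespace InfJet

theorem proj_value (ζ : ConnInfJet π) : ζ.value.proj = ζ.base := by
  obtain ⟨s, h1, -, -⟩ := ζ.exists_section 0
  rw [← h1]
  exact ConnSec.proj_eq s

theorem dbase_raw (ζ : ConnInfJet π) (w : EN) : dbase π ζ.base (HomTotal.raw ζ.value w) = w := by
  obtain ⟨s, h1, -, -⟩ := ζ.exists_section 0
  have h2 := (mem_connFib_iff.1 s.mem_fib.self_of_nhds).2 w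
  rwa [h1, ζ.proj_value] at h2

theorem inChart_iff_homDom (ζ : ConnInfJet π) (q₀ : HomTotal π) :
    ζ.InChart q₀.proj q₀ ↔ ζ.base ∈ homDom π q₀.proj := by
  have h : ζ.InChart q₀.proj q₀ ↔ ζ.base ∈ (chartAt EM q₀.proj).source ∧
    ζ.value ∈ (chartAt (ModelProd EM (EN →L[ℝ] EM)) q₀).source := Iff.rfl
  rw [h, HomTotal.mem_source_iff, ζ.proj_value]
  exact ⟨fun h => h.2, fun h => ⟨h.1, h⟩⟩

theorem val_coords (ζ : ConnInfJet π) {x : M} {q₀ : HomTotal π} (k : ℕ) (h : ζ.InChart x q₀) :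
    JetCoord.val (ζ.coords k x q₀) = extChartAt (homModel EN EM) q₀ ζ.value := by
  obtain ⟨s, h1, -, h3⟩ := ζ.exists_section k
  obtain ⟨h4, h5⟩ := h3 k le_rfl x q₀ h
  rw [← h5]
  change s.expr x q₀ (extChartAt 𝓘(ℝ, EM) x ζ.base) = _
  exact (s.expr_extChartAt h4.1).trans (congrArg _ h1)

theorem fieldCoord_coords (ζ : ConnInfJet π) {c : M} {q₀ : HomTotal π} (hq : q₀.proj = c)
    (h : ζ.InChart c q₀) (X : VF EN N) :
    fieldCoord π c X (ζ.coords 0 c q₀) =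
      tcc EM ζ.base c ζ.base (HomTotal.raw ζ.value (X (π ζ.base))) := by
  subst hq
  have h1 := HomTotal.fieldCoord_eq (q₀ := q₀) (q := ζ.value)
    (by rw [ζ.proj_value]; exact (ζ.inChart_iff_homDom q₀).1 h) X (x := ζ.coords 0 q₀.proj q₀)
    (by rw [ζ.proj_value]; exact ζ.coords_fst 0 h) (ζ.val_coords 0 h)
  rwa [ζ.proj_value] at h1

/-- The value at an infinite jet of a connection of the lift of a vector field. -/
def liftRaw (ζ : ConnInfJet π) (X : VF EN N) : EM := HomTotal.raw ζ.value (X (π ζ.base))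

theorem curv_jet (ζ : ConnInfJet π) (X Y : VF EN N) :
    ConnJet.curv (ζ.jet 1) X Y =
      totalD (fieldCoord π ζ.base Y) (ζ.coords 1 ζ.base ζ.value) (ζ.liftRaw X) -
      totalD (fieldCoord π ζ.base X) (ζ.coords 1 ζ.base ζ.value) (ζ.liftRaw Y) := by
  obtain ⟨s, h1, h2, h3⟩ := ζ.exists_section 1
  have h4 := ConnSec.curv_jet s X Y
  rw [h1, (h3 1 le_rfl _ _ ζ.inChart_self).2, h2 1 le_rfl] at h4
  exact h4

theorem jet_mem_flatEq₀_iff [FiniteDimensional ℝ EN] [CompleteSpace EM] (ζ : ConnInfJet π) :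
    ζ.jet 1 ∈ flatEq₀ π ↔ ∀ X Y : VF EN N,
      totalD (fieldCoord π ζ.base Y) (ζ.coords 1 ζ.base ζ.value) (ζ.liftRaw X) -
      totalD (fieldCoord π ζ.base X) (ζ.coords 1 ζ.base ζ.value) (ζ.liftRaw Y) =
        ζ.liftRaw (X.bracket Y) := by
  rw [mem_flatEq₀_iff]
  refine forall_congr' fun X => forall_congr' fun Y => ?_
  rw [curv_jet]
  obtain ⟨s, h1, h2, -⟩ := ζ.exists_section 1
  have h3 : HomTotal.raw (ζ.jet 1).value ((X.bracket Y) (π (ζ.jet 1).base)) =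
      ζ.liftRaw (X.bracket Y) := by
    rw [← h2 1 le_rfl, Jet.value_jet]
    rw [h1]
    rfl
  rw [h3]

theorem jet_one_mem [FiniteDimensional ℝ EN] {ζ : ConnInfJet π} (h : ζ ∈ flatEq π) :
    ζ.jet 1 ∈ flatEq₀ π := by
  obtain ⟨x, s, h1, h2, -⟩ := h 0
  exact h1 ▸ h2

end InfJet

end ConnectionJets

end FlatReps

end

noncomputable section

namespace FlatReps


/-! ### Second derivatives along the Cartan planes -/

section SecondDerivatives

variable {EB HB B EP HP P W : Type*}
  [NormedAddCommGroup EB] [NormedSpace ℝ EB] [TopologicalSpace HB]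
  [TopologicalSpace B] [ChartedSpace HB B]
  [NormedAddCommGroup EP] [NormedSpace ℝ EP] [TopologicalSpace HP]
  [TopologicalSpace P] [ChartedSpace HP P]
  [NormedAddCommGroup W] [NormedSpace ℝ W]
  {IB : ModelWithCorners ℝ EB HB} {IP : ModelWithCorners ℝ EP HP} {fib : B → Set P}

/-- Along a section with the given jet this is the second derivative of a smooth function, which is
symmetric. -/
theorem totalD_totalD_symm {k : ℕ} {G : JetCoord EB EP k → W} {U : Set (JetCoord EB EP k)}
    (hU : IsOpen U) (hG : ContDiffOn ℝ ∞ G U) {r : EB → EP} {u : EB} (hr : SmoothNear r u)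
    (hu : prol k r u ∈ U) (v w : EB) :
    totalD (totalD G) (prol (k + 1 + 1) r u) v w = totalD (totalD G) (prol (k + 1 + 1) r u) w v := by
  have hmem : ∀ᶠ y in 𝓝 u, prol k r y ∈ U :=
    (contDiffAt_prol k hr.contDiffAt).continuousAt.eventually (hU.mem_nhds hu)
  have hd : ∀ x ∈ U, DifferentiableAt ℝ G x := fun x hx =>
    (hG.contDiffAt (hU.mem_nhds hx)).differentiableAt (by simp)
  have h1 : (fun y => totalD G (prol (k + 1) r y)) =ᶠ[𝓝 u] fderiv ℝ (fun y => G (prol k r y)) := by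
    filter_upwards [hmem, hr] with y h1 h2
    exact (fderiv_comp_prol (hd _ h1) h2).fderiv.symm
  have h2 : DifferentiableAt ℝ (totalD G) (prol (k + 1) r u) :=
    ((contDiffOn_totalD hU hG).contDiffAt ((hU.preimage
      (JetCoord.truncL (Nat.le_succ k)).continuous).mem_nhds hu)).differentiableAt (by simp)
  have h3 := (fderiv_comp_prol h2 hr.contDiffAt).fderiv
  rw [← h3, h1.fderiv_eq]
  have h4 : ContDiffAt ℝ ∞ (fun y => G (prol k r y)) u :=
    (hG.contDiffAt (hU.mem_nhds hu)).comp u (contDiffAt_prol k hr.contDiffAt)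
  exact (h4.isSymmSndFDerivAt (by
    rw [minSmoothness_of_isRCLikeNormedField]; exact ENat.LEInfty.out)).eq v w

theorem InfJet.totalD_totalD_symm [IB.Boundaryless] [IsManifold IB ∞ B] [IP.Boundaryless] [IsManifold IP ∞ P]
    (z : InfJet IB IP fib) {b₀ : B} {q₀ : P} {k : ℕ} {G : JetCoord EB EP k → W}
    {U : Set (JetCoord EB EP k)} (hU : IsOpen U) (hG : ContDiffOn ℝ ∞ G U) (hc : z.InChart b₀ q₀)
    (hm : z.coords k b₀ q₀ ∈ U) (v w : EB) :
    totalD (totalD G) (z.coords (k + 1 + 1) b₀ q₀) v w =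
      totalD (totalD G) (z.coords (k + 1 + 1) b₀ q₀) w v := by
  obtain ⟨s, -, -, hs⟩ := z.exists_section (k + 1 + 1)
  have h1 := hs (k + 1 + 1) le_rfl _ _ hc
  have h2 := hs k (by omega) _ _ hc
  rw [← h2.2] at hm
  rw [← h1.2]
  exact FlatReps.totalD_totalD_symm hU hG (s.smoothNear_expr h1.1) hm v w

end SecondDerivatives

/-! ### Cartan derivatives in a fixed chart -/

section CartanDerivatives

variable {EM M EP HP P W W' W'' : Type*}
  [NormedAddCommGroup EM] [NormedSpace ℝ EM] [TopologicalSpace M] [ChartedSpace EM M]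
  [NormedAddCommGroup EP] [NormedSpace ℝ EP] [TopologicalSpace HP]
  [TopologicalSpace P] [ChartedSpace HP P] {IP : ModelWithCorners ℝ EP HP} {fib : M → Set P}
  [IP.Boundaryless] [IsManifold IP ∞ P] {E : Set (InfJet 𝓘(ℝ, EM) IP fib)}
  [IsManifold 𝓘(ℝ, EM) ∞ M]
  [NormedAddCommGroup W] [NormedSpace ℝ W] [NormedAddCommGroup W'] [NormedSpace ℝ W']
  [NormedAddCommGroup W''] [NormedSpace ℝ W'']

/-- The derivative along the Cartan plane, in the chart around `c`. -/
def cartanIn (f : E → W) (c : M) (z : E) : EM →L[ℝ] W :=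
  (cartanD f z).comp (tcc EM c z.1.base z.1.base)

theorem cartanIn_self (f : E → W) (z : E) : cartanIn f z.1.base z = cartanD f z := by
  ext v
  exact congrArg (cartanD f z) (tcc_self_apply (mem_chart_source _ _) v)

theorem cartanD_apply_eq (f : E → W) {c : M} {z : E} (hc : z.1.base ∈ (chartAt EM c).source)
    (v : EM) : cartanD f z v = cartanIn f c z (tcc EM z.1.base c z.1.base v) :=
  congrArg (cartanD f z) (tcc_tcc (mem_chart_source _ _) hc v).symm

namespace CartanClosed

/-- `cartanD` refers to the chart at the base point of `z`, which jumps with `z`. With the chart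
held at `c`, the derivative is represented by `totalD G` and can be differentiated again. -/
theorem repIn_cartanIn (hE : CartanClosed E) {f : E → W} {c : M} {q₀ : P} {k : ℕ}
    {G : JetCoord EM EP k → W} {U : Set (JetCoord EM EP k)} (h : RepIn f c q₀ k G U) :
    RepIn (cartanIn f c) c q₀ (k + 1) (totalD G) (JetCoord.truncL (Nat.le_succ k) ⁻¹' U) where
  isOpen := h.isOpen.preimage (JetCoord.truncL (Nat.le_succ k)).continuous
  contDiffOn := contDiffOn_totalD h.isOpen h.contDiffOn
  eq z hc hm := by
    rw [mem_preimage, ← z.1.coords_trunc _ hc] at hm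
    ext v
    rw [cartanIn, hE.cartanD_eq h hc hm]
    exact congrArg (totalD G _) (tcc_tcc hc.1 (mem_chart_source _ _) v)

theorem smoothOfOrderAt_cartanIn (hE : CartanClosed E) {f : E → W} {z : E} {k : ℕ}
    (h : SmoothOfOrderAt k f z) : SmoothOfOrderAt (k + 1) (cartanIn f z.1.base) z := by
  obtain ⟨G, U, h, hm⟩ := h
  refine ⟨_, _, hE.repIn_cartanIn h, ?_⟩
  rw [mem_preimage, ← z.1.coords_trunc _ z.1.inChart_self]
  exact hm

/-- This symmetry is the integrability of the Cartan distribution: coordinate fields on the base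
have commuting Cartan lifts. -/
theorem cartanD_cartanIn_symm (hE : CartanClosed E) {f : E → W} {z : E} {k : ℕ}
    (h : SmoothOfOrderAt k f z) (v w : EM) :
    cartanD (cartanIn f z.1.base) z v w = cartanD (cartanIn f z.1.base) z w v := by
  obtain ⟨G, U, h, hm⟩ := h
  have hm' : z.1.coords (k + 1) z.1.base z.1.value ∈ JetCoord.truncL (Nat.le_succ k) ⁻¹' U := by
    rw [mem_preimage, ← z.1.coords_trunc _ z.1.inChart_self]
    exact hm
  rw [hE.cartanD_eq_self (hE.repIn_cartanIn h) hm']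
  exact z.1.totalD_totalD_symm h.isOpen h.contDiffOn z.1.inChart_self hm v w

theorem cartanD_bilin (hE : CartanClosed E) {f : E → W} {g : E → W'} {z : E} {k : ℕ}
    (hf : SmoothOfOrderAt k f z) (hg : SmoothOfOrderAt k g z) (β : W →L[ℝ] W' →L[ℝ] W'') (v : EM) :
    SmoothOfOrderAt k (fun z => β (f z) (g z)) z ∧ cartanD (fun z => β (f z) (g z)) z v =
      β (f z) (cartanD g z v) + β (cartanD f z v) (g z) := by
  obtain ⟨h1, h2⟩ := hE.cartanD_prodMk hf hg
  have h3 : ContDiff ℝ ∞ (fun p : W × W' => β p.1 p.2) := β.isBoundedBilinearMap.contDiff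
  obtain ⟨h4, h5⟩ := hE.cartanD_comp h1 isOpen_univ h3.contDiffOn (mem_univ _)
  refine ⟨h4, ?_⟩
  have h6 : HasFDerivAt (fun p : W × W' => β p.1 p.2) _ (f z, g z) :=
    β.isBoundedBilinearMap.hasFDerivAt (f z, g z)
  rw [h5, h2, h6.fderiv]
  rfl

theorem cartanD_clm (hE : CartanClosed E) {f : E → W} {z : E} {k : ℕ}
    (hf : SmoothOfOrderAt k f z) (ℓ : W →L[ℝ] W') :
    cartanD (fun z => ℓ (f z)) z = ℓ.comp (cartanD f z) := by
  rw [(hE.cartanD_comp hf isOpen_univ ℓ.contDiff.contDiffOn (mem_univ _)).2, ℓ.fderiv]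

end CartanClosed

theorem smoothFun.exists_order (f g : smoothFun E) :
    ∃ k, ∀ z, SmoothOfOrderAt k f.1 z ∧ SmoothOfOrderAt k g.1 z := by
  obtain ⟨k, hk⟩ := f.2
  obtain ⟨l, hl⟩ := g.2
  exact ⟨max k l, fun z => ⟨(isSmoothOfOrder_iff.1 hk z).mono (le_max_left _ _),
    (isSmoothOfOrder_iff.1 hl z).mono (le_max_right _ _)⟩⟩

/-- The derivative along a vector of the Cartan plane. -/
def CartanClosed.cartanLift (hE : CartanClosed E) (z : E) (v : EM) : smoothFun E →ₗ[ℝ] ℝ where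
  toFun f := cartanD f.1 z v
  map_add' f g := by
    obtain ⟨k, hk⟩ := smoothFun.exists_order f g
    have h1 := hE.cartanD_clm ((hk z).1.prodMk (hk z).2)
      (ContinuousLinearMap.fst ℝ ℝ ℝ + ContinuousLinearMap.snd ℝ ℝ ℝ)
    rw [(hE.cartanD_prodMk (hk z).1 (hk z).2).2] at h1
    exact congrArg (fun L : EM →L[ℝ] ℝ => L v) h1
  map_smul' c f := by
    obtain ⟨k, hk⟩ := smoothFun.exists_order f f
    have h1 := hE.cartanD_clm (hk z).1 (c • ContinuousLinearMap.id ℝ ℝ)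
    exact congrArg (fun L : EM →L[ℝ] ℝ => L v) h1

end CartanDerivatives

/-! ### Flat families of linear maps -/

section FlatLifts

variable {EN N EM M EP HP P : Type*}
  [NormedAddCommGroup EN] [NormedSpace ℝ EN] [TopologicalSpace N] [ChartedSpace EN N]
  [NormedAddCommGroup EM] [NormedSpace ℝ EM] [TopologicalSpace M] [ChartedSpace EM M]
  [NormedAddCommGroup EP] [NormedSpace ℝ EP] [TopologicalSpace HP]
  [TopologicalSpace P] [ChartedSpace HP P] {IP : ModelWithCorners ℝ EP HP} {fib : M → Set P}
  [IP.Boundaryless] [IsManifold IP ∞ P] {E : Set (InfJet 𝓘(ℝ, EM) IP fib)}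
  [IsManifold 𝓘(ℝ, EN) ∞ N] [IsManifold 𝓘(ℝ, EM) ∞ M]

/-- The vector field along `E → M` that is obtained from a vector field on `N` by a family of
linear maps. -/
def liftVec (π : C^∞⟮𝓘(ℝ, EM), M; 𝓘(ℝ, EN), N⟯) (T : E → EN →L[ℝ] EM) (X : VF EN N) (z : E) : EM :=
  T z (X (π z.1.base))

/-- The coordinate expression of `liftVec` in the chart around `c`. -/
def liftIn (π : C^∞⟮𝓘(ℝ, EM), M; 𝓘(ℝ, EN), N⟯) (T : E → EN →L[ℝ] EM) (X : VF EN N) (c : M) (z : E) :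
    EM :=
  tcc EM z.1.base c z.1.base (liftVec π T X z)

theorem liftIn_self (π : C^∞⟮𝓘(ℝ, EM), M; 𝓘(ℝ, EN), N⟯) (T : E → EN →L[ℝ] EM) (X : VF EN N) (z : E) :
    liftIn π T X z.1.base z = liftVec π T X z := tcc_self_apply (mem_chart_source _ _) _

theorem liftIn_eq (π : C^∞⟮𝓘(ℝ, EM), M; 𝓘(ℝ, EN), N⟯) (T : E → EN →L[ℝ] EM) (X : VF EN N) {c : M}
    {z : E} (hz : z.1.base ∈ homDom π c) :
    liftIn π T X c z = homCoord π T c (π c) z (pullCoord π c X z.1.base) :=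
  (congrArg (fun w => tcc EM _ _ _ (T z w)) (tcc_tcc (mem_chart_source _ _) hz.2 _)).symm

/-- The family of linear maps is of uniformly bounded order. -/
def HasUniformOrder (π : C^∞⟮𝓘(ℝ, EM), M; 𝓘(ℝ, EN), N⟯) (T : E → EN →L[ℝ] EM) (K : ℕ) : Prop :=
  ∀ z : E, SmoothOfOrderAt K (homCoord π T z.1.base (π z.1.base)) z

variable {π : C^∞⟮𝓘(ℝ, EM), M; 𝓘(ℝ, EN), N⟯} {T : E → EN →L[ℝ] EM} {K : ℕ}

theorem HasUniformOrder.smoothOfOrderAt_liftIn (hT : HasUniformOrder π T K) (X : VF EN N) (z : E) :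
    SmoothOfOrderAt K (liftIn π T X z.1.base) z := by
  have h1 : SmoothOfOrderAt K (fun z' : E => pullCoord π z.1.base X z'.1.base) z := by
    refine SmoothOfOrderAt.of_base K ?_
    filter_upwards [(isOpen_homDom π z.1.base).mem_nhds (mem_homDom_self _)] with x hx
    exact contMDiffAt_pullCoord hx X
  refine (((hT z).prodMk h1).contDiff_comp (Φ := fun p : (EN →L[ℝ] EM) × EN => p.1 p.2)
    (by fun_prop)).congr_base (isOpen_homDom π z.1.base) (mem_homDom_self _) fun z' hz' => ?_
  exact (liftIn_eq π T X hz').symm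

/-- The derivative of `f` along the vector field obtained from the vector field `X` on `N`. -/
def liftDeriv (π : C^∞⟮𝓘(ℝ, EM), M; 𝓘(ℝ, EN), N⟯) (T : E → EN →L[ℝ] EM) (X : VF EN N) (f : E → ℝ)
    (z : E) : ℝ :=
  cartanD f z (liftVec π T X z)

theorem liftDeriv_eq (X : VF EN N) (f : E → ℝ) {c : M} {z : E}
    (hz : z.1.base ∈ (chartAt EM c).source) :
    liftDeriv π T X f z = cartanIn f c z (liftIn π T X c z) :=
  cartanD_apply_eq f hz _

theorem HasUniformOrder.smoothOfOrderAt_liftDeriv (hT : HasUniformOrder π T K) (hE : CartanClosed E)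
    (X : VF EN N) {f : E → ℝ} {z : E} {k : ℕ} (hf : SmoothOfOrderAt k f z) :
    SmoothOfOrderAt (max (k + 1) K) (liftDeriv π T X f) z := by
  refine ((((hE.smoothOfOrderAt_cartanIn hf).mono (le_max_left _ K)).prodMk
    ((hT.smoothOfOrderAt_liftIn X z).mono (le_max_right (k + 1) _))).contDiff_comp
    (Φ := fun p : (EM →L[ℝ] ℝ) × EM => p.1 p.2) (by fun_prop)).congr_base
    (chartAt EM z.1.base).open_source (mem_chart_source _ _) fun z' hz' => ?_
  exact (liftDeriv_eq X f hz').symm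

/-- The curvature of a family of linear maps. -/
def liftCurv (π : C^∞⟮𝓘(ℝ, EM), M; 𝓘(ℝ, EN), N⟯) (T : E → EN →L[ℝ] EM) (X Y : VF EN N) (z : E) : EM :=
  cartanD (liftIn π T Y z.1.base) z (liftVec π T X z) -
    cartanD (liftIn π T X z.1.base) z (liftVec π T Y z)

/-- By the product rule each iterated derivative is the derivative of `f` along a derivative of the
lift, plus a second Cartan derivative of `f`. The latter terms are symmetric and cancel, leaving the
Cartan lift of the curvature expression. -/
theorem HasUniformOrder.commutator (hT : HasUniformOrder π T K) (hE : CartanClosed E)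
    (X Y : VF EN N) {f : E → ℝ} {z : E} {k : ℕ} (hf : SmoothOfOrderAt k f z) :
    liftDeriv π T X (liftDeriv π T Y f) z - liftDeriv π T Y (liftDeriv π T X f) z =
      cartanD f z (liftCurv π T X Y z) := by
  have h1 : ∀ X Y : VF EN N, liftDeriv π T X (liftDeriv π T Y f) z =
      cartanD f z (cartanD (liftIn π T Y z.1.base) z (liftVec π T X z)) +
        cartanD (cartanIn f z.1.base) z (liftVec π T X z) (liftVec π T Y z) := by
    intro X Y
    obtain ⟨h2, h3⟩ := hE.cartanD_bilin
      ((hE.smoothOfOrderAt_cartanIn hf).mono (le_max_left _ K))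
      ((hT.smoothOfOrderAt_liftIn Y z).mono (le_max_right (k + 1) _))
      (ContinuousLinearMap.id ℝ (EM →L[ℝ] ℝ)) (liftVec π T X z)
    rw [liftDeriv, ← hE.cartanD_congr_base h2 (chartAt EM z.1.base).open_source
      (mem_chart_source _ _) fun z' hz' => (liftDeriv_eq Y f hz').symm, h3, cartanIn_self,
      liftIn_self]
    rfl
  rw [h1, h1, hE.cartanD_cartanIn_symm hf (liftVec π T X z) (liftVec π T Y z), liftCurv, map_sub]
  ring

theorem CartanClosed.cartanD_pullback (hE : CartanClosed E) {h : M → ℝ}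
    (hh : ContMDiff 𝓘(ℝ, EM) 𝓘(ℝ, ℝ) ∞ h) (z : E) :
    cartanD (fun z : E => h z.1.base) z = mderiv EM h z.1.base := by
  rw [hE.cartanD_base (Eventually.of_forall fun b => hh b),
    mderiv_eq_fderiv_self ((hh _).mdifferentiableAt (by simp))]

/-- Families of right inverses `T_{π(x)} N → T_x M` of the differential of `π` of bounded order
and without curvature. -/
structure IsFlatLift [FiniteDimensional ℝ EN] (π : C^∞⟮𝓘(ℝ, EM), M; 𝓘(ℝ, EN), N⟯)
    (T : E → EN →L[ℝ] EM) (K : ℕ) : Prop where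
  order : HasUniformOrder π T K
  dbase : ∀ z w, dbase π z.1.base (T z w) = w
  curv : ∀ X Y z, liftCurv π T X Y z = liftVec π T (X.bracket Y) z

variable [FiniteDimensional ℝ EN]

theorem HasUniformOrder.liftDeriv_mem (hT : HasUniformOrder π T K) (hE : CartanClosed E)
    (X : VF EN N) (f : smoothFun E) : liftDeriv π T X f.1 ∈ smoothFun E := by
  obtain ⟨k, hk⟩ := f.2
  exact ⟨_, isSmoothOfOrder_iff.2 fun z =>
    hT.smoothOfOrderAt_liftDeriv hE X (isSmoothOfOrder_iff.1 hk z)⟩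

/-- The derivation of the algebra of smooth functions given by a vector field on `N`. -/
def HasUniformOrder.derivation (hT : HasUniformOrder π T K) (hE : CartanClosed E) (X : VF EN N) :
    VectorFieldOn E :=
  Derivation.mk'
    { toFun := fun f => ⟨liftDeriv π T X f.1, hT.liftDeriv_mem hE X f⟩
      map_add' := fun f g => Subtype.ext (funext fun z =>
        (hE.cartanLift z (liftVec π T X z)).map_add f g)
      map_smul' := fun c f => Subtype.ext (funext fun z =>
        (hE.cartanLift z (liftVec π T X z)).map_smul c f) }
    fun f g => Subtype.ext (funext fun z => by
      obtain ⟨k, hk⟩ := smoothFun.exists_order f g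
      have h1 := (hE.cartanD_bilin (hk z).1 (hk z).2 (ContinuousLinearMap.mul ℝ ℝ)
        (liftVec π T X z)).2
      refine h1.trans ?_
      change _ = f.1 z * cartanD g.1 z (liftVec π T X z) + g.1 z * cartanD f.1 z (liftVec π T X z)
      rw [ContinuousLinearMap.mul_apply', ContinuousLinearMap.mul_apply', mul_comm (g.1 z)])

theorem HasUniformOrder.isCartanLift (hT : HasUniformOrder π T K) (hE : CartanClosed E)
    (X : VF EN N) (z : E) : IsCartanLift z (show EM from liftVec π T X z)
      ((hT.derivation hE X).at z) :=
  (hE.isCartanLift_iff z _ _).2 fun _ => rfl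

/-- The flat representation given by a flat family of linear maps. -/
def IsFlatLift.representation (hT : IsFlatLift π T K) (hE : CartanClosed E) :
    FlatRepresentation E π where
  toFun := hT.order.derivation hE
  map_add X Y := Derivation.ext fun f => Subtype.ext (funext fun z => by
    change cartanD f.1 z (T z (X (π z.1.base) + Y (π z.1.base))) = _
    exact (congrArg (cartanD f.1 z) ((T z).map_add _ _)).trans ((cartanD f.1 z).map_add _ _))
  map_smul h X := Derivation.ext fun f => Subtype.ext (funext fun z => by
    change cartanD f.1 z (T z (h (π z.1.base) • X (π z.1.base))) = _
    exact (congrArg (cartanD f.1 z) ((T z).map_smul _ _)).trans ((cartanD f.1 z).map_smul _ _))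
  lifts X h z := by
    have h1 := hE.cartanD_pullback (h.contMDiff.comp π.contMDiff) z
    change cartanD (fun z : E => (h ∘ π) z.1.base) z (liftVec π T X z) = _
    rw [h1]
    refine (congrArg (fun L : EM →L[ℝ] ℝ => L (liftVec π T X z)) (mderiv_comp_base
      ((h.contMDiff _).mdifferentiableAt (by simp)))).trans ?_
    exact congrArg (mderiv EN h (π z.1.base)) (hT.dbase z _)
  flat X Y := Derivation.ext fun f => Subtype.ext (funext fun z => by
    obtain ⟨k, hk⟩ := smoothFun.exists_order f f
    rw [Derivation.commutator_apply]
    refine Eq.trans ?_ (hT.order.commutator hE X Y (hk z).1).symm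
    rw [hT.curv]
    rfl)
  mem_cartan X z := ⟨_, hT.order.isCartanLift hE X z⟩

end FlatLifts

end FlatReps

end

noncomputable section

namespace FlatReps


/-! ### Local functions and vector fields -/

section LocalObjects

variable {EM M : Type*} [NormedAddCommGroup EM] [NormedSpace ℝ EM] [FiniteDimensional ℝ EM]
  [TopologicalSpace M] [ChartedSpace EM M] [T2Space M]

theorem exists_chartFamily_nhds (x : M) :
    ∃ A ∈ 𝓝 x, ChartFamily EM (fun _ : Unit => A) (fun _ => x) := by
  have : LocallyCompactSpace M := Manifold.locallyCompact_of_finiteDimensional 𝓘(ℝ, EM)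
  obtain ⟨A, hA, hAc, hAs⟩ := exists_mem_nhds_isClosed_subset
    ((chartAt EM x).open_source.mem_nhds (mem_chart_source EM x))
  exact ⟨A, hA, fun _ => hAc, locallyFinite_of_finite _, fun i j hij => (hij rfl).elim,
    fun _ => hAs⟩

variable [IsManifold 𝓘(ℝ, EM) ∞ M]

theorem exists_bump {x : M} {s : Set M} (hs : s ∈ 𝓝 x) :
    ∃ χ : C^∞⟮𝓘(ℝ, EM), M; 𝓘(ℝ, ℝ), ℝ⟯, (∀ᶠ y in 𝓝 x, χ y = 1) ∧ tsupport χ ⊆ s := by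
  obtain ⟨χ, -, hχ⟩ := (SmoothBumpFunction.nhds_basis_tsupport (I := 𝓘(ℝ, EM)) x).mem_iff.1 hs
  exact ⟨⟨χ, χ.contMDiff⟩, χ.eventuallyEq_one, hχ⟩

variable [SecondCountableTopology M]

theorem exists_local_coord (x : M) :
    ∃ g : C^∞⟮𝓘(ℝ, EM), M; 𝓘(ℝ, EM), EM⟯, ∀ᶠ y in 𝓝 x, g y = extChartAt 𝓘(ℝ, EM) x y := by
  obtain ⟨A, hA, hA'⟩ := exists_chartFamily_nhds (EM := EM) x
  obtain ⟨g, hg⟩ := hA'.exists_map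
  exact ⟨g, mem_of_superset hA fun y hy => hg () y hy⟩

theorem exists_local_vectorField (x : M) (w : EM) :
    ∃ X : VF EM M, ∀ᶠ y in 𝓝 x, X y = tcc EM x y y w := by
  obtain ⟨A, hA, hA'⟩ := exists_chartFamily_nhds (EM := EM) x
  obtain ⟨X, hX⟩ := hA'.exists_vectorField w
  exact ⟨X, mem_of_superset hA fun y hy => hX () y hy⟩

theorem exists_vectorField_eq (x : M) (w : EM) : ∃ X : VF EM M, X x = w := by
  obtain ⟨X, hX⟩ := exists_local_vectorField x w
  exact ⟨X, hX.self_of_nhds.trans (tcc_self_apply (mem_chart_source _ _) w)⟩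

theorem mderiv_eq_tcc_of_eventuallyEq {g : C^∞⟮𝓘(ℝ, EM), M; 𝓘(ℝ, EM), EM⟯} {x : M} {c : M}
    (hx : x ∈ (chartAt EM c).source) (hg : ∀ᶠ y in 𝓝 x, g y = extChartAt 𝓘(ℝ, EM) c y) :
    mderiv EM g x = tcc EM x c x := by
  rw [← mderiv_extChartAt hx]
  exact Filter.EventuallyEq.mfderiv_eq hg

/-- Tangent vectors are determined by the derivatives of functions. -/
theorem eq_of_forall_mderiv_eq {x : M} {v w : EM}
    (h : ∀ h : C^∞⟮𝓘(ℝ, EM), M; 𝓘(ℝ, ℝ), ℝ⟯, mderiv EM h x v = mderiv EM h x w) : v = w := by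
  obtain ⟨g, hg⟩ := exists_local_coord (EM := EM) x
  have h1 := mderiv_eq_tcc_of_eventuallyEq (mem_chart_source _ _) hg
  have h2 : ∀ ℓ : EM →L[ℝ] ℝ, ℓ v = ℓ w := fun ℓ => by
    have h3 := h ⟨fun x => ℓ (g x), ℓ.contMDiff.comp g.contMDiff⟩
    have h4 : mderiv EM (fun x => ℓ (g x)) x = ℓ.comp (mderiv EM g x) :=
      mderiv_clm_comp ℓ ((g.contMDiff x).mdifferentiableAt (by simp))
    have h5 : ∀ v, mderiv EM (fun x => ℓ (g x)) x v = ℓ v := fun v => by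
      rw [h4, h1]
      exact congrArg ℓ (tcc_self_apply (mem_chart_source _ _) v)
    exact (h5 v).symm.trans (h3.trans (h5 w))
  have h6 : v - w = 0 := SeparatingDual.eq_zero_of_forall_dual_eq_zero (R := ℝ) fun ℓ => by
    rw [map_sub, h2, sub_self]
  exact sub_eq_zero.1 h6

end LocalObjects

/-! ### Flat representations as families of linear maps -/

section Representations

variable {EN N EM M EP HP P : Type*}
  [NormedAddCommGroup EN] [NormedSpace ℝ EN] [TopologicalSpace N] [ChartedSpace EN N]
  [NormedAddCommGroup EM] [NormedSpace ℝ EM] [TopologicalSpace M] [ChartedSpace EM M]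
  [NormedAddCommGroup EP] [NormedSpace ℝ EP] [TopologicalSpace HP]
  [TopologicalSpace P] [ChartedSpace HP P] {IP : ModelWithCorners ℝ EP HP} {fib : M → Set P}
  [IP.Boundaryless] [IsManifold IP ∞ P] {E : Set (InfJet 𝓘(ℝ, EM) IP fib)}
  [IsManifold 𝓘(ℝ, EN) ∞ N] [IsManifold 𝓘(ℝ, EM) ∞ M]
  [FiniteDimensional ℝ EN] [FiniteDimensional ℝ EM]
  [T2Space N] [SecondCountableTopology N] [T2Space M] [SecondCountableTopology M]

/-- Functions pulled back from `M` already separate the vectors, so a Cartan lift determines the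
vector that it lifts. -/
theorem CartanClosed.eq_of_forall_cartanD_eq (hE : CartanClosed E) {z : E} {v w : EM}
    (h : ∀ f : smoothFun E, cartanD f.1 z v = cartanD f.1 z w) : v = w := by
  refine eq_of_forall_mderiv_eq (x := z.1.base) fun g => ?_
  rw [← hE.cartanD_pullback g.contMDiff z]
  exact h (pullBase g g.contMDiff)

variable {π : C^∞⟮𝓘(ℝ, EM), M; 𝓘(ℝ, EN), N⟯}

namespace FlatRepresentation

theorem toFun_smul_apply (R : FlatRepresentation E π) (h : C^∞⟮𝓘(ℝ, EN), N; 𝓘(ℝ, ℝ), ℝ⟯)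
    (X : VF EN N) (f : smoothFun E) (z : E) :
    (R.toFun (X.smul h) f).1 z = h (π z.1.base) * (R.toFun X f).1 z := by
  rw [R.map_smul]
  rfl

theorem toFun_sum_apply (R : FlatRepresentation E π) {ι : Type*} (s : Finset ι) (X : ι → VF EN N)
    (f : smoothFun E) (z : E) :
    (R.toFun (∑ i ∈ s, X i) f).1 z = ∑ i ∈ s, (R.toFun (X i) f).1 z := by
  classical
  induction s using Finset.induction_on with
  | empty =>
    have h1 : (R.toFun 0 f).1 z = (R.toFun 0 f).1 z + (R.toFun 0 f).1 z := by
      have h2 := R.map_add 0 0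
      rw [add_zero] at h2
      exact congrArg (fun D : VectorFieldOn E => (D f).1 z) h2
    rw [Finset.sum_empty, Finset.sum_empty]
    exact left_eq_add.1 h1
  | insert i s hi ih =>
    rw [Finset.sum_insert hi, Finset.sum_insert hi, R.map_add, ← ih]
    rfl

/-- Linearity over functions implies locality: multiplying both fields by a bump function supported
where they agree makes them equal and does not change the values at `z`. -/
theorem toFun_congr (R : FlatRepresentation E π) {X Y : VF EN N} {z : E}
    (h : ∀ᶠ y in 𝓝 (π z.1.base), X y = Y y) (f : smoothFun E) :
    (R.toFun X f).1 z = (R.toFun Y f).1 z := by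
  obtain ⟨χ, h1, h2⟩ := exists_bump (EM := EN) h
  have h3 : X.smul χ = Y.smul χ := by
    ext y
    change χ y • X y = χ y • Y y
    by_cases hy : y ∈ tsupport χ
    · rw [show X y = Y y from h2 hy]
    · rw [image_eq_zero_of_notMem_tsupport hy, zero_smul, zero_smul]
  have h4 := R.toFun_smul_apply χ X f z
  rw [h3, R.toFun_smul_apply, h1.self_of_nhds, one_mul, one_mul] at h4
  exact h4.symm

/-- A flat representation is determined at a point by a linear map on the tangent space of `N`. -/
theorem exists_lift_at (R : FlatRepresentation E π) (hE : CartanClosed E) (z : E) :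
    ∃ T : EN →L[ℝ] EM, ∀ (X : VF EN N) (f : smoothFun E),
      (R.toFun X f).1 z = cartanD f.1 z (T (X (π z.1.base))) := by
  choose V hV using fun X => R.mem_cartan X z
  have hV' : ∀ (X : VF EN N) (f : smoothFun E), (R.toFun X f).1 z =
      cartanD f.1 z (show EM from V X) := fun X f => (hE.isCartanLift_iff z _ _).1 (hV X) f
  let b := Module.finBasis ℝ EN
  choose Xb hXb using fun w : EN => exists_local_vectorField (EM := EN) (π z.1.base) w
  -- On a basis, `T` is prescribed by the vectors whose Cartan lifts are the values of the
  -- representation on locally constant coordinate fields.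
  let T : EN →L[ℝ] EM := ∑ j, (LinearMap.toContinuousLinearMap (b.coord j)).smulRight
    (show EM from V (Xb (b j)))
  refine ⟨T, fun X f => ?_⟩
  obtain ⟨χ⟩ : Nonempty (SmoothBumpFunction 𝓘(ℝ, EN) (π z.1.base)) := inferInstance
  let a : Fin (Module.finrank ℝ EN) → N → ℝ := fun j y =>
    b.coord j (tcc EN y (π z.1.base) y (X y))
  have ha : ∀ j, ContMDiffOn 𝓘(ℝ, EN) 𝓘(ℝ, ℝ) ∞ (a j) (chartAt EN (π z.1.base)).source :=
    fun j y hy => ((LinearMap.toContinuousLinearMap (b.coord j)).contMDiff.contMDiffAt.comp y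
      (X.contMDiffAt_coord hy)).contMDiffWithinAt
  let h : Fin (Module.finrank ℝ EN) → C^∞⟮𝓘(ℝ, EN), N; 𝓘(ℝ, ℝ), ℝ⟯ := fun j =>
    ⟨fun y => χ y • a j y, χ.contMDiff_smul (ha j)⟩
  -- Near the point `X` is a combination of the coordinate fields with coefficients that the cutoff
  -- makes global; locality and linearity over functions then reduce `X` to these fields.
  have h1 : ∀ᶠ y in 𝓝 (π z.1.base), X y = (∑ j, (Xb (b j)).smul (h j) : VF EN N) y := by
    filter_upwards [χ.eventuallyEq_one, (chartAt EN (π z.1.base)).open_source.mem_nhds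
      (mem_chart_source EN (π z.1.base)), eventually_all.2 fun j => hXb (b j)] with y e1 e2 e3
    have e4 : (∑ j, (Xb (b j)).smul (h j) : VF EN N) y = ∑ j, (χ y • a j y) • Xb (b j) y := by
      refine (congrFun (map_sum (ContMDiffSection.coeAddHom 𝓘(ℝ, EN) EN ∞
        (TangentSpace 𝓘(ℝ, EN) : N → Type _)) (fun j => (Xb (b j)).smul (h j)) Finset.univ) y).trans ?_
      rw [Finset.sum_apply]
      rfl
    have e5 := b.sum_repr (tcc EN y (π z.1.base) y (X y))
    have e6 : (X y : EN) = tcc EN (π z.1.base) y y (tcc EN y (π z.1.base) y (X y)) :=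
      (tcc_tcc (mem_chart_source _ _) e2 _).symm
    rw [e4]
    refine e6.trans ?_
    conv_lhs => rw [← e5]
    rw [map_sum]
    refine Finset.sum_congr rfl fun j _ => ?_
    rw [_root_.map_smul, e1, Pi.one_apply, one_smul]
    exact congrArg (a j y • ·) (e3 j).symm
  rw [R.toFun_congr h1, R.toFun_sum_apply]
  have h2 : T (X (π z.1.base)) = ∑ j, b.coord j (X (π z.1.base)) • (show EM from V (Xb (b j))) := by
    refine (_root_.sum_apply _ _ _).trans (Finset.sum_congr rfl fun j _ => rfl)
  rw [h2, map_sum]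
  refine Finset.sum_congr rfl fun j _ => ?_
  rw [R.toFun_smul_apply, hV', _root_.map_smul]
  have h3 : h j (π z.1.base) = b.coord j (X (π z.1.base)) := by
    change χ _ • b.coord j (tcc EN _ _ _ _) = _
    rw [χ.eq_one, one_smul]
    exact congrArg (b.coord j) (tcc_self_apply (mem_chart_source _ _) _)
  rw [h3, smul_eq_mul]

/-- A flat representation is given by a flat family of linear maps. -/
theorem exists_isFlatLift (R : FlatRepresentation E π) (hE : CartanClosed E) :
    ∃ (T : E → EN →L[ℝ] EM) (K : ℕ), IsFlatLift π T K ∧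
      ∀ X z, IsCartanLift z (show EM from liftVec π T X z) ((R.toFun X).at z) := by
  choose T hT using R.exists_lift_at hE
  have hT' : ∀ (X : VF EN N) (f : smoothFun E), liftDeriv π T X f.1 = (R.toFun X f).1 :=
    fun X f => funext fun z => (hT z X f).symm
  -- The components of `T` are the functions that the representation assigns to pullbacks from `M`;
  -- each is smooth on `E` and so has a finite order.
  obtain ⟨K, hK⟩ := exists_uniform_order π T fun h X => by
    obtain ⟨k, hk⟩ := (R.toFun X (pullBase h h.contMDiff)).2
    refine ⟨k, ?_⟩
    convert hk using 1
    funext z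
    rw [hT]
    exact congrArg (fun L : EM →L[ℝ] ℝ => L _) (hE.cartanD_pullback h.contMDiff z).symm
  refine ⟨T, K, ⟨hK, fun z w => ?_, fun X Y z => ?_⟩, fun X z =>
    (hE.isCartanLift_iff z _ _).2 fun f => hT z X f⟩
  -- Functions from `N` detect the projection of the lift: on these the representation acts as `X`
  -- does.
  · obtain ⟨X, hX⟩ := exists_vectorField_eq (π z.1.base) w
    refine eq_of_forall_mderiv_eq (x := π z.1.base) fun h => ?_
    have h1 := R.lifts X h z
    rw [hT] at h1
    have h2 : cartanD (pullComp E π h).1 z = mderiv EM (fun x => h (π x)) z.1.base :=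
      hE.cartanD_pullback (h.contMDiff.comp π.contMDiff) z
    rw [h2, mderiv_comp_base ((h.contMDiff _).mdifferentiableAt (by simp)), hX] at h1
    refine h1.trans ?_
    rw [← hX]
    rfl
  -- The commutator formula and compatibility with brackets equate the Cartan lifts of the two
  -- sides, hence the sides.
  · refine hE.eq_of_forall_cartanD_eq (z := z) fun f => ?_
    obtain ⟨k, hk⟩ := f.2
    have hK' : HasUniformOrder π T K := hK
    rw [← hK'.commutator hE X Y (isSmoothOfOrder_iff.1 hk z)]
    have h1 := hT' X (R.toFun Y f)
    have h2 := hT' Y (R.toFun X f)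
    rw [← hT'] at h1 h2
    rw [h1, h2]
    refine Eq.trans ?_ (hT z (X.bracket Y) f)
    rw [R.flat, Derivation.commutator_apply]
    rfl

end FlatRepresentation

end Representations

end FlatReps

end

noncomputable section

namespace FlatReps


/-! ### Morphisms to the equation of flat connections -/

section FlatMorphisms

variable {EN N EM M EP HP P : Type*}
  [NormedAddCommGroup EN] [NormedSpace ℝ EN] [TopologicalSpace N] [ChartedSpace EN N]
  [NormedAddCommGroup EM] [NormedSpace ℝ EM] [TopologicalSpace M] [ChartedSpace EM M]
  [NormedAddCommGroup EP] [NormedSpace ℝ EP] [TopologicalSpace HP]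
  [TopologicalSpace P] [ChartedSpace HP P] {IP : ModelWithCorners ℝ EP HP} {fib : M → Set P}
  [IP.Boundaryless] [IsManifold IP ∞ P] {E : Set (InfJet 𝓘(ℝ, EM) IP fib)}
  [IsManifold 𝓘(ℝ, EN) ∞ N] [IsManifold 𝓘(ℝ, EM) ∞ M]
  {π : C^∞⟮𝓘(ℝ, EM), M; 𝓘(ℝ, EN), N⟯} {T : E → EN →L[ℝ] EM} {K : ℕ}

/-- The linear maps given by the infinite jets of connections. -/
def connLift (F : Set (ConnInfJet π)) (ζ : F) : EN →L[ℝ] EM := HomTotal.raw ζ.1.value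

theorem repIn_liftIn {F : Set (ConnInfJet π)} {c : M} {q : HomTotal π} (hq : q.proj = c)
    (X : VF EN N) : RepIn (liftIn π (connLift F) X c) c q 0 (fieldCoord π c X)
      (Prod.fst ⁻¹' coordSet EM c (homDom π c)) where
  isOpen := (isOpen_coordSet c (isOpen_homDom π c)).preimage continuous_fst
  contDiffOn := contDiffOn_fieldCoord c X
  eq ζ hc _ := (ζ.1.fieldCoord_coords hq hc X).symm

theorem InfJet.coords_mem_homDom (ζ : ConnInfJet π) :
    ζ.coords 0 ζ.base ζ.value ∈ Prod.fst ⁻¹' coordSet EM ζ.base (homDom π ζ.base) := by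
  rw [mem_preimage, ζ.coords_fst 0 ζ.inChart_self]
  exact mem_coordSet (mem_chart_source _ _) (mem_homDom_self _)

theorem tcc_apply_congr {A A' : EN →L[ℝ] EM} {b b' c c' : M} (X : VF EN N) (hb : b = b')
    (hc : c = c') (hA : A = A') :
    tcc EM b c b (A (X (π b))) = tcc EM b' c' b' (A' (X (π b'))) := by
  subst hb hc hA
  rfl

theorem apply_congr {A A' : EN →L[ℝ] EM} {b b' : M} (X : VF EN N) (hb : b = b') (hA : A = A') :
    A (X (π b)) = A' (X (π b')) := by
  subst hb hA
  rfl

/-- The map to the bundle of connections given by a family of linear maps. -/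
def connMap (π : C^∞⟮𝓘(ℝ, EM), M; 𝓘(ℝ, EN), N⟯) (T : E → EN →L[ℝ] EM) (z : E) : HomTotal π :=
  HomTotal.mk z.1.base (T z)

theorem HasUniformOrder.exists_mapRep (hT : HasUniformOrder π T K) (z : E) :
    ∃ (Θ : JetCoord EM EP K → EM × (EN →L[ℝ] EM)) (U : Set (JetCoord EM EP K)),
      MapRep (homModel EN EM) (connMap π T) z.1.base z.1.value (connMap π T z) K Θ U ∧
        z.1.coords K z.1.base z.1.value ∈ U := by
  have h1 : SmoothOfOrderAt K (fun z' : E => extChartAt 𝓘(ℝ, EM) z.1.base z'.1.base) z := by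
    refine SmoothOfOrderAt.of_base K ?_
    filter_upwards [(chartAt EM z.1.base).open_source.mem_nhds (mem_chart_source _ _)] with x hx
    exact contMDiffAt_extChartAt' hx
  obtain ⟨G, U, h, hm⟩ := h1.prodMk (hT z)
  refine ⟨G, _, ⟨h.congr_base (isOpen_homDom π z.1.base) fun z' hz' =>
    (HomTotal.chart_apply (connMap π T z) (connMap π T z') hz'.1 hz'.2).symm, fun z' hc hm' => ?_⟩,
    RepIn.congr_base_mem z.1.inChart_self hm (mem_homDom_self _)⟩
  have h2 := hm'.2.2
  rw [mem_preimage, z'.1.coords_fst K hc,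
    (extChartAt 𝓘(ℝ, EM) z.1.base).left_inv (by rw [extChartAt_source]; exact hc.1)] at h2
  exact (HomTotal.mem_source_iff _ _).2 h2

theorem InfJet.liftRaw_eq {ζ : ConnInfJet π} {x : M} {A : EN →L[ℝ] EM} (hb : ζ.base = x)
    (hv : ζ.value = HomTotal.mk x A) (X : VF EN N) : ζ.liftRaw X = A (X (π x)) :=
  apply_congr X hb (by rw [hv]; rfl)

/-- The prolongation of a flat family of linear maps takes its values in the equation of flat
connections. -/
theorem IsFlatLift.jet_mem [FiniteDimensional ℝ EN] [CompleteSpace EM] (hT : IsFlatLift π T K)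
    (hE : CartanClosed E) {φ : E → ConnInfJet π} (hφ : IsProlongation (connMap π T) K φ) (z : E) :
    (φ z).jet 1 ∈ flatEq₀ π := by
  rw [InfJet.jet_mem_flatEq₀_iff]
  intro X Y
  -- That `φ` lands in the equation of flat connections is not yet available, so it is treated as a
  -- map to all infinite jets, whence `univ`.
  have hf : ∀ X : VF EN N, (fun z' => liftIn π (connLift univ) X (φ z).base ⟨φ z', mem_univ _⟩) =
      liftIn π T X z.1.base := fun X => funext fun z' =>
    tcc_apply_congr X (hφ.base z') (hφ.base z) (by rw [connLift, hφ.value]; rfl)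
  have hD : ∀ X : VF EN N, cartanD (liftIn π T X z.1.base) z =
      totalD (fieldCoord π (φ z).base X) ((φ z).coords 1 (φ z).base (φ z).value) := fun X => by
    rw [← hf]
    exact (hφ.cartanD_comp hE (fun _ => mem_univ _) (repIn_liftIn (φ z).proj_value X)
      (φ z).coords_mem_homDom).2
  rw [← hD, ← hD, InfJet.liftRaw_eq (hφ.base z) (hφ.value z),
    InfJet.liftRaw_eq (hφ.base z) (hφ.value z), InfJet.liftRaw_eq (hφ.base z) (hφ.value z)]
  exact hT.curv X Y z

variable [FiniteDimensional ℝ EN]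

/-- The family of linear maps given by a morphism to the equation of flat connections. -/
def FlatMorphism.lift (φ : FlatMorphism E π) (z : E) : EN →L[ℝ] EM :=
  connLift (flatEq π) (φ.toFun z)

/-- The prolongation of `T` is the morphism. Being right inverse to the differential of `π` puts `T`
into the bundle of connections, zero curvature puts the `1`-jets into the first-order equation, and
`mem_infProlong` supplies all higher consequences. -/
theorem IsFlatLift.exists_flatMorphism [CompleteSpace EM] (hT : IsFlatLift π T K)
    (hE : CartanClosed E) : ∃ φ : FlatMorphism E π, φ.lift = T := by
  have : CompleteSpace EN := FiniteDimensional.complete ℝ EN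
  obtain ⟨φ, hφ⟩ := hE.exists_prolongation hasRetraction_connFib (τ := connMap π T) (K := K)
    (fun z => mem_connFib_iff.2 ⟨rfl, hT.dbase z⟩) hT.order.exists_mapRep
  have hmem : ∀ z, φ z ∈ flatEq π := hφ.mem_infProlong hE (hT.jet_mem hE hφ)
  refine ⟨⟨⟨fun z => ⟨φ z, hmem z⟩, ?_, ?_⟩, hφ.base⟩, funext fun z => ?_⟩
  · rintro f ⟨k, hk⟩
    refine ⟨K + k, isSmoothOfOrder_iff.2 fun z => ?_⟩
    obtain ⟨G, U, h, hm⟩ := isSmoothOfOrder_iff.1 hk ⟨φ z, hmem z⟩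
    exact (hφ.cartanD_comp hE hmem h hm).1
  · rintro z δ ⟨v, hv⟩
    refine ⟨(show EM from v), fun f k G hG => ?_⟩
    obtain ⟨U, h, hm⟩ := isLocalRep_iff.1 hG
    refine Eq.trans ?_ ((φ z).totalDeriv_eq (h.differentiableAt hm) _).symm
    have h1 := (hE.isCartanLift_iff z v δ).1 hv
    refine (h1 _).trans ?_
    exact congrArg (fun L : EM →L[ℝ] ℝ => L v) (hφ.cartanD_comp hE hmem h hm).2
  · change HomTotal.raw (φ z).value = T z
    rw [hφ.value]
    rfl

theorem FlatMorphism.value_eq (φ : FlatMorphism E π) (z : E) :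
    (φ.toFun z).1.value = connMap π φ.lift z :=
  (HomTotal.mk_raw ((φ.toFun z).1.proj_value.trans (φ.base_eq z))).symm

theorem FlatMorphism.liftIn_eq (φ : FlatMorphism E π) (X : VF EN N) (c : M) (z : E) :
    liftIn π (connLift (flatEq π)) X c (φ.toFun z) = liftIn π φ.lift X c z :=
  tcc_apply_congr X (φ.base_eq z) rfl rfl

/-- The correspondence involves `φ` only through its family of linear maps, which is what both
constructions produce or consume. -/
theorem corresponds_iff (R : FlatRepresentation E π) (φ : FlatMorphism E π) :
    Corresponds R φ ↔ ∀ X z, IsCartanLift z (show EM from liftVec π φ.lift X z)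
      ((R.toFun X).at z) := by
  refine forall_congr' fun X => forall_congr' fun z => ?_
  have h1 : (show EM from liftAt π (φ.toFun z).1 X) = liftVec π φ.lift X z :=
    apply_congr X ((φ.toFun z).1.proj_value.trans (φ.base_eq z)) rfl
  exact iff_of_eq (congrArg (fun v : EM => IsCartanLift z (show EM from v) ((R.toFun X).at z)) h1)

end FlatMorphisms

end FlatReps

end

noncomputable section

namespace FlatReps


/-! ### Derivatives along morphisms -/

section EqMorphisms

variable {EM M EP HP P EP' HP' P' : Type*}
  [NormedAddCommGroup EM] [NormedSpace ℝ EM] [FiniteDimensional ℝ EM]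
  [TopologicalSpace M] [ChartedSpace EM M] [IsManifold 𝓘(ℝ, EM) ∞ M]
  [T2Space M] [SecondCountableTopology M]
  [NormedAddCommGroup EP] [NormedSpace ℝ EP] [TopologicalSpace HP]
  [TopologicalSpace P] [ChartedSpace HP P] {IP : ModelWithCorners ℝ EP HP} {fib : M → Set P}
  [IP.Boundaryless] [IsManifold IP ∞ P] {E : Set (InfJet 𝓘(ℝ, EM) IP fib)}
  [NormedAddCommGroup EP'] [NormedSpace ℝ EP'] [TopologicalSpace HP']
  [TopologicalSpace P'] [ChartedSpace HP' P'] {IP' : ModelWithCorners ℝ EP' HP'}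
  {fib' : M → Set P'} [IP'.Boundaryless] [IsManifold IP' ∞ P']
  {E' : Set (InfJet 𝓘(ℝ, EM) IP' fib')}

theorem IsCartanLift.apply_pullBase {z : E} {v : EM} {δ : smoothFun E →ₗ[ℝ] ℝ}
    (h : IsCartanLift z (show EM from v) δ) (g : C^∞⟮𝓘(ℝ, EM), M; 𝓘(ℝ, ℝ), ℝ⟯) :
    δ (pullBase g g.contMDiff) = mderiv EM g z.1.base v := by
  have h1 : ContDiffOn ℝ ∞ (fun u => g ((extChartAt 𝓘(ℝ, EM) z.1.base).symm u))
      (extChartAt 𝓘(ℝ, EM) z.1.base).target :=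
    (g.contMDiff.comp_contMDiffOn (contMDiffOn_extChartAt_symm z.1.base)).contDiffOn
  have h2 : IsLocalRep (pullBase (E := E) g g.contMDiff).1 z 0
      (fun x => g ((extChartAt 𝓘(ℝ, EM) z.1.base).symm x.1)) := by
    refine isLocalRep_iff.2 ⟨_, RepIn.of_base (isOpen_extChartAt_target _) h1
      fun z' hc _ => ?_, ?_⟩
    · rw [(extChartAt 𝓘(ℝ, EM) z.1.base).left_inv (by rw [extChartAt_source]; exact hc.1)]
      rfl
    · rw [mem_preimage, z.1.coords_fst 0 z.1.inChart_self]
      exact mem_extChartAt_target _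
  rw [h _ _ _ h2, mderiv_eq_fderiv_self ((g.contMDiff _).mdifferentiableAt (by simp))]
  rfl

/-- The derivatives along the Cartan planes of the pullback of a smooth function by a morphism over
the base. -/
theorem EqMorphism.cartanD_comp (hE : CartanClosed E) (φ : EqMorphism E E')
    (hb : ∀ z, (φ.toFun z).1.base = z.1.base) (f : smoothFun E') {z : E} {c : M} {q : P'}
    (hc : (φ.toFun z).1.base = c) (hq : (φ.toFun z).1.value = q) {k : ℕ}
    {G : JetCoord EM EP' k → ℝ} {U : Set (JetCoord EM EP' k)} (h : RepIn f.1 c q k G U)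
    (hm : (φ.toFun z).1.coords k c q ∈ U) :
    cartanD (f.1 ∘ φ.toFun) z = totalD G ((φ.toFun z).1.coords (k + 1) c q) := by
  subst hc hq
  ext v
  have hl : IsCartanLift z (show EM from v) (hE.cartanLift z v) :=
    (hE.isCartanLift_iff z _ _).2 fun _ => rfl
  -- Preservation of Cartan planes gives the lift of some vector `w`. Since `φ` covers the identity
  -- of the base, testing on functions from `M` shows that `w` is `v`.
  obtain ⟨w, hw⟩ := φ.cartan z _ ⟨_, hl⟩
  have h1 : (show EM from w) = v := by
    refine eq_of_forall_mderiv_eq (x := z.1.base) fun g => ?_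
    have h2 := IsCartanLift.apply_pullBase (v := (show EM from w)) hw g
    have h3 := IsCartanLift.apply_pullBase hl g
    have h4 : pullback φ.toFun φ.smooth (pullBase g g.contMDiff) = pullBase g g.contMDiff :=
      Subtype.ext (funext fun z => congrArg g (hb z))
    rw [LinearMap.comp_apply, h4, h3] at h2
    rw [h2]
    exact congrArg (fun x => mderiv EM g x (show EM from w)) (hb z).symm
  have h5 := hw f k G (isLocalRep_iff.2 ⟨U, h, hm⟩)
  rw [InfJet.totalDeriv_eq _ (h.differentiableAt hm)] at h5
  refine h5.trans ?_
  rw [h1]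

end EqMorphisms

/-! ### The flat family of linear maps of a morphism -/

section FlatMorphisms

variable {EN N EM M EP HP P : Type*}
  [NormedAddCommGroup EN] [NormedSpace ℝ EN] [TopologicalSpace N] [ChartedSpace EN N]
  [NormedAddCommGroup EM] [NormedSpace ℝ EM] [TopologicalSpace M] [ChartedSpace EM M]
  [NormedAddCommGroup EP] [NormedSpace ℝ EP] [TopologicalSpace HP]
  [TopologicalSpace P] [ChartedSpace HP P] {IP : ModelWithCorners ℝ EP HP} {fib : M → Set P}
  [IP.Boundaryless] [IsManifold IP ∞ P] {E : Set (InfJet 𝓘(ℝ, EM) IP fib)}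
  [IsManifold 𝓘(ℝ, EN) ∞ N] [IsManifold 𝓘(ℝ, EM) ∞ M]
  [FiniteDimensional ℝ EN] [FiniteDimensional ℝ EM]
  [T2Space N] [SecondCountableTopology N] [T2Space M] [SecondCountableTopology M]
  {π : C^∞⟮𝓘(ℝ, EM), M; 𝓘(ℝ, EN), N⟯}

/-- The derivative of a function on `M` along the lift of a vector field on `N`, as a function of
the infinite jet of the connection. -/
def connDeriv (F : Set (ConnInfJet π)) (h : M → ℝ) (X : VF EN N) (ζ : F) : ℝ :=
  mderiv EM h ζ.1.base (liftVec π (connLift F) X ζ)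

/-- These are global scalar functions of order zero on jets of connections that together recover the
connection. A morphism is only known to act well on scalar smooth functions, so `T` is reached
through them. -/
theorem connDeriv_mem (F : Set (ConnInfJet π)) (h : C^∞⟮𝓘(ℝ, EM), M; 𝓘(ℝ, ℝ), ℝ⟯) (X : VF EN N) :
    connDeriv F h X ∈ smoothFun F := by
  refine ⟨0, isSmoothOfOrder_iff.2 fun ζ => ?_⟩
  have h1 : SmoothOfOrderAt 0 (liftIn π (connLift F) X ζ.1.base) ζ :=
    ⟨_, _, repIn_liftIn ζ.1.proj_value X, ζ.1.coords_mem_homDom⟩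
  have h2 : SmoothOfOrderAt 0 (fun ζ' : F =>
      fderiv ℝ (fun u => h ((extChartAt 𝓘(ℝ, EM) ζ.1.base).symm u))
        (extChartAt 𝓘(ℝ, EM) ζ.1.base ζ'.1.base)) ζ := by
    refine SmoothOfOrderAt.of_base (IB := 𝓘(ℝ, EM)) (z := ζ) (g := fun x =>
      fderiv ℝ (fun u => h ((extChartAt 𝓘(ℝ, EM) ζ.1.base).symm u))
        (extChartAt 𝓘(ℝ, EM) ζ.1.base x)) 0 ?_
    filter_upwards [(chartAt EM ζ.1.base).open_source.mem_nhds (mem_chart_source _ _)] with x hx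
    have h3 : ContDiffOn ℝ ∞ (fun u => h ((extChartAt 𝓘(ℝ, EM) ζ.1.base).symm u))
        (extChartAt 𝓘(ℝ, EM) ζ.1.base).target :=
      (h.contMDiff.comp_contMDiffOn (contMDiffOn_extChartAt_symm ζ.1.base)).contDiffOn
    have h4 := (h3.contDiffAt ((isOpen_extChartAt_target (I := 𝓘(ℝ, EM)) ζ.1.base).mem_nhds
      ((extChartAt 𝓘(ℝ, EM) ζ.1.base).map_source (by rw [extChartAt_source]; exact hx)))).fderiv_right
      (m := ∞) (by simp)
    exact h4.contMDiffAt.comp x (contMDiffAt_extChartAt' hx)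
  refine ((h2.prodMk h1).contDiff_comp (Φ := fun p : (EM →L[ℝ] ℝ) × EM => p.1 p.2)
    (by fun_prop)).congr_base (chartAt EM ζ.1.base).open_source (mem_chart_source _ _)
    fun ζ' hζ' => ?_
  exact (mderiv_eq_fderiv ((h.contMDiff _).mdifferentiableAt (by simp)) hζ' _).symm

namespace FlatMorphism

/-- Each component of the lift is the pullback by `φ` of a function `connDeriv`, so it has a finite
order; `exists_uniform_order` makes the bound uniform. -/
theorem exists_uniformOrder (φ : FlatMorphism E π) : ∃ K, HasUniformOrder π φ.lift K := by
  refine exists_uniform_order π φ.lift fun h X => ?_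
  obtain ⟨k, hk⟩ := φ.smooth _ (connDeriv_mem (flatEq π) h X)
  refine ⟨k, ?_⟩
  convert hk using 1
  funext z
  have h1 : ∀ b b' : M, b = b' → ∀ A : EN →L[ℝ] EM,
      mderiv EM h b (A (X (π b))) = mderiv EM h b' (A (X (π b'))) := by
    rintro b _ rfl A
    rfl
  exact h1 _ _ (φ.base_eq z).symm _

/-- Tests the vector-valued lift with functionals `ℓ`. A global function agreeing near the base
point with `ℓ` of the chart turns `ℓ` of the lift into a function `connDeriv`, to which the chain
rule for morphisms applies. -/
theorem cartanD_liftIn (hE : CartanClosed E) (φ : FlatMorphism E π) (X : VF EN N) (z : E) :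
    cartanD (liftIn π φ.lift X z.1.base) z = totalD (fieldCoord π (φ.toFun z).1.base X)
      ((φ.toFun z).1.coords 1 (φ.toFun z).1.base (φ.toFun z).1.value) := by
  obtain ⟨K, hK⟩ := φ.exists_uniformOrder
  have hs := hK.smoothOfOrderAt_liftIn X z
  rw [← φ.base_eq z] at hs ⊢
  generalize hζ : φ.toFun z = ζ at hs ⊢
  obtain ⟨g, hg⟩ := exists_local_coord (EM := EM) ζ.1.base
  obtain ⟨O, hgO, hO, hzO⟩ := eventually_nhds_iff.1 (hg.eventually_nhds.and
    ((chartAt EM ζ.1.base).open_source.mem_nhds (mem_chart_source EM ζ.1.base)))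
  have hgd : ∀ x ∈ O, mderiv EM g x = tcc EM x ζ.1.base x := fun x hx =>
    mderiv_eq_tcc_of_eventuallyEq (hgO x hx).2 (hgO x hx).1
  ext v
  refine sub_eq_zero.1 (SeparatingDual.eq_zero_of_forall_dual_eq_zero (R := ℝ) fun ℓ => ?_)
  rw [_root_.map_sub, sub_eq_zero]
  let h : C^∞⟮𝓘(ℝ, EM), M; 𝓘(ℝ, ℝ), ℝ⟯ := ⟨fun x => ℓ (g x), ℓ.contMDiff.comp g.contMDiff⟩
  have hh : ∀ x ∈ O, ∀ w, mderiv EM h x w = ℓ (tcc EM x ζ.1.base x w) := fun x hx w => by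
    have h1 : mderiv EM h x = ℓ.comp (mderiv EM g x) :=
      mderiv_clm_comp ℓ ((g.contMDiff x).mdifferentiableAt (by simp))
    rw [h1, ← hgd x hx]
    rfl
  have h1 : RepIn (connDeriv (flatEq π) h X) ζ.1.base ζ.1.value 0 _ _ :=
    ((repIn_liftIn ζ.1.proj_value X).comp isOpen_univ ℓ.contDiff.contDiffOn).congr_base hO
      fun ζ' hζ' => (hh _ hζ' _).symm
  have hm := RepIn.congr_base_mem ζ.1.inChart_self
    (show _ ∈ _ ∩ fieldCoord π ζ.1.base X ⁻¹' univ from ⟨ζ.1.coords_mem_homDom, mem_univ _⟩) hzO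
  have h2 := EqMorphism.cartanD_comp hE φ.toEqMorphism φ.base_eq
    ⟨_, connDeriv_mem (flatEq π) h X⟩ (z := z) (congrArg (fun ζ => ζ.1.base) hζ)
    (congrArg (fun ζ => ζ.1.value) hζ) h1 (by rw [hζ]; exact hm)
  rw [hζ] at h2
  have h3 : DifferentiableAt ℝ (fieldCoord π ζ.1.base X)
      (JetCoord.truncL (Nat.le_succ 0) (ζ.1.coords (0 + 1) ζ.1.base ζ.1.value)) := by
    rw [← ζ.1.coords_trunc _ ζ.1.inChart_self]
    exact (repIn_liftIn (F := flatEq π) ζ.1.proj_value X).differentiableAt ζ.1.coords_mem_homDom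
  rw [totalD_clm ℓ h3] at h2
  have h4 := hE.cartanD_congr_base (hs.contDiff_comp ℓ.contDiff) (g := connDeriv (flatEq π) h X ∘ φ.toFun)
    hO (by rw [← φ.base_eq, hζ]; exact hzO) fun z' hz' => by
      rw [← φ.base_eq] at hz'
      rw [Function.comp_apply, connDeriv, hh _ hz']
      exact congrArg ℓ (φ.liftIn_eq X ζ.1.base z').symm
  rw [hE.cartanD_clm hs] at h4
  exact congrArg (fun L : EM →L[ℝ] ℝ => L v) (h4.trans h2)

/-- Only the first-order part of the target equation is needed: `cartanD_liftIn` translates the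
curvature of the `1`-jet of `φ z` into the curvature of the lift. -/
theorem exists_isFlatLift (hE : CartanClosed E) (φ : FlatMorphism E π) :
    ∃ K, IsFlatLift π φ.lift K := by
  obtain ⟨K, hK⟩ := φ.exists_uniformOrder
  refine ⟨K, hK, fun z w => ?_, fun X Y z => ?_⟩
  · rw [← φ.base_eq]
    exact (φ.toFun z).1.dbase_raw w
  · have h1 := (InfJet.jet_mem_flatEq₀_iff _).1 (InfJet.jet_one_mem (φ.toFun z).2) X Y
    rw [← φ.cartanD_liftIn hE, ← φ.cartanD_liftIn hE,
      InfJet.liftRaw_eq (φ.base_eq z) (φ.value_eq z),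
      InfJet.liftRaw_eq (φ.base_eq z) (φ.value_eq z),
      InfJet.liftRaw_eq (φ.base_eq z) (φ.value_eq z)] at h1
    exact h1

end FlatMorphism

end FlatMorphisms

end FlatReps

end

noncomputable section

namespace FlatReps


/-! ### Morphisms and flat representations -/

section Correspondence

variable {EN N EM M EP HP P : Type*}
  [NormedAddCommGroup EN] [NormedSpace ℝ EN] [TopologicalSpace N] [ChartedSpace EN N]
  [NormedAddCommGroup EM] [NormedSpace ℝ EM] [TopologicalSpace M] [ChartedSpace EM M]
  [NormedAddCommGroup EP] [NormedSpace ℝ EP] [TopologicalSpace HP]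
  [TopologicalSpace P] [ChartedSpace HP P] {IP : ModelWithCorners ℝ EP HP} {fib : M → Set P}
  [IP.Boundaryless] [IsManifold IP ∞ P] {E : Set (InfJet 𝓘(ℝ, EM) IP fib)}
  [IsManifold 𝓘(ℝ, EN) ∞ N] [IsManifold 𝓘(ℝ, EM) ∞ M]
  [FiniteDimensional ℝ EN] [FiniteDimensional ℝ EM]
  [T2Space N] [SecondCountableTopology N] [T2Space M] [SecondCountableTopology M]
  {π : C^∞⟮𝓘(ℝ, EM), M; 𝓘(ℝ, EN), N⟯}

/-- A linear functional of the coordinates of an infinite jet of a connection, cut off by a function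
on the base. -/
def coordFun (F : Set (ConnInfJet π)) (χ : M → ℝ) {k : ℕ} (q : HomTotal π)
    (Λ : JetCoord EM (EM × (EN →L[ℝ] EM)) k →L[ℝ] ℝ) (ζ : F) : ℝ :=
  χ ζ.1.base * Λ (ζ.1.coords k q.proj q)

theorem repIn_coords (F : Set (ConnInfJet π)) {k : ℕ} (q : HomTotal π)
    (Λ : JetCoord EM (EM × (EN →L[ℝ] EM)) k →L[ℝ] ℝ) :
    RepIn (fun ζ : F => Λ (ζ.1.coords k q.proj q)) q.proj q k Λ univ :=
  ⟨isOpen_univ, (by fun_prop : ContDiff ℝ ∞ Λ).contDiffOn, fun _ _ _ => rfl⟩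

theorem coordFun_mem (F : Set (ConnInfJet π)) {χ : C^∞⟮𝓘(ℝ, EM), M; 𝓘(ℝ, ℝ), ℝ⟯} {k : ℕ}
    {q : HomTotal π} (hχ : tsupport χ ⊆ homDom π q.proj)
    (Λ : JetCoord EM (EM × (EN →L[ℝ] EM)) k →L[ℝ] ℝ) : coordFun F χ q Λ ∈ smoothFun F := by
  refine ⟨k, isSmoothOfOrder_iff.2 fun ζ => ?_⟩
  by_cases hζ : ζ.1.base ∈ tsupport χ
  · have h1 := (repIn_coords F q Λ).smoothOfOrderAt
      ((ζ.1.inChart_iff_homDom q).2 (hχ hζ)) (mem_univ _)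
    exact ((SmoothOfOrderAt.of_base k (Eventually.of_forall fun x =>
      χ.contMDiff x)).prodMk h1).contDiff_comp (Φ := fun p : ℝ × ℝ => p.1 * p.2) (by fun_prop)
  · have h1 : SmoothOfOrderAt k (fun _ : F => (0 : ℝ)) ζ :=
      ⟨_, univ, ⟨isOpen_univ, contDiffOn_const, fun _ _ _ => rfl⟩, mem_univ _⟩
    refine h1.congr_base (isClosed_tsupport χ).isOpen_compl hζ fun ζ' hζ' => ?_
    rw [coordFun, image_eq_zero_of_notMem_tsupport hζ', zero_mul]

namespace FlatMorphism

/-- The lift fixes the jet of order zero. If the `k`-jets agree at all points of `E`, so do the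
pullbacks of functions of the `k`-jet and their Cartan derivatives; by the chain rule for morphisms
these contain the derivatives of order `k + 1`. -/
theorem eq_of_lift_eq (hE : CartanClosed E) {φ ψ : FlatMorphism E π} (h : φ.lift = ψ.lift) :
    φ = ψ := by
  have hv : ∀ z, (φ.toFun z).1.value = (ψ.toFun z).1.value := fun z => by
    rw [φ.value_eq, ψ.value_eq, h]
  have hb : ∀ z, (φ.toFun z).1.base = (ψ.toFun z).1.base := fun z =>
    (φ.base_eq z).trans (ψ.base_eq z).symm
  have hin : ∀ (z : E) (q : HomTotal π), (φ.toFun z).1.InChart q.proj q →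
      (ψ.toFun z).1.InChart q.proj q := fun z q hq => by
    rw [InfJet.inChart_iff_homDom] at hq ⊢
    rwa [← hb]
  have hself : ∀ (z : E) (k : ℕ), (φ.toFun z).1.coords k (connMap π φ.lift z).proj
      (connMap π φ.lift z) = (ψ.toFun z).1.coords k (connMap π φ.lift z).proj
      (connMap π φ.lift z) → (φ.toFun z).1.jet k = (ψ.toFun z).1.jet k := by
    intro z k hz
    refine InfJet.jet_eq_of_coords_eq (hb z) (hv z) ?_
    rw [φ.base_eq, φ.value_eq]
    exact hz
  have hz : ∀ k z, (φ.toFun z).1.jet k = (ψ.toFun z).1.jet k := by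
    intro k
    induction k with
    | zero =>
      intro z
      refine hself z 0 ?_
      generalize hq : connMap π φ.lift z = q
      have h1 : (φ.toFun z).1.InChart q.proj q := by
        rw [InfJet.inChart_iff_homDom, φ.base_eq, ← hq]
        exact mem_homDom_self _
      have h2 := hin z q h1
      refine JetCoord.ext_comp ?_ fun i hi => ?_
      · rw [InfJet.coords_fst _ 0 h1, InfJet.coords_fst _ 0 h2, hb]
      · obtain rfl : i = 0 := Nat.le_zero.1 hi
        rw [← val_eq_iff, InfJet.val_coords _ 0 h1, InfJet.val_coords _ 0 h2, hv]
    | succ k ih =>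
      intro z
      refine hself z (k + 1) ?_
      have hφv := φ.value_eq z
      have hψv := ψ.value_eq z
      rw [← h] at hψv
      generalize hq : connMap π φ.lift z = q at hφv hψv
      have hqz : z.1.base = q.proj := by rw [← hq]; rfl
      have h1 : (φ.toFun z).1.InChart q.proj q := by
        rw [InfJet.inChart_iff_homDom, φ.base_eq, hqz]
        exact mem_homDom_self _
      have h2 := hin z q h1
      -- Jet coordinates make sense only over a chart. The cutoff turns them into smooth functions
      -- on the whole equation, as required for pulling back, without changing them near the point.
      obtain ⟨χ, hχ1, hχ⟩ := exists_bump (EM := EM)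
        ((isOpen_homDom π q.proj).mem_nhds (mem_homDom_self q.proj))
      obtain ⟨O, hχO, hO, hzO⟩ := eventually_nhds_iff.1 hχ1
      have hD : ∀ (θ : FlatMorphism E π), (θ.toFun z).1.value = q →
          ∀ Λ : JetCoord EM (EM × (EN →L[ℝ] EM)) k →L[ℝ] ℝ,
          cartanD (coordFun (flatEq π) χ q Λ ∘ θ.toFun) z =
            Λ.comp (shift ((θ.toFun z).1.coords (k + 1) q.proj q)) := by
        intro θ hθ Λ
        have e1 : (θ.toFun z).1.base = q.proj := (θ.base_eq z).trans hqz
        have e2 : (θ.toFun z).1.InChart q.proj q := by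
          rw [InfJet.inChart_iff_homDom, e1]
          exact mem_homDom_self _
        have e3 : RepIn (coordFun (flatEq π) χ q Λ) q.proj q k Λ _ :=
          (repIn_coords (flatEq π) q Λ).congr_base hO fun ζ hζ => by
            rw [coordFun, hχO _ hζ, one_mul]
        have e4 := EqMorphism.cartanD_comp hE θ.toEqMorphism θ.base_eq
          ⟨_, coordFun_mem (flatEq π) hχ Λ⟩ (z := z) e1 hθ e3
          (RepIn.congr_base_mem e2 (mem_univ _) (by rw [e1]; exact hzO))
        refine e4.trans ?_
        rw [totalD, Λ.fderiv]
      have hcomp : ∀ Λ : JetCoord EM (EM × (EN →L[ℝ] EM)) k →L[ℝ] ℝ,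
          coordFun (flatEq π) χ q Λ ∘ φ.toFun = coordFun (flatEq π) χ q Λ ∘ ψ.toFun := by
        intro Λ
        funext z'
        have h3 : (φ.toFun z').1.coords k q.proj q = (ψ.toFun z').1.coords k q.proj q :=
          congrArg (fun θ => Jet.coords θ q.proj q) (ih z')
        rw [Function.comp_apply, Function.comp_apply, coordFun, coordFun, h3, hb]
      -- `shift` of the `(k+1)`-jet is the total derivative of the coordinates of the `k`-jet, so
      -- its components are reached by functionals of these coordinates. The component of order `j +
      -- 1` on `m` is that of order `j` of the shift along `m 0`.
      have hshift : ∀ (v : EM) (j : ℕ) (hj : j ≤ k) (m : Fin j → EM),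
          JetCoord.comp j hj (shift ((φ.toFun z).1.coords (k + 1) q.proj q) v) m =
            JetCoord.comp j hj (shift ((ψ.toFun z).1.coords (k + 1) q.proj q) v) m := by
        intro v j hj m
        refine sub_eq_zero.1 (SeparatingDual.eq_zero_of_forall_dual_eq_zero (R := ℝ) fun ℓ => ?_)
        rw [_root_.map_sub, sub_eq_zero]
        have h3 := fun Λ => (hD φ hφv Λ).symm.trans ((congrArg (fun f => cartanD f z)
          (hcomp Λ)).trans (hD ψ hψv Λ))
        exact congrArg (fun L : EM →L[ℝ] ℝ => L v) (h3 (ℓ.comp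
          ((ContinuousMultilinearMap.apply ℝ (fun _ : Fin j => EM) (EM × (EN →L[ℝ] EM)) m).comp
            (JetCoord.comp j hj))))
      refine JetCoord.ext_comp ?_ fun i hi => ?_
      · rw [InfJet.coords_fst _ _ h1, InfJet.coords_fst _ _ h2, hb]
      · cases i with
        | zero => rw [← val_eq_iff, InfJet.val_coords _ _ h1, InfJet.val_coords _ _ h2, hv]
        | succ j =>
          refine ContinuousMultilinearMap.ext fun m => ?_
          have h3 := hshift (m 0) j (Nat.le_of_succ_le_succ hi) (Fin.tail m)
          rw [comp_shift, comp_shift, ContinuousMultilinearMap.curryLeft_apply,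
            ContinuousMultilinearMap.curryLeft_apply, Fin.cons_self_tail] at h3
          exact h3
  have hfun : φ.toFun = ψ.toFun :=
    funext fun z => Subtype.ext (Subtype.ext (funext fun k => hz k z))
  obtain ⟨⟨f, _, _⟩, _⟩ := φ
  obtain ⟨⟨g, _, _⟩, _⟩ := ψ
  obtain rfl : f = g := hfun
  rfl

end FlatMorphism

theorem Corresponds.eq_left (hE : CartanClosed E) {R R' : FlatRepresentation E π}
    {φ : FlatMorphism E π} (h : Corresponds R φ) (h' : Corresponds R' φ) : R = R' := by
  rw [corresponds_iff] at h h'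
  have h1 : R.toFun = R'.toFun := funext fun X => Derivation.ext fun f =>
    Subtype.ext (funext fun z => ((hE.isCartanLift_iff z _ _).1 (h X z) f).trans
      ((hE.isCartanLift_iff z _ _).1 (h' X z) f).symm)
  cases R
  cases R'
  congr

/-- The representation determines the lifted vectors, because a Cartan lift determines its vector;
every tangent vector of `N` is a value of some field, so the linear maps agree, and they determine
the morphism. -/
theorem Corresponds.eq_right (hE : CartanClosed E) {R : FlatRepresentation E π}
    {φ ψ : FlatMorphism E π} (h : Corresponds R φ) (h' : Corresponds R ψ) : φ = ψ := by
  rw [corresponds_iff] at h h'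
  refine FlatMorphism.eq_of_lift_eq hE (funext fun z => ContinuousLinearMap.ext fun w => ?_)
  obtain ⟨X, hX⟩ := exists_vectorField_eq (π z.1.base) w
  have h1 : liftVec π φ.lift X z = liftVec π ψ.lift X z :=
    hE.eq_of_forall_cartanD_eq (z := z) fun f =>
      ((hE.isCartanLift_iff z _ _).1 (h X z) f).symm.trans
        ((hE.isCartanLift_iff z _ _).1 (h' X z) f)
  have h2 : ∀ T : E → EN →L[ℝ] EM, liftVec π T X z = T z w := fun T => congrArg (T z) hX
  rwa [h2, h2] at h1

theorem exists_corresponds_left (hE : CartanClosed E) (φ : FlatMorphism E π) :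
    ∃ R : FlatRepresentation E π, Corresponds R φ := by
  obtain ⟨K, hT⟩ := φ.exists_isFlatLift hE
  exact ⟨hT.representation hE, (corresponds_iff _ _).2 (hT.order.isCartanLift hE)⟩

theorem exists_corresponds_right (hE : CartanClosed E) (R : FlatRepresentation E π) :
    ∃ φ : FlatMorphism E π, Corresponds R φ := by
  have : CompleteSpace EM := FiniteDimensional.complete ℝ EM
  obtain ⟨T, K, hT, hR⟩ := R.exists_isFlatLift hE
  obtain ⟨φ, rfl⟩ := hT.exists_flatMorphism hE
  exact ⟨φ, (corresponds_iff _ _).2 hR⟩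

theorem exists_equiv_corresponds (hE : CartanClosed E) :
    ∃ e : FlatMorphism E π ≃ FlatRepresentation E π, ∀ φ R, e φ = R ↔ Corresponds R φ := by
  choose f hf using fun φ : FlatMorphism E π => exists_corresponds_left hE φ
  choose g hg using fun R : FlatRepresentation E π => exists_corresponds_right hE R
  refine ⟨⟨f, g, fun φ => (hg (f φ)).eq_right hE (hf φ), fun R => (hf (g R)).eq_left hE (hg R)⟩,
    fun φ R => ⟨?_, fun h => (hf φ).eq_left hE h⟩⟩
  rintro rfl
  exact hf φ

end Correspondence

end FlatReps

end

/-! ### The theorem for formally integrable equations in a fibre bundle -/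

open scoped Manifold ContDiff in
open FlatReps in
theorem theorem4p1
    -- the base `N`
    {EN : Type*} [NormedAddCommGroup EN] [NormedSpace ℝ EN] [FiniteDimensional ℝ EN]
    {N : Type*} [TopologicalSpace N] [ChartedSpace EN N] [IsManifold 𝓘(ℝ, EN) ∞ N]
    [T2Space N] [SecondCountableTopology N]
    -- the manifold `M` of independent variables
    {EM : Type*} [NormedAddCommGroup EM] [NormedSpace ℝ EM] [FiniteDimensional ℝ EM]
    {M : Type*} [TopologicalSpace M] [ChartedSpace EM M] [IsManifold 𝓘(ℝ, EM) ∞ M]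
    [T2Space M] [SecondCountableTopology M]
    -- the fibre bundle `π : M → N` with typical fibre `A`
    {EA : Type*} [NormedAddCommGroup EA] [NormedSpace ℝ EA] [FiniteDimensional ℝ EA]
    {A : Type*} [TopologicalSpace A] [ChartedSpace EA A] [IsManifold 𝓘(ℝ, EA) ∞ A]
    (π : C^∞⟮𝓘(ℝ, EM), M; 𝓘(ℝ, EN), N⟯)
    (hπ : IsSmoothFiberBundle 𝓘(ℝ, EN) 𝓘(ℝ, EM) 𝓘(ℝ, EA) A π)
    -- the fibre bundle `ζ : P → M` with typical fibre `Q`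
    {EP : Type*} [NormedAddCommGroup EP] [NormedSpace ℝ EP] [FiniteDimensional ℝ EP]
    {P : Type*} [TopologicalSpace P] [ChartedSpace EP P] [IsManifold 𝓘(ℝ, EP) ∞ P]
    [T2Space P] [SecondCountableTopology P]
    {EQ : Type*} [NormedAddCommGroup EQ] [NormedSpace ℝ EQ] [FiniteDimensional ℝ EQ]
    {Q : Type*} [TopologicalSpace Q] [ChartedSpace EQ Q] [IsManifold 𝓘(ℝ, EQ) ∞ Q]
    (ζ : P → M) (hζ : IsSmoothFiberBundle 𝓘(ℝ, EM) 𝓘(ℝ, EP) 𝓘(ℝ, EQ) Q ζ)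
    -- the differential equation of order `k` imposed on sections of `ζ`
    (k : ℕ) (E₀ : Set (Jet 𝓘(ℝ, EM) 𝓘(ℝ, EP) (fun x : M => ζ ⁻¹' {x}) k))
    (hE : IsFormallyIntegrable E₀) :
    ∃ e : FlatMorphism (infProlong E₀) π ≃ FlatRepresentation (infProlong E₀) π,
      ∀ φ R, e φ = R ↔ Corresponds R φ := exists_equiv_corresponds (hE.cartanClosed hζ.hasRetraction)
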